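/- **Setting.** Let $r>4$ and let $$H(z;\varepsilon)=\tfrac{p_1^2}{2}+V_1(q_1)+\tfrac{p_2^2}{2}+V_2(q_2)+\varepsilon V_c(q_1,q_2),$$ where $V_i$ is $C^r$ on an open interval $U_i\ni 0$, $V_i(0)=0$ and $q\,V_i'(q)>0$ for $q\neq0$, and $V_c$ is $C^r$ on $U_1\times U_2$ with bounded derivatives up to order $r$. Let $q^w_i\in U_i$, $q_i^w<0$. A particle moves under $H$ outside the step $\{q_1<q_1^w,\ q_2<q_2^w\}$ with elastic reflections: $p_1\mapsto-p_1$ at the right wall ($q_1=q_1^w$, $q_2<q_2^w$, $p_1<0$) and $p_2\mapsto-p_2$ at the upper wall ($q_2=q_2^w$, $q_1<q_1^w$, $p_2<0$); a trajectory that reaches the corner $(q_1^w,q_2^w)$ stops. Fix an energy $h>V_1(q_1^w)+V_2(q_2^w)$ for which the sets $\{q\in U_i: V_i(q)\le h\}$ are compact. Let $\Sigma_h=\{p_1=0,\ \dot p_1<0,\ H=h\}$, with coordinates $(\theta,I)\in(\mathbb R/2\pi\mathbb Z)\times\mathbb R$, the angle and action of the oscillator $\frac{p_2^2}{2}+V_2(q_2)$,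 with $\theta=0$ at the right turning point and $\operatorname{sign}\theta=-\operatorname{sign}p_2$ for $\theta\in[-\pi,\pi)$. Let $\mathcal F_\varepsilon$ be the first return map to $\Sigma_h$. The tangential curve $\sigma^\varepsilon_{tan}$ is the set of points of $\Sigma_h$ whose trajectories touch $\{q_1=q_1^w\}$ with $p_1=0$ before returning to $\Sigma_h$. The corner-singularity curves $\sigma^\varepsilon_{R0},\sigma^\varepsilon_{01},\sigma^\varepsilon_{1R}$ are the sets of points of $\Sigma_h$ whose trajectories reach the corner before returning to $\Sigma_h$, with incoming momentum satisfying, respectively, $(p_1\le0,\,p_2\ge0)$, $(p_1\ge0,\,p_2\le0)$, $(p_1\le0,\,p_2\le0)$. Write $\mathcal R_2(\theta,I)=(-\theta,I)$. **Theorem.** There are $\Delta>0$, $C\ge0$ and $\varepsilon_0>0$ with $C\varepsilon_0<\Delta$ such that for every $|\varepsilon|<\varepsilon_0$ the following holds. 1. $\sigma^\varepsilon_{tan}=\{I=I_{tan}(\theta)\}$ for a continuous function $I_{tan}=I^\varepsilon_{tan}$. In the normal coordinates $(\phi,K)=S(\theta,I)=(\theta,I-I_{tan}(\theta))$ the curves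 $\sigma_{ab}^\varepsilon$, $ab\in\{R0,01,1R\}$, restricted to $-\Delta\le K\le 0$, are graphs $\phi=\phi_{ab}(K)$ of continuous functions. 2. For $(abc)$ a cyclic permutation of $(R01)$ let $J_b=\{-\Delta<K<0,\ \phi\in(\phi_{ab}(K),\phi_{bc}(K))\}$, where $(\alpha,\beta)$ is the open arc of the circle from $\alpha$ to $\beta$ in the direction of increasing angle. Then $\mathcal F_\varepsilon$ is defined on $J_R\cup J_0\cup J_1$. Put $\bar J_b=\mathcal F_\varepsilon(J_b)$. 3. (Order.) On each circle $K=k$, $-\Delta<k<0$, the sets $J_R,J_0,J_1$ are nonempty and occur in the cyclic order $(J_R,J_0,J_1)$. On each circle $\{I=I_{tan}(-\theta)+k\}$, $-(\Delta-C|\varepsilon|)<k<0$, the sets $\bar J_1,\bar J_0,\bar J_R$ are nonempty and occur in the cyclic order $(\bar J_1,\bar J_0,\bar J_R)$, that is, in the reversed order. 4. (Boundaries.) There are angle functions $\bar\phi_{10},\bar\phi_{0R},\bar\phi_{R1}$ on $[-\Delta,0]$, defining the curves $\bar\sigma_{ab}=\{(\bar\phi_{ab}(k),\,I_{tan}(-\bar\phi_{ab}(k))+k):-\Delta\le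 k\le0\}$ in the coordinates $(\theta,I)$, such that for every cyclic permutation $(abc)$ of $(10R)$ the left and right boundaries of $\bar J_b$ are $\bar\sigma_{ab}$ and $\bar\sigma_{bc}$. Precisely, $\bar J_b\subset\{-(\Delta+C|\varepsilon|)<I-I_{tan}(-\theta)<0\}$, and $\bar J_b$ meets the circle $\{I=I_{tan}(-\theta)+k\}$ in a subset of the arc $(\bar\phi_{ab}(k),\bar\phi_{bc}(k))$ if $-\Delta<k<0$, and in exactly this arc if $-(\Delta-C|\varepsilon|)<k<0$. Moreover, with $\sigma^\varepsilon_{ba},\sigma^\varepsilon_{cb}$ restricted to $-\Delta\le K\le0$, $$\bar\sigma_{ab}=\mathcal R_2\,\sigma_{ba}^\varepsilon,\qquad \bar\sigma_{bc}=\mathcal R_2\,\sigma_{cb}^\varepsilon .$$ 5. (Normal coordinates.) Statements 3 and 4 hold for the map $S\mathcal F_\varepsilon S^{-1}$ in the coordinates $(\phi,K)$, with the circles $\{K=\varepsilon f(\phi)+k\}$ in place of $\{I=I_{tan}(-\theta)+k\}$ and with $\mathcal R_\varepsilon(\phi,K)=(-\phi,\,K-\varepsilon f(\phi))$ in place of $\mathcal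 R_2$, where $\varepsilon f(\phi)=I_{tan}(-\phi)-I_{tan}(\phi)$. -/

import Mathlib

open Set Filter Topology

noncomputable section

namespace OscStep

/-- The data of the perturbed oscillators-step system with
`H(z;ε) = p₁²/2 + V₁(q₁) + p₂²/2 + V₂(q₂) + ε V_c(q₁,q₂)`
and step `{q₁ < w₁, q₂ < w₂}`. The potential `V i` is defined on an open interval `U i` (all of `ℝ`,
or a bounded interval for potentials such as `tan²`); values outside are irrelevant.
`V₁, U₁, w₁` refer to the horizontal and `V₂, U₂, w₂` to the vertical direction. -/
structure StepSystem where
  r : ℕ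
  four_lt_r : 4 < r
  U₁ : Set ℝ
  U₂ : Set ℝ
  isOpen_U₁ : IsOpen U₁
  isOpen_U₂ : IsOpen U₂
  ordConnected_U₁ : U₁.OrdConnected
  ordConnected_U₂ : U₂.OrdConnected
  zero_mem_U₁ : (0 : ℝ) ∈ U₁
  zero_mem_U₂ : (0 : ℝ) ∈ U₂
  V₁ : ℝ → ℝ
  V₂ : ℝ → ℝ
  smooth_V₁ : ContDiffOn ℝ r V₁ U₁
  smooth_V₂ : ContDiffOn ℝ r V₂ U₂
  V₁_zero : V₁ 0 = 0
  V₂_zero : V₂ 0 = 0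
  well_V₁ : ∀ q ∈ U₁, q ≠ 0 → 0 < q * deriv V₁ q
  well_V₂ : ∀ q ∈ U₂, q ≠ 0 → 0 < q * deriv V₂ q
  Vc : ℝ × ℝ → ℝ
  smooth_Vc : ContDiffOn ℝ r Vc (U₁ ×ˢ U₂)
  bounded_Vc : ∃ M : ℝ, ∀ n ≤ r, ∀ q ∈ U₁ ×ˢ U₂, ‖iteratedFDeriv ℝ n Vc q‖ ≤ M
  w₁ : ℝ
  w₂ : ℝ
  w₁_mem : w₁ ∈ U₁
  w₂_mem : w₂ ∈ U₂
  w₁_neg : w₁ < 0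
  w₂_neg : w₂ < 0

/-- Phase space, in the order `(q₁, p₁, q₂, p₂)`. -/
abbrev Phase : Type := ℝ × ℝ × ℝ × ℝ

def q₁ (z : Phase) : ℝ := z.1
def p₁ (z : Phase) : ℝ := z.2.1
def q₂ (z : Phase) : ℝ := z.2.2.1
def p₂ (z : Phase) : ℝ := z.2.2.2

/-- The cylinder, with coordinates `(θ, I)` or `(φ, K)`; angles are taken modulo `2π`. -/
abbrev Cyl : Type := Real.Angle × ℝ

namespace StepSystem

variable (S : StepSystem)

/-! ### The impact flow -/

/-- The perturbed Hamiltonian. -/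
def hamiltonian (ε : ℝ) (z : Phase) : ℝ :=
  p₁ z ^ 2 / 2 + S.V₁ (q₁ z) + p₂ z ^ 2 / 2 + S.V₂ (q₂ z) + ε * S.Vc (q₁ z, q₂ z)

/-- `dp₁/dt = -∂H/∂q₁`. -/
def force₁ (ε : ℝ) (z : Phase) : ℝ :=
  -(deriv S.V₁ (q₁ z) + ε * deriv (fun x => S.Vc (x, q₂ z)) (q₁ z))

/-- `dp₂/dt = -∂H/∂q₂`. -/
def force₂ (ε : ℝ) (z : Phase) : ℝ :=
  -(deriv S.V₂ (q₂ z) + ε * deriv (fun y => S.Vc (q₁ z, y)) (q₂ z))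

/-- The Hamiltonian vector field. -/
def field (ε : ℝ) (z : Phase) : Phase :=
  (p₁ z, S.force₁ ε z, p₂ z, S.force₂ ε z)

/-- The position lies in the domain of the potentials and outside the open step. -/
def Free (z : Phase) : Prop :=
  q₁ z ∈ S.U₁ ∧ q₂ z ∈ S.U₂ ∧ ¬ (q₁ z < S.w₁ ∧ q₂ z < S.w₂)

def AtCorner (z : Phase) : Prop := q₁ z = S.w₁ ∧ q₂ z = S.w₂

/-- Elastic impact, from the incoming state `z` to the outgoing state `z'`, at the right wall
(first case) or at the upper wall (second case) of the step. -/
def Impact (z z' : Phase) : Prop :=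
  (q₁ z = S.w₁ ∧ p₁ z < 0 ∧ q₂ z < S.w₂ ∧ z' = (q₁ z, -p₁ z, q₂ z, p₂ z)) ∨
  (q₂ z = S.w₂ ∧ p₂ z < 0 ∧ q₁ z < S.w₁ ∧ z' = (q₁ z, p₁ z, q₂ z, -p₂ z))

/-- `z` is a trajectory of the step system on `[0, T]` whose impacts occur exactly at the times in the
finite set `hits`. At an impact time `z t` is the outgoing state. A trajectory stops at the corner,
so the corner can be reached only at the final time, and `z T` is then the incoming state. -/
structure IsTrajectory (ε T : ℝ) (z : ℝ → Phase) (hits : Finset ℝ) : Prop where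
  hits_mem : ∀ t ∈ hits, t ∈ Ioo 0 T
  free : ∀ t ∈ Icc 0 T, S.Free (z t)
  no_corner : ∀ t ∈ Ico 0 T, ¬ S.AtCorner (z t)
  right_deriv : ∀ t ∈ Ico 0 T, HasDerivWithinAt z (S.field ε (z t)) (Ici t) t
  left_deriv : ∀ t ∈ Ioc 0 T, t ∉ hits → HasDerivWithinAt z (S.field ε (z t)) (Iic t) t
  impact : ∀ t ∈ hits, ∃ z', Tendsto z (𝓝[<] t) (𝓝 z') ∧ S.Impact z' (z t)

/-- The section `Σ_h : p₁ = 0, dp₁/dt < 0, H = h`. -/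
def section_ (ε h : ℝ) : Set Phase :=
  {z | q₁ z ∈ S.U₁ ∧ q₂ z ∈ S.U₂ ∧ p₁ z = 0 ∧ S.force₁ ε z < 0 ∧ S.hamiltonian ε z = h}

/-- The trajectory segment from `z₀ ∈ Σ_h` arrives at `z₁` after time `T > 0`, without
visiting `Σ_h` at the times strictly in between. -/
def Reaches (ε h : ℝ) (z₀ z₁ : Phase) : Prop :=
  z₀ ∈ S.section_ ε h ∧ ∃ T > 0, ∃ (z : ℝ → Phase) (hits : Finset ℝ),
    S.IsTrajectory ε T z hits ∧ z 0 = z₀ ∧ z T = z₁ ∧ ∀ t ∈ Ioo 0 T, z t ∉ S.section_ ε h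

/-! ### Action-angle coordinates of the vertical oscillator -/

def energy₂ (q p : ℝ) : ℝ := p ^ 2 / 2 + S.V₂ q

/-- Turning points of the vertical oscillator at energy `E`. -/
def qmin₂ (E : ℝ) : ℝ := sInf {q | q ∈ S.U₂ ∧ S.V₂ q ≤ E}
def qmax₂ (E : ℝ) : ℝ := sSup {q | q ∈ S.U₂ ∧ S.V₂ q ≤ E}

/-- The period `T₂(E) = 2 ∫ dq / √(2(E - V₂))`. -/
def period₂ (E : ℝ) : ℝ :=
  2 * ∫ x in (S.qmin₂ E)..(S.qmax₂ E), 1 / √(2 * (E - S.V₂ x))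

/-- The action `(1/2π) ∮ p₂ dq₂`. -/
def action₂ (E : ℝ) : ℝ :=
  (1 / Real.pi) * ∫ x in (S.qmin₂ E)..(S.qmax₂ E), √(2 * (E - S.V₂ x))

/-- The angle, `2π/T₂` times the travel time from the right turning point; `θ = 0` at
`q₂ = q₂,max`, `p₂ = 0`, and `sign θ = -sign p₂` for `θ ∈ [-π, π)`. -/
def angle₂ (q p : ℝ) : Real.Angle :=
  let E := S.energy₂ q p
  let θ : ℝ := (2 * Real.pi / S.period₂ E) * ∫ x in q..(S.qmax₂ E), 1 / √(2 * (E - S.V₂ x))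
  if p ≤ 0 then (θ : Real.Angle) else -(θ : Real.Angle)

/-- The coordinates `(θ, I) = S₂(q₂, p₂)` of a point of the section. -/
def coord (z : Phase) : Cyl :=
  (S.angle₂ (q₂ z) (p₂ z), S.action₂ (S.energy₂ (q₂ z) (p₂ z)))

/-- The graph of the first return map `F_ε` to `Σ_h` in the coordinates `(θ, I)`. -/
def ReturnsTo (ε h : ℝ) (x y : Cyl) : Prop :=
  ∃ z₀ z₁, S.Reaches ε h z₀ z₁ ∧ z₁ ∈ S.section_ ε h ∧ S.coord z₀ = x ∧ S.coord z₁ = y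

/-- The tangential curve: initial conditions on `Σ_h` whose trajectory touches
the line `q₁ = w₁` tangentially before the first return. -/
def tangentialCurve (ε h : ℝ) : Set Cyl :=
  {x | ∃ z₀ z₁, S.Reaches ε h z₀ z₁ ∧ z₁ ∉ S.section_ ε h ∧ q₁ z₁ = S.w₁ ∧ p₁ z₁ = 0 ∧
    S.coord z₀ = x}

end StepSystem

/-! ### Corner-singularity curves and regions -/

/-- Labels `R`, `0`, `1` of the regions. -/
inductive Label where
  | R
  | zero
  | one
  deriving DecidableEq

/-- The cyclic permutation `R → 0 → 1 → R`. -/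
def Label.next : Label → Label
  | .R => .zero
  | .zero => .one
  | .one => .R

/-- `(abc)` is a cyclic permutation of `(R01)`. Hence `(abc)` is a cyclic permutation of `(10R)`
iff `IsCyc c b a`. -/
def IsCyc (a b c : Label) : Prop := b = a.next ∧ c = b.next

/-- The signs of the incoming corner momenta `p_{R0}`, `p_{01}`, `p_{1R}`. -/
def cornerDirection : Label → Label → ℝ → ℝ → Prop
  | .R, .zero, p, p' => p ≤ 0 ∧ 0 ≤ p'
  | .zero, .one, p, p' => 0 ≤ p ∧ p' ≤ 0
  | .one, .R, p, p' => p ≤ 0 ∧ p' ≤ 0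
  | _, _, _, _ => False

/-- The corner-singularity curve `σ_{ab}`, `ab ∈ {R0, 01, 1R}`: initial conditions on `Σ_h` whose
trajectory hits the corner in the direction `p_{ab}` (and hence does not return). -/
def StepSystem.cornerCurve (S : StepSystem) (ε h : ℝ) (a b : Label) : Set Cyl :=
  {x | ∃ z₀ z₁, S.Reaches ε h z₀ z₁ ∧ S.AtCorner z₁ ∧ cornerDirection a b (p₁ z₁) (p₂ z₁) ∧
    S.coord z₀ = x}

/-- Normal coordinates `(φ, K) = (θ, I - I_tan(θ))` and their inverse. -/
def toNormal (Itan : Real.Angle → ℝ) (x : Cyl) : Cyl := (x.1, x.2 - Itan x.1)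
def ofNormal (Itan : Real.Angle → ℝ) (u : Cyl) : Cyl := (u.1, u.2 + Itan u.1)

/-- The odd function `ε f(φ;ε) = I_tan(-φ) - I_tan(φ)`. -/
def epsF (Itan : Real.Angle → ℝ) (φ : Real.Angle) : ℝ := Itan (-φ) - Itan φ

/-- The reflection `(θ, I) ↦ (-θ, I)`. -/
def reflect (x : Cyl) : Cyl := (-x.1, x.2)

/-- The reversor in normal coordinates, `(φ, K) ↦ (-φ, K - ε f(φ))`. -/
def reflectNormal (Itan : Real.Angle → ℝ) (u : Cyl) : Cyl := (-u.1, u.2 - epsF Itan u.1)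

/-- The open region in the potentially impacting band of height `Δ`, in normal coordinates,
whose left border is `φ = l(K)` and whose right border is `φ = r(K)`. -/
def regionBetween (l r : ℝ → Real.Angle) (Δ : ℝ) : Set Cyl :=
  {u | u.2 ∈ Ioo (-Δ) 0 ∧ u.1 ∈ cIoo (l u.2) (r u.2)}

/-- The image of `A` under the (partial) map with graph `F`. -/
def imageUnder (F : Cyl → Cyl → Prop) (A : Set Cyl) : Set Cyl := {y | ∃ x ∈ A, F x y}

/-- The angles at which the closed curve `{(θ, g(θ) + k)}` meets `A`. -/
def slice (g : Real.Angle → ℝ) (A : Set Cyl) (k : ℝ) : Set Real.Angle := {θ | (θ, g θ + k) ∈ A}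

/-- The curve `{(φ(k), g(φ(k)) + k) : k ∈ [-Δ, 0]}`. -/
def curveOver (g : Real.Angle → ℝ) (φ : ℝ → Real.Angle) (Δ : ℝ) : Set Cyl :=
  (fun k => (φ k, g (φ k) + k)) '' Icc (-Δ) 0

/-- The sets `A`, `B`, `C` occur in this cyclic order, in the direction of increasing angle, on each
of the closed curves `{(θ, g(θ) + k)}`, `-m < k < 0`. -/
def InOrder (g : Real.Angle → ℝ) (m : ℝ) (A B C : Set Cyl) : Prop :=
  ∀ k ∈ Ioo (-m) 0, (slice g A k).Nonempty ∧ (slice g B k).Nonempty ∧ (slice g C k).Nonempty ∧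
    ∀ α ∈ slice g A k, ∀ β ∈ slice g B k, ∀ γ ∈ slice g C k, sbtw α β γ

/-- `A` is a layer of height `Δ` below the graph of `g`, up to an error `δ` in the position of its lower
edge, and its left and right boundaries are the curves `l` and `r`: on the closed curve
`{(θ, g(θ) + k)}` it occupies the open arc from `l k` to `r k`. -/
structure HasSides (g : Real.Angle → ℝ) (A : Set Cyl) (l r : ℝ → Real.Angle) (Δ δ : ℝ) :
    Prop where
  height : ∀ x ∈ A, x.2 - g x.1 ∈ Ioo (-(Δ + δ)) 0
  slice_subset : ∀ k ∈ Ioo (-Δ) 0, slice g A k ⊆ cIoo (l k) (r k)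
  slice_eq : ∀ k ∈ Ioo (-(Δ - δ)) 0, slice g A k = cIoo (l k) (r k)

/-- The region `J_b` in the coordinates `(φ, K)`, given the angles `φ_{ab}(K)` of the
corner-singularity curves: its borders are `σ_{ab}` and `σ_{bc}` with `(abc)` cyclic. -/
def regionNormal (φ : Label → Label → ℝ → Real.Angle) (Δ : ℝ) (b : Label) : Set Cyl :=
  regionBetween (φ b.next.next b) (φ b b.next) Δ

/-- The region `J_b` in the coordinates `(θ, I)`. -/
def region (Itan : Real.Angle → ℝ) (φ : Label → Label → ℝ → Real.Angle) (Δ : ℝ) (b : Label) :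
    Set Cyl :=
  toNormal Itan ⁻¹' regionNormal φ Δ b

/-- The part of `σ_{ab}` in the potentially impacting band `-Δ ≤ K ≤ 0`, in the coordinates `(θ, I)`. -/
def StepSystem.cornerCurveBand (S : StepSystem) (ε h : ℝ) (Itan : Real.Angle → ℝ) (Δ : ℝ)
    (a b : Label) : Set Cyl :=
  {x | x ∈ S.cornerCurve ε h a b ∧ x.2 - Itan x.1 ∈ Icc (-Δ) 0}

/-- The return map in normal coordinates, `S ∘ F_ε ∘ S⁻¹`, as a graph. -/
def StepSystem.ReturnsToNormal (S : StepSystem) (ε h : ℝ) (Itan : Real.Angle → ℝ) (u v : Cyl) :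
    Prop :=
  S.ReturnsTo ε h (ofNormal Itan u) (ofNormal Itan v)

end OscStep

end

noncomputable section

open Real
open scoped NNReal

local notation "ℝ³" => ℝ × ℝ × ℝ
local notation "I(" c "," r ")" => Icc (c - r) (c + r)

/-! ### Monotonicity from derivatives -/

section

variable {f f' : ℝ → ℝ} {a b : ℝ} (hd : ∀ t ∈ Icc a b, HasDerivAt f (f' t) t)
include hd

lemma monotoneOn_Icc (h : ∀ t ∈ Ioo a b, 0 ≤ f' t) : MonotoneOn f (Icc a b) :=
  monotoneOn_of_deriv_nonneg (convex_Icc _ _) (fun t ht => (hd t ht).continuousAt.continuousWithinAt)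
    (fun t ht => (hd t (interior_subset ht)).differentiableAt.differentiableWithinAt) fun t ht => by
      rw [interior_Icc] at ht; rw [(hd t (Ioo_subset_Icc_self ht)).deriv]; exact h t ht

lemma antitoneOn_Icc (h : ∀ t ∈ Ioo a b, f' t ≤ 0) : AntitoneOn f (Icc a b) := by
  simpa using (monotoneOn_Icc (fun t ht => (hd t ht).neg) fun t ht => neg_nonneg.2 (h t ht)).neg

lemma strictMonoOn_Icc (h : ∀ t ∈ Ioo a b, 0 < f' t) : StrictMonoOn f (Icc a b) :=
  strictMonoOn_of_deriv_pos (convex_Icc _ _) (fun t ht => (hd t ht).continuousAt.continuousWithinAt)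
    fun t ht => by
      rw [interior_Icc] at ht; rw [(hd t (Ioo_subset_Icc_self ht)).deriv]; exact h t ht

lemma strictAntiOn_Icc (h : ∀ t ∈ Ioo a b, f' t < 0) : StrictAntiOn f (Icc a b) := by
  simpa using (strictMonoOn_Icc (fun t ht => (hd t ht).neg) fun t ht => neg_pos.2 (h t ht)).neg

end

namespace SmoothFlow

universe u
variable {α : Type u} [TopologicalSpace α] [CompactSpace α]
  {E : Type u} [NormedAddCommGroup E] [NormedSpace ℝ E]

/-- Pointwise application of a family of continuous linear maps, as a continuous bilinear map. -/
def pointwiseApply (α E F : Type u) [TopologicalSpace α] [CompactSpace α]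
    [NormedAddCommGroup E] [NormedSpace ℝ E] [NormedAddCommGroup F] [NormedSpace ℝ F] :
    C(α, E →L[ℝ] F) →L[ℝ] C(α, E) →L[ℝ] C(α, F) :=
  LinearMap.mkContinuous₂
    (LinearMap.mk₂ ℝ (fun (A : C(α, E →L[ℝ] F)) (v : C(α, E)) =>
        (⟨fun t => A t (v t), A.continuous.clm_apply v.continuous⟩ : C(α, F)))
      (fun A A' v => by ext t; simp) (fun c A v => by ext t; simp)
      (fun A v v' => by ext t; simp) (fun c A v => by ext t; simp)) 1
    (fun A v => by
      rw [one_mul]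
      refine (ContinuousMap.norm_le _ (by positivity)).2 fun t => ?_
      exact ((A t).le_opNorm _).trans
        (mul_le_mul (A.norm_coe_le_norm t) (v.norm_coe_le_norm t) (norm_nonneg _) (norm_nonneg A)))

lemma norm_pointwiseApply_le {F : Type u} [NormedAddCommGroup F] [NormedSpace ℝ F]
    (A : C(α, E →L[ℝ] F)) : ‖pointwiseApply α E F A‖ ≤ ‖A‖ := by
  refine ContinuousLinearMap.opNorm_le_bound _ (norm_nonneg A) fun v => ?_
  refine (ContinuousMap.norm_le _ (by positivity)).2 fun t => ?_
  exact ((A t).le_opNorm _).trans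
    (mul_le_mul (A.norm_coe_le_norm t) (v.norm_coe_le_norm t) (norm_nonneg _) (norm_nonneg A))

/-- The composition operator `u ↦ f ∘ u`. -/
def postcomp (α : Type u) [TopologicalSpace α] {E F : Type u} [TopologicalSpace E]
    [TopologicalSpace F] (f : E → F) (hf : Continuous f) (u : C(α, E)) : C(α, F) :=
  (⟨f, hf⟩ : C(E, F)).comp u

lemma hasFDerivAt_postcomp {F : Type u} [NormedAddCommGroup F] [NormedSpace ℝ F]
    {f : E → F} (hf : ContDiff ℝ 1 f) (u : C(α, E)) :
    HasFDerivAt (postcomp α f hf.continuous)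
      (pointwiseApply α E F (postcomp α (fderiv ℝ f) (hf.continuous_fderiv one_ne_zero) u)) u := by
  rw [hasFDerivAt_iff_isLittleO_nhds_zero, Asymptotics.isLittleO_iff]
  intro c hc
  have hcont : Continuous (postcomp α (fderiv ℝ f) (hf.continuous_fderiv one_ne_zero)) :=
    ContinuousMap.continuous_postcomp _
  obtain ⟨δ, hδ, H⟩ := (Metric.continuous_iff
    (f := postcomp α (fderiv ℝ f) (hf.continuous_fderiv one_ne_zero))).1 hcont u c hc
  filter_upwards [Metric.ball_mem_nhds (0 : C(α, E)) hδ] with v hv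
  rw [mem_ball_zero_iff] at hv
  refine (ContinuousMap.norm_le _ (by positivity)).2 fun t => ?_
  have key : ∀ x ∈ segment ℝ (u t) (u t + v t), ‖fderiv ℝ f x - fderiv ℝ f (u t)‖ ≤ c := by
    intro x hx
    rw [segment_eq_image'] at hx
    obtain ⟨l, hl, rfl⟩ := hx
    have h1 : dist (u + l • v) u < δ := by
      rw [dist_eq_norm, add_sub_cancel_left, norm_smul, Real.norm_of_nonneg hl.1]
      exact (mul_le_of_le_one_left (norm_nonneg _) hl.2).trans_lt hv
    have h2 := (ContinuousMap.dist_apply_le_dist (f := postcomp α (fderiv ℝ f)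
      (hf.continuous_fderiv one_ne_zero) (u + l • v)) (g := postcomp α (fderiv ℝ f)
      (hf.continuous_fderiv one_ne_zero) u) t).trans (H _ h1).le
    rw [dist_eq_norm] at h2
    simpa [postcomp] using h2
  have h3 := (convex_segment (𝕜 := ℝ) (u t) (u t + v t)).norm_image_sub_le_of_norm_hasFDerivWithin_le'
    (f := f) (f' := fderiv ℝ f) (φ := fderiv ℝ f (u t)) (C := c)
    (fun x _ => ((hf.differentiable one_ne_zero) x).hasFDerivAt.hasFDerivWithinAt) key
    (left_mem_segment _ _ _) (right_mem_segment _ _ _)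
  rw [add_sub_cancel_left] at h3
  exact h3.trans (mul_le_mul_of_nonneg_left (v.norm_coe_le_norm t) hc.le)

lemma contDiff_postcomp (n : ℕ) : ∀ {F : Type u} [NormedAddCommGroup F] [NormedSpace ℝ F]
    {f : E → F} (hf : ContDiff ℝ n f), ContDiff ℝ n (postcomp α f hf.continuous) := by
  induction n with
  | zero =>
    intro F _ _ f hf
    exact contDiff_zero.2 (ContinuousMap.continuous_postcomp _)
  | succ n ih =>
    intro F _ _ f hf
    have h1 : ContDiff ℝ 1 f := hf.of_le (by exact_mod_cast Nat.le_add_left 1 n)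
    have h2 : ContDiff ℝ n (fderiv ℝ f) := hf.fderiv_right (by norm_cast)
    refine contDiff_succ_iff_hasFDerivAt.2 ⟨_, ?_, fun u => hasFDerivAt_postcomp h1 u⟩
    exact (pointwiseApply α E F).contDiff.comp (ih h2)

/-- The primitive vanishing at `0` of a continuous function on `[-1, 1]`. -/
def primitive (E : Type) [NormedAddCommGroup E] [NormedSpace ℝ E] :
    C(Icc (-1 : ℝ) 1, E) →L[ℝ] C(Icc (-1 : ℝ) 1, E) :=
  LinearMap.mkContinuous
    { toFun := fun w => ⟨fun t => ∫ s in (0 : ℝ)..t, w (projIcc (-1) 1 (by norm_num) s), by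
        have hc : Continuous fun s : ℝ => w (projIcc (-1) 1 (by norm_num) s) :=
          w.continuous.comp continuous_projIcc
        exact (intervalIntegral.continuous_primitive
          (fun a b => hc.intervalIntegrable a b) 0).comp continuous_subtype_val⟩
      map_add' := fun w w' => by
        have hc : ∀ w : C(Icc (-1 : ℝ) 1, E),
            Continuous fun s : ℝ => w (projIcc (-1) 1 (by norm_num) s) := fun w =>
          w.continuous.comp continuous_projIcc
        ext t
        exact intervalIntegral.integral_add ((hc w).intervalIntegrable _ _)
          ((hc w').intervalIntegrable _ _)
      map_smul' := fun c w => by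
        ext t
        exact intervalIntegral.integral_smul _ _ } 1
    (fun w => by
      refine (ContinuousMap.norm_le _ (by positivity)).2 fun t => ?_
      refine (intervalIntegral.norm_integral_le_of_norm_le_const
        (C := ‖w‖) fun s _ => w.norm_coe_le_norm _).trans ?_
      have : |(t : ℝ) - 0| ≤ 1 := by rw [sub_zero]; exact abs_le.2 t.2
      nlinarith [norm_nonneg w])

lemma norm_primitive_le (E : Type) [NormedAddCommGroup E] [NormedSpace ℝ E] :
    ‖primitive E‖ ≤ 1 := LinearMap.mkContinuous_norm_le _ zero_le_one _

end SmoothFlow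

namespace SmoothFlow

variable {E : Type} [NormedAddCommGroup E] [NormedSpace ℝ E]

/-- The Picard operator for `u' = s • f u`, `u 0 = x`, on `[-1, 1]`. -/
def picardOp (f : E → E) (hf : Continuous f) (p : ℝ × E) (u : C(Icc (-1 : ℝ) 1, E)) :
    C(Icc (-1 : ℝ) 1, E) :=
  ContinuousMap.const _ p.2 + p.1 • primitive E (postcomp _ f hf u)

lemma picardOp_apply (f : E → E) (hf : Continuous f) (p : ℝ × E) (u : C(Icc (-1 : ℝ) 1, E))
    (t : Icc (-1 : ℝ) 1) : picardOp f hf p u t =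
      p.2 + p.1 • ∫ r in (0 : ℝ)..t, f (u (projIcc (-1) 1 (by norm_num) r)) := rfl

lemma contracting_picardOp {f : E → E} {K : ℝ≥0} (hK : LipschitzWith K f) {p : ℝ × E}
    (hp : ‖p.1‖₊ * K < 1) : ContractingWith (‖p.1‖₊ * K) (picardOp f hK.continuous p) := by
  refine ⟨hp, LipschitzWith.of_dist_le_mul fun u v => ?_⟩
  have h1 : dist (postcomp (Icc (-1 : ℝ) 1) f hK.continuous u) (postcomp _ f hK.continuous v)
      ≤ K * dist u v := by
    refine (ContinuousMap.dist_le (by positivity)).2 fun t => ?_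
    exact (hK.dist_le_mul _ _).trans
      (mul_le_mul_of_nonneg_left (ContinuousMap.dist_apply_le_dist t) K.2)
  have h2 := (primitive E).le_of_opNorm_le (norm_primitive_le E)
    (postcomp (Icc (-1 : ℝ) 1) f hK.continuous u - postcomp _ f hK.continuous v)
  rw [one_mul, map_sub, ← dist_eq_norm, ← dist_eq_norm] at h2
  calc dist (picardOp f hK.continuous p u) (picardOp f hK.continuous p v)
      = ‖p.1‖ * dist (primitive E (postcomp (Icc (-1 : ℝ) 1) f hK.continuous u))
          (primitive E (postcomp _ f hK.continuous v)) := by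
        rw [picardOp, picardOp, dist_add_left, dist_eq_norm, dist_eq_norm, ← smul_sub]
        exact norm_smul p.1 (_ : C(Icc (-1 : ℝ) 1, E))
    _ ≤ ‖p.1‖ * (K * dist u v) := mul_le_mul_of_nonneg_left (h2.trans h1) (norm_nonneg _)
    _ = _ := by rw [← mul_assoc]; rfl

lemma contDiff_picardOp {n : ℕ} {f : E → E} (hf : ContDiff ℝ n f) :
    ContDiff ℝ n (fun q : (ℝ × E) × C(Icc (-1 : ℝ) 1, E) => picardOp f hf.continuous q.1 q.2) := by
  have h1 : ContDiff ℝ n (fun x : E => ContinuousMap.const (Icc (-1 : ℝ) 1) x) := by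
    let L : E →L[ℝ] C(Icc (-1 : ℝ) 1, E) := LinearMap.mkContinuous
      { toFun := fun x => ContinuousMap.const _ x
        map_add' := fun _ _ => rfl
        map_smul' := fun _ _ => rfl } 1 (fun x => by
          rw [one_mul]
          exact (ContinuousMap.norm_le _ (norm_nonneg x)).2 fun t => le_rfl)
    exact L.contDiff
  have h2 : ContDiff ℝ n (fun q : (ℝ × E) × C(Icc (-1 : ℝ) 1, E) =>
      primitive E (postcomp _ f hf.continuous q.2)) :=
    (primitive E).contDiff.comp ((contDiff_postcomp n hf).comp contDiff_snd)
  exact (h1.comp contDiff_fst.snd).add (contDiff_fst.fst.smul h2)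

lemma isInvertible_one_sub [CompleteSpace E] {A : E →L[ℝ] E} (hA : ‖A‖ < 1) :
    (ContinuousLinearMap.id ℝ E - A).IsInvertible :=
  ⟨ContinuousLinearEquiv.unitsEquiv ℝ E (Units.oneSub A hA), by ext x; rfl⟩

lemma contDiffAt_fixedPoint [CompleteSpace E] {n : ℕ} (hn : n ≠ 0) {f : E → E}
    (hf : ContDiff ℝ n f) {K : ℝ≥0} (hK : LipschitzWith K f)
    {U : ℝ × E → C(Icc (-1 : ℝ) 1, E)}
    (hU : ∀ p : ℝ × E, ‖p.1‖₊ * K < 1 → picardOp f hf.continuous p (U p) = U p)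
    {p : ℝ × E} (hp : ‖p.1‖₊ * K < 1) : ContDiffAt ℝ n U p := by
  set G : (ℝ × E) × C(Icc (-1 : ℝ) 1, E) → C(Icc (-1 : ℝ) 1, E) :=
    fun q => q.2 - picardOp f hf.continuous q.1 q.2 with hG
  have hGd : ContDiff ℝ n G := contDiff_snd.sub (contDiff_picardOp hf)
  have hn' : ((n : ℕ) : WithTop ℕ∞) ≠ 0 := by exact_mod_cast hn
  have hf1 : ContDiff ℝ 1 f := hf.of_le (by exact_mod_cast Nat.one_le_iff_ne_zero.2 hn)
  set A := p.1 • (primitive E).comp (pointwiseApply (Icc (-1 : ℝ) 1) E E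
    (postcomp _ (fderiv ℝ f) (hf1.continuous_fderiv one_ne_zero) (U p))) with hA
  have hpart : fderiv ℝ G (p, U p) ∘L .inr ℝ (ℝ × E) C(Icc (-1 : ℝ) 1, E) =
      ContinuousLinearMap.id ℝ _ - A := by
    have h1 : HasFDerivAt (fun v => G (p, v))
        (fderiv ℝ G (p, U p) ∘L .inr ℝ (ℝ × E) C(Icc (-1 : ℝ) 1, E)) (U p) :=
      HasFDerivAt.comp (U p) ((hGd.differentiable hn') (p, U p)).hasFDerivAt
        (hasFDerivAt_prodMk_right p (U p))
    have h2 : HasFDerivAt (fun v => G (p, v)) (ContinuousLinearMap.id ℝ _ - A) (U p) := by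
      have h3 := ((primitive E).hasFDerivAt.comp _ (hasFDerivAt_postcomp hf1 (U p))).const_smul p.1
      exact (hasFDerivAt_id (𝕜 := ℝ) (U p)).sub (h3.const_add (ContinuousMap.const _ p.2))
    exact h1.unique h2
  have hAn : ‖A‖ < 1 := by
    have h3 : ‖postcomp (Icc (-1 : ℝ) 1) (fderiv ℝ f) (hf1.continuous_fderiv one_ne_zero) (U p)‖
        ≤ K := by
      refine (ContinuousMap.norm_le _ K.2).2 fun t => ?_
      exact norm_fderiv_le_of_lipschitz ℝ hK
    calc ‖A‖ ≤ ‖p.1‖ * (1 * K) := by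
          refine (ContinuousLinearMap.opNorm_smul_le _ _).trans ?_
          refine mul_le_mul_of_nonneg_left ?_ (norm_nonneg _)
          refine (ContinuousLinearMap.opNorm_comp_le _ _).trans ?_
          exact mul_le_mul (norm_primitive_le E) ((norm_pointwiseApply_le _).trans h3)
            (norm_nonneg _) zero_le_one
      _ < 1 := by rw [one_mul]; exact_mod_cast hp
  have hinv : (fderiv ℝ G (p, U p) ∘L .inr ℝ (ℝ × E) C(Icc (-1 : ℝ) 1, E)).IsInvertible := by
    rw [hpart]; exact isInvertible_one_sub hAn
  have cdf : ContDiffAt ℝ n G (p, U p) := hGd.contDiffAt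
  refine (cdf.contDiffAt_implicitFunction hn' hinv).congr_of_eventuallyEq ?_
  have hopen : ∀ᶠ q : ℝ × E in 𝓝 p, ‖q.1‖₊ * K < 1 :=
    (isOpen_lt (by fun_prop) continuous_const).mem_nhds hp
  filter_upwards [cdf.eventually_apply_implicitFunction hn' hinv, hopen] with q hq hqK
  have h0 : G (p, U p) = 0 := sub_eq_zero.2 (hU p hp).symm
  have hq' := sub_eq_zero.1 (hq.trans h0)
  exact (contracting_picardOp hK hqK).fixedPoint_unique' (hU q hqK) hq'.symm

/-- A globally Lipschitz field has global solutions. -/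
lemma exists_global_solution [CompleteSpace E] {f : E → E} (hf : ContDiff ℝ 1 f) {K : ℝ≥0}
    (hK : LipschitzWith K f) (x : E) :
    ∃ γ : ℝ → E, γ 0 = x ∧ ∀ t, HasDerivAt γ (f (γ t)) t := by
  obtain ⟨s, hs0, hs⟩ : ∃ s : ℝ, 0 < s ∧ ‖s‖₊ * K < 1 := by
    refine ⟨(K + 1 : ℝ)⁻¹, by positivity, ?_⟩
    have : ‖(K + 1 : ℝ)⁻¹‖ * K < 1 := by
      rw [Real.norm_of_nonneg (by positivity), inv_mul_lt_iff₀ (by positivity)]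
      linarith
    exact_mod_cast this
  have loc : ∀ x : E, ∃ γ : ℝ → E, γ 0 = x ∧ ∀ t ∈ Ioo (-s) s, HasDerivAt γ (f (γ t)) t := by
    intro x
    have hc := contracting_picardOp hK (p := (s, x)) hs
    set u := ContractingWith.fixedPoint _ hc with hu
    have hfix : picardOp f hK.continuous (s, x) u = u := hc.fixedPoint_isFixedPt
    have hcont : Continuous fun r : ℝ => f (u (projIcc (-1) 1 (by norm_num) r)) :=
      hK.continuous.comp (u.continuous.comp continuous_projIcc)
    have heq : ∀ t ∈ Icc (-1 : ℝ) 1, u (projIcc (-1) 1 (by norm_num) t) =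
        x + s • ∫ r in (0 : ℝ)..t, f (u (projIcc (-1) 1 (by norm_num) r)) := by
      intro t ht
      conv_lhs => rw [← hfix]
      rw [picardOp_apply, projIcc_of_mem _ ht]
    refine ⟨fun t => x + s • ∫ r in (0 : ℝ)..(t / s), f (u (projIcc (-1) 1 (by norm_num) r)),
      by simp, fun t ht => ?_⟩
    have hts : t / s ∈ Icc (-1 : ℝ) 1 := by
      constructor
      · rw [le_div_iff₀ hs0]; linarith [ht.1]
      · rw [div_le_iff₀ hs0]; linarith [ht.2]
    have h1 : HasDerivAt (fun t => ∫ r in (0 : ℝ)..t, f (u (projIcc (-1) 1 (by norm_num) r)))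
        (f (u (projIcc (-1) 1 (by norm_num) (t / s)))) (t / s) :=
      intervalIntegral.integral_hasDerivAt_right (hcont.intervalIntegrable _ _)
        (hcont.stronglyMeasurableAtFilter _ _) hcont.continuousAt
    have h2 := ((h1.scomp t ((hasDerivAt_id t).div_const s)).const_smul s).const_add x
    convert! h2 using 1
    beta_reduce
    rw [← heq _ hts, smul_smul, mul_one_div_cancel hs0.ne', one_smul]
  have hv : ContMDiff (modelWithCornersSelf ℝ E) (modelWithCornersSelf ℝ E).tangent 1
      (fun x : E => (⟨x, f x⟩ : TangentBundle (modelWithCornersSelf ℝ E) E)) := by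
    exact contMDiff_vectorSpace_iff_contDiff.2 hf
  obtain ⟨γ, h0, hγ⟩ := exists_isMIntegralCurve_of_isMIntegralCurveOn (M := E)
    (I := modelWithCornersSelf ℝ E) (v := f) hv hs0 (fun x => by
      obtain ⟨γ, h0, hγ⟩ := loc x
      exact ⟨γ, h0, fun t ht => (hγ t ht).hasFDerivAt.hasFDerivWithinAt.hasMFDerivWithinAt⟩) x
  refine ⟨γ, h0, fun t => ?_⟩
  have h1 : HasFDerivAt γ (ContinuousLinearMap.smulRight (1 : ℝ →L[ℝ] ℝ) (f (γ t))) t :=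
    (hγ t).hasFDerivAt
  simpa using h1.hasDerivAt

lemma global_solution_unique {f : E → E} {K : ℝ≥0} (hK : LipschitzWith K f) {γ γ' : ℝ → E}
    (h : ∀ t, HasDerivAt γ (f (γ t)) t) (h' : ∀ t, HasDerivAt γ' (f (γ' t)) t) {t0 : ℝ}
    (h0 : γ t0 = γ' t0) : γ = γ' :=
  ODE_solution_unique_univ (v := fun _ => f) (s := fun _ => univ) (K := K)
    (fun _ => hK.lipschitzOnWith) (fun t => ⟨h t, trivial⟩) (fun t => ⟨h' t, trivial⟩) h0

/-- The flow of a globally Lipschitz `C^n` field exists for all times and is jointly `C^n`. -/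
lemma exists_contDiff_flow [CompleteSpace E] {n : ℕ} (hn : n ≠ 0) {f : E → E}
    (hf : ContDiff ℝ n f) {K : ℝ≥0} (hK : LipschitzWith K f) :
    ∃ Φ : ℝ → E → E, (∀ x, Φ 0 x = x) ∧
      (∀ x t, HasDerivAt (fun t => Φ t x) (f (Φ t x)) t) ∧
      ContDiff ℝ n (fun p : ℝ × E => Φ p.1 p.2) := by
  have hf1 : ContDiff ℝ 1 f := hf.of_le (by exact_mod_cast Nat.one_le_iff_ne_zero.2 hn)
  choose γ h0 hγ using exists_global_solution hf1 hK
  refine ⟨fun t x => γ x t, h0, hγ, ?_⟩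
  have hadd : ∀ x s t, γ x (s + t) = γ (γ x t) s := by
    intro x s t
    have : (fun s => γ x (s + t)) = γ (γ x t) := global_solution_unique hK
      (fun s => (hγ x (s + t)).comp_add_const s t) (hγ (γ x t)) (t0 := 0) (by simp [h0])
    exact congrFun this s
  have hcγ : ∀ x, Continuous (γ x) := fun x =>
    continuous_iff_continuousAt.2 fun t => (hγ x t).continuousAt
  set U : ℝ × E → C(Icc (-1 : ℝ) 1, E) := fun p =>
    ⟨fun t => γ p.2 (p.1 * t), (hcγ p.2).comp (by fun_prop)⟩ with hUdef
  have hU : ∀ p : ℝ × E, ‖p.1‖₊ * K < 1 → picardOp f hf.continuous p (U p) = U p := by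
    rintro ⟨s, x⟩ -
    ext t
    rw [picardOp_apply]
    have h1 : ∀ r, HasDerivAt (fun r => γ x (s * r)) (s • f (γ x (s * r))) r := fun r => by
      have := (hγ x (s * r)).scomp r ((hasDerivAt_id r).const_mul s)
      simpa [Function.comp_def] using this
    have hc : Continuous fun r => f (γ x (s * r)) :=
      hK.continuous.comp ((hcγ x).comp (by fun_prop))
    have h2 := intervalIntegral.integral_eq_sub_of_hasDerivAt (a := 0) (b := (t : ℝ))
      (fun r _ => h1 r) ((hc.const_smul s).intervalIntegrable _ _)
    rw [intervalIntegral.integral_smul] at h2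
    have h3 : ∫ r in (0 : ℝ)..t, f ((U (s, x)) (projIcc (-1) 1 (by norm_num) r)) =
        ∫ r in (0 : ℝ)..t, f (γ x (s * r)) := by
      refine intervalIntegral.integral_congr fun r hr => ?_
      have hr' : r ∈ Icc (-1 : ℝ) 1 := by
        have ht := t.2
        rcases le_total 0 (t : ℝ) with h | h
        · rw [uIcc_of_le h] at hr; exact ⟨by linarith [hr.1], hr.2.trans ht.2⟩
        · rw [uIcc_of_ge h] at hr; exact ⟨ht.1.trans hr.1, by linarith [hr.2]⟩
      simp only [hUdef, ContinuousMap.coe_mk, projIcc_of_mem _ hr']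
    rw [h3]
    change x + s • _ = γ x (s * t)
    rw [h2, mul_zero, h0]; abel
  have hsmall : ∀ p : ℝ × E, ‖p.1‖₊ * K < 1 → ContDiffAt ℝ n (fun p : ℝ × E => γ p.2 p.1) p := by
    intro p hp
    have h1 := contDiffAt_fixedPoint hn hf hK hU hp
    have h2 := (ContinuousMap.evalCLM ℝ (⟨1, by norm_num⟩ : Icc (-1 : ℝ) 1) (M := E)).contDiff.contDiffAt.comp
      p (n := n) h1
    refine h2.congr_of_eventuallyEq (Eventually.of_forall fun q => ?_)
    simp [hUdef]
  have hall : ∀ N : ℕ, ∀ p : ℝ × E, ‖p.1‖ * K < 2 ^ N →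
      ContDiffAt ℝ n (fun p : ℝ × E => γ p.2 p.1) p := by
    intro N
    induction N with
    | zero => intro p hp; exact hsmall p (by rw [pow_zero] at hp; exact_mod_cast hp)
    | succ N ih =>
      intro p hp
      have hhalf : ‖p.1 / 2‖ * K < 2 ^ N := by
        rw [norm_div, Real.norm_of_nonneg (zero_le_two (α := ℝ))]
        rw [pow_succ] at hp; linarith
      have h1 : ContDiffAt ℝ n (fun q : ℝ × E => (q.1 / 2, q.2)) p := by fun_prop
      have h2 : ContDiffAt ℝ n (fun q : ℝ × E => γ q.2 (q.1 / 2)) p :=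
        ContDiffAt.comp p (g := fun p : ℝ × E => γ p.2 p.1) (ih (p.1 / 2, p.2) hhalf) h1
      have h3 : ContDiffAt ℝ n (fun q : ℝ × E => (q.1 / 2, γ q.2 (q.1 / 2))) p :=
        (show ContDiffAt ℝ n (fun q : ℝ × E => q.1 / 2) p by fun_prop).prodMk h2
      have h4 := ContDiffAt.comp p (g := fun p : ℝ × E => γ p.2 p.1)
        (ih (p.1 / 2, γ p.2 (p.1 / 2)) hhalf) h3
      refine h4.congr_of_eventuallyEq (Eventually.of_forall fun q => ?_)
      change γ q.2 q.1 = γ (γ q.2 (q.1 / 2)) (q.1 / 2)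
      rw [← hadd, add_halves]
  refine contDiff_iff_contDiffAt.2 fun p => ?_
  obtain ⟨N, hN⟩ := pow_unbounded_of_one_lt (‖p.1‖ * K) (one_lt_two (α := ℝ))
  exact hall N p hN

end SmoothFlow

/-! ### One-dimensional oscillators -/

namespace Oscillator

/-- `a` is the force of a potential `W` which has a well on `[l, r]` with minimum at `0`. -/
structure Well (a W : ℝ → ℝ) (l r : ℝ) : Prop where
  l_neg : l < 0
  r_pos : 0 < r
  cont : Continuous a
  deriv : ∀ q, HasDerivAt W (-a q) q
  neg : ∀ q ∈ Ioc 0 r, a q < 0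
  pos : ∀ q ∈ Ico l 0, 0 < a q

/-- `(q, p)` solves `q' = p`, `p' = a q`. -/
structure IsMotion (a q p : ℝ → ℝ) : Prop where
  dq : ∀ t, HasDerivAt q (p t) t
  dp : ∀ t, HasDerivAt p (a (q t)) t

variable {a W q p : ℝ → ℝ} {l r : ℝ}

namespace Well

lemma strictMonoOn (h : Well a W l r) : StrictMonoOn W (Icc 0 r) := by
  refine strictMonoOn_Icc (fun x _ => h.deriv x) fun x hx => ?_
  linarith [h.neg x ⟨hx.1, hx.2.le⟩]

lemma strictAntiOn (h : Well a W l r) : StrictAntiOn W (Icc l 0) := by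
  refine strictAntiOn_Icc (fun x _ => h.deriv x) fun x hx => ?_
  linarith [h.pos x ⟨hx.1.le, hx.2⟩]

lemma continuous (h : Well a W l r) : Continuous W :=
  continuous_iff_continuousAt.2 fun x => (h.deriv x).continuousAt

/-- Between two points `y < 0 < x` of the well of equal potential lies a sublevel set. -/
lemma le_iff (h : Well a W l r) {x y z : ℝ} (hx : x ∈ Ioc 0 r) (hy : y ∈ Ico l 0)
    (hxy : W y = W x) (hz : z ∈ Icc l r) : W z ≤ W x ↔ z ∈ Icc y x := by
  rcases le_total 0 z with h0 | h0
  · rw [h.strictMonoOn.le_iff_le ⟨h0, hz.2⟩ ⟨hx.1.le, hx.2⟩]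
    exact ⟨fun h1 => ⟨hy.2.le.trans h0, h1⟩, fun h1 => h1.2⟩
  · rw [← hxy, h.strictAntiOn.le_iff_ge ⟨hz.1, h0⟩ ⟨hy.1, hy.2.le⟩]
    exact ⟨fun h1 => ⟨h1, h0.trans hx.1.le⟩, fun h1 => h1.1⟩

lemma lt_iff (h : Well a W l r) {x y z : ℝ} (hx : x ∈ Ioc 0 r) (hy : y ∈ Ico l 0)
    (hxy : W y = W x) (hz : z ∈ Icc l r) : W z < W x ↔ z ∈ Ioo y x := by
  rcases le_total 0 z with h0 | h0
  · rw [h.strictMonoOn.lt_iff_lt ⟨h0, hz.2⟩ ⟨hx.1.le, hx.2⟩]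
    exact ⟨fun h1 => ⟨hy.2.trans_le h0, h1⟩, fun h1 => h1.2⟩
  · rw [← hxy, h.strictAntiOn.lt_iff_gt ⟨hz.1, h0⟩ ⟨hy.1, hy.2.le⟩]
    exact ⟨fun h1 => ⟨h1, h0.trans_lt hx.1⟩, fun h1 => h1.1⟩

end Well

namespace IsMotion

lemma contq (m : IsMotion a q p) : Continuous q :=
  continuous_iff_continuousAt.2 fun t => (m.dq t).continuousAt

lemma contp (m : IsMotion a q p) : Continuous p :=
  continuous_iff_continuousAt.2 fun t => (m.dp t).continuousAt

lemma energy (m : IsMotion a q p) (h : Well a W l r) (s t : ℝ) :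
    p s ^ 2 / 2 + W (q s) = p t ^ 2 / 2 + W (q t) := by
  have hd : ∀ t, HasDerivAt (fun t => p t ^ 2 / 2 + W (q t)) 0 t := fun t => by
    have h1 := (((m.dp t).pow 2).div_const 2).add ((h.deriv (q t)).comp t (m.dq t))
    refine h1.congr_deriv ?_
    push_cast; ring
  exact is_const_of_deriv_eq_zero (fun t => (hd t).differentiableAt) (fun t => (hd t).deriv) s t

lemma reverse (m : IsMotion a q p) (c : ℝ) :
    IsMotion a (fun t => q (c - t)) (fun t => -p (c - t)) where
  dq t := by
    have := (m.dq (c - t)).comp_const_sub c t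
    exact this
  dp t := by
    have := ((m.dp (c - t)).comp_const_sub c t).neg
    rw [neg_neg] at this
    exact this

lemma shift (m : IsMotion a q p) (c : ℝ) :
    IsMotion a (fun t => q (t + c)) (fun t => p (t + c)) where
  dq t := (m.dq (t + c)).comp_add_const t c
  dp t := (m.dp (t + c)).comp_add_const t c

lemma unique {K : ℝ≥0} (hK : LipschitzWith K a) {q' p' : ℝ → ℝ} (m : IsMotion a q p)
    (m' : IsMotion a q' p') {t0 : ℝ} (h1 : q t0 = q' t0) (h2 : p t0 = p' t0) : q = q' ∧ p = p' := by
  have hf : LipschitzWith (max 1 K) (fun z : ℝ × ℝ => (z.2, a z.1)) := by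
    refine LipschitzWith.prodMk LipschitzWith.prod_snd ?_
    simpa [Function.comp_def] using hK.comp LipschitzWith.prod_fst
  have := SmoothFlow.global_solution_unique hf (γ := fun t => (q t, p t))
    (γ' := fun t => (q' t, p' t)) (t0 := t0) (fun t => (m.dq t).prodMk (m.dp t))
    (fun t => (m'.dq t).prodMk (m'.dp t)) (by simp [h1, h2])
  exact ⟨funext fun t => congrArg Prod.fst (congrFun this t),
    funext fun t => congrArg Prod.snd (congrFun this t)⟩

/-- Reflection of a motion at a turning point. -/
lemma symm_of_turning {K : ℝ≥0} (hK : LipschitzWith K a) (m : IsMotion a q p) {c : ℝ}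
    (hc : p c = 0) (t : ℝ) : q (c - t) = q (c + t) ∧ p (c - t) = -p (c + t) := by
  obtain ⟨h1, h2⟩ := (m.reverse c).unique hK (m.shift c) (t0 := 0) (by simp) (by simp [hc])
  constructor
  · rw [add_comm]; exact congrFun h1 t
  · rw [add_comm, ← congrFun h2 t, neg_neg]

lemma mem_Icc (m : IsMotion a q p) (h : Well a W l r) {x y : ℝ} (hx : x ∈ Ioo 0 r)
    (hy : y ∈ Ioo l 0) (hxy : W y = W x) {t0 : ℝ} (hq : q t0 ∈ Icc y x)
    (hE : p t0 ^ 2 / 2 + W (q t0) = W x) (t : ℝ) : q t ∈ Icc y x := by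
  have hW : ∀ t, W (q t) ≤ W x := fun t => by
    have := m.energy h t t0
    nlinarith [sq_nonneg (p t)]
  have himg : q '' univ ⊆ Icc y x := by
    have hpre : IsPreconnected (q '' univ) := isPreconnected_univ.image q m.contq.continuousOn
    have hoc := hpre.ordConnected
    rintro _ ⟨t, -, rfl⟩
    have hcore : ∀ z ∈ q '' univ, z ∈ Icc l r → z ∈ Icc y x := by
      rintro _ ⟨s, -, rfl⟩ hz
      exact (h.le_iff ⟨hx.1, hx.2.le⟩ ⟨hy.1.le, hy.2⟩ hxy hz).1 (hW s)
    have h0 : q t0 ∈ q '' univ := mem_image_of_mem q trivial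
    have ht : q t ∈ q '' univ := mem_image_of_mem q trivial
    by_contra hcon
    rcases not_and_or.1 hcon with h1 | h1
    · obtain ⟨z, hz1, hz2⟩ := exists_between (max_lt hy.1 (not_le.1 h1))
      have := hcore z (hoc.out ht h0 ⟨((le_max_right _ _).trans_lt hz1).le, hz2.le.trans hq.1⟩)
        ⟨((le_max_left _ _).trans_lt hz1).le, hz2.le.trans (hy.2.le.trans h.r_pos.le)⟩
      exact absurd this.1 (not_le.2 hz2)
    · obtain ⟨z, hz1, hz2⟩ := exists_between (lt_min hx.2 (not_le.1 h1))
      have := hcore z (hoc.out h0 ht ⟨hq.2.trans hz1.le, (hz2.trans_le (min_le_right _ _)).le⟩)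
        ⟨h.l_neg.le.trans (hx.1.le.trans hz1.le), (hz2.trans_le (min_le_left _ _)).le⟩
      exact absurd this.2 (not_le.2 hz1)
  exact himg (mem_image_of_mem q trivial)

/-- A motion released at rest at `x > 0` reaches the opposite turning point `y < 0`. -/
lemma exists_half_period (m : IsMotion a q p) (h : Well a W l r) {x y : ℝ} (hx : x ∈ Ioo 0 r)
    (hy : y ∈ Ioo l 0) (hxy : W y = W x) (hq0 : q 0 = x) (hp0 : p 0 = 0) :
    ∃ τ > 0, (∀ t ∈ Ioo 0 τ, p t < 0) ∧ p τ = 0 ∧ q τ = y := by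
  have hmem : ∀ t, q t ∈ Icc y x := m.mem_Icc h hx hy hxy (t0 := 0)
    (by rw [hq0]; exact ⟨(hy.2.trans hx.1).le, le_rfl⟩) (by rw [hq0, hp0]; ring)
  obtain ⟨η, hη, hneg⟩ : ∃ η > 0, ∀ t ∈ Ioc 0 η, p t < 0 := by
    have hd : HasDerivAt p (a x) 0 := hq0 ▸ m.dp 0
    have h1 := (hasDerivAt_iff_tendsto_slope.1 hd).eventually
      (gt_mem_nhds (h.neg x ⟨hx.1, hx.2.le⟩))
    rw [eventually_nhdsWithin_iff, Metric.eventually_nhds_iff] at h1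
    obtain ⟨η, hη, h1⟩ := h1
    refine ⟨η / 2, by positivity, fun t ht => ?_⟩
    have h2 := h1 (y := t) (by rw [Real.dist_eq, sub_zero, abs_of_pos ht.1]; linarith [ht.2]) ht.1.ne'
    rw [slope_def_field, hp0, sub_zero, sub_zero] at h2
    by_contra hcon
    exact absurd h2 (not_lt.2 (div_nonneg (not_lt.1 hcon) ht.1.le))
  obtain ⟨t1, ht1, hpt1⟩ : ∃ t1 > η, 0 ≤ p t1 := by
    by_contra! hcon
    have hneg' : ∀ t > 0, p t < 0 := fun t ht => by
      rcases le_or_gt t η with h1 | h1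
      exacts [hneg t ⟨ht, h1⟩, hcon t h1]
    have hanti : AntitoneOn q (Ici 0) := antitoneOn_of_deriv_nonpos (convex_Ici 0)
      m.contq.continuousOn (fun t _ => (m.dq t).differentiableAt.differentiableWithinAt)
      fun t ht => by rw [interior_Ici] at ht; rw [(m.dq t).deriv]; exact (hneg' t ht).le
    obtain ⟨t1, ht1, hq1⟩ : ∃ t1 > η, q t1 < 0 := by
      by_contra! hq
      have hp : ∀ t > η, p t ≤ p η := fun t ht => by
        have := (convex_Icc η t).image_sub_le_mul_sub_of_deriv_le m.contp.continuousOn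
          (fun s _ => (m.dp s).differentiableAt.differentiableWithinAt) (C := 0)
          (fun s hs => by
            rw [interior_Icc] at hs
            rw [(m.dp s).deriv]
            rcases (hq s hs.1).eq_or_lt with h0 | h0
            · rw [← h0]
              have ha : Tendsto a (𝓝[>] 0) (𝓝 (a 0)) := h.cont.continuousAt.continuousWithinAt
              refine le_of_tendsto ha ?_
              filter_upwards [Ioc_mem_nhdsGT h.r_pos] with z hz
              exact (h.neg z hz).le
            · exact (h.neg _ ⟨h0, (hmem s).2.trans hx.2.le⟩).le)
          η (left_mem_Icc.2 ht.le) t (right_mem_Icc.2 ht.le) ht.le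
        linarith
      have hpη := hneg η ⟨hη, le_rfl⟩
      set t := η + (q η + 1) / -p η with ht
      have hqη : 0 ≤ q η := by
        refine ge_of_tendsto (m.contq.continuousAt.continuousWithinAt (s := Ioi η)) ?_
        filter_upwards [self_mem_nhdsWithin] with s hs using hq s hs
      have htη : η < t := by
        rw [ht]; have : 0 < (q η + 1) / -p η := div_pos (by linarith) (by linarith)
        linarith
      have := (convex_Icc η t).image_sub_le_mul_sub_of_deriv_le m.contq.continuousOn
          (fun s _ => (m.dq s).differentiableAt.differentiableWithinAt) (C := p η)
          (fun s hs => by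
            rw [interior_Icc] at hs
            rw [(m.dq s).deriv]
            exact hp s hs.1) η (left_mem_Icc.2 htη.le) t (right_mem_Icc.2 htη.le) htη.le
      have e : p η * (t - η) = -(q η + 1) := by
        rw [ht, add_sub_cancel_left, div_neg, mul_neg, mul_div_cancel₀ _ hpη.ne]
      linarith [hq t htη]
    obtain ⟨z, hz, hzmin⟩ := (isCompact_Icc (a := y) (b := q t1)).exists_isMinOn
      ⟨q t1, (hmem t1).1, le_rfl⟩ h.cont.continuousOn
    have hc : 0 < a z := h.pos z ⟨hy.1.le.trans hz.1, hz.2.trans_lt hq1⟩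
    set t := t1 + (-p t1) / a z with ht
    have htt : t1 ≤ t := by
      rw [ht]; have := div_nonneg (neg_nonneg.2 (hcon t1 ht1).le) hc.le; linarith
    have := (convex_Icc t1 t).mul_sub_le_image_sub_of_le_deriv m.contp.continuousOn
          (fun s _ => (m.dp s).differentiableAt.differentiableWithinAt) (C := a z)
          (fun s hs => by
            rw [interior_Icc] at hs
            rw [(m.dp s).deriv]
            exact hzmin ⟨(hmem s).1, hanti (mem_Ici.2 (hη.trans ht1).le)
              (mem_Ici.2 ((hη.trans ht1).le.trans hs.1.le)) hs.1.le⟩)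
          t1 (left_mem_Icc.2 htt) t (right_mem_Icc.2 htt) htt
    have e : a z * (t - t1) = -p t1 := by rw [ht]; field_simp; ring
    linarith [hcon t (ht1.trans_le htt)]
  set T := {t | t ∈ Icc η t1 ∧ 0 ≤ p t} with hT
  have hTc : IsCompact T := isCompact_Icc.inter_right (isClosed_le continuous_const m.contp)
  obtain ⟨τ, ⟨hτ, hpτ⟩, hτmin⟩ := hTc.exists_isLeast ⟨t1, ⟨ht1.le, le_rfl⟩, hpt1⟩
  have hτη : η < τ := lt_of_le_of_ne hτ.1 fun e => by
    rw [← e] at hpτ; exact absurd (hneg η ⟨hη, le_rfl⟩) (not_lt.2 hpτ)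
  have hlt : ∀ t ∈ Ioo 0 τ, p t < 0 := fun t ht => by
    rcases le_or_gt t η with h1 | h1
    · exact hneg t ⟨ht.1, h1⟩
    · by_contra hcon
      exact absurd (hτmin ⟨⟨h1.le, ht.2.le.trans hτ.2⟩, not_lt.1 hcon⟩) (not_le.2 ht.2)
  have hτ0 : 0 < τ := hη.trans hτη
  have hpz : p τ = 0 := by
    refine le_antisymm ?_ hpτ
    refine le_of_tendsto (m.contp.continuousAt.continuousWithinAt (s := Iio τ)) ?_
    filter_upwards [Ioo_mem_nhdsLT hτ0] with s hs using (hlt s hs).le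
  refine ⟨τ, hτ0, hlt, hpz, ?_⟩
  have hsa : StrictAntiOn q (Icc 0 τ) := strictAntiOn_Icc (fun t _ => m.dq t) hlt
  have h1 : q τ < x := hq0 ▸ hsa (left_mem_Icc.2 hτ0.le) (right_mem_Icc.2 hτ0.le) hτ0
  have h2 := m.energy h τ 0
  rw [hpz, hp0, hq0] at h2
  have h3 := (h.lt_iff ⟨hx.1, hx.2.le⟩ ⟨hy.1.le, hy.2⟩ hxy (z := q τ)
    ⟨hy.1.le.trans (hmem τ).1, (hmem τ).2.trans hx.2.le⟩).not.1 (by linarith)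
  exact ((hmem τ).1.eq_or_lt.resolve_right fun h4 => h3 ⟨h4, h1⟩).symm

end IsMotion

end Oscillator

namespace Oscillator

/-- The motion `(q, p)` released at rest at `x` swings to the opposite turning point `y` in time `τ`. -/
structure HalfSwing (a W : ℝ → ℝ) (l r : ℝ) (q p : ℝ → ℝ) (x y τ : ℝ) : Prop where
  well : Well a W l r
  motion : IsMotion a q p
  hx : x ∈ Ioo 0 r
  hy : y ∈ Ioo l 0
  hxy : W y = W x
  q_zero : q 0 = x
  p_zero : p 0 = 0
  τ_pos : 0 < τ
  neg : ∀ t ∈ Ioo 0 τ, p t < 0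
  p_τ : p τ = 0
  q_τ : q τ = y

namespace HalfSwing

variable {a W q p : ℝ → ℝ} {l r x y τ : ℝ}

lemma mem_Icc (s : HalfSwing a W l r q p x y τ) (t : ℝ) : q t ∈ Icc y x :=
  s.motion.mem_Icc s.well s.hx s.hy s.hxy (t0 := 0)
    (by rw [s.q_zero]; exact ⟨(s.hy.2.trans s.hx.1).le, le_rfl⟩) (by rw [s.q_zero, s.p_zero]; ring) t

lemma energy (s : HalfSwing a W l r q p x y τ) (t : ℝ) : p t ^ 2 / 2 + W (q t) = W x := by
  have := s.motion.energy s.well t 0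
  rw [s.q_zero, s.p_zero] at this; linarith

lemma strictAntiOn (s : HalfSwing a W l r q p x y τ) : StrictAntiOn q (Icc 0 τ) :=
  strictAntiOn_Icc (fun t _ => s.motion.dq t) s.neg

lemma nonpos (s : HalfSwing a W l r q p x y τ) {t : ℝ} (ht : t ∈ Icc 0 τ) : p t ≤ 0 := by
  rcases ht.1.eq_or_lt with h | h
  · rw [← h, s.p_zero]
  · rcases ht.2.eq_or_lt with h' | h'
    · rw [h', s.p_τ]
    · exact (s.neg t ⟨h, h'⟩).le

lemma neg_p_eq (s : HalfSwing a W l r q p x y τ) {t : ℝ} (ht : t ∈ Icc 0 τ) :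
    -p t = √(2 * (W x - W (q t))) := by
  rw [eq_comm, Real.sqrt_eq_iff_mul_self_eq _ (by linarith [s.nonpos ht])]
  · have := s.energy t; nlinarith
  · have := s.energy t; nlinarith [sq_nonneg (p t)]

lemma image_Ioo (s : HalfSwing a W l r q p x y τ) {t : ℝ} (ht : t ∈ Icc 0 τ) :
    q '' Ioo 0 t = Ioo (q t) x := by
  ext z
  constructor
  · rintro ⟨u, hu, rfl⟩
    have h0 : (0 : ℝ) ∈ Icc 0 τ := ⟨le_rfl, s.τ_pos.le⟩
    have hu' : u ∈ Icc 0 τ := ⟨hu.1.le, hu.2.le.trans ht.2⟩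
    exact ⟨s.strictAntiOn hu' ht hu.2, s.q_zero ▸ s.strictAntiOn h0 hu' hu.1⟩
  · rintro ⟨h1, h2⟩
    obtain ⟨u, hu, rfl⟩ := intermediate_value_Icc' ht.1 s.motion.contq.continuousOn
      (show z ∈ Icc (q t) (q 0) from ⟨h1.le, s.q_zero ▸ h2.le⟩)
    refine ⟨u, ⟨lt_of_le_of_ne hu.1 ?_, lt_of_le_of_ne hu.2 ?_⟩, rfl⟩
    · rintro rfl; exact h2.ne s.q_zero
    · rintro rfl; exact h1.ne rfl

lemma integral_eq (s : HalfSwing a W l r q p x y τ) (g : ℝ → ℝ) {t : ℝ} (ht : t ∈ Icc 0 τ) :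
    ∫ z in (q t)..x, g z = ∫ u in Ioo 0 t, -p u * g (q u) := by
  have hle : q t ≤ x := (s.mem_Icc t).2
  rw [intervalIntegral.integral_of_le hle, MeasureTheory.integral_Ioc_eq_integral_Ioo,
    ← s.image_Ioo ht, MeasureTheory.integral_image_eq_integral_abs_deriv_smul measurableSet_Ioo
      (fun u _ => (s.motion.dq u).hasDerivWithinAt)
      (s.strictAntiOn.injOn.mono (Ioo_subset_Icc_self.trans (Icc_subset_Icc_right ht.2)))]
  refine MeasureTheory.setIntegral_congr_fun measurableSet_Ioo fun u hu => ?_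
  simp only [smul_eq_mul]
  rw [abs_of_nonpos (s.nonpos ⟨hu.1.le, hu.2.le.trans ht.2⟩)]

lemma integral_time (s : HalfSwing a W l r q p x y τ) {t : ℝ} (ht : t ∈ Icc 0 τ) :
    ∫ z in (q t)..x, 1 / √(2 * (W x - W z)) = t := by
  rw [s.integral_eq _ ht]
  have : ∫ u in Ioo 0 t, -p u * (1 / √(2 * (W x - W (q u)))) = ∫ u in Ioo 0 t, (1 : ℝ) := by
    refine MeasureTheory.setIntegral_congr_fun measurableSet_Ioo fun u hu => ?_
    rw [← s.neg_p_eq ⟨hu.1.le, hu.2.le.trans ht.2⟩]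
    exact mul_one_div_cancel (by linarith [s.neg u ⟨hu.1, hu.2.trans_le ht.2⟩])
  rw [this]
  simp [ht.1]

lemma integral_action (s : HalfSwing a W l r q p x y τ) :
    ∫ z in y..x, √(2 * (W x - W z)) = ∫ u in (0 : ℝ)..τ, p u ^ 2 := by
  have ht : τ ∈ Icc 0 τ := ⟨s.τ_pos.le, le_rfl⟩
  have := s.integral_eq (fun z => √(2 * (W x - W z))) ht
  rw [s.q_τ] at this
  rw [this, intervalIntegral.integral_of_le s.τ_pos.le, MeasureTheory.integral_Ioc_eq_integral_Ioo]
  refine MeasureTheory.setIntegral_congr_fun measurableSet_Ioo fun u hu => ?_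
  rw [← s.neg_p_eq ⟨hu.1.le, hu.2.le⟩]; ring

lemma even (s : HalfSwing a W l r q p x y τ) {K : ℝ≥0} (hK : LipschitzWith K a) (t : ℝ) :
    q (-t) = q t ∧ p (-t) = -p t := by
  simpa using s.motion.symm_of_turning hK s.p_zero t

lemma periodic (s : HalfSwing a W l r q p x y τ) {K : ℝ≥0} (hK : LipschitzWith K a) (t : ℝ) :
    q (t + 2 * τ) = q t ∧ p (t + 2 * τ) = p t := by
  obtain ⟨h1, h2⟩ := s.motion.symm_of_turning hK s.p_τ (t + τ)
  obtain ⟨h3, h4⟩ := s.even hK t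
  rw [show τ - (t + τ) = -t by ring, show τ + (t + τ) = t + 2 * τ by ring] at h1 h2
  exact ⟨by rw [← h1, h3], by linarith⟩

lemma pos_of_mem (s : HalfSwing a W l r q p x y τ) {K : ℝ≥0} (hK : LipschitzWith K a) {t : ℝ}
    (ht : t ∈ Ioo τ (2 * τ)) : 0 < p t := by
  have h1 := (s.motion.symm_of_turning hK s.p_τ (t - τ)).2
  rw [show τ - (t - τ) = 2 * τ - t by ring, show τ + (t - τ) = t by ring] at h1
  linarith [s.neg (2 * τ - t) ⟨by linarith [ht.2], by linarith [ht.1]⟩]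

/-- The half swing covers the lower half of the energy level. -/
lemma exists_time_of_nonpos (s : HalfSwing a W l r q p x y τ) {q0 p0 : ℝ} (hq : q0 ∈ Icc l r)
    (hE : p0 ^ 2 / 2 + W q0 = W x) (hp : p0 ≤ 0) : ∃ t ∈ Icc 0 τ, q t = q0 ∧ p t = p0 := by
  have hq' : q0 ∈ Icc y x :=
    (s.well.le_iff ⟨s.hx.1, s.hx.2.le⟩ ⟨s.hy.1.le, s.hy.2⟩ s.hxy hq).1 (by nlinarith [sq_nonneg p0])
  obtain ⟨t, ht, rfl⟩ := intermediate_value_Icc' s.τ_pos.le s.motion.contq.continuousOn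
    (show q0 ∈ Icc (q τ) (q 0) by rwa [s.q_zero, s.q_τ])
  refine ⟨t, ht, rfl, ?_⟩
  have h1 := s.neg_p_eq ht
  have h2 : √(2 * (W x - W (q t))) = -p0 := by
    rw [← hE, show 2 * (p0 ^ 2 / 2 + W (q t) - W (q t)) = (-p0) ^ 2 by ring,
      Real.sqrt_sq (by linarith)]
  linarith

end HalfSwing

end Oscillator

/-! ### Extension of the potentials outside of the relevant energy range -/

namespace Oscillator

lemma contDiff_mul_of_tsupport {E : Type*} [NormedAddCommGroup E] [NormedSpace ℝ E] {n : ℕ}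
    {χ g : E → ℝ} {O : Set E} (hO : IsOpen O) (hχ : ContDiff ℝ n χ) (hs : tsupport χ ⊆ O)
    (hg : ContDiffOn ℝ n g O) : ContDiff ℝ n (fun x => χ x * g x) := by
  refine contDiff_iff_contDiffAt.2 fun x => ?_
  by_cases hx : x ∈ O
  · exact hχ.contDiffAt.mul (hg.contDiffAt (hO.mem_nhds hx))
  · have h0 : (fun x => χ x * g x) =ᶠ[𝓝 x] fun _ => 0 := by
      filter_upwards [(isClosed_tsupport χ).isOpen_compl.mem_nhds fun h => hx (hs h)] with y hy
      rw [image_eq_zero_of_notMem_tsupport hy, zero_mul]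
    exact contDiffAt_const.congr_of_eventuallyEq h0

/-- `[l, r]` is a compact part of the well of `V` which contains the sublevel set of some level
above `h`, `a` and `W` are extensions of the force and the potential on `[l, r]` and `χ` is a cutoff
function adapted to `[l, r]`. -/
structure Core (U : Set ℝ) (V : ℝ → ℝ) (h : ℝ) (a W χ : ℝ → ℝ) (l r h' : ℝ) : Prop where
  well : Well a W l r
  subset : Icc l r ⊆ U
  lt_level : h < h'
  mem_of_lt : ∀ q ∈ U, V q < h' → q ∈ Ioo l r
  level_le_l : h' ≤ V l
  level_le_r : h' ≤ V r
  W_eq : ∀ q ∈ Icc l r, W q = V q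
  a_eq : ∀ q ∈ Icc l r, a q = -_root_.deriv V q
  contDiff : ContDiff ℝ 2 a
  lipschitz : ∃ K : ℝ≥0, LipschitzWith K a
  χ_contDiff : ContDiff ℝ 2 χ
  χ_compact : HasCompactSupport χ
  χ_tsupport : tsupport χ ⊆ U
  χ_eq : ∀ q ∈ Icc l r, χ q = 1

lemma exists_core {U : Set ℝ} {V : ℝ → ℝ} {h : ℝ} {n : ℕ} (hn : 4 < n) (hU : IsOpen U)
    (hUc : U.OrdConnected) (h0 : (0 : ℝ) ∈ U) (hV : ContDiffOn ℝ n V U) (hV0 : V 0 = 0)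
    (hw : ∀ q ∈ U, q ≠ 0 → 0 < q * deriv V q) (hh : 0 < h)
    (hc : IsCompact {q | q ∈ U ∧ V q ≤ h}) :
    ∃ a W χ l r h', Core U V h a W χ l r h' := by
  have hne : {q | q ∈ U ∧ V q ≤ h}.Nonempty := ⟨0, h0, by rw [hV0]; exact hh.le⟩
  have hdiff : ∀ q ∈ U, HasDerivAt V (deriv V q) q := fun q hq =>
    ((hV.differentiableOn (by norm_cast; omega)).differentiableAt (hU.mem_nhds hq)).hasDerivAt
  obtain ⟨m, ⟨hmU, hmh⟩, hm⟩ := hc.exists_isGreatest hne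
  obtain ⟨m', ⟨hmU', hmh'⟩, hm'⟩ := hc.exists_isLeast hne
  have hm0 : 0 ≤ m := hm ⟨h0, by rw [hV0]; exact hh.le⟩
  have hm0' : m' ≤ 0 := hm' ⟨h0, by rw [hV0]; exact hh.le⟩
  obtain ⟨e1, he1, hb1⟩ := Metric.isOpen_iff.1 hU m hmU
  obtain ⟨e2, he2, hb2⟩ := Metric.isOpen_iff.1 hU m' hmU'
  set e := min e1 e2 with he
  have he0 : 0 < e := lt_min he1 he2
  have hrU' : m + 2 * e / 3 ∈ U := hb1 (by
    rw [Metric.mem_ball, Real.dist_eq, add_sub_cancel_left, abs_of_pos (by positivity)]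
    linarith [min_le_left e1 e2])
  have hlU' : m' - 2 * e / 3 ∈ U := hb2 (by
    rw [Metric.mem_ball, Real.dist_eq, sub_sub_cancel_left, abs_neg, abs_of_pos (by positivity)]
    linarith [min_le_right e1 e2])
  have hbig : Icc (m' - 2 * e / 3) (m + 2 * e / 3) ⊆ U := hUc.out hlU' hrU'
  set l := m' - e / 3 with hl
  set r := m + e / 3 with hr
  have hl0 : l < 0 := by linarith
  have hr0 : 0 < r := by linarith
  have hsub : Icc l r ⊆ U := (Icc_subset_Icc (by linarith) (by linarith)).trans hbig
  have hrh : h < V r := by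
    by_contra hcon
    have := hm ⟨hsub ⟨by linarith, le_rfl⟩, not_lt.1 hcon⟩
    linarith
  have hlh : h < V l := by
    by_contra hcon
    have := hm' ⟨hsub ⟨le_rfl, by linarith⟩, not_lt.1 hcon⟩
    linarith
  have hmono : ∀ u ∈ U, ∀ v ∈ U, 0 ≤ u → u ≤ v → V u ≤ V v := by
    intro u hu v hv h1 h2
    have hs := hUc.out hu hv
    refine monotoneOn_Icc (fun z hz => hdiff z (hs hz)) (fun z hz => ?_) ⟨le_rfl, h2⟩ ⟨h2, le_rfl⟩ h2
    have hz0 : 0 < z := h1.trans_lt hz.1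
    exact (pos_of_mul_pos_right (hw z (hs ⟨hz.1.le, hz.2.le⟩) hz0.ne') hz0.le).le
  have hanti : ∀ u ∈ U, ∀ v ∈ U, v ≤ 0 → u ≤ v → V v ≤ V u := by
    intro u hu v hv h1 h2
    have hs := hUc.out hu hv
    refine antitoneOn_Icc (fun z hz => hdiff z (hs hz)) (fun z hz => ?_) ⟨le_rfl, h2⟩ ⟨h2, le_rfl⟩ h2
    have hz0 : z < 0 := hz.2.trans_le h1
    have := hw z (hs ⟨hz.1.le, hz.2.le⟩) hz0.ne
    nlinarith
  let f : ContDiffBump ((l + r) / 2) := ⟨(r - l) / 2, (r - l) / 2 + e / 3, by linarith, by linarith⟩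
  have hfin : ∀ q ∈ Icc l r, f q = 1 := fun q hq => f.one_of_mem_closedBall (by
    rw [Metric.mem_closedBall, Real.dist_eq, abs_le]
    constructor
    · change -((r - l) / 2) ≤ _; linarith [hq.1]
    · change _ ≤ (r - l) / 2; linarith [hq.2])
  have hfts : tsupport f ⊆ U := by
    rw [f.tsupport_eq]
    intro q hq
    rw [Metric.mem_closedBall, Real.dist_eq, abs_le] at hq
    change -((r - l) / 2 + e / 3) ≤ _ ∧ _ ≤ (r - l) / 2 + e / 3 at hq
    exact hbig ⟨by linarith [hq.1], by linarith [hq.2]⟩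
  have hdV : ContDiffOn ℝ (2 : ℕ) (deriv V) U :=
    hV.deriv_of_isOpen hU (by norm_cast; omega)
  set a : ℝ → ℝ := fun q => f q * -deriv V q with ha
  have haC : ContDiff ℝ (2 : ℕ) a := contDiff_mul_of_tsupport hU f.contDiff hfts hdV.neg
  have hacs : HasCompactSupport a := f.hasCompactSupport.mul_right
  obtain ⟨K, hK⟩ := haC.lipschitzWith_of_hasCompactSupport hacs (by norm_num)
  have haeq : ∀ q ∈ Icc l r, a q = -deriv V q := fun q hq => by rw [ha]; simp [hfin q hq]
  set W : ℝ → ℝ := fun q => -∫ x in (0 : ℝ)..q, a x with hW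
  have hWd : ∀ q, HasDerivAt W (-a q) q := fun q =>
    (intervalIntegral.integral_hasDerivAt_right (haC.continuous.intervalIntegrable _ _)
      (haC.continuous.stronglyMeasurableAtFilter _ _) haC.continuous.continuousAt).neg
  have hWV : ∀ q ∈ Icc l r, W q = V q := by
    intro q hq
    have h1 : ∀ z ∈ uIcc 0 q, z ∈ Icc l r := fun z hz =>
      (ordConnected_Icc (a := l) (b := r)).uIcc_subset ⟨hl0.le, hr0.le⟩ hq hz
    have h2 := intervalIntegral.integral_eq_sub_of_hasDerivAt (a := 0) (b := q) (f := V)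
      (f' := fun z => -a z)
      (fun z hz => by
        have := hdiff z (hsub (h1 z hz))
        rwa [haeq z (h1 z hz), neg_neg]) (haC.continuous.neg.intervalIntegrable _ _)
    rw [hV0, sub_zero, intervalIntegral.integral_neg] at h2
    exact h2
  refine ⟨a, W, f, l, r, min (V l) (V r), ⟨hl0, hr0, haC.continuous, hWd, ?_, ?_⟩, hsub,
    lt_min hlh hrh, ?_, min_le_left _ _, min_le_right _ _, hWV, haeq, haC, ⟨K, hK⟩, f.contDiff,
    f.hasCompactSupport, hfts, hfin⟩
  · intro q hq
    have hq' : q ∈ Icc l r := ⟨by linarith [hq.1], hq.2⟩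
    rw [haeq q hq']
    have := pos_of_mul_pos_right (hw q (hsub hq') hq.1.ne') hq.1.le
    linarith
  · intro q hq
    have hq' : q ∈ Icc l r := ⟨hq.1, by linarith [hq.2]⟩
    rw [haeq q hq']
    have := hw q (hsub hq') hq.2.ne
    nlinarith [hq.2]
  · intro q hq hlt
    refine ⟨?_, ?_⟩
    · by_contra hcon
      have := hanti q hq l (hsub ⟨le_rfl, by linarith⟩) hl0.le (not_lt.1 hcon)
      linarith [min_le_left (V l) (V r)]
    · by_contra hcon
      have := hmono r (hsub ⟨by linarith, le_rfl⟩) q hq hr0.le (not_lt.1 hcon)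
      linarith [min_le_right (V l) (V r)]

end Oscillator

lemma HasDerivAt.prod_fst {E F : Type*} [NormedAddCommGroup E] [NormedSpace ℝ E]
    [NormedAddCommGroup F] [NormedSpace ℝ F] {f : ℝ → E × F} {f' : E × F} {t : ℝ}
    (h : HasDerivAt f f' t) : HasDerivAt (fun t => (f t).1) f'.1 t :=
  (ContinuousLinearMap.fst ℝ E F).hasFDerivAt.comp_hasDerivAt t h

lemma HasDerivAt.prod_snd {E F : Type*} [NormedAddCommGroup E] [NormedSpace ℝ E]
    [NormedAddCommGroup F] [NormedSpace ℝ F] {f : ℝ → E × F} {f' : E × F} {t : ℝ}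
    (h : HasDerivAt f f' t) : HasDerivAt (fun t => (f t).2) f'.2 t :=
  (ContinuousLinearMap.snd ℝ E F).hasFDerivAt.comp_hasDerivAt t h

namespace OscStep

open Oscillator StepSystem

/-- Global smooth extensions of the equations of motion, with their flow, and the flow of the vertical
oscillator started at rest, with its action. -/
structure Model (S : StepSystem) (h : ℝ) where
  (a₁ W1 χ1 a₂ W2 χ2 : ℝ → ℝ)
  (l₁ r₁ h₁ l₂ r₂ h₂ : ℝ)
  core1 : Core S.U₁ S.V₁ h a₁ W1 χ1 l₁ r₁ h₁
  core2 : Core S.U₂ S.V₂ h a₂ W2 χ2 l₂ r₂ h₂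
  κ : ℝ → ℝ
  (b₁ b₂ : ℝ × ℝ → ℝ)
  κ_eq : ∀ ε, |ε| ≤ 1 → κ ε = ε
  b1_eq : ∀ q ∈ Icc l₁ r₁ ×ˢ Icc l₂ r₂, b₁ q = -deriv (fun x => S.Vc (x, q.2)) q.1
  b2_eq : ∀ q ∈ Icc l₁ r₁ ×ˢ Icc l₂ r₂, b₂ q = -deriv (fun y => S.Vc (q.1, y)) q.2
  κ_cont : Continuous κ
  b1_cont : Continuous b₁
  B : ℝ
  b2_le : ∀ q, |b₂ q| ≤ B
  Vc_le : ∀ q ∈ S.U₁ ×ˢ S.U₂, |S.Vc q| ≤ B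
  lipschitz : ∃ K : ℝ≥0, ∀ ε, LipschitzWith K (fun z : Phase =>
    ((p₁ z, a₁ (q₁ z) + κ ε * b₁ (q₁ z, q₂ z), p₂ z, a₂ (q₂ z) + κ ε * b₂ (q₁ z, q₂ z)) : Phase))
  Φ : ℝ → ℝ → Phase → Phase
  Φ_zero : ∀ ε z, Φ 0 ε z = z
  Φ_deriv : ∀ ε z t, HasDerivAt (fun t => Φ t ε z)
    ((p₁ (Φ t ε z), a₁ (q₁ (Φ t ε z)) + κ ε * b₁ (q₁ (Φ t ε z), q₂ (Φ t ε z)), p₂ (Φ t ε z),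
      a₂ (q₂ (Φ t ε z)) + κ ε * b₂ (q₁ (Φ t ε z), q₂ (Φ t ε z))) : Phase) t
  Φ_contDiff : ContDiff ℝ 2 (fun p : ℝ × ℝ × Phase => Φ p.1 p.2.1 p.2.2)
  (Q P A : ℝ → ℝ → ℝ)
  motion : ∀ x, IsMotion a₂ (Q x) (P x)
  Q_zero : ∀ x, Q x 0 = x
  P_zero : ∀ x, P x 0 = 0
  A_zero : ∀ x, A x 0 = 0
  A_deriv : ∀ x t, P x t ^ 2 ≤ 2 * h₂ → HasDerivAt (A x) (P x t ^ 2) t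
  Q_contDiff : ContDiff ℝ 2 (fun p : ℝ × ℝ => Q p.1 p.2)
  P_contDiff : ContDiff ℝ 2 (fun p : ℝ × ℝ => P p.1 p.2)
  A_contDiff : ContDiff ℝ 2 (fun p : ℝ × ℝ => A p.1 p.2)

lemma exists_perturbation (S : StepSystem) {h : ℝ} {a₁ W1 χ1 a₂ W2 χ2 : ℝ → ℝ}
    {l₁ r₁ h₁ l₂ r₂ h₂ : ℝ} (c1 : Core S.U₁ S.V₁ h a₁ W1 χ1 l₁ r₁ h₁)
    (c2 : Core S.U₂ S.V₂ h a₂ W2 χ2 l₂ r₂ h₂) (v : ℝ × ℝ) :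
    ∃ b : ℝ × ℝ → ℝ, ContDiff ℝ 2 b ∧ HasCompactSupport b ∧
      ∀ q ∈ Icc l₁ r₁ ×ˢ Icc l₂ r₂, b q = -fderiv ℝ S.Vc q v := by
  have hO : IsOpen (S.U₁ ×ˢ S.U₂) := S.isOpen_U₁.prod S.isOpen_U₂
  set χ : ℝ × ℝ → ℝ := fun q => χ1 q.1 * χ2 q.2 with hχ
  have hχC : ContDiff ℝ (2 : ℕ) χ := (c1.χ_contDiff.comp contDiff_fst).mul
    (c2.χ_contDiff.comp contDiff_snd)
  have hsupp : Function.support χ ⊆ tsupport χ1 ×ˢ tsupport χ2 := fun q hq =>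
    ⟨subset_tsupport _ (left_ne_zero_of_mul hq), subset_tsupport _ (right_ne_zero_of_mul hq)⟩
  have hts : tsupport χ ⊆ tsupport χ1 ×ˢ tsupport χ2 :=
    closure_minimal hsupp ((isClosed_tsupport _).prod (isClosed_tsupport _))
  have hχc : HasCompactSupport χ :=
    (c1.χ_compact.isCompact.prod c2.χ_compact.isCompact).of_isClosed_subset (isClosed_tsupport _) hts
  have hg : ContDiffOn ℝ (2 : ℕ) (fun q => -fderiv ℝ S.Vc q v) (S.U₁ ×ˢ S.U₂) := by
    have h1 : ContDiffOn ℝ (2 : ℕ) (fderiv ℝ S.Vc) (S.U₁ ×ˢ S.U₂) :=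
      S.smooth_Vc.fderiv_of_isOpen hO (by have := S.four_lt_r; norm_cast; omega)
    exact (h1.clm_apply contDiffOn_const).neg
  refine ⟨fun q => χ q * -fderiv ℝ S.Vc q v, contDiff_mul_of_tsupport hO hχC
    (hts.trans (prod_mono c1.χ_tsupport c2.χ_tsupport)) hg, hχc.mul_right, fun q hq => ?_⟩
  simp only [hχ, c1.χ_eq _ hq.1, c2.χ_eq _ hq.2, mul_one, one_mul]

lemma exists_cutoff_of_bound (R : ℝ) (hR : 0 < R) : ∃ χ : ℝ → ℝ, ContDiff ℝ 2 χ ∧ HasCompactSupport χ ∧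
    ∀ x, |x| ≤ R → χ x = 1 := by
  let f : ContDiffBump (0 : ℝ) := ⟨R, R + 1, hR, by linarith⟩
  exact ⟨f, f.contDiff, f.hasCompactSupport, fun x hx => f.one_of_mem_closedBall (by
    rw [Metric.mem_closedBall, Real.dist_eq, sub_zero]; exact hx)⟩

lemma exists_model (S : StepSystem) (h : ℝ) (hh : 0 < h)
    (hU1 : IsCompact {q | q ∈ S.U₁ ∧ S.V₁ q ≤ h}) (hU2 : IsCompact {q | q ∈ S.U₂ ∧ S.V₂ q ≤ h}) :
    Nonempty (Model S h) := by
  obtain ⟨a₁, W1, χ1, l₁, r₁, h₁, c1⟩ := exists_core S.four_lt_r S.isOpen_U₁ S.ordConnected_U₁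
    S.zero_mem_U₁ S.smooth_V₁ S.V₁_zero S.well_V₁ hh hU1
  obtain ⟨a₂, W2, χ2, l₂, r₂, h₂, c2⟩ := exists_core S.four_lt_r S.isOpen_U₂ S.ordConnected_U₂
    S.zero_mem_U₂ S.smooth_V₂ S.V₂_zero S.well_V₂ hh hU2
  have hO : IsOpen (S.U₁ ×ˢ S.U₂) := S.isOpen_U₁.prod S.isOpen_U₂
  have hVd : ∀ q ∈ Icc l₁ r₁ ×ˢ Icc l₂ r₂, HasFDerivAt S.Vc (fderiv ℝ S.Vc q) q := fun q hq =>
    ((S.smooth_Vc.differentiableOn (by have := S.four_lt_r; norm_cast; omega)).differentiableAt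
      (hO.mem_nhds ⟨c1.subset hq.1, c2.subset hq.2⟩)).hasFDerivAt
  obtain ⟨b₁, hb1, hb1c, hb1e⟩ := exists_perturbation S c1 c2 (1, 0)
  obtain ⟨b₂, hb2, hb2c, hb2e⟩ := exists_perturbation S c1 c2 (0, 1)
  obtain ⟨ψ, hψ, hψc, hψe⟩ := exists_cutoff_of_bound 1 one_pos
  set κ : ℝ → ℝ := fun e => ψ e * e with hκ
  have hκC : ContDiff ℝ 2 κ := hψ.mul contDiff_id
  have hκc : HasCompactSupport κ := hψc.mul_right
  obtain ⟨B, hB⟩ := hb2c.exists_bound_of_continuous hb2.continuous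
  obtain ⟨M, hM⟩ := S.bounded_Vc
  obtain ⟨K1, hK1⟩ := c1.lipschitz
  obtain ⟨K2, hK2⟩ := c2.lipschitz
  have hgC : ∀ b : ℝ × ℝ → ℝ, ContDiff ℝ 2 b →
      ContDiff ℝ 2 (fun x : ℝ³ => κ x.1 * b x.2) := fun b hb =>
    (hκC.comp contDiff_fst).mul (hb.comp contDiff_snd)
  have hgL : ∀ b : ℝ × ℝ → ℝ, ContDiff ℝ 2 b → HasCompactSupport b →
      ∃ K : ℝ≥0, LipschitzWith K (fun x : ℝ³ => κ x.1 * b x.2) := by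
    intro b hb hbc
    refine (hgC b hb).lipschitzWith_of_hasCompactSupport ?_ (by norm_num)
    have hsupp : Function.support (fun x : ℝ³ => κ x.1 * b x.2) ⊆ tsupport κ ×ˢ tsupport b :=
      fun q hq => ⟨subset_tsupport _ (left_ne_zero_of_mul hq),
        subset_tsupport _ (right_ne_zero_of_mul hq)⟩
    exact (hκc.isCompact.prod hbc.isCompact).of_isClosed_subset (isClosed_tsupport _)
      (closure_minimal hsupp ((isClosed_tsupport _).prod (isClosed_tsupport _)))
  obtain ⟨L1, hL1⟩ := hgL b₁ hb1 hb1c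
  obtain ⟨L2, hL2⟩ := hgL b₂ hb2 hb2c
  -- the flow of the step system without step
  let F : ℝ × Phase → ℝ × Phase := fun x =>
    (0, x.2.2.1, a₁ x.2.1 + κ x.1 * b₁ (x.2.1, x.2.2.2.1), x.2.2.2.2,
      a₂ x.2.2.2.1 + κ x.1 * b₂ (x.2.1, x.2.2.2.1))
  have hF : ContDiff ℝ (2 : ℕ) F := by
    have g1 := (hgC b₁ hb1).comp (show ContDiff ℝ 2 fun x : ℝ × Phase =>
      (x.1, x.2.1, x.2.2.2.1) by fun_prop)
    have g2 := (hgC b₂ hb2).comp (show ContDiff ℝ 2 fun x : ℝ × Phase =>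
      (x.1, x.2.1, x.2.2.2.1) by fun_prop)
    have e1 := c1.contDiff.comp (show ContDiff ℝ 2 fun x : ℝ × Phase => x.2.1 by fun_prop)
    have e2 := c2.contDiff.comp (show ContDiff ℝ 2 fun x : ℝ × Phase => x.2.2.2.1 by fun_prop)
    exact contDiff_const.prodMk ((show ContDiff ℝ 2 fun x : ℝ × Phase => x.2.2.1 by fun_prop).prodMk
      ((e1.add g1).prodMk ((show ContDiff ℝ 2 fun x : ℝ × Phase => x.2.2.2.2 by fun_prop).prodMk
        (e2.add g2))))
  have lq1 : LipschitzWith 1 (fun x : ℝ × Phase => x.2.1) := by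
    simpa [Function.comp_def] using (LipschitzWith.prod_fst (α := ℝ) (β := ℝ³)).comp
      (LipschitzWith.prod_snd (α := ℝ) (β := Phase))
  have l2 : LipschitzWith 1 (fun x : ℝ × Phase => x.2.2) := by
    simpa [Function.comp_def] using (LipschitzWith.prod_snd (α := ℝ) (β := ℝ³)).comp
      (LipschitzWith.prod_snd (α := ℝ) (β := Phase))
  have lp1 : LipschitzWith 1 (fun x : ℝ × Phase => x.2.2.1) := by
    simpa [Function.comp_def] using (LipschitzWith.prod_fst (α := ℝ) (β := ℝ × ℝ)).comp l2
  have l3 : LipschitzWith 1 (fun x : ℝ × Phase => x.2.2.2) := by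
    simpa [Function.comp_def] using (LipschitzWith.prod_snd (α := ℝ) (β := ℝ × ℝ)).comp l2
  have lq2 : LipschitzWith 1 (fun x : ℝ × Phase => x.2.2.2.1) := by
    simpa [Function.comp_def] using (LipschitzWith.prod_fst (α := ℝ) (β := ℝ)).comp l3
  have lp2 : LipschitzWith 1 (fun x : ℝ × Phase => x.2.2.2.2) := by
    simpa [Function.comp_def] using (LipschitzWith.prod_snd (α := ℝ) (β := ℝ)).comp l3
  have lm : LipschitzWith 1 (fun x : ℝ × Phase => (x.1, x.2.1, x.2.2.2.1)) := by
    simpa using (LipschitzWith.prod_fst (α := ℝ) (β := Phase)).prodMk (lq1.prodMk lq2)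
  obtain ⟨KF, hKF⟩ : ∃ K : ℝ≥0, LipschitzWith K F :=
    ⟨_, (LipschitzWith.const (0 : ℝ)).prodMk (lp1.prodMk
      (((hK1.comp lq1).add (hL1.comp lm)).prodMk (lp2.prodMk ((hK2.comp lq2).add (hL2.comp lm)))))⟩
  obtain ⟨Ψ, hΨ0, hΨd, hΨC⟩ := SmoothFlow.exists_contDiff_flow two_ne_zero hF hKF
  have hε : ∀ ε (z : Phase) t, (Ψ t (ε, z)).1 = ε := fun ε z t => by
    have hd : ∀ t, HasDerivAt (fun t => (Ψ t (ε, z)).1) 0 t := fun t => by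
      exact (hΨd (ε, z) t).prod_fst
    have := is_const_of_deriv_eq_zero (fun t => (hd t).differentiableAt) (fun t => (hd t).deriv) t 0
    simpa [hΨ0] using this
  -- the flow of the vertical oscillator
  have hh2 : 0 < h₂ := hh.trans c2.lt_level
  obtain ⟨ξ, hξ, hξc, hξe⟩ := exists_cutoff_of_bound √(2 * h₂) (by positivity)
  let m : ℝ → ℝ := fun p => ξ p * p ^ 2
  have hm : ContDiff ℝ 2 m := hξ.mul (by fun_prop)
  obtain ⟨Km, hKm⟩ := hm.lipschitzWith_of_hasCompactSupport (hξc.mul_right) (by norm_num)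
  let G : ℝ³ → ℝ³ := fun x => (x.2.1, a₂ x.1, m x.2.1)
  have hG : ContDiff ℝ (2 : ℕ) G :=
    (show ContDiff ℝ 2 fun x : ℝ³ => x.2.1 by fun_prop).prodMk
      ((c2.contDiff.comp contDiff_fst).prodMk
        (hm.comp (show ContDiff ℝ 2 fun x : ℝ³ => x.2.1 by fun_prop)))
  have lp : LipschitzWith 1 (fun x : ℝ³ => x.2.1) := by
    simpa [Function.comp_def] using (LipschitzWith.prod_fst (α := ℝ) (β := ℝ)).comp
      (LipschitzWith.prod_snd (α := ℝ) (β := ℝ × ℝ))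
  obtain ⟨KG, hKG⟩ : ∃ K : ℝ≥0, LipschitzWith K G :=
    ⟨_, lp.prodMk ((hK2.comp LipschitzWith.prod_fst).prodMk (hKm.comp lp))⟩
  obtain ⟨Γ, hΓ0, hΓd, hΓC⟩ := SmoothFlow.exists_contDiff_flow two_ne_zero hG hKG
  have hΓC' : ContDiff ℝ 2 (fun p : ℝ × ℝ => Γ p.2 (p.1, 0, 0)) :=
    hΓC.comp (show ContDiff ℝ 2 fun p : ℝ × ℝ => (p.2, ((p.1, 0, 0) : ℝ³)) by fun_prop)
  refine ⟨{
    a₁ := a₁, W1 := W1, χ1 := χ1, a₂ := a₂, W2 := W2, χ2 := χ2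
    l₁ := l₁, r₁ := r₁, h₁ := h₁, l₂ := l₂, r₂ := r₂, h₂ := h₂
    core1 := c1, core2 := c2, κ := κ, b₁ := b₁, b₂ := b₂
    κ_eq := fun ε hε => by simp only [hκ, hψe ε hε, one_mul]
    b1_eq := fun q hq => ?_
    b2_eq := fun q hq => ?_
    κ_cont := hκC.continuous, b1_cont := hb1.continuous
    B := max B M
    b2_le := fun q => (hB q).trans (le_max_left _ _)
    Vc_le := fun q hq => ?_
    lipschitz := ⟨KF, fun ε => ?_⟩
    Φ := fun t ε z => (Ψ t (ε, z)).2
    Φ_zero := fun ε z => by simp [hΨ0]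
    Φ_deriv := fun ε z t => ?_
    Φ_contDiff := hΨC.snd.comp (show ContDiff ℝ 2 fun p : ℝ × ℝ × Phase => (p.1, (p.2.1, p.2.2)) by
      fun_prop)
    Q := fun x t => (Γ t (x, 0, 0)).1
    P := fun x t => (Γ t (x, 0, 0)).2.1
    A := fun x t => (Γ t (x, 0, 0)).2.2
    motion := fun x => ⟨fun t => (hΓd (x, 0, 0) t).prod_fst,
      fun t => (hΓd (x, 0, 0) t).prod_snd.prod_fst⟩
    Q_zero := fun x => by simp [hΓ0]
    P_zero := fun x => by simp [hΓ0]
    A_zero := fun x => by simp [hΓ0]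
    A_deriv := fun x t hle => ?_
    Q_contDiff := hΓC'.fst
    P_contDiff := hΓC'.snd.fst
    A_contDiff := hΓC'.snd.snd }⟩
  · rw [hb1e q hq]
    have h1 : HasDerivAt (fun x : ℝ => (x, q.2)) ((1 : ℝ), (0 : ℝ)) q.1 :=
      (hasDerivAt_id q.1).prodMk (hasDerivAt_const _ _)
    have h2 : HasDerivAt (fun x => S.Vc (x, q.2)) _ q.1 := (hVd q hq).comp_hasDerivAt q.1 h1
    rw [h2.deriv]
  · rw [hb2e q hq]
    have h1 : HasDerivAt (fun y : ℝ => (q.1, y)) ((0 : ℝ), (1 : ℝ)) q.2 :=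
      (hasDerivAt_const _ _).prodMk (hasDerivAt_id q.2)
    have h2 : HasDerivAt (fun y => S.Vc (q.1, y)) _ q.2 := (hVd q hq).comp_hasDerivAt q.2 h1
    rw [h2.deriv]
  · have := hM 0 (Nat.zero_le _) q hq
    rw [norm_iteratedFDeriv_zero, Real.norm_eq_abs] at this
    exact this.trans (le_max_right _ _)
  · have h1 : LipschitzWith 1 (fun z : Phase => (ε, z)) := by
      simpa using (LipschitzWith.const ε).prodMk LipschitzWith.id
    have h2 := (LipschitzWith.prod_snd (α := ℝ) (β := Phase)).comp (hKF.comp h1)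
    rw [one_mul, mul_one] at h2
    exact h2
  · have h1 : HasDerivAt (fun t => (Ψ t (ε, z)).2) (F (Ψ t (ε, z))).2 t :=
      (hΨd (ε, z) t).prod_snd
    have h2 : F (Ψ t (ε, z)) = F (ε, (Ψ t (ε, z)).2) := congrArg F (Prod.ext (hε ε z t) rfl)
    rw [h2] at h1
    exact h1
  · have h1 : HasDerivAt (fun t => (Γ t (x, 0, 0)).2.2) (G (Γ t (x, 0, 0))).2.2 t :=
      (hΓd (x, 0, 0) t).prod_snd.prod_snd
    have h2 : m (Γ t (x, 0, 0)).2.1 = (Γ t (x, 0, 0)).2.1 ^ 2 := by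
      have := hξe (Γ t (x, 0, 0)).2.1 (Real.abs_le_sqrt hle)
      simp only [m, this, one_mul]
    rw [← h2]
    exact h1

@[simp] lemma q1_mk (a b c d : ℝ) : q₁ (a, b, c, d) = a := rfl
@[simp] lemma p1_mk (a b c d : ℝ) : p₁ (a, b, c, d) = b := rfl
@[simp] lemma q2_mk (a b c d : ℝ) : q₂ (a, b, c, d) = c := rfl
@[simp] lemma p2_mk (a b c d : ℝ) : p₂ (a, b, c, d) = d := rfl

lemma contDiff_q1 {n : WithTop ℕ∞} : ContDiff ℝ n q₁ := contDiff_fst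
lemma contDiff_p1 {n : WithTop ℕ∞} : ContDiff ℝ n p₁ := contDiff_fst.comp contDiff_snd
lemma contDiff_q2 {n : WithTop ℕ∞} : ContDiff ℝ n q₂ :=
  contDiff_fst.comp (contDiff_snd.comp contDiff_snd)
lemma contDiff_p2 {n : WithTop ℕ∞} : ContDiff ℝ n p₂ :=
  contDiff_snd.comp (contDiff_snd.comp contDiff_snd)

@[fun_prop] lemma continuous_q1 : Continuous q₁ := (contDiff_q1 (n := 0)).continuous
@[fun_prop] lemma continuous_p1 : Continuous p₁ := (contDiff_p1 (n := 0)).continuous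
@[fun_prop] lemma continuous_q2 : Continuous q₂ := (contDiff_q2 (n := 0)).continuous
@[fun_prop] lemma continuous_p2 : Continuous p₂ := (contDiff_p2 (n := 0)).continuous

lemma hasDerivWithinAt_coords {z : ℝ → Phase} {z' : Phase} {s : Set ℝ} {t : ℝ}
    (h : HasDerivWithinAt z z' s t) :
    HasDerivWithinAt (fun t => q₁ (z t)) (q₁ z') s t ∧ HasDerivWithinAt (fun t => p₁ (z t)) (p₁ z') s t ∧
    HasDerivWithinAt (fun t => q₂ (z t)) (q₂ z') s t ∧ HasDerivWithinAt (fun t => p₂ (z t)) (p₂ z') s t :=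
  have L {L : Phase →L[ℝ] ℝ} : HasDerivWithinAt (fun t => L (z t)) (L z') s t :=
    L.hasFDerivAt.comp_hasDerivWithinAt t h
  ⟨L (L := .fst ℝ _ _), L (L := .comp (.fst ℝ _ _) (.snd ℝ _ _)),
    L (L := .comp (.fst ℝ _ _) (.comp (.snd ℝ _ _) (.snd ℝ _ _))),
    L (L := .comp (.snd ℝ _ _) (.comp (.snd ℝ _ _) (.snd ℝ _ _)))⟩

namespace StepSystem

variable {S : StepSystem} {ε T : ℝ} {z : ℝ → Phase} {hits : Finset ℝ}

lemma hasDerivAt_V1 (S : StepSystem) {q : ℝ} (hq : q ∈ S.U₁) : HasDerivAt S.V₁ (deriv S.V₁ q) q :=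
  ((S.smooth_V₁.differentiableOn (by have := S.four_lt_r; norm_cast; omega)).differentiableAt
    (S.isOpen_U₁.mem_nhds hq)).hasDerivAt

lemma hasDerivAt_V2 (S : StepSystem) {q : ℝ} (hq : q ∈ S.U₂) : HasDerivAt S.V₂ (deriv S.V₂ q) q :=
  ((S.smooth_V₂.differentiableOn (by have := S.four_lt_r; norm_cast; omega)).differentiableAt
    (S.isOpen_U₂.mem_nhds hq)).hasDerivAt

lemma hasFDerivAt_Vc (S : StepSystem) {q : ℝ × ℝ} (hq : q ∈ S.U₁ ×ˢ S.U₂) :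
    HasFDerivAt S.Vc (fderiv ℝ S.Vc q) q :=
  ((S.smooth_Vc.differentiableOn (by have := S.four_lt_r; norm_cast; omega)).differentiableAt
    ((S.isOpen_U₁.prod S.isOpen_U₂).mem_nhds hq)).hasFDerivAt

lemma fderiv_Vc (S : StepSystem) {q : ℝ × ℝ} (hq : q ∈ S.U₁ ×ˢ S.U₂) (v : ℝ × ℝ) :
    fderiv ℝ S.Vc q v = v.1 * deriv (fun x => S.Vc (x, q.2)) q.1 +
      v.2 * deriv (fun y => S.Vc (q.1, y)) q.2 := by
  have h1 : HasDerivAt (fun x => S.Vc (x, q.2)) (fderiv ℝ S.Vc q (1, 0)) q.1 :=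
    (S.hasFDerivAt_Vc hq).comp_hasDerivAt q.1 ((hasDerivAt_id q.1).prodMk (hasDerivAt_const _ _))
  have h2 : HasDerivAt (fun y => S.Vc (q.1, y)) (fderiv ℝ S.Vc q (0, 1)) q.2 :=
    (S.hasFDerivAt_Vc hq).comp_hasDerivAt q.2 ((hasDerivAt_const _ _).prodMk (hasDerivAt_id q.2))
  rw [h1.deriv, h2.deriv]
  have : v = v.1 • ((1 : ℝ), (0 : ℝ)) + v.2 • ((0 : ℝ), (1 : ℝ)) := by ext <;> simp
  conv_lhs => rw [this, map_add, map_smul, map_smul]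
  simp

lemma hasDerivWithinAt_hamiltonian {s : Set ℝ} {t : ℝ} (h₁ : q₁ (z t) ∈ S.U₁)
    (h₂ : q₂ (z t) ∈ S.U₂) (h : HasDerivWithinAt z (S.field ε (z t)) s t) :
    HasDerivWithinAt (fun t => S.hamiltonian ε (z t)) 0 s t := by
  obtain ⟨d1, d2, d3, d4⟩ := hasDerivWithinAt_coords h
  have hU : (q₁ (z t), q₂ (z t)) ∈ S.U₁ ×ˢ S.U₂ := ⟨h₁, h₂⟩
  have e1 := (S.hasDerivAt_V1 h₁).comp_hasDerivWithinAt t d1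
  have e2 := (S.hasDerivAt_V2 h₂).comp_hasDerivWithinAt t d3
  have e3 := (S.hasFDerivAt_Vc hU).comp_hasDerivWithinAt t (d1.prodMk d3)
  have key := ((((d2.pow 2).div_const 2).add e1).add ((d4.pow 2).div_const 2)).add e2 |>.add
    (e3.const_mul ε)
  refine key.congr_deriv ?_
  rw [S.fderiv_Vc hU]
  simp only [field, force₁, force₂, q1_mk, p1_mk, q2_mk, p2_mk]
  push_cast; ring

lemma continuousAt_hamiltonian {z : Phase} (h₁ : q₁ z ∈ S.U₁) (h₂ : q₂ z ∈ S.U₂) :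
    ContinuousAt (S.hamiltonian ε) z := by
  have e1 : ContinuousAt (fun z => S.V₁ (q₁ z)) z :=
    ContinuousAt.comp (g := S.V₁) (S.hasDerivAt_V1 h₁).continuousAt continuous_q1.continuousAt
  have e2 : ContinuousAt (fun z => S.V₂ (q₂ z)) z :=
    ContinuousAt.comp (g := S.V₂) (S.hasDerivAt_V2 h₂).continuousAt continuous_q2.continuousAt
  have e3 : ContinuousAt (fun z => S.Vc (q₁ z, q₂ z)) z :=
    ContinuousAt.comp (g := S.Vc) (f := fun z => (q₁ z, q₂ z))
      (S.hasFDerivAt_Vc (q := (q₁ z, q₂ z)) ⟨h₁, h₂⟩).continuousAt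
      (by fun_prop)
  unfold hamiltonian
  fun_prop

lemma Impact.hamiltonian_eq {z z' : Phase} (h : S.Impact z z') :
    S.hamiltonian ε z = S.hamiltonian ε z' := by
  rcases h with ⟨-, -, -, rfl⟩ | ⟨-, -, -, rfl⟩ <;> simp [hamiltonian]

lemma Impact.positions {z z' : Phase} (h : S.Impact z z') : q₁ z' = q₁ z ∧ q₂ z' = q₂ z := by
  rcases h with ⟨-, -, -, rfl⟩ | ⟨-, -, -, rfl⟩ <;> simp

lemma Impact.unique {z z' z'' : Phase} (h : S.Impact z z') (h' : S.Impact z z'') : z' = z'' := by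
  rcases h with ⟨h1, h2, h3, rfl⟩ | ⟨h1, h2, h3, rfl⟩ <;>
    rcases h' with ⟨k1, k2, k3, rfl⟩ | ⟨k1, k2, k3, rfl⟩
  · rfl
  · linarith
  · linarith
  · rfl

/-- Energy is conserved along trajectories with impacts. -/
lemma IsTrajectory.hamiltonian_eq (hz : S.IsTrajectory ε T z hits) {t : ℝ} (ht : t ∈ Icc 0 T) :
    S.hamiltonian ε (z t) = S.hamiltonian ε (z 0) := by
  refine constant_of_has_deriv_right_zero (f := fun t => S.hamiltonian ε (z t)) (a := 0) (b := T)
    ?_ ?_ t ht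
  · intro t ht
    have hr : t < T → ContinuousWithinAt (fun t => S.hamiltonian ε (z t)) (Ici t) t := fun h =>
      (hasDerivWithinAt_hamiltonian (hz.free t ht).1 (hz.free t ht).2.1
        (hz.right_deriv t ⟨ht.1, h⟩)).continuousWithinAt
    have hl : 0 < t → ContinuousWithinAt (fun t => S.hamiltonian ε (z t)) (Iic t) t := fun h => by
      by_cases hh : t ∈ hits
      · obtain ⟨z', h1, h2⟩ := hz.impact t hh
        rw [← continuousWithinAt_Iio_iff_Iic, ContinuousWithinAt, ← h2.hamiltonian_eq]
        refine (continuousAt_hamiltonian ?_ ?_).tendsto.comp h1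
        · rw [← h2.positions.1]; exact (hz.free t ht).1
        · rw [← h2.positions.2]; exact (hz.free t ht).2.1
      · exact (hasDerivWithinAt_hamiltonian (hz.free t ht).1 (hz.free t ht).2.1
          (hz.left_deriv t ⟨h, ht.2⟩ hh)).continuousWithinAt
    rcases ht.1.eq_or_lt with h0 | h0
    · rcases ht.2.eq_or_lt with h1 | h1
      · have : Icc 0 T = {t} := by rw [← h1, ← h0, Icc_self]
        rw [this]; exact continuousWithinAt_singleton
      · exact (hr h1).mono fun s hs => h0 ▸ hs.1
    · rcases ht.2.eq_or_lt with h1 | h1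
      · exact (hl h0).mono fun s hs => h1 ▸ hs.2
      · exact ((hl h0).union (hr h1)).mono fun s _ => le_total s t
  · intro t ht
    have hf := hz.free t ⟨ht.1, ht.2.le⟩
    exact hasDerivWithinAt_hamiltonian hf.1 hf.2.1 (hz.right_deriv t ht)

end StepSystem

namespace Model

variable {S : StepSystem} {h : ℝ} (M : Model S h)

lemma B_nonneg (M : Model S h) : 0 ≤ M.B := (abs_nonneg _).trans (M.b2_le (0, 0))

/-- The extended Hamiltonian vector field. -/
def field (ε : ℝ) (z : Phase) : Phase :=
  (p₁ z, M.a₁ (q₁ z) + M.κ ε * M.b₁ (q₁ z, q₂ z), p₂ z, M.a₂ (q₂ z) + M.κ ε * M.b₂ (q₁ z, q₂ z))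

/-- The position lies in the region where the extended field agrees with the Hamiltonian one. -/
def InCore (z : Phase) : Prop := q₁ z ∈ Ioo M.l₁ M.r₁ ∧ q₂ z ∈ Ioo M.l₂ M.r₂

lemma isOpen_inCore : IsOpen {z | M.InCore z} :=
  (isOpen_Ioo.preimage continuous_q1).inter (isOpen_Ioo.preimage continuous_q2)

variable {M} {ε : ℝ} {z : Phase}

lemma InCore.mem_U (hz : M.InCore z) : q₁ z ∈ S.U₁ ∧ q₂ z ∈ S.U₂ :=
  ⟨M.core1.subset (Ioo_subset_Icc_self hz.1), M.core2.subset (Ioo_subset_Icc_self hz.2)⟩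

lemma field_eq (hε : |ε| ≤ 1) (hz : M.InCore z) : M.field ε z = S.field ε z := by
  have h1 := Ioo_subset_Icc_self hz.1
  have h2 := Ioo_subset_Icc_self hz.2
  have hb : (q₁ z, q₂ z) ∈ Icc M.l₁ M.r₁ ×ˢ Icc M.l₂ M.r₂ := ⟨h1, h2⟩
  simp only [field, StepSystem.field, StepSystem.force₁, StepSystem.force₂, M.κ_eq ε hε,
    M.core1.a_eq _ h1, M.core2.a_eq _ h2, M.b1_eq _ hb, M.b2_eq _ hb]
  congr 2
  · ring
  · congr 1; ring

variable (M)

lemma hasDerivAt_Φ (ε : ℝ) (z : Phase) (t : ℝ) :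
    HasDerivAt (fun t => M.Φ t ε z) (M.field ε (M.Φ t ε z)) t := M.Φ_deriv ε z t

lemma continuous_Φ : Continuous fun p : ℝ × ℝ × Phase => M.Φ p.1 p.2.1 p.2.2 :=
  M.Φ_contDiff.continuous

lemma continuous_Φ_time (ε : ℝ) (z : Phase) : Continuous fun t => M.Φ t ε z :=
  continuous_iff_continuousAt.2 fun t => (M.hasDerivAt_Φ ε z t).continuousAt

lemma hasDerivAt_coords (ε : ℝ) (z : Phase) (t : ℝ) :
    HasDerivAt (fun t => q₁ (M.Φ t ε z)) (p₁ (M.Φ t ε z)) t ∧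
    HasDerivAt (fun t => p₁ (M.Φ t ε z)) (p₁ (M.field ε (M.Φ t ε z))) t ∧
    HasDerivAt (fun t => q₂ (M.Φ t ε z)) (p₂ (M.Φ t ε z)) t ∧
    HasDerivAt (fun t => p₂ (M.Φ t ε z)) (p₂ (M.field ε (M.Φ t ε z))) t := by
  obtain ⟨d1, d2, d3, d4⟩ := hasDerivWithinAt_coords (M.hasDerivAt_Φ ε z t).hasDerivWithinAt (s := univ)
  exact ⟨d1.hasDerivAt univ_mem, d2.hasDerivAt univ_mem, d3.hasDerivAt univ_mem,
    d4.hasDerivAt univ_mem⟩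

lemma exists_lipschitz_field : ∃ K : ℝ≥0, ∀ ε, LipschitzWith K (M.field ε) := M.lipschitz

lemma Φ_unique {γ : ℝ → Phase} (hγ : ∀ t, HasDerivAt γ (M.field ε (γ t)) t) (t : ℝ) :
    γ t = M.Φ t ε (γ 0) := by
  obtain ⟨K, hK⟩ := M.exists_lipschitz_field
  exact congrFun (SmoothFlow.global_solution_unique (hK ε) hγ (M.hasDerivAt_Φ ε (γ 0)) (t0 := 0)
    (by rw [M.Φ_zero])) t

lemma Φ_add (s t : ℝ) (ε : ℝ) (z : Phase) : M.Φ (s + t) ε z = M.Φ s ε (M.Φ t ε z) := by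
  have := M.Φ_unique (γ := fun s => M.Φ (s + t) ε z)
    (fun s => (M.hasDerivAt_Φ ε z (s + t)).comp_add_const s t) s
  simpa using this

/-- Time reversal `(q, p) ↦ (q, -p)`. -/
def _root_.OscStep.timeRev (z : Phase) : Phase := (q₁ z, -p₁ z, q₂ z, -p₂ z)

@[simp] lemma _root_.OscStep.timeRev_timeRev (z : Phase) : timeRev (timeRev z) = z := by
  simp [timeRev]; rfl

lemma Φ_timeRev (t ε : ℝ) (z : Phase) : M.Φ t ε (timeRev z) = timeRev (M.Φ (-t) ε z) := by
  have h1 := M.Φ_unique (ε := ε) (γ := fun t => timeRev (M.Φ (-t) ε z)) (fun t => by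
    obtain ⟨d1, d2, d3, d4⟩ := M.hasDerivAt_coords ε z (-t)
    have e1 := d1.scomp t (hasDerivAt_neg t)
    have e2 := (d2.scomp t (hasDerivAt_neg t)).neg
    have e3 := d3.scomp t (hasDerivAt_neg t)
    have e4 := (d4.scomp t (hasDerivAt_neg t)).neg
    refine (e1.prodMk (e2.prodMk (e3.prodMk e4))).congr_deriv ?_
    simp [timeRev, field]) t
  rw [h1]; simp [M.Φ_zero]

end Model

/-- Induction along a compact interval: continuity from the left and local continuation. -/
lemma forall_mem_Icc_of_continuation {P : ℝ → Prop} {a c : ℝ} (h0 : P a)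
    (hcl : ∀ t ∈ Ioc a c, (∀ s ∈ Ico a t, P s) → P t)
    (hop : ∀ t ∈ Ico a c, P t → ∃ u > t, ∀ s ∈ Ioo t u, s < c → P s) : ∀ t ∈ Icc a c, P t := by
  by_contra! hcon
  obtain ⟨t0, ht₀, hP⟩ := hcon
  set B := {t | t ∈ Icc a c ∧ ¬ P t}
  have hne : B.Nonempty := ⟨t0, ht₀, hP⟩
  have hbdd : BddBelow B := ⟨a, fun t ht => ht.1.1⟩
  set σ := sInf B
  have hσa : a ≤ σ := le_csInf hne fun t ht => ht.1.1
  have hσc : σ ≤ c := (csInf_le hbdd ⟨ht₀, hP⟩).trans ht₀.2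
  have hlt : ∀ s ∈ Ico a σ, P s := fun s hs => by
    by_contra hPs
    exact absurd (csInf_le hbdd ⟨⟨hs.1, hs.2.le.trans hσc⟩, hPs⟩) (not_le.2 hs.2)
  have hPσ : P σ := by
    rcases hσa.eq_or_lt with h | h
    · rw [← h]; exact h0
    · exact hcl σ ⟨h, hσc⟩ hlt
  rcases hσc.eq_or_lt with h | h
  · obtain ⟨t, htB, ht⟩ : ∃ t ∈ B, t = σ := by
      obtain ⟨t, htB⟩ := hne
      exact ⟨t, htB, le_antisymm (htB.1.2.trans h.ge) (csInf_le hbdd htB)⟩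
    exact htB.2 (ht ▸ hPσ)
  · obtain ⟨u, hu, hP'⟩ := hop σ ⟨hσa, h⟩ hPσ
    obtain ⟨t, htB, ht⟩ := exists_lt_of_csInf_lt hne (show sInf B < min u c from lt_min hu h)
    have hσt : σ ≤ t := csInf_le hbdd htB
    rcases hσt.eq_or_lt with h' | h'
    · exact htB.2 (h' ▸ hPσ)
    · exact htB.2 (hP' t ⟨h', ht.trans_le (min_le_left _ _)⟩ (ht.trans_le (min_le_right _ _)))

namespace StepSystem

variable (S : StepSystem)

/-- The position lies outside the closed step. -/
def Outside (z : Phase) : Prop := ¬ (q₁ z ≤ S.w₁ ∧ q₂ z ≤ S.w₂)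

/-- A state at which the motion is smooth. -/
structure Interior (z : Phase) : Prop where
  free : S.Free z
  not_corner : ¬ S.AtCorner z
  not_impact : ∀ z', ¬ S.Impact z z'

variable {S} {z z' : Phase} {ε h : ℝ}

lemma Outside.interior (hz : S.Outside z) (h₁ : q₁ z ∈ S.U₁) (h₂ : q₂ z ∈ S.U₂) : S.Interior z :=
  ⟨⟨h₁, h₂, fun h => hz ⟨h.1.le, h.2.le⟩⟩, fun h => hz ⟨h.1.le, h.2.le⟩, fun z' h => by
    rcases h with ⟨h1, -, h2, -⟩ | ⟨h1, -, h2, -⟩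
    · exact hz ⟨h1.le, h2.le⟩
    · exact hz ⟨h2.le, h1.le⟩⟩

lemma Outside.not_outgoing (hz : S.Outside z) : ¬ S.Impact z' z := fun h => by
  obtain ⟨e1, e2⟩ := h.positions
  rcases h with ⟨h1, -, h2, -⟩ | ⟨h1, -, h2, -⟩
  · exact hz ⟨(e1.trans h1).le, (e2.trans_lt h2).le⟩
  · exact hz ⟨(e1.trans_lt h2).le, (e2.trans h1).le⟩

end StepSystem

namespace Model

variable {S : StepSystem} {h : ℝ} (M : Model S h) {ε T : ℝ} {z : ℝ → Phase} {hits : Finset ℝ}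
lemma eventually_not_mem_hits (hits : Finset ℝ) (t : ℝ) : ∀ᶠ s in 𝓝[≠] t, s ∉ hits := by
  have : ∀ᶠ s in 𝓝 t, s ∈ ((hits.erase t : Finset ℝ) : Set ℝ)ᶜ :=
    (hits.erase t).finite_toSet.isClosed.isOpen_compl.mem_nhds (by simp)
  rw [eventually_nhdsWithin_iff]
  filter_upwards [this] with s hs hne hmem
  exact hs (Finset.mem_coe.2 (Finset.mem_erase.2 ⟨hne, hmem⟩))

lemma _root_.OscStep.StepSystem.IsTrajectory.hasDerivAt (hz : S.IsTrajectory ε T z hits) {t : ℝ}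
    (ht : t ∈ Ioo 0 T) (hh : t ∉ hits) : HasDerivAt z (S.field ε (z t)) t := by
  have := (hz.left_deriv t ⟨ht.1, ht.2.le⟩ hh).union (hz.right_deriv t ⟨ht.1.le, ht.2⟩)
  exact this.hasDerivAt (by rw [Iic_union_Ici]; exact univ_mem)

/-- As long as the flow does not meet an obstacle, the trajectory follows the flow. -/
lemma eqOn_flow (hε : |ε| ≤ 1) (hz : S.IsTrajectory ε T z hits) {a b : ℝ} (ha : a ∈ Ico 0 T)
    (hb : a + b ≤ T) (hcore : ∀ s ∈ Ico 0 b, M.InCore (M.Φ s ε (z a)))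
    (hint : ∀ s ∈ Ioo 0 b, ∀ z', ¬ S.Impact (M.Φ s ε (z a)) z') :
    ∀ t ∈ Ico a (a + b), z t = M.Φ (t - a) ε (z a) ∧ (a < t → t ∉ hits) := by
  intro t0 ht₀
  have hcont : Continuous fun t => M.Φ (t - a) ε (z a) :=
    (M.continuous_Φ_time ε (z a)).comp (continuous_id.sub continuous_const)
  have hder (t : ℝ) : HasDerivAt (fun t => M.Φ (t - a) ε (z a)) (M.field ε (M.Φ (t - a) ε (z a))) t :=
    (M.hasDerivAt_Φ ε (z a) (t - a)).comp_sub_const t a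
  refine forall_mem_Icc_of_continuation (P := fun t => z t = M.Φ (t - a) ε (z a) ∧ (a < t → t ∉ hits))
    (a := a) (c := t0) ?_ ?_ ?_ t0 ⟨ht₀.1, le_rfl⟩
  · simp [M.Φ_zero]
  · intro t ht hP
    have htT : t < T := ht.2.trans_lt (ht₀.2.trans_le hb)
    have h1 : Tendsto z (𝓝[<] t) (𝓝 (M.Φ (t - a) ε (z a))) := by
      refine (hcont.continuousAt.tendsto.mono_left nhdsWithin_le_nhds).congr' ?_
      filter_upwards [Ioo_mem_nhdsLT ht.1] with s hs using (hP s ⟨hs.1.le, hs.2⟩).1.symm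
    have hh : t ∉ hits := fun hh => by
      obtain ⟨z', h2, h3⟩ := hz.impact t hh
      rw [tendsto_nhds_unique h2 h1] at h3
      exact hint (t - a) ⟨by linarith [ht.1], by linarith [ht.2, ht₀.2]⟩ _ h3
    refine ⟨?_, fun _ => hh⟩
    have h4 := (hz.left_deriv t ⟨ha.1.trans_lt ht.1, htT.le⟩ hh).continuousWithinAt
    exact tendsto_nhds_unique (h4.tendsto.mono_left (nhdsWithin_mono _ Iio_subset_Iic_self)) h1
  · intro t ht hP
    have htT : t < T := ht.2.trans (ht₀.2.trans_le hb)
    have ht0 : 0 ≤ t := ha.1.trans ht.1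
    have hr := (hz.right_deriv t ⟨ht0, htT⟩)
    have hc : M.InCore (z t) := by
      rw [hP.1]; exact hcore _ ⟨by linarith [ht.1], by linarith [ht.2, ht₀.2]⟩
    have e1 : ∀ᶠ s in 𝓝[>] t, M.InCore (z s) :=
      (hr.continuousWithinAt.mono Ioi_subset_Ici_self) (M.isOpen_inCore.mem_nhds hc)
    have e2 : ∀ᶠ s in 𝓝[>] t, s ∉ hits :=
      (eventually_not_mem_hits hits t).filter_mono (nhdsWithin_mono _ fun s hs => ne_of_gt hs)
    obtain ⟨u, hu, hU⟩ := mem_nhdsGT_iff_exists_Ioo_subset.1 (e1.and e2)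
    refine ⟨u, hu, fun s hs hsc => ⟨?_, fun _ => (hU hs).2⟩⟩
    have hsT : s < T := hsc.trans (ht₀.2.trans_le hb)
    obtain ⟨K, hK⟩ := M.exists_lipschitz_field
    have hright (x) (hx : x ∈ Ico t s) : HasDerivWithinAt z (M.field ε (z x)) (Ici x) x := by
      have : M.InCore (z x) := by
        rcases hx.1.eq_or_lt with h' | h'
        · rw [← h']; exact hc
        · exact (hU ⟨h', hx.2.trans hs.2⟩).1
      rw [field_eq hε this]
      exact hz.right_deriv x ⟨ht0.trans hx.1, hx.2.trans hsT⟩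
    refine ODE_solution_unique_of_mem_Icc_right (v := fun _ => M.field ε) (s := fun _ => univ) (K := K)
      (fun _ _ => (hK ε).lipschitzOnWith) ?_ hright (fun _ _ => mem_univ _) hcont.continuousOn
      (fun x _ => (hder x).hasDerivWithinAt) (fun _ _ => mem_univ _) hP.1 ⟨hs.1.le, le_rfl⟩
    intro x hx
    rcases hx.1.eq_or_lt with h' | h'
    · rw [← h']; exact hr.continuousWithinAt.mono fun y hy => hy.1
    · exact (hz.hasDerivAt ⟨ht0.trans_lt h', hx.2.trans_lt hsT⟩
        (hU ⟨h', hx.2.trans_lt hs.2⟩).2).continuousAt.continuousWithinAt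

/-- At the end of a smooth stretch, the trajectory either continues smoothly or has an impact. -/
lemma flow_or_impact (hε : |ε| ≤ 1) (hz : S.IsTrajectory ε T z hits) {a b : ℝ} (ha : a ∈ Ico 0 T)
    (hb0 : 0 < b) (hb : a + b ≤ T) (hcore : ∀ s ∈ Ico 0 b, M.InCore (M.Φ s ε (z a)))
    (hint : ∀ s ∈ Ioo 0 b, ∀ z', ¬ S.Impact (M.Φ s ε (z a)) z') :
    z (a + b) = M.Φ b ε (z a) ∨ (a + b < T ∧ S.Impact (M.Φ b ε (z a)) (z (a + b))) := by
  have key := M.eqOn_flow hε hz ha hb hcore hint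
  have h1 : Tendsto z (𝓝[<] (a + b)) (𝓝 (M.Φ b ε (z a))) := by
    have h2 : Continuous fun t => M.Φ (t - a) ε (z a) :=
      (M.continuous_Φ_time ε (z a)).comp (continuous_id.sub continuous_const)
    have h3 : Tendsto (fun t => M.Φ (t - a) ε (z a)) (𝓝[<] (a + b)) (𝓝 (M.Φ (a + b - a) ε (z a))) :=
      h2.continuousAt.tendsto.mono_left nhdsWithin_le_nhds
    rw [add_sub_cancel_left] at h3
    refine h3.congr' ?_
    filter_upwards [Ioo_mem_nhdsLT (show a < a + b by linarith)] with s hs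
      using (key s ⟨hs.1.le, hs.2⟩).1.symm
  by_cases hh : a + b ∈ hits
  · obtain ⟨z', h2, h3⟩ := hz.impact _ hh
    rw [tendsto_nhds_unique h2 h1] at h3
    exact .inr ⟨(hz.hits_mem _ hh).2, h3⟩
  · have h4 := (hz.left_deriv (a + b) ⟨by linarith [ha.1], hb⟩ hh).continuousWithinAt
    exact .inl <|
      tendsto_nhds_unique (h4.tendsto.mono_left (nhdsWithin_mono _ Iio_subset_Iic_self)) h1

lemma flow_of_not_impact (hε : |ε| ≤ 1) (hz : S.IsTrajectory ε T z hits) {a b : ℝ}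
    (ha : a ∈ Ico 0 T) (hb0 : 0 < b) (hb : a + b ≤ T)
    (hcore : ∀ s ∈ Ico 0 b, M.InCore (M.Φ s ε (z a)))
    (hint : ∀ s ∈ Ioc 0 b, ∀ z', ¬ S.Impact (M.Φ s ε (z a)) z') :
    z (a + b) = M.Φ b ε (z a) :=
  (M.flow_or_impact hε hz ha hb0 hb hcore fun s hs => hint s ⟨hs.1, hs.2.le⟩).resolve_right
    fun h => hint b ⟨hb0, le_rfl⟩ _ h.2

lemma not_flow_of_impact (hz : S.IsTrajectory ε T z hits) {t : ℝ} (ht : t ∈ Ico 0 T) {zo : Phase} :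
    ¬ S.Impact (z t) zo := by
  intro hi
  obtain ⟨d1, -, d3, -⟩ := hasDerivWithinAt_coords ((hz.right_deriv t ht).mono Ioi_subset_Ici_self)
  have hT : ∀ᶠ s in 𝓝[>] t, s ∈ Icc 0 T := by
    filter_upwards [Ioo_mem_nhdsGT ht.2] with s hs using ⟨ht.1.trans hs.1.le, hs.2.le⟩
  rcases hi with ⟨h1, h2, h3, -⟩ | ⟨h1, h2, h3, -⟩
  · have e1 : ∀ᶠ s in 𝓝[>] t, q₁ (z s) < q₁ (z t) := by
      have := (hasDerivWithinAt_iff_tendsto_slope' (by simp)).1 d1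
      filter_upwards [this.eventually_lt_const (show q₁ (S.field ε (z t)) < 0 from h2), self_mem_nhdsWithin] with s hs hst
      rw [slope_def_field, div_neg_iff] at hs
      rcases hs with hs | hs <;> linarith [show t < s from hst]
    have e2 : ∀ᶠ s in 𝓝[>] t, q₂ (z s) < S.w₂ := d3.continuousWithinAt.tendsto.eventually_lt_const h3
    obtain ⟨s, hs1, hs2, hs3⟩ := (e1.and (e2.and hT)).exists
    exact (hz.free s hs3).2.2 ⟨h1 ▸ hs1, hs2⟩
  · have e1 : ∀ᶠ s in 𝓝[>] t, q₂ (z s) < q₂ (z t) := by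
      have := (hasDerivWithinAt_iff_tendsto_slope' (by simp)).1 d3
      filter_upwards [this.eventually_lt_const (show q₂ (S.field ε (z t)) < 0 from h2), self_mem_nhdsWithin] with s hs hst
      rw [slope_def_field, div_neg_iff] at hs
      rcases hs with hs | hs <;> linarith [show t < s from hst]
    have e2 : ∀ᶠ s in 𝓝[>] t, q₁ (z s) < S.w₁ := d1.continuousWithinAt.tendsto.eventually_lt_const h3
    obtain ⟨s, hs1, hs2, hs3⟩ := (e1.and (e2.and hT)).exists
    exact (hz.free s hs3).2.2 ⟨hs2, h1 ▸ hs1⟩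

/-- Backward in time, the trajectory follows the flow outside the closed step. -/
lemma eq_flow_backward (hε : |ε| ≤ 1) (hz : S.IsTrajectory ε T z hits) {b : ℝ} (hb0 : 0 ≤ b)
    (hb : b ≤ T) (hcore : ∀ s ∈ Ico 0 b, M.InCore (M.Φ (-s) ε (z T)))
    (hout : ∀ s ∈ Ioo 0 b, S.Outside (M.Φ (-s) ε (z T))) :
    z (T - b) = M.Φ (-b) ε (z T) := by
  have hder (t : ℝ) : HasDerivAt (fun t => M.Φ (t - T) ε (z T)) (M.field ε (M.Φ (t - T) ε (z T))) t :=
    (M.hasDerivAt_Φ ε (z T) (t - T)).comp_sub_const t T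
  have hcont : Continuous fun t => M.Φ (t - T) ε (z T) :=
    continuous_iff_continuousAt.2 fun t => (hder t).continuousAt
  refine forall_mem_Icc_of_continuation (P := fun s => z (T - s) = M.Φ (-s) ε (z T))
    (a := 0) (c := b) ?_ ?_ ?_ b ⟨hb0, le_rfl⟩
  · simp [M.Φ_zero]
  · intro s hs hP
    have h1 : Tendsto z (𝓝[>] (T - s)) (𝓝 (M.Φ (-s) ε (z T))) := by
      have h3 : Tendsto (fun t => M.Φ (t - T) ε (z T)) (𝓝[>] (T - s)) (𝓝 (M.Φ (T - s - T) ε (z T))) :=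
        hcont.continuousAt.tendsto.mono_left nhdsWithin_le_nhds
      rw [show T - s - T = -s by ring] at h3
      refine h3.congr' ?_
      filter_upwards [Ioo_mem_nhdsGT (show T - s < T by linarith [hs.1])] with t ht
      have := hP (T - t) ⟨by linarith [ht.2], by linarith [ht.1]⟩
      rw [sub_sub_cancel, neg_sub] at this
      exact this.symm
    have h4 := (hz.right_deriv (T - s) ⟨by linarith [hs.2], by linarith [hs.1]⟩).continuousWithinAt
    exact tendsto_nhds_unique (h4.tendsto.mono_left (nhdsWithin_mono _ Ioi_subset_Ici_self)) h1
  · intro s hs hP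
    have hTs : T - s ∈ Ioc 0 T := ⟨by linarith [hs.2], by linarith [hs.1]⟩
    have hh : T - s ∉ hits := fun hh => by
      rcases hs.1.eq_or_lt with h0 | h0
      · rw [← h0, sub_zero] at hh; exact absurd (hz.hits_mem _ hh).2 (lt_irrefl _)
      · obtain ⟨z', -, h3⟩ := hz.impact _ hh
        rw [hP] at h3
        exact (hout s ⟨h0, hs.2⟩).not_outgoing h3
    have hl := hz.left_deriv (T - s) hTs hh
    have hc : M.InCore (z (T - s)) := by rw [hP]; exact hcore s hs
    have e1 : ∀ᶠ t in 𝓝[<] (T - s), M.InCore (z t) :=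
      (hl.continuousWithinAt.mono Iio_subset_Iic_self) (M.isOpen_inCore.mem_nhds hc)
    have e2 : ∀ᶠ t in 𝓝[<] (T - s), t ∉ hits :=
      (eventually_not_mem_hits hits _).filter_mono (nhdsWithin_mono _ fun s hs => ne_of_lt hs)
    obtain ⟨u, hu, hU⟩ := mem_nhdsLT_iff_exists_Ioo_subset.1 (e1.and e2)
    refine ⟨T - u, by linarith [show u < T - s from hu], fun s' hs' hsc => ?_⟩
    obtain ⟨K, hK⟩ := M.exists_lipschitz_field
    have hmem (x) (hx : x ∈ Ioc (T - s') (T - s)) : M.InCore (z x) ∧ x ∉ hits := by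
      rcases hx.2.eq_or_lt with h' | h'
      · rw [h']; exact ⟨hc, hh⟩
      · exact hU ⟨by linarith [hx.1, hs'.2], h'⟩
    have hmem' (x) (hx : x ∈ Icc (T - s') (T - s)) : x ∉ hits :=
      (by
        rcases hx.2.eq_or_lt with h' | h'
        · rw [h']; exact hh
        · exact (hU ⟨by linarith [hx.1, hs'.2], h'⟩).2)
    have hleft (x) (hx : x ∈ Ioc (T - s') (T - s)) : HasDerivWithinAt z (M.field ε (z x)) (Iic x) x := by
      rw [field_eq hε (hmem x hx).1]
      exact hz.left_deriv x ⟨by linarith [hx.1], hx.2.trans hTs.2⟩ (hmem x hx).2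
    have := ODE_solution_unique_of_mem_Icc_left (v := fun _ => M.field ε) (s := fun _ => univ) (K := K)
      (f := z) (g := fun t => M.Φ (t - T) ε (z T)) (a := T - s') (b := T - s)
      (fun _ _ => (hK ε).lipschitzOnWith) ?_ hleft (fun _ _ => mem_univ _) hcont.continuousOn
      (fun x _ => (hder x).hasDerivWithinAt) (fun _ _ => mem_univ _)
      (by rw [hP]; congr 1; ring) (x := T - s') ⟨le_rfl, by linarith [hs'.1]⟩
    · rw [this]; simp
    intro x hx
    rcases hx.2.eq_or_lt with h' | h'
    · rw [h']; exact hl.continuousWithinAt.mono fun y hy => hy.2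
    · exact (hz.hasDerivAt ⟨by linarith [hx.1], h'.trans_le hTs.2⟩
        (hmem' x hx)).continuousAt.continuousWithinAt

end Model

namespace Model

variable {S : StepSystem} {h : ℝ} (M : Model S h) {ε : ℝ}

/-- A stretch of the flow without obstacles and without visits to the section. -/
structure Leg (ε h' : ℝ) (z : Phase) (b : ℝ) : Prop where
  pos : 0 < b
  core : ∀ s ∈ Icc 0 b, M.InCore (M.Φ s ε z)
  interior : ∀ s ∈ Ioo 0 b, S.Interior (M.Φ s ε z)
  not_section : ∀ s ∈ Ioo 0 b, M.Φ s ε z ∉ S.section_ ε h'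

/-- A flow segment with at most one impact. -/
def Route (ε h' : ℝ) (z₀ z₁ : Phase) : Prop :=
  (∃ b, M.Leg ε h' z₀ b ∧ z₁ = M.Φ b ε z₀) ∨
  ∃ b c zo, M.Leg ε h' z₀ b ∧ S.Impact (M.Φ b ε z₀) zo ∧ M.Φ b ε z₀ ∉ S.section_ ε h' ∧
    zo ∉ S.section_ ε h' ∧ M.Leg ε h' zo c ∧ z₁ = M.Φ c ε zo

variable {M} {h' : ℝ} {z₀ z₁ : Phase}

lemma hasDerivAt_Φ_of_inCore (hε : |ε| ≤ 1) {t : ℝ} (hc : M.InCore (M.Φ t ε z₀)) :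
    HasDerivAt (fun t => M.Φ t ε z₀) (S.field ε (M.Φ t ε z₀)) t := by
  rw [← field_eq hε hc]; exact M.hasDerivAt_Φ ε z₀ t

/-- A leg followed by a leg, with a smooth state in between, is a leg. -/
lemma Leg.append {b c : ℝ} (h1 : M.Leg ε h' z₀ b) (hi : S.Interior (M.Φ b ε z₀))
    (hs : M.Φ b ε z₀ ∉ S.section_ ε h') (h2 : M.Leg ε h' (M.Φ b ε z₀) c) : M.Leg ε h' z₀ (b + c) := by
  have hb := h1.pos
  have hc := h2.pos
  have key (s) : M.Φ s ε z₀ = M.Φ (s - b) ε (M.Φ b ε z₀) := by rw [← M.Φ_add, sub_add_cancel]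
  refine ⟨by linarith, fun s hs' => ?_, fun s hs' => ?_, fun s hs' => ?_⟩
  · rcases le_total s b with h | h
    · exact h1.core s ⟨hs'.1, h⟩
    · rw [key]; exact h2.core _ ⟨by linarith, by linarith [hs'.2]⟩
  · rcases lt_trichotomy s b with h | h | h
    · exact h1.interior s ⟨hs'.1, h⟩
    · rw [h]; exact hi
    · rw [key]; exact h2.interior _ ⟨by linarith, by linarith [hs'.2]⟩
  · rcases lt_trichotomy s b with h | h | h
    · exact h1.not_section s ⟨hs'.1, h⟩
    · rw [h]; exact hs
    · rw [key]; exact h2.not_section _ ⟨by linarith, by linarith [hs'.2]⟩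

lemma not_corner_of_impact {z zo : Phase} (hi : S.Impact z zo) : ¬ S.AtCorner z := fun hc => by
  rcases hi with ⟨-, -, h3, -⟩ | ⟨-, -, h3, -⟩
  · exact absurd hc.2 h3.ne
  · exact absurd hc.1 h3.ne

lemma not_corner_outgoing {z zo : Phase} (hi : S.Impact z zo) : ¬ S.AtCorner zo := fun hc =>
  not_corner_of_impact hi ⟨hi.positions.1 ▸ hc.1, hi.positions.2 ▸ hc.2⟩

/-- The flow along a route is a trajectory of the step system. -/
lemma Route.reaches (hε : |ε| ≤ 1) (h₀ : z₀ ∈ S.section_ ε h') (hi0 : S.Interior z₀)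
    (hf : S.Free z₁) (hr : M.Route ε h' z₀ z₁) : S.Reaches ε h' z₀ z₁ := by
  refine ⟨h₀, ?_⟩
  rcases hr with ⟨b, hb, rfl⟩ | ⟨b, c, zo, hb, hi, hsi, hso, hc, rfl⟩
  · refine ⟨b, hb.pos, fun t => M.Φ t ε z₀, ∅, ⟨by simp, fun t ht => ?_, fun t ht => ?_,
      fun t ht => ?_, fun t ht _ => ?_, by simp⟩, M.Φ_zero .., rfl, hb.not_section⟩
    · rcases ht.1.eq_or_lt with h | h
      · rw [← h, M.Φ_zero]; exact hi0.free
      rcases ht.2.eq_or_lt with h2 | h2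
      · rw [h2]; exact hf
      exact (hb.interior t ⟨h, h2⟩).free
    · rcases ht.1.eq_or_lt with h | h
      · rw [← h, M.Φ_zero]; exact hi0.not_corner
      exact (hb.interior t ⟨h, ht.2⟩).not_corner
    · exact (hasDerivAt_Φ_of_inCore hε (hb.core t ⟨ht.1, ht.2.le⟩)).hasDerivWithinAt
    · exact (hasDerivAt_Φ_of_inCore hε (hb.core t ⟨ht.1.le, ht.2⟩)).hasDerivWithinAt
  · have hb0 := hb.pos
    have hc0 := hc.pos
    set z : ℝ → Phase := fun t => if t < b then M.Φ t ε z₀ else M.Φ (t - b) ε zo with hz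
    have z_lt {t} (ht : t < b) : z t = M.Φ t ε z₀ := if_pos ht
    have z_ge {t} (ht : b ≤ t) : z t = M.Φ (t - b) ε zo := if_neg (not_lt.2 ht)
    have z_b : z b = zo := by rw [z_ge le_rfl, sub_self, M.Φ_zero]
    have hfo : S.Free zo := by
      refine ⟨?_, ?_, ?_⟩
      · rw [hi.positions.1]; exact (hb.core b ⟨hb0.le, le_rfl⟩).mem_U.1
      · rw [hi.positions.2]; exact (hb.core b ⟨hb0.le, le_rfl⟩).mem_U.2
      · rw [hi.positions.1, hi.positions.2]
        rcases hi with ⟨h1, -, -, -⟩ | ⟨h1, -, -, -⟩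
        · exact fun h => h.1.ne h1
        · exact fun h => h.2.ne h1
    have d_lt {t} (ht : 0 ≤ t) (htb : t < b) : HasDerivAt z (S.field ε (z t)) t := by
      rw [z_lt htb]
      refine (hasDerivAt_Φ_of_inCore hε (hb.core t ⟨ht, htb.le⟩)).congr_of_eventuallyEq ?_
      filter_upwards [Iio_mem_nhds htb] with s hs using z_lt hs
    have d_ge {t} (ht : b ≤ t) (htc : t ≤ b + c) :
        HasDerivAt (fun t => M.Φ (t - b) ε zo) (S.field ε (z t)) t := by
      rw [z_ge ht]
      exact (hasDerivAt_Φ_of_inCore hε (hc.core (t - b) ⟨by linarith, by linarith⟩)).comp_sub_const t b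
    have d_gt {t} (ht : b < t) (htc : t ≤ b + c) : HasDerivAt z (S.field ε (z t)) t := by
      refine (d_ge ht.le htc).congr_of_eventuallyEq ?_
      filter_upwards [Ioi_mem_nhds ht] with s hs using z_ge (le_of_lt hs)
    refine ⟨b + c, by linarith, z, {b}, ⟨?_, fun t ht => ?_, fun t ht => ?_, fun t ht => ?_,
      fun t ht hh => ?_, ?_⟩, ?_, ?_, fun t ht => ?_⟩
    · simp only [Finset.mem_singleton, forall_eq, mem_Ioo]; exact ⟨hb0, by linarith⟩
    · rcases lt_trichotomy t b with h | h | h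
      · rw [z_lt h]
        rcases ht.1.eq_or_lt with h0 | h0
        · rw [← h0, M.Φ_zero]; exact hi0.free
        · exact (hb.interior t ⟨h0, h⟩).free
      · rw [h, z_b]; exact hfo
      · rw [z_ge h.le]
        rcases ht.2.eq_or_lt with h2 | h2
        · rw [h2, add_sub_cancel_left]; exact hf
        · exact (hc.interior _ ⟨by linarith, by linarith⟩).free
    · rcases lt_trichotomy t b with h | h | h
      · rw [z_lt h]
        rcases ht.1.eq_or_lt with h0 | h0
        · rw [← h0, M.Φ_zero]; exact hi0.not_corner
        · exact (hb.interior t ⟨h0, h⟩).not_corner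
      · rw [h, z_b]; exact not_corner_outgoing hi
      · rw [z_ge h.le]
        exact (hc.interior _ ⟨by linarith, by linarith [ht.2]⟩).not_corner
    · rcases lt_trichotomy t b with h | h | h
      · exact (d_lt ht.1 h).hasDerivWithinAt
      · exact (d_ge h.ge ht.2.le).hasDerivWithinAt.congr (fun s hs => z_ge (h ▸ hs)) (z_ge h.ge)
      · exact (d_gt h ht.2.le).hasDerivWithinAt
    · rcases lt_trichotomy t b with h | h | h
      · exact (d_lt ht.1.le h).hasDerivWithinAt
      · exact absurd (by simpa using h) hh
      · exact (d_gt h ht.2).hasDerivWithinAt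
    · simp only [Finset.mem_singleton, forall_eq]
      refine ⟨M.Φ b ε z₀, ?_, z_b ▸ hi⟩
      refine ((M.continuous_Φ_time ε z₀).continuousAt.tendsto.mono_left nhdsWithin_le_nhds).congr' ?_
      filter_upwards [self_mem_nhdsWithin] with s hs using (z_lt hs).symm
    · rw [z_lt hb0, M.Φ_zero]
    · rw [z_ge (by linarith), add_sub_cancel_left]
    · rcases lt_trichotomy t b with h | h | h
      · rw [z_lt h]; exact hb.not_section t ⟨ht.1, h⟩
      · rw [h, z_b]; exact hso
      · rw [z_ge h.le]; exact hc.not_section _ ⟨by linarith, by linarith [ht.2]⟩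

/-- A trajectory that passes a stretch without obstacles up to a final state on the section or at
the corner has not stopped before. -/
lemma eq_or_of_leg (hε : |ε| ≤ 1) {T : ℝ} {z : ℝ → Phase} {hits : Finset ℝ}
    (hz : S.IsTrajectory ε T z hits) (hs : ∀ t ∈ Ioo 0 T, z t ∉ S.section_ ε h') {a b : ℝ}
    (ha : a ∈ Ico 0 T) (hb : M.Leg ε h' (z a) b) (hz1 : z₁ = M.Φ b ε (z a))
    (hend : (z₁ ∈ S.section_ ε h' ∧ S.Interior z₁) ∨ S.AtCorner z₁) :
    z T = z₁ ∨ (z T ∉ S.section_ ε h' ∧ ¬ S.AtCorner (z T)) := by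
  have hb0 := hb.pos
  subst hz1
  rcases lt_or_ge (a + b) T with h | h
  · exfalso
    have : z (a + b) = M.Φ b ε (z a) := by
      refine M.flow_of_not_impact hε hz ha hb0 h.le (fun s hs => hb.core s ⟨hs.1, hs.2.le⟩)
        fun s hs z' hi => ?_
      rcases hs.2.eq_or_lt with h2 | h2
      · rw [h2] at hi
        rcases hend with h3 | h3
        · exact h3.2.not_impact _ hi
        · exact not_corner_of_impact hi h3
      · exact (hb.interior s ⟨hs.1, h2⟩).not_impact _ hi
    rw [← this] at hend
    rcases hend with h3 | h3
    · exact hs _ ⟨by linarith [ha.1], h⟩ h3.1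
    · exact hz.no_corner _ ⟨by linarith [ha.1], h⟩ h3
  · have hT : z (a + (T - a)) = M.Φ (T - a) ε (z a) ∨
        (a + (T - a) < T ∧ S.Impact (M.Φ (T - a) ε (z a)) (z (a + (T - a)))) := by
      refine M.flow_or_impact hε hz ha (by linarith [ha.2]) (by linarith)
        (fun s hs => hb.core s ⟨hs.1, by linarith [hs.2]⟩)
        fun s hs z' hi => (hb.interior s ⟨hs.1, by linarith [hs.2]⟩).not_impact _ hi
    have hT' := hT.resolve_right fun h => by linarith [h.1]
    rw [add_sub_cancel] at hT'
    rcases h.eq_or_lt with h2 | h2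
    · left; rw [hT', h2, add_sub_cancel_left]
    · right
      rw [hT']
      have hm : T - a ∈ Ioo 0 b := ⟨by linarith [ha.2], by linarith⟩
      exact ⟨hb.not_section _ hm, (hb.interior _ hm).not_corner⟩

/-- Trajectories from the section are unique up to their next visit to the section or corner. -/
lemma Route.unique (hε : |ε| ≤ 1) (hr : M.Route ε h' z₀ z₁)
    (hend : (z₁ ∈ S.section_ ε h' ∧ S.Interior z₁) ∨ S.AtCorner z₁) {z' : Phase}
    (hz' : S.Reaches ε h' z₀ z') : z' = z₁ ∨ (z' ∉ S.section_ ε h' ∧ ¬ S.AtCorner z') := by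
  obtain ⟨h₀, T, hT, z, hits, hz, rfl, rfl, hs⟩ := hz'
  rcases hr with ⟨b, hb, hz1⟩ | ⟨b, c, zo, hb, hi, hsi, hso, hc, hz1⟩
  · exact eq_or_of_leg hε hz hs ⟨le_rfl, hT⟩ hb hz1 hend
  · rcases lt_or_ge b T with hbT | hbT
    · have h1 := M.flow_or_impact hε hz (a := 0) (b := b) ⟨le_rfl, hT⟩ hb.pos (by linarith)
        (fun s hs => hb.core s ⟨hs.1, hs.2.le⟩) fun s hs => (hb.interior s hs).not_impact
      rw [zero_add] at h1
      rcases h1 with h1 | h1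
      · exact absurd (h1 ▸ hi) (not_flow_of_impact hz ⟨hb.pos.le, hbT⟩)
      · have h2 := h1.2.unique hi
        exact eq_or_of_leg hε hz hs ⟨hb.pos.le, hbT⟩ (by rw [h2]; exact hc) (by rw [h2]; exact hz1) hend
    · right
      have h1 := M.flow_or_impact hε hz (a := 0) (b := T) ⟨le_rfl, hT⟩ hT (by linarith)
        (fun s hs => hb.core s ⟨hs.1, hs.2.le.trans hbT⟩)
        fun s hs => (hb.interior s ⟨hs.1, hs.2.trans_le hbT⟩).not_impact
      rw [zero_add] at h1
      rw [h1.resolve_right fun h => lt_irrefl _ h.1]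
      rcases hbT.eq_or_lt with h2 | h2
      · rw [h2]; exact ⟨hsi, not_corner_of_impact hi⟩
      · exact ⟨hb.not_section T ⟨hT, h2⟩, (hb.interior T ⟨hT, h2⟩).not_corner⟩

end Model

end OscStep

/-! ### Arcs of the circle -/

namespace CircleArc

lemma sbtw_coe {u v w : ℝ} (h1 : u < v) (h2 : v < w) (h3 : w < u + 2 * π) :
    sbtw (u : Angle) (v : Angle) (w : Angle) := by
  have : Fact (0 < 2 * π) := ⟨by positivity⟩
  rw [sbtw_iff_not_btw]
  change ¬ btw (w : ℝ ⧸ AddSubgroup.zmultiples (2 * π)) (v : ℝ ⧸ AddSubgroup.zmultiples (2 * π)) u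
  rw [QuotientAddGroup.btw_coe_iff, not_le]
  have e1 : toIcoMod (Fact.out : 0 < 2 * π) w v = v + 2 * π :=
    (toIcoMod_eq_iff _).2 ⟨⟨by linarith, by linarith⟩, -1, by simp⟩
  have e2 : toIocMod (Fact.out : 0 < 2 * π) w u = u + 2 * π :=
    (toIocMod_eq_iff _).2 ⟨⟨by linarith, by linarith⟩, -1, by simp⟩
  rw [e1, e2]; linarith

/-- The lift of an angle to a given interval of length `2π`. -/
lemma exists_lift (u : ℝ) (θ : Angle) : ∃ v : ℝ, u ≤ v ∧ v < u + 2 * π ∧ (v : Angle) = θ := by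
  have hp : 0 < 2 * π := by positivity
  induction θ using Angle.induction_on with
  | h x =>
    refine ⟨toIcoMod hp u x, left_le_toIcoMod _ _ _, toIcoMod_lt_right _ _ _, ?_⟩
    rw [Angle.angle_eq_iff_two_pi_dvd_sub]
    refine ⟨-toIcoDiv hp u x, ?_⟩
    rw [toIcoMod, zsmul_eq_mul]; push_cast; ring

lemma mem_cIoo_coe {u w : ℝ} (h1 : u < w) (h2 : w < u + 2 * π) {θ : Angle} :
    θ ∈ cIoo (u : Angle) (w : Angle) ↔ ∃ v ∈ Ioo u w, (v : Angle) = θ := by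
  constructor
  · intro (h : sbtw (u : Angle) θ w)
    obtain ⟨v, hv1, hv2, rfl⟩ := exists_lift u θ
    refine ⟨v, ⟨lt_of_le_of_ne hv1 ?_, ?_⟩, rfl⟩
    · rintro rfl; exact sbtw_irrefl_left h
    · by_contra hvw
      rcases (not_lt.1 hvw).eq_or_lt with rfl | hlt
      · exact sbtw_irrefl_right h
      · exact h.not_sbtw (sbtw_cyclic.1 (sbtw_cyclic.1 (sbtw_coe h1 hlt hv2)))
  · rintro ⟨v, hv, rfl⟩
    exact sbtw_coe hv.1 hv.2 h2

lemma cIoo_coe_nonempty {u w : ℝ} (h1 : u < w) (h2 : w < u + 2 * π) :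
    (cIoo (u : Angle) (w : Angle)).Nonempty :=
  let ⟨v, hv⟩ := exists_between h1
  ⟨v, (mem_cIoo_coe h1 h2).2 ⟨v, hv, rfl⟩⟩

lemma coe_add_two_pi (x : ℝ) : ((x + 2 * π : ℝ) : Angle) = x := by simp

lemma neg_mem_cIoo {u w : ℝ} (h1 : u < w) (h2 : w < u + 2 * π) {θ : Angle} :
    -θ ∈ cIoo (u : Angle) (w : Angle) ↔
      θ ∈ cIoo (-(w : Angle)) (-(u : Angle)) := by
  rw [← Angle.coe_neg, ← Angle.coe_neg, mem_cIoo_coe h1 h2,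
    mem_cIoo_coe (by linarith) (by linarith)]
  constructor
  · rintro ⟨v, hv, h⟩
    exact ⟨-v, ⟨by linarith [hv.2], by linarith [hv.1]⟩, by rw [Angle.coe_neg, h, neg_neg]⟩
  · rintro ⟨v, hv, h⟩
    exact ⟨-v, ⟨by linarith [hv.2], by linarith [hv.1]⟩, by rw [Angle.coe_neg, h]⟩

lemma sbtw_of_mem_arcs {l m r : ℝ} (h1 : l < m) (h2 : m < r) (h3 : r < l + 2 * π)
    {α β γ : Angle} (hα : α ∈ cIoo (r : Angle) (l : Angle))
    (hβ : β ∈ cIoo (l : Angle) (m : Angle))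
    (hγ : γ ∈ cIoo (m : Angle) (r : Angle)) : sbtw α β γ := by
  rw [← coe_add_two_pi l, mem_cIoo_coe h3 (by linarith)] at hα
  rw [mem_cIoo_coe h1 (by linarith)] at hβ
  rw [mem_cIoo_coe h2 (by linarith)] at hγ
  obtain ⟨a, ha, rfl⟩ := hα
  obtain ⟨b, hb, rfl⟩ := hβ
  obtain ⟨c, hc, rfl⟩ := hγ
  exact sbtw_cyclic.1 (sbtw_coe (hb.2.trans hc.1) (hc.2.trans ha.1) (by linarith [ha.2, hb.1]))

end CircleArc

namespace OscStep

open Oscillator StepSystem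

open CircleArc

lemma conclusion_of_transitions {S : StepSystem} {h ε Δ δ : ℝ} (hδ : 0 ≤ δ)
    {Itan : Angle → ℝ} {x : Label → ℝ → ℝ} {Trans : Label → Cyl → Cyl → Prop}
    (hx : ∀ b, ContinuousOn (x b) (Icc (-Δ) 0))
    (hcorner : ∀ b, ∀ k ∈ Icc (-Δ) 0, ∀ θ : Angle,
      (θ, Itan θ + k) ∈ S.cornerCurve ε h b b.next ↔ θ = x b k)
    (hord : ∀ k ∈ Ioo (-Δ) 0, x .R k < x .zero k ∧ x .zero k < x .one k ∧
      x .one k < x .R k + 2 * π)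
    (harc : ∀ b, ∀ k ∈ Ioo (-Δ) 0, ∀ θ : Angle,
      θ ∈ cIoo (x b.next.next k : Angle) (x b k : Angle) ↔
        ∃ y, Trans b (θ, Itan θ + k) y)
    (hret : ∀ b u v, Trans b u v → S.ReturnsTo ε h u v)
    (huniq : ∀ b u v v', Trans b u v → S.ReturnsTo ε h u v' → v' = v)
    (hrev : ∀ b u v, Trans b u v → Trans b (reflect v) (reflect u))
    (hneg : ∀ b u v, Trans b u v → u.2 - Itan u.1 < 0)
    (hclose : ∀ b u v, Trans b u v → |(v.2 - Itan (-v.1)) - (u.2 - Itan u.1)| ≤ δ) :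
    ∃ φ : Label → Label → ℝ → Angle,
      (∀ a, ContinuousOn (φ a a.next) (Icc (-Δ) 0) ∧ ∀ k ∈ Icc (-Δ) 0, ∀ θ : Angle,
          (θ, Itan θ + k) ∈ S.cornerCurve ε h a a.next ↔ θ = φ a a.next k) ∧
        (∀ b, ∀ x ∈ region Itan φ Δ b, ∃! y, S.ReturnsTo ε h x y) ∧
        InOrder Itan Δ (region Itan φ Δ .R) (region Itan φ Δ .zero) (region Itan φ Δ .one) ∧
        InOrder (fun θ => Itan (-θ)) (Δ - δ)
          (imageUnder (S.ReturnsTo ε h) (region Itan φ Δ .one))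
          (imageUnder (S.ReturnsTo ε h) (region Itan φ Δ .zero))
          (imageUnder (S.ReturnsTo ε h) (region Itan φ Δ .R)) ∧
        InOrder (fun _ => 0) Δ
          (regionNormal φ Δ .R) (regionNormal φ Δ .zero) (regionNormal φ Δ .one) ∧
        InOrder (epsF Itan) (Δ - δ)
          (imageUnder (S.ReturnsToNormal ε h Itan) (regionNormal φ Δ .one))
          (imageUnder (S.ReturnsToNormal ε h Itan) (regionNormal φ Δ .zero))
          (imageUnder (S.ReturnsToNormal ε h Itan) (regionNormal φ Δ .R)) ∧
        ∃ φbar : Label → Label → ℝ → Angle, ∀ a b c, IsCyc c b a →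
          (HasSides (fun θ => Itan (-θ)) (imageUnder (S.ReturnsTo ε h) (region Itan φ Δ b))
              (φbar a b) (φbar b c) Δ δ ∧
            curveOver (fun θ => Itan (-θ)) (φbar a b) Δ =
              reflect '' S.cornerCurveBand ε h Itan Δ b a ∧
            curveOver (fun θ => Itan (-θ)) (φbar b c) Δ =
              reflect '' S.cornerCurveBand ε h Itan Δ c b) ∧
          (HasSides (epsF Itan) (imageUnder (S.ReturnsToNormal ε h Itan) (regionNormal φ Δ b))
              (φbar a b) (φbar b c) Δ δ ∧
            curveOver (epsF Itan) (φbar a b) Δ =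
              reflectNormal Itan '' (toNormal Itan '' S.cornerCurveBand ε h Itan Δ b a) ∧
            curveOver (epsF Itan) (φbar b c) Δ =
              reflectNormal Itan '' (toNormal Itan '' S.cornerCurveBand ε h Itan Δ c b)) := by
  set φ : Label → Label → ℝ → Angle := fun a _ k => (x a k : Angle) with hφ
  have hnnn : ∀ b : Label, b.next.next.next = b := by intro b; cases b <;> rfl
  have hreg : ∀ b (u : Cyl), u ∈ region Itan φ Δ b ↔
      u.2 - Itan u.1 ∈ Ioo (-Δ) 0 ∧ ∃ y, Trans b u y := by
    intro b u
    have : u = (u.1, Itan u.1 + (u.2 - Itan u.1)) := by ext <;> simp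
    constructor
    · rintro ⟨h1, h2⟩
      refine ⟨h1, ?_⟩
      rw [this]
      exact (harc b _ h1 u.1).1 h2
    · rintro ⟨h1, h2⟩
      rw [this] at h2
      exact ⟨h1, (harc b _ h1 u.1).2 h2⟩
  have himg : ∀ b (y : Cyl), y ∈ imageUnder (S.ReturnsTo ε h) (region Itan φ Δ b) ↔
      ∃ u : Cyl, u.2 - Itan u.1 ∈ Ioo (-Δ) 0 ∧ Trans b u y := by
    intro b y
    constructor
    · rintro ⟨u, hu, huy⟩
      obtain ⟨h1, v, hv⟩ := (hreg b u).1 hu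
      exact ⟨u, h1, huniq b u v y hv huy ▸ hv⟩
    · rintro ⟨u, h1, h2⟩
      exact ⟨u, (hreg b u).2 ⟨h1, y, h2⟩, hret b u y h2⟩
  have hsliceJ : ∀ b, ∀ k ∈ Ioo (-Δ) 0,
      slice Itan (region Itan φ Δ b) k = cIoo (x b.next.next k : Angle) (x b k) := by
    intro b k hk
    ext θ
    change (_ ∧ _) ↔ _
    simp only [toNormal, add_sub_cancel_left, hφ]
    exact and_iff_right hk
  have hsliceN : ∀ b, ∀ k ∈ Ioo (-Δ) 0,
      slice (fun _ => 0) (regionNormal φ Δ b) k = cIoo (x b.next.next k : Angle) (x b k) := by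
    intro b k hk
    ext θ
    change (_ ∧ _) ↔ _
    simp only [zero_add, hφ]
    exact and_iff_right hk
  have hnegarc : ∀ b, ∀ k ∈ Ioo (-Δ) 0, ∀ θ : Angle,
      -θ ∈ cIoo (x b.next.next k : Angle) (x b k) ↔
        θ ∈ cIoo (-(x b k : Angle)) (-(x b.next.next k : Angle)) := by
    intro b k hk θ
    obtain ⟨h1, h2, h3⟩ := hord k hk
    cases b
    · change -θ ∈ cIoo (x .one k : Angle) (x .R k) ↔
        θ ∈ cIoo (-(x .R k : Angle)) (-(x .one k : Angle))
      rw [← coe_add_two_pi (x .R k)]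
      exact neg_mem_cIoo h3 (by linarith)
    · exact neg_mem_cIoo h1 (by linarith)
    · exact neg_mem_cIoo h2 (by linarith)
  have hsub : ∀ b, ∀ k ∈ Ioo (-Δ) 0,
      slice (fun θ => Itan (-θ)) (imageUnder (S.ReturnsTo ε h) (region Itan φ Δ b)) k ⊆
        cIoo (-(x b k : Angle)) (-(x b.next.next k : Angle)) := by
    intro b k hk θ hθ
    obtain ⟨u, -, hu⟩ := (himg b _).1 hθ
    rw [← hnegarc b k hk]
    exact (harc b k hk _).2 ⟨_, hrev b _ _ hu⟩
  have heq : ∀ b, ∀ k ∈ Ioo (-(Δ - δ)) 0,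
      slice (fun θ => Itan (-θ)) (imageUnder (S.ReturnsTo ε h) (region Itan φ Δ b)) k =
        cIoo (-(x b k : Angle)) (-(x b.next.next k : Angle)) := by
    intro b k hk
    have hk' : k ∈ Ioo (-Δ) 0 := ⟨by linarith [hk.1], hk.2⟩
    refine (hsub b k hk').antisymm fun θ hθ => ?_
    rw [← hnegarc b k hk', harc b k hk'] at hθ
    obtain ⟨w, hw⟩ := hθ
    have h1 := hclose b _ _ hw
    have h2 := hrev b _ _ hw
    have h3 := hneg b _ _ h2
    refine (himg b _).2 ⟨reflect w, ⟨?_, h3⟩, by simpa [reflect] using h2⟩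
    simp only [reflect, add_sub_cancel_left] at h1 ⊢
    linarith [(abs_le.1 h1).1, hk.1]
  have hheight : ∀ b, ∀ y ∈ imageUnder (S.ReturnsTo ε h) (region Itan φ Δ b),
      y.2 - Itan (-y.1) ∈ Ioo (-(Δ + δ)) 0 := by
    intro b y hy
    obtain ⟨u, hu, huy⟩ := (himg b y).1 hy
    exact ⟨by linarith [(abs_le.1 (hclose b _ _ huy)).1, hu.1], hneg b _ _ (hrev b _ _ huy)⟩
  have hnorm : ∀ b (v : Cyl), v ∈ imageUnder (S.ReturnsToNormal ε h Itan) (regionNormal φ Δ b) ↔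
      ofNormal Itan v ∈ imageUnder (S.ReturnsTo ε h) (region Itan φ Δ b) := by
    intro b v
    constructor
    · rintro ⟨u, hu, huv⟩
      refine ⟨ofNormal Itan u, ?_, huv⟩
      change toNormal Itan (ofNormal Itan u) ∈ regionNormal φ Δ b
      have : toNormal Itan (ofNormal Itan u) = u := by ext <;> simp [toNormal, ofNormal]
      rwa [this]
    · rintro ⟨u, hu, huv⟩
      refine ⟨toNormal Itan u, hu, ?_⟩
      change S.ReturnsTo ε h (ofNormal Itan (toNormal Itan u)) _
      have : ofNormal Itan (toNormal Itan u) = u := by ext <;> simp [toNormal, ofNormal]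
      rwa [this]
  have hslnorm : ∀ b k, slice (epsF Itan)
      (imageUnder (S.ReturnsToNormal ε h Itan) (regionNormal φ Δ b)) k =
        slice (fun θ => Itan (-θ)) (imageUnder (S.ReturnsTo ε h) (region Itan φ Δ b)) k := by
    intro b k
    ext θ
    change (θ, epsF Itan θ + k) ∈ imageUnder (S.ReturnsToNormal ε h Itan) (regionNormal φ Δ b) ↔
      (θ, Itan (-θ) + k) ∈ imageUnder (S.ReturnsTo ε h) (region Itan φ Δ b)
    rw [hnorm]
    have : ofNormal Itan (θ, epsF Itan θ + k) = (θ, Itan (-θ) + k) := by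
      ext
      · rfl
      · simp only [ofNormal, epsF]; ring
    rw [this]
  have hband : ∀ b, S.cornerCurveBand ε h Itan Δ b b.next =
      (fun k => ((x b k : Angle), Itan (x b k) + k)) '' Icc (-Δ) 0 := by
    intro b
    ext u
    have hu : u = (u.1, Itan u.1 + (u.2 - Itan u.1)) := by ext <;> simp
    constructor
    · rintro ⟨h1, h2⟩
      rw [hu] at h1
      have := (hcorner b _ h2 _).1 h1
      refine ⟨_, h2, ?_⟩
      ext
      · exact this.symm
      · simp only; rw [← this]; ring
    · rintro ⟨k, hk, rfl⟩
      exact ⟨(hcorner b k hk _).2 rfl, by simpa using hk⟩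
  have hcurve : ∀ b, curveOver (fun θ => Itan (-θ)) (fun k => -(x b k : Angle)) Δ =
      reflect '' S.cornerCurveBand ε h Itan Δ b b.next := by
    intro b
    rw [hband, image_image, curveOver]
    simp [reflect]
  have hcurveN : ∀ b, curveOver (epsF Itan) (fun k => -(x b k : Angle)) Δ =
      reflectNormal Itan '' (toNormal Itan '' S.cornerCurveBand ε h Itan Δ b b.next) := by
    intro b
    rw [hband, image_image, image_image, curveOver]
    refine image_congr fun k _ => ?_
    ext
    · rfl
    · simp only [reflectNormal, toNormal, epsF, neg_neg]; ring
  have hordJ : ∀ (g : Angle → ℝ) (A B D : Set Cyl),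
      (∀ k ∈ Ioo (-Δ) 0, slice g A k = cIoo (x .one k : Angle) (x .R k)) →
      (∀ k ∈ Ioo (-Δ) 0, slice g B k = cIoo (x .R k : Angle) (x .zero k)) →
      (∀ k ∈ Ioo (-Δ) 0, slice g D k = cIoo (x .zero k : Angle) (x .one k)) →
      InOrder g Δ A B D := by
    intro g A B D hA hB hD k hk
    rw [hA k hk, hB k hk, hD k hk]
    obtain ⟨h1, h2, h3⟩ := hord k hk
    refine ⟨?_, cIoo_coe_nonempty h1 (by linarith), cIoo_coe_nonempty h2 (by linarith), ?_⟩
    · rw [← coe_add_two_pi (x .R k)]; exact cIoo_coe_nonempty h3 (by linarith)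
    · intro α hα β hβ γ hγ
      exact sbtw_of_mem_arcs h1 h2 h3 hα hβ hγ
  have hordbar : ∀ (g : Angle → ℝ) (A B D : Set Cyl),
      (∀ k ∈ Ioo (-(Δ - δ)) 0, slice g A k = cIoo (-(x .one k : Angle)) (-(x .zero k : Angle))) →
      (∀ k ∈ Ioo (-(Δ - δ)) 0, slice g B k = cIoo (-(x .zero k : Angle)) (-(x .R k : Angle))) →
      (∀ k ∈ Ioo (-(Δ - δ)) 0, slice g D k = cIoo (-(x .R k : Angle)) (-(x .one k : Angle))) →
      InOrder g (Δ - δ) A B D := by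
    intro g A B D hA hB hD k hk
    rw [hA k hk, hB k hk, hD k hk]
    obtain ⟨h1, h2, h3⟩ := hord k ⟨by linarith [hk.1], hk.2⟩
    rw [← Angle.coe_neg, ← Angle.coe_neg, ← Angle.coe_neg,
      ← coe_add_two_pi (-x .one k)]
    refine ⟨?_, cIoo_coe_nonempty (by linarith) (by linarith),
      cIoo_coe_nonempty (by linarith) (by linarith), ?_⟩
    · rw [coe_add_two_pi]; exact cIoo_coe_nonempty (by linarith) (by linarith)
    · intro α hα β hβ γ hγ
      exact sbtw_of_mem_arcs (l := -x .zero k) (m := -x .R k) (r := -x .one k + 2 * π)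
        (by linarith) (by linarith) (by linarith) hα hβ hγ
  refine ⟨φ, fun a => ⟨?_, hcorner a⟩, ?_, ?_, ?_, ?_, ?_, fun a b k => -(x b k : Angle), ?_⟩
  · exact Angle.continuous_coe.comp_continuousOn (hx a)
  · intro b u hu
    obtain ⟨-, y, hy⟩ := (hreg b u).1 hu
    exact ⟨y, hret b u y hy, fun y' hy' => huniq b u y y' hy hy'⟩
  · exact hordJ _ _ _ _ (hsliceJ .R) (hsliceJ .zero) (hsliceJ .one)
  · exact hordbar _ _ _ _ (heq .one) (heq .zero) (heq .R)
  · exact hordJ _ _ _ _ (hsliceN .R) (hsliceN .zero) (hsliceN .one)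
  · refine hordbar _ _ _ _ ?_ ?_ ?_ <;> intro k hk <;> rw [hslnorm]
    exacts [heq .one k hk, heq .zero k hk, heq .R k hk]
  · rintro a b c ⟨rfl, rfl⟩
    have hc : c.next.next.next = c := hnnn c
    have hs := hsub c.next
    have he := heq c.next
    rw [hc] at hs he
    refine ⟨⟨⟨hheight _, hs, he⟩, hcurve _, hcurve _⟩, ⟨⟨?_, ?_, ?_⟩, hcurveN _, hcurveN _⟩⟩
    · intro v hv
      have := hheight _ _ ((hnorm _ v).1 hv)
      have e : (ofNormal Itan v).2 - Itan (-(ofNormal Itan v).1) = v.2 - epsF Itan v.1 := by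
        simp only [ofNormal, epsF]; ring
      rwa [e] at this
    · intro k hk; rw [hslnorm]; exact hs k hk
    · intro k hk; rw [hslnorm]; exact he k hk

end OscStep

/-! ### Action and angle of the vertical oscillator -/

namespace Oscillator

variable {a W q p : ℝ → ℝ} {l r x y : ℝ}

lemma Well.zero_le (h : Well a W l r) {z : ℝ} (hz : z ∈ Icc l r) : W 0 ≤ W z := by
  rcases le_total 0 z with h0 | h0
  · exact h.strictMonoOn.monotoneOn ⟨le_rfl, h.r_pos.le⟩ ⟨h0, hz.2⟩ h0
  · exact h.strictAntiOn.antitoneOn ⟨hz.1, h0⟩ ⟨h.l_neg.le, le_rfl⟩ h0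

/-- The point on the left slope of the well at the height of a given point of the right slope. -/
lemma Well.exists_left (h : Well a W l r) (hx : x ∈ Ioo 0 r) (hl : W x < W l) :
    ∃ y ∈ Ioo l 0, W y = W x := by
  have h0 : W 0 < W x := h.strictMonoOn ⟨le_rfl, h.r_pos.le⟩ ⟨hx.1.le, hx.2.le⟩ hx.1
  obtain ⟨y, hy, hyx⟩ := intermediate_value_Ioo' h.l_neg.le h.continuous.continuousOn ⟨h0, hl⟩
  exact ⟨y, hy, hyx⟩

/-- The point on the right slope of the well at the height of a given point of the left slope. -/
lemma Well.exists_right (h : Well a W l r) (hy : y ∈ Ioo l 0) (hr : W y < W r) :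
    ∃ x ∈ Ioo 0 r, W y = W x := by
  have h0 : W 0 < W y := h.strictAntiOn ⟨hy.1.le, hy.2.le⟩ ⟨h.l_neg.le, le_rfl⟩ hy.2
  obtain ⟨x, hx, hyx⟩ := intermediate_value_Ioo h.r_pos.le h.continuous.continuousOn ⟨h0, hr⟩
  exact ⟨x, hx, hyx.symm⟩

end Oscillator

namespace OscStep

open Oscillator StepSystem

namespace Model

variable {S : StepSystem} {h : ℝ} (M : Model S h)

/-- The admissible amplitudes of the vertical oscillator. -/
def Amp : Set ℝ := {a | a ∈ Ioo 0 M.r₂ ∧ M.W2 a < M.h₂}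

/-- Half of the period of the vertical oscillator. -/
def half (a : ℝ) : ℝ := sInf {t | 0 < t ∧ M.P a t = 0}

/-- The position at a given angle. -/
def angQ (θ a : ℝ) : ℝ := M.Q a (M.half a * θ / π)

/-- The momentum at a given angle. -/
def angP (θ a : ℝ) : ℝ := M.P a (M.half a * θ / π)

/-- The action. -/
def act (a : ℝ) : ℝ := M.A a (M.half a) / π

lemma isOpen_amp : IsOpen M.Amp :=
  isOpen_Ioo.inter (isOpen_Iio.preimage M.core2.well.continuous)

variable {M} {a : ℝ}

lemma _root_.Oscillator.HalfSwing.isLeast {f W q p : ℝ → ℝ} {l r x y τ : ℝ}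
    (s : HalfSwing f W l r q p x y τ) : IsLeast {t | 0 < t ∧ p t = 0} τ :=
  ⟨⟨s.τ_pos, s.p_τ⟩, fun t ht => by
    by_contra! hlt
    exact (s.neg t ⟨ht.1, hlt⟩).ne ht.2⟩

lemma W2_zero : M.W2 0 = 0 := by
  rw [M.core2.W_eq 0 ⟨M.core2.well.l_neg.le, M.core2.well.r_pos.le⟩, S.V₂_zero]

lemma W1_zero : M.W1 0 = 0 := by
  rw [M.core1.W_eq 0 ⟨M.core1.well.l_neg.le, M.core1.well.r_pos.le⟩, S.V₁_zero]

lemma level_le_W2 : M.h₂ ≤ M.W2 M.l₂ ∧ M.h₂ ≤ M.W2 M.r₂ := by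
  have hl := M.core2.well.l_neg
  have hr := M.core2.well.r_pos
  rw [M.core2.W_eq _ ⟨le_rfl, (hl.trans hr).le⟩, M.core2.W_eq _ ⟨(hl.trans hr).le, le_rfl⟩]
  exact ⟨M.core2.level_le_l, M.core2.level_le_r⟩

lemma level_le_W1 : M.h₁ ≤ M.W1 M.l₁ ∧ M.h₁ ≤ M.W1 M.r₁ := by
  have hl := M.core1.well.l_neg
  have hr := M.core1.well.r_pos
  rw [M.core1.W_eq _ ⟨le_rfl, (hl.trans hr).le⟩, M.core1.W_eq _ ⟨(hl.trans hr).le, le_rfl⟩]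
  exact ⟨M.core1.level_le_l, M.core1.level_le_r⟩

lemma halfSwing (ha : a ∈ M.Amp) :
    HalfSwing M.a₂ M.W2 M.l₂ M.r₂ (M.Q a) (M.P a) a (M.Q a (M.half a)) (M.half a) := by
  obtain ⟨y, hy, hya⟩ := M.core2.well.exists_left ha.1 (ha.2.trans_le level_le_W2.1)
  obtain ⟨τ, h0, hneg, hp, hq⟩ := (M.motion a).exists_half_period M.core2.well ha.1 hy hya
    (M.Q_zero a) (M.P_zero a)
  have s : HalfSwing M.a₂ M.W2 M.l₂ M.r₂ (M.Q a) (M.P a) a y τ :=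
    ⟨M.core2.well, M.motion a, ha.1, hy, hya, M.Q_zero a, M.P_zero a, h0, hneg, hp, hq⟩
  have : M.half a = τ := s.isLeast.csInf_eq
  rw [this, hq]; exact s

lemma half_pos (ha : a ∈ M.Amp) : 0 < M.half a := (halfSwing ha).τ_pos

lemma Q_mem (ha : a ∈ M.Amp) (t : ℝ) : M.Q a t ∈ Icc (M.Q a (M.half a)) a ∧
    M.Q a t ∈ Ioo M.l₂ M.r₂ := by
  have s := halfSwing ha
  have h1 := s.mem_Icc t
  exact ⟨h1, s.hy.1.trans_le h1.1, h1.2.trans_lt s.hx.2⟩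

lemma energy2_eq {q : ℝ} (hq : q ∈ Icc M.l₂ M.r₂) (p : ℝ) :
    S.energy₂ q p = p ^ 2 / 2 + M.W2 q := by
  rw [StepSystem.energy₂, M.core2.W_eq q hq]

lemma energy2_QP (ha : a ∈ M.Amp) (t : ℝ) : S.energy₂ (M.Q a t) (M.P a t) = M.W2 a := by
  rw [energy2_eq (Ioo_subset_Icc_self (Q_mem ha t).2), (halfSwing ha).energy t]

lemma sublevel_eq (ha : a ∈ M.Amp) :
    {q | q ∈ S.U₂ ∧ S.V₂ q ≤ M.W2 a} = Icc (M.Q a (M.half a)) a := by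
  have s := halfSwing ha
  ext q
  constructor
  · rintro ⟨hq, hV⟩
    have h1 := Ioo_subset_Icc_self (M.core2.mem_of_lt q hq (hV.trans_lt ha.2))
    rw [← M.core2.W_eq q h1] at hV
    exact (s.well.le_iff ⟨s.hx.1, s.hx.2.le⟩ ⟨s.hy.1.le, s.hy.2⟩ s.hxy h1).1 hV
  · intro hq
    have h1 : q ∈ Icc M.l₂ M.r₂ := ⟨s.hy.1.le.trans hq.1, hq.2.trans s.hx.2.le⟩
    refine ⟨M.core2.subset h1, ?_⟩
    rw [← M.core2.W_eq q h1]
    exact (s.well.le_iff ⟨s.hx.1, s.hx.2.le⟩ ⟨s.hy.1.le, s.hy.2⟩ s.hxy h1).2 hq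

lemma qmin2_eq (ha : a ∈ M.Amp) : S.qmin₂ (M.W2 a) = M.Q a (M.half a) := by
  have s := halfSwing ha
  rw [StepSystem.qmin₂, sublevel_eq ha, csInf_Icc (s.hy.2.trans s.hx.1).le]

lemma qmax2_eq (ha : a ∈ M.Amp) : S.qmax₂ (M.W2 a) = a := by
  have s := halfSwing ha
  rw [StepSystem.qmax₂, sublevel_eq ha, csSup_Icc (s.hy.2.trans s.hx.1).le]

lemma integral_congr_core (ha : a ∈ M.Amp) (g : ℝ → ℝ) (t : ℝ) :
    ∫ x in (M.Q a t)..a, g (S.V₂ x) = ∫ x in (M.Q a t)..a, g (M.W2 x) := by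
  have s := halfSwing ha
  refine intervalIntegral.integral_congr fun x hx => ?_
  rw [uIcc_of_le (Q_mem ha t).1.2] at hx
  rw [M.core2.W_eq x ⟨s.hy.1.le.trans ((Q_mem ha t).1.1.trans hx.1), hx.2.trans s.hx.2.le⟩]

lemma integral_time (ha : a ∈ M.Amp) {t : ℝ} (ht : t ∈ Icc 0 (M.half a)) :
    ∫ x in (M.Q a t)..(S.qmax₂ (M.W2 a)), 1 / √(2 * (M.W2 a - S.V₂ x)) = t := by
  rw [qmax2_eq ha, integral_congr_core ha (fun v => 1 / √(2 * (M.W2 a - v)))]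
  exact (halfSwing ha).integral_time ht

lemma period2_eq (ha : a ∈ M.Amp) : S.period₂ (M.W2 a) = 2 * M.half a := by
  rw [StepSystem.period₂, qmin2_eq ha, integral_time ha ⟨(half_pos ha).le, le_rfl⟩]

lemma P_sq_le (ha : a ∈ M.Amp) (t : ℝ) : M.P a t ^ 2 ≤ 2 * M.h₂ := by
  have h1 := (halfSwing ha).energy t
  have h2 := M.core2.well.zero_le (Ioo_subset_Icc_self (Q_mem ha t).2)
  rw [W2_zero] at h2
  linarith [ha.2]

lemma action2_eq (ha : a ∈ M.Amp) : S.action₂ (M.W2 a) = M.act a := by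
  rw [StepSystem.action₂, qmin2_eq ha, qmax2_eq ha,
    integral_congr_core ha (fun v => √(2 * (M.W2 a - v))), (halfSwing ha).integral_action,
    intervalIntegral.integral_eq_sub_of_hasDerivAt (f := M.A a) (fun t _ => M.A_deriv a t (P_sq_le ha t))
      (((M.motion a).contp.pow 2).intervalIntegrable _ _), M.A_zero, act]
  ring

lemma QP_periodic (ha : a ∈ M.Amp) (t : ℝ) :
    M.Q a (t + 2 * M.half a) = M.Q a t ∧ M.P a (t + 2 * M.half a) = M.P a t := by
  obtain ⟨K, hK⟩ := M.core2.lipschitz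
  exact (halfSwing ha).periodic hK t

lemma QP_even (ha : a ∈ M.Amp) (t : ℝ) : M.Q a (-t) = M.Q a t ∧ M.P a (-t) = -M.P a t := by
  obtain ⟨K, hK⟩ := M.core2.lipschitz
  exact (halfSwing ha).even hK t

lemma ang_add_two_pi (ha : a ∈ M.Amp) (θ : ℝ) :
    M.angQ (θ + 2 * π) a = M.angQ θ a ∧ M.angP (θ + 2 * π) a = M.angP θ a := by
  have := QP_periodic ha (M.half a * θ / π)
  rw [show M.half a * θ / π + 2 * M.half a = M.half a * (θ + 2 * π) / π by
    field_simp] at this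
  exact this

lemma ang_neg (ha : a ∈ M.Amp) (θ : ℝ) :
    M.angQ (-θ) a = M.angQ θ a ∧ M.angP (-θ) a = -M.angP θ a := by
  have := QP_even ha (M.half a * θ / π)
  rw [show -(M.half a * θ / π) = M.half a * (-θ) / π by ring] at this
  exact this

lemma ang_periodic (ha : a ∈ M.Amp) (θ : ℝ) (n : ℤ) :
    M.angQ (θ + n * (2 * π)) a = M.angQ θ a ∧ M.angP (θ + n * (2 * π)) a = M.angP θ a := by
  have h1 : Function.Periodic (fun θ => M.angQ θ a) (2 * π) := fun θ => (ang_add_two_pi ha θ).1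
  have h2 : Function.Periodic (fun θ => M.angP θ a) (2 * π) := fun θ => (ang_add_two_pi ha θ).2
  exact ⟨h1.int_mul n θ, h2.int_mul n θ⟩

lemma ang_congr (ha : a ∈ M.Amp) {θ θ' : ℝ} (hθ : (θ : Angle) = θ') :
    M.angQ θ a = M.angQ θ' a ∧ M.angP θ a = M.angP θ' a := by
  obtain ⟨n, hn⟩ := Angle.angle_eq_iff_two_pi_dvd_sub.1 hθ
  rw [show θ = θ' + n * (2 * π) by linarith]
  exact ang_periodic ha θ' n

lemma angle2_eq (ha : a ∈ M.Amp) (θ : ℝ) : S.angle₂ (M.angQ θ a) (M.angP θ a) = θ := by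
  have hpi := Real.pi_pos
  have hτ := half_pos ha
  have s := halfSwing ha
  obtain ⟨K, hK⟩ := M.core2.lipschitz
  obtain ⟨v, hv0, hv2, hv⟩ := CircleArc.exists_lift 0 (θ : Angle)
  rw [← hv, (ang_congr ha hv.symm).1, (ang_congr ha hv.symm).2]
  set t := M.half a * v / π with ht
  have hvt : v = π * t / M.half a := by rw [ht]; field_simp
  have ht0 : 0 ≤ t := by positivity
  have ht2 : t < 2 * M.half a := by
    rw [ht, div_lt_iff₀ hpi]; nlinarith
  change S.angle₂ (M.Q a t) (M.P a t) = v
  simp only [StepSystem.angle₂, energy2_QP ha, period2_eq ha]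
  rcases le_or_gt t (M.half a) with h1 | h1
  · rw [if_pos (s.nonpos ⟨ht0, h1⟩), integral_time ha ⟨ht0, h1⟩, hvt]
    congr 1; field_simp
  · rw [if_neg (not_le.2 (s.pos_of_mem hK ⟨h1, ht2⟩))]
    have h3 : M.Q a t = M.Q a (2 * M.half a - t) := by
      rw [← (QP_even ha t).1, ← (QP_periodic ha (-t)).1]; congr 1; ring
    rw [h3, integral_time ha ⟨by linarith, by linarith⟩, ← Angle.coe_neg,
      Angle.angle_eq_iff_two_pi_dvd_sub]
    refine ⟨-1, ?_⟩
    rw [hvt]; field_simp; push_cast; ring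

lemma coord_ang (ha : a ∈ M.Amp) (θ x p : ℝ) :
    S.coord (x, p, M.angQ θ a, M.angP θ a) = (↑θ, M.act a) := by
  change (S.angle₂ (M.angQ θ a) (M.angP θ a), S.action₂ (S.energy₂ (M.angQ θ a) (M.angP θ a))) = _
  rw [angle2_eq ha]
  congr 1
  rw [angQ, angP, energy2_QP ha, action2_eq ha]

/-- Every state of the vertical oscillator of admissible energy has an angle. -/
lemma exists_ang {q p : ℝ} (hq : q ∈ S.U₂) (hE : 0 < S.energy₂ q p) (hE' : S.energy₂ q p < M.h₂) :
    ∃ a ∈ M.Amp, ∃ θ, q = M.angQ θ a ∧ p = M.angP θ a ∧ M.W2 a = S.energy₂ q p := by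
  have hV : S.V₂ q < M.h₂ := by
    have : S.energy₂ q p = p ^ 2 / 2 + S.V₂ q := rfl
    nlinarith [sq_nonneg p]
  have hq' := M.core2.mem_of_lt q hq hV
  have hqI := Ioo_subset_Icc_self hq'
  have h0 : M.W2 0 < S.energy₂ q p := by rw [W2_zero]; exact hE
  obtain ⟨a, ha, haE⟩ := intermediate_value_Ioo M.core2.well.r_pos.le
    M.core2.well.continuous.continuousOn ⟨h0, hE'.trans_le level_le_W2.2⟩
  have hA : a ∈ M.Amp := ⟨ha, by rw [haE]; exact hE'⟩
  have s := halfSwing hA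
  have hτ := half_pos hA
  have hpi := Real.pi_pos
  rw [energy2_eq hqI] at haE
  have key (t : ℝ) : M.half a * (π * t / M.half a) / π = t := by field_simp
  refine ⟨a, hA, ?_⟩
  rcases le_total p 0 with hp | hp
  · obtain ⟨t, ht, h1, h2⟩ := s.exists_time_of_nonpos hqI haE.symm hp
    refine ⟨π * t / M.half a, ?_, ?_, ?_⟩
    · rw [angQ, key, h1]
    · rw [angP, key, h2]
    · rw [haE, energy2_eq hqI]
  · obtain ⟨t, ht, h1, h2⟩ := s.exists_time_of_nonpos (p0 := -p) hqI (by rw [haE]; ring) (by linarith)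
    refine ⟨-(π * t / M.half a), ?_, ?_, ?_⟩
    · rw [(ang_neg hA _).1, angQ, key, h1]
    · rw [(ang_neg hA _).2, angP, key, h2, neg_neg]
    · rw [haE, energy2_eq hqI]

/-- The action grows at least linearly with the energy. -/
lemma act_sub_ge {a b : ℝ} (ha : a ∈ M.Amp) (hb : b ∈ M.Amp) (hab : a ≤ b) :
    (M.W2 b - M.W2 a) * (a - M.Q a (M.half a)) / √(2 * M.h₂) ≤ π * (M.act b - M.act a) := by
  have sa := halfSwing ha
  have sb := halfSwing hb
  have hpi := Real.pi_pos
  set ya := M.Q a (M.half a)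
  set yb := M.Q b (M.half b)
  have hW : M.W2 a ≤ M.W2 b :=
    M.core2.well.strictMonoOn.monotoneOn ⟨ha.1.1.le, ha.1.2.le⟩ ⟨hb.1.1.le, hb.1.2.le⟩ hab
  have hE (a : ℝ) (ha : a ∈ M.Amp) :
      π * M.act a = ∫ z in (M.Q a (M.half a))..a, √(2 * (M.W2 a - M.W2 z)) := by
    rw [← action2_eq ha, StepSystem.action₂, qmin2_eq ha, qmax2_eq ha,
      integral_congr_core ha (fun v => √(2 * (M.W2 a - v)))]
    field_simp
  have hc (e : ℝ) : Continuous fun z => √(2 * (e - M.W2 z)) := by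
    have := M.core2.well.continuous; fun_prop
  have hyab : yb ≤ ya := by
    have h1 : M.W2 ya ≤ M.W2 b := sa.hxy.le.trans hW
    exact ((sb.well.le_iff ⟨sb.hx.1, sb.hx.2.le⟩ ⟨sb.hy.1.le, sb.hy.2⟩ sb.hxy
      ⟨sa.hy.1.le, (sa.hy.2.trans sa.well.r_pos).le⟩).1 h1).1
  have hya : ya ≤ a := (sa.hy.2.trans sa.hx.1).le
  have h1 : (∫ z in ya..a, √(2 * (M.W2 b - M.W2 z))) ≤ ∫ z in yb..b, √(2 * (M.W2 b - M.W2 z)) :=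
    intervalIntegral.integral_mono_interval hyab hya hab
      (Eventually.of_forall fun z => Real.sqrt_nonneg _) ((hc _).intervalIntegrable _ _)
  have h2 : (∫ z in ya..a, (M.W2 b - M.W2 a) / √(2 * M.h₂)) ≤
      ∫ z in ya..a, (√(2 * (M.W2 b - M.W2 z)) - √(2 * (M.W2 a - M.W2 z))) := by
    refine intervalIntegral.integral_mono_on hya intervalIntegrable_const
      (((hc _).sub (hc _)).intervalIntegrable _ _) fun z hz => ?_
    have hzI : z ∈ Icc M.l₂ M.r₂ := ⟨sa.hy.1.le.trans hz.1, hz.2.trans sa.hx.2.le⟩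
    have hz0 := M.core2.well.zero_le hzI
    rw [W2_zero] at hz0
    have hza := (sa.well.le_iff ⟨sa.hx.1, sa.hx.2.le⟩ ⟨sa.hy.1.le, sa.hy.2⟩ sa.hxy hzI).2 hz
    set u := √(2 * (M.W2 b - M.W2 z))
    set v := √(2 * (M.W2 a - M.W2 z))
    have hu : u ^ 2 = 2 * (M.W2 b - M.W2 z) := Real.sq_sqrt (by linarith)
    have hv : v ^ 2 = 2 * (M.W2 a - M.W2 z) := Real.sq_sqrt (by linarith)
    have hu' : u ≤ √(2 * M.h₂) := Real.sqrt_le_sqrt (by linarith [hb.2])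
    have hv' : v ≤ √(2 * M.h₂) := Real.sqrt_le_sqrt (by linarith [ha.2])
    have huv : v ≤ u := Real.sqrt_le_sqrt (by linarith)
    have hs : 0 < √(2 * M.h₂) := Real.sqrt_pos.2 (by linarith [hb.2])
    rw [div_le_iff₀ hs]
    nlinarith
  rw [intervalIntegral.integral_const, intervalIntegral.integral_sub ((hc _).intervalIntegrable _ _)
    ((hc _).intervalIntegrable _ _), smul_eq_mul] at h2
  rw [mul_sub π, hE a ha, hE b hb]
  calc _ = (a - ya) * ((M.W2 b - M.W2 a) / √(2 * M.h₂)) := by ring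
    _ ≤ _ := h2
    _ ≤ _ := by linarith

lemma act_strictMonoOn : StrictMonoOn M.act M.Amp := fun a ha b hb hab => by
  have h1 := act_sub_ge ha hb hab.le
  have hW : M.W2 a < M.W2 b :=
    M.core2.well.strictMonoOn ⟨ha.1.1.le, ha.1.2.le⟩ ⟨hb.1.1.le, hb.1.2.le⟩ hab
  have s := halfSwing ha
  have h0 := M.core2.well.zero_le ⟨ha.1.1.le.trans' M.core2.well.l_neg.le, ha.1.2.le⟩
  rw [W2_zero] at h0
  have h2 : 0 < (M.W2 b - M.W2 a) * (a - M.Q a (M.half a)) / √(2 * M.h₂) :=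
    div_pos (mul_pos (by linarith) (by linarith [s.hy.2, s.hx.1])) (Real.sqrt_pos.2 (by linarith [ha.2]))
  have h3 := h2.trans_le h1
  have := pos_of_mul_pos_right h3 Real.pi_pos.le
  linarith

lemma act_pos (ha : a ∈ M.Amp) : 0 < M.act a := by
  have s := halfSwing ha
  have h1 : π * M.act a = ∫ u in (0 : ℝ)..(M.half a), M.P a u ^ 2 := by
    rw [intervalIntegral.integral_eq_sub_of_hasDerivAt (f := M.A a)
      (fun t _ => M.A_deriv a t (P_sq_le ha t)) (((M.motion a).contp.pow 2).intervalIntegrable _ _),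
      M.A_zero, act]
    field_simp; ring
  have h2 : 0 < ∫ u in (0 : ℝ)..(M.half a), M.P a u ^ 2 :=
    intervalIntegral.intervalIntegral_pos_of_pos_on (((M.motion a).contp.pow 2).intervalIntegrable _ _)
      (fun t ht => by have := (s.neg t ht).ne; positivity) (half_pos ha)
  exact pos_of_mul_pos_right (h1 ▸ h2) Real.pi_pos.le

lemma action2_zero (M : Model S h) (hh : 0 < h) : S.action₂ 0 = 0 := by
  have : {q | q ∈ S.U₂ ∧ S.V₂ q ≤ 0} = {0} := by
    ext q
    refine ⟨fun ⟨hq, hV⟩ => ?_, ?_⟩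
    · have h0 : (0 : ℝ) < M.h₂ := hh.trans M.core2.lt_level
      have hq' := Ioo_subset_Icc_self (M.core2.mem_of_lt q hq (hV.trans_lt h0))
      rw [← M.core2.W_eq q hq', ← W2_zero (M := M)] at hV
      by_contra hne
      rcases lt_or_gt_of_ne hne with h | h
      · exact absurd (M.core2.well.strictAntiOn ⟨hq'.1, h.le⟩ ⟨M.core2.well.l_neg.le, le_rfl⟩ h) (not_lt.2 hV)
      · exact absurd (M.core2.well.strictMonoOn ⟨le_rfl, M.core2.well.r_pos.le⟩ ⟨h.le, hq'.2⟩ h) (not_lt.2 hV)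
    · rintro rfl; exact ⟨S.zero_mem_U₂, S.V₂_zero.le⟩
  rw [StepSystem.action₂, StepSystem.qmin₂, StepSystem.qmax₂, this, csInf_singleton, csSup_singleton,
    intervalIntegral.integral_same, mul_zero]

end Model

end OscStep

/-! ### Implicit functions and uniformity -/

namespace ImplicitScalar

variable {E : Type*} [NormedAddCommGroup E] [NormedSpace ℝ E]
  {n : WithTop ℕ∞} {f : E × ℝ → ℝ}

lemma isInvertible_of_ne_zero {u : E × ℝ} (hd : fderiv ℝ f u (0, 1) ≠ 0) :
    (fderiv ℝ f u ∘L .inr ℝ E ℝ).IsInvertible := by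
  refine ⟨ContinuousLinearEquiv.unitsEquivAut ℝ (Units.mk0 _ hd), ?_⟩
  ext
  simp

variable [CompleteSpace E]

/-- A continuous solution of a nondegenerate scalar equation is smooth. -/
lemma contDiffAt_of_implicit {u : E} {g : E → ℝ} (hf : ContDiffAt ℝ n f (u, g u)) (hn : n ≠ 0)
    (hd : fderiv ℝ f (u, g u) (0, 1) ≠ 0) (hg : ContinuousAt g u)
    (heq : ∀ᶠ x in 𝓝 u, f (x, g x) = f (u, g u)) : ContDiffAt ℝ n g u := by
  have hi := isInvertible_of_ne_zero hd
  refine (hf.contDiffAt_implicitFunction hn hi).congr_of_eventuallyEq ?_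
  have h1 : Tendsto (fun x => (x, g x)) (𝓝 u) (𝓝 (u, g u)) := by
    rw [nhds_prod_eq]; exact tendsto_id.prodMk hg
  filter_upwards [heq, h1.eventually (hf.eventually_apply_eq_iff_implicitFunction hn hi)] with x h2 h3
  exact (h3.1 h2).symm

/-- The implicit function theorem on a box, for an equation that is monotone in the unknown. -/
lemma exists_on_box {N : Set E} (hN : IsOpen N) {c d : ℝ} (hcd : c < d) (hn : n ≠ 0)
    (hf : ∀ u ∈ N, ∀ y ∈ Icc c d, ContDiffAt ℝ n f (u, y))
    (hd : ∀ u ∈ N, ∀ y ∈ Icc c d, 0 < fderiv ℝ f (u, y) (0, 1))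
    (hc0 : ∀ u ∈ N, f (u, c) < 0) (hd0 : ∀ u ∈ N, 0 < f (u, d)) :
    ∃ g : E → ℝ, ∀ u ∈ N, g u ∈ Ioo c d ∧ ContDiffAt ℝ n g u ∧ f (u, g u) = 0 ∧
      ∀ y ∈ Icc c d, (f (u, y) < 0 ↔ y < g u) ∧ (f (u, y) = 0 ↔ y = g u) := by
  have hder (u) (hu : u ∈ N) (y) (hy : y ∈ Icc c d) :
      HasDerivAt (fun y => f (u, y)) (fderiv ℝ f (u, y) (0, 1)) y :=
    ((hf u hu y hy).differentiableAt hn).hasFDerivAt.comp_hasDerivAt y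
      ((hasDerivAt_const y u).prodMk (hasDerivAt_id y))
  have hcont (u) (hu : u ∈ N) : ContinuousOn (fun y => f (u, y)) (Icc c d) := fun y hy =>
    (hder u hu y hy).continuousAt.continuousWithinAt
  have hmono (u) (hu : u ∈ N) : StrictMonoOn (fun y => f (u, y)) (Icc c d) :=
    strictMonoOn_Icc (hder u hu) fun y hy => hd u hu y (Ioo_subset_Icc_self hy)
  have hex (u) (hu : u ∈ N) : ∃ y ∈ Ioo c d, f (u, y) = 0 :=
    intermediate_value_Ioo hcd.le (hcont u hu) ⟨hc0 u hu, hd0 u hu⟩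
  choose! g hg hg0 using hex
  have hiff (u) (hu : u ∈ N) (y) (hy : y ∈ Icc c d) :
      (f (u, y) < 0 ↔ y < g u) ∧ (f (u, y) = 0 ↔ y = g u) := by
    have hgI := Ioo_subset_Icc_self (hg u hu)
    constructor
    · rw [← (hmono u hu).lt_iff_lt hy hgI]; simp only [hg0 u hu]
    · constructor
      · intro h; exact (hmono u hu).injOn hy hgI (h.trans (hg0 u hu).symm)
      · rintro rfl; exact hg0 u hu
  refine ⟨g, fun u hu => ⟨hg u hu, ?_, hg0 u hu, hiff u hu⟩⟩
  have hgI := Ioo_subset_Icc_self (hg u hu)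
  have hu' := hf u hu _ hgI
  have hne := (hd u hu _ hgI).ne'
  have hi := isInvertible_of_ne_zero hne
  have hψ := hu'.contDiffAt_implicitFunction hn hi
  have hψu : hu'.implicitFunction hn hi u = g u := hu'.implicitFunction_apply_self hn hi
  refine hψ.congr_of_eventuallyEq ?_
  have e1 := hu'.eventually_apply_implicitFunction hn hi
  have e2 : ∀ᶠ x in 𝓝 u, hu'.implicitFunction hn hi x ∈ Ioo c d := by
    refine hψ.continuousAt.eventually_mem (Ioo_mem_nhds ?_ ?_) <;> rw [hψu]
    exacts [(hg u hu).1, (hg u hu).2]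
  filter_upwards [e1, e2, hN.mem_nhds hu] with x h1 h2 h3
  rw [hg0 u hu] at h1
  exact (((hiff x h3 _ (Ioo_subset_Icc_self h2)).2).1 h1).symm

end ImplicitScalar

/-- Local uniformity in a periodic variable. -/
lemma eventually_forall_of_periodic {X : Type*} [TopologicalSpace X] {P : X → ℝ → Prop} {x0 : X}
    {c : ℝ} (hc : 0 < c) (hper : ∀ᶠ x in 𝓝 x0, ∀ θ, ∀ n : ℤ, P x θ → P x (θ + n * c))
    (hP : ∀ θ, ∀ᶠ z : X × ℝ in 𝓝 (x0, θ), P z.1 z.2) : ∀ᶠ x in 𝓝 x0, ∀ θ, P x θ := by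
  filter_upwards [hper, (isCompact_Icc (a := (0 : ℝ)) (b := c)).eventually_forall_of_forall_eventually
    (P := P) fun θ _ => hP θ] with x h1 h2 θ
  have h3 := h2 (toIcoMod hc 0 θ) ⟨(toIcoMod_mem_Ico hc 0 θ).1, by
    have := (toIcoMod_mem_Ico hc 0 θ).2; linarith⟩
  have h4 := h1 _ (toIcoDiv hc 0 θ) h3
  have h5 := toIcoMod_add_toIcoDiv_zsmul hc 0 θ
  rw [zsmul_eq_mul] at h5
  rwa [h5] at h4

namespace OscStep

open Oscillator StepSystem

namespace Model

variable {S : StepSystem} {h : ℝ} {M : Model S h} {a : ℝ}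

lemma continuous_Q (M : Model S h) : Continuous fun p : ℝ × ℝ => M.Q p.1 p.2 := M.Q_contDiff.continuous
lemma continuous_P (M : Model S h) : Continuous fun p : ℝ × ℝ => M.P p.1 p.2 := M.P_contDiff.continuous

lemma amp_mem_nhds (ha : a ∈ M.Amp) : M.Amp ∈ 𝓝 a := M.isOpen_amp.mem_nhds ha

lemma continuousAt_half (ha : a ∈ M.Amp) : ContinuousAt M.half a := by
  have s := halfSwing ha
  set τ := M.half a with hτ
  have hτ0 : 0 < τ := half_pos ha
  obtain ⟨K, hK⟩ := M.core2.lipschitz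
  obtain ⟨η0, hη0, hQ⟩ := Metric.eventually_nhds_iff.1 ((M.motion a).contq.continuousAt.eventually
    (lt_mem_nhds (show 0 < M.Q a 0 by rw [M.Q_zero]; exact ha.1.1)))
  rw [Metric.continuousAt_iff']
  intro e he
  obtain ⟨η, hη, hlt⟩ := exists_between (show 0 < min (min η0 (τ / 4)) (e / 2) by positivity)
  simp only [lt_min_iff] at hlt
  obtain ⟨⟨hη1, hη2⟩, hη3⟩ := hlt
  have e1 : ∀ᶠ b in 𝓝 a, ∀ t ∈ Icc 0 η, 0 < M.Q b t :=
    isCompact_Icc.eventually_forall_of_forall_eventually fun t ht =>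
      M.continuous_Q.continuousAt.eventually (lt_mem_nhds (hQ (by
        rw [Real.dist_eq, sub_zero, abs_of_nonneg ht.1]; exact ht.2.trans_lt hη1)))
  have e2 : ∀ᶠ b in 𝓝 a, ∀ t ∈ Icc η (τ - η), M.P b t < 0 :=
    isCompact_Icc.eventually_forall_of_forall_eventually fun t ht =>
      M.continuous_P.continuousAt.eventually (gt_mem_nhds (s.neg t ⟨by linarith [ht.1], by linarith [ht.2]⟩))
  have e3 : ∀ᶠ b in 𝓝 a, 0 < M.P b (τ + η) := by
    have : Continuous fun b => M.P b (τ + η) := M.continuous_P.comp (continuous_id.prodMk continuous_const)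
    exact this.continuousAt.eventually (lt_mem_nhds (s.pos_of_mem hK ⟨by linarith, by linarith⟩))
  filter_upwards [e1, e2, e3, amp_mem_nhds ha] with b h1 h2 h3 hb
  have sb := halfSwing hb
  have hneg : ∀ t ∈ Ioc 0 (τ - η), M.P b t < 0 := fun t ht => by
    rcases le_total η t with h | h
    · exact h2 t ⟨h, ht.2⟩
    · have : StrictAntiOn (M.P b) (Icc 0 η) := strictAntiOn_Icc (fun x _ => (M.motion b).dp x)
        fun x hx => M.core2.well.neg _ ⟨h1 x (Ioo_subset_Icc_self hx), (Q_mem hb x).2.2.le⟩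
      have := this ⟨le_rfl, hη.le⟩ ⟨ht.1.le, h⟩ ht.1
      rwa [M.P_zero] at this
  have hlow : τ - η < M.half b := by
    by_contra! hle
    exact (hneg _ ⟨half_pos hb, hle⟩).ne sb.p_τ
  have hup : M.half b < τ + η := by
    obtain ⟨t, ht, ht0⟩ := intermediate_value_Ioo (show τ - η ≤ τ + η by linarith)
      (M.motion b).contp.continuousOn ⟨hneg (τ - η) ⟨by linarith, le_rfl⟩, h3⟩
    exact (sb.isLeast.2 ⟨by linarith [ht.1], ht0⟩).trans_lt ht.2
  rw [Real.dist_eq, abs_lt]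
  constructor <;> linarith

lemma contDiffAt_half (ha : a ∈ M.Amp) : ContDiffAt ℝ 2 M.half a := by
  have s := halfSwing ha
  have hP := M.P_contDiff.contDiffAt (x := (a, M.half a))
  refine ImplicitScalar.contDiffAt_of_implicit (f := fun p : ℝ × ℝ => M.P p.1 p.2) hP (by norm_num) ?_
    (continuousAt_half ha) ?_
  · have h1 := (hP.differentiableAt (by norm_num)).hasFDerivAt.comp_hasDerivAt (M.half a)
      ((hasDerivAt_const (M.half a) a).prodMk (hasDerivAt_id _))
    have h2 := h1.unique ((M.motion a).dp (M.half a))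
    rw [h2]
    exact (M.core2.well.pos _ ⟨s.hy.1.le, s.hy.2⟩).ne'
  · filter_upwards [amp_mem_nhds ha] with b hb
    rw [(halfSwing hb).p_τ, s.p_τ]

lemma contDiffAt_ang (ha : a ∈ M.Amp) (θ : ℝ) :
    ContDiffAt ℝ 2 (fun p : ℝ × ℝ => M.angQ p.1 p.2) (θ, a) ∧
    ContDiffAt ℝ 2 (fun p : ℝ × ℝ => M.angP p.1 p.2) (θ, a) := by
  have h1 : ContDiffAt ℝ 2 (fun p : ℝ × ℝ => (p.2, M.half p.2 * p.1 / π)) (θ, a) := by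
    have : ContDiffAt ℝ 2 (fun p : ℝ × ℝ => M.half p.2) (θ, a) :=
      ContDiffAt.comp (g := M.half) (θ, a) (contDiffAt_half ha) contDiffAt_snd
    exact contDiffAt_snd.prodMk ((this.mul contDiffAt_fst).div_const _)
  exact ⟨(M.Q_contDiff.contDiffAt).comp (θ, a) h1, (M.P_contDiff.contDiffAt).comp (θ, a) h1⟩

lemma contDiffAt_act (ha : a ∈ M.Amp) : ContDiffAt ℝ 2 M.act a := by
  have h1 : ContDiffAt ℝ 2 (fun a => (a, M.half a)) a := contDiffAt_id.prodMk (contDiffAt_half ha)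
  exact ((M.A_contDiff.contDiffAt).comp a h1).div_const _

lemma deriv_act_pos (ha : a ∈ M.Amp) : 0 < deriv M.act a := by
  have s := halfSwing ha
  have hd := ((contDiffAt_act ha).differentiableAt (by norm_num)).hasDerivAt
  have hW := M.core2.well.deriv a
  have hneg := M.core2.well.neg a ⟨ha.1.1, ha.1.2.le⟩
  set C := (a - M.Q a (M.half a)) / √(2 * M.h₂) with hC
  have h0 := M.core2.well.zero_le ⟨ha.1.1.le.trans' M.core2.well.l_neg.le, ha.1.2.le⟩
  rw [W2_zero] at h0
  have hCpos : 0 < C := div_pos (by linarith [s.hy.2, s.hx.1]) (Real.sqrt_pos.2 (by linarith [ha.2]))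
  have t1 := (hasDerivAt_iff_tendsto_slope.1 (hW.mul_const C)).mono_left
    (nhdsWithin_mono a (fun b hb => ne_of_gt hb : Ioi a ⊆ {a}ᶜ))
  have t2 := (hasDerivAt_iff_tendsto_slope.1 (hd.const_mul π)).mono_left
    (nhdsWithin_mono a (fun b hb => ne_of_gt hb : Ioi a ⊆ {a}ᶜ))
  have h1 : -M.a₂ a * C ≤ π * deriv M.act a := by
    refine le_of_tendsto_of_tendsto t1 t2 ?_
    filter_upwards [self_mem_nhdsWithin, mem_nhdsWithin_of_mem_nhds (amp_mem_nhds ha)] with b hb hbA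
    rw [slope_def_field, slope_def_field]
    refine div_le_div_of_nonneg_right ?_ (sub_nonneg.2 (le_of_lt hb))
    have := act_sub_ge ha hbA (le_of_lt hb)
    rw [hC]
    calc _ = _ := by ring
      _ ≤ _ := this
      _ = _ := by ring
  have h2 : 0 < -M.a₂ a * C := mul_pos (by linarith) hCpos
  exact pos_of_mul_pos_right (h2.trans_le h1) Real.pi_pos.le

end Model

/-- A potential with a well at `0` is positive away from `0`. -/
lemma pos_of_well {U : Set ℝ} {V : ℝ → ℝ} (hU : U.OrdConnected) (h0 : (0 : ℝ) ∈ U)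
    (hd : ∀ q ∈ U, HasDerivAt V (deriv V q) q) (hV0 : V 0 = 0)
    (hw : ∀ q ∈ U, q ≠ 0 → 0 < q * deriv V q) {q : ℝ} (hq : q ∈ U) (hne : q ≠ 0) : 0 < V q := by
  rcases lt_or_gt_of_ne hne with hlt | hlt
  · have hsub : Icc q 0 ⊆ U := hU.out hq h0
    obtain ⟨c, hc, hcV⟩ := exists_deriv_eq_slope V hlt
      (fun x hx => (hd x (hsub hx)).continuousAt.continuousWithinAt)
      (fun x hx => (hd x (hsub (Ioo_subset_Icc_self hx))).differentiableAt.differentiableWithinAt)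
    have h1 := hw c (hsub (Ioo_subset_Icc_self hc)) hc.2.ne
    have h2 : deriv V c < 0 := by
      by_contra! h3; exact absurd h1 (not_lt.2 (mul_nonpos_of_nonpos_of_nonneg hc.2.le h3))
    rw [hcV, hV0, div_neg_iff] at h2
    rcases h2 with h2 | h2 <;> linarith
  · have hsub : Icc 0 q ⊆ U := hU.out h0 hq
    obtain ⟨c, hc, hcV⟩ := exists_deriv_eq_slope V hlt
      (fun x hx => (hd x (hsub hx)).continuousAt.continuousWithinAt)
      (fun x hx => (hd x (hsub (Ioo_subset_Icc_self hx))).differentiableAt.differentiableWithinAt)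
    have h1 := hw c (hsub (Ioo_subset_Icc_self hc)) hc.1.ne'
    have h2 : 0 < deriv V c := pos_of_mul_pos_right h1 hc.1.le
    rw [hcV, hV0, div_pos_iff] at h2
    rcases h2 with h2 | h2 <;> linarith

lemma StepSystem.V1_pos (S : StepSystem) {q : ℝ} (hq : q ∈ S.U₁) (h0 : q ≠ 0) : 0 < S.V₁ q :=
  pos_of_well S.ordConnected_U₁ S.zero_mem_U₁ (fun _ => S.hasDerivAt_V1) S.V₁_zero S.well_V₁ hq h0

lemma StepSystem.V2_pos (S : StepSystem) {q : ℝ} (hq : q ∈ S.U₂) (h0 : q ≠ 0) : 0 < S.V₂ q :=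
  pos_of_well S.ordConnected_U₂ S.zero_mem_U₂ (fun _ => S.hasDerivAt_V2) S.V₂_zero S.well_V₂ hq h0

lemma StepSystem.V1_nonneg (S : StepSystem) {q : ℝ} (hq : q ∈ S.U₁) : 0 ≤ S.V₁ q := by
  rcases eq_or_ne q 0 with rfl | h0
  · exact S.V₁_zero.ge
  · exact (S.V1_pos hq h0).le

lemma StepSystem.V2_nonneg (S : StepSystem) {q : ℝ} (hq : q ∈ S.U₂) : 0 ≤ S.V₂ q := by
  rcases eq_or_ne q 0 with rfl | h0
  · exact S.V₂_zero.ge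
  · exact (S.V2_pos hq h0).le

namespace Model

variable {S : StepSystem} {h : ℝ} (M : Model S h)

lemma κ_zero : M.κ 0 = 0 := M.κ_eq 0 (by simp)

/-- For `ε = 0` the horizontal motion is that of an oscillator. -/
lemma motion1 (z : Phase) :
    IsMotion M.a₁ (fun t => q₁ (M.Φ t 0 z)) (fun t => p₁ (M.Φ t 0 z)) where
  dq t := (M.hasDerivAt_coords 0 z t).1
  dp t := (M.hasDerivAt_coords 0 z t).2.1.congr_deriv (by simp [field, M.κ_zero])

/-- For `ε = 0` the vertical motion is that of an oscillator. -/
lemma motion2 (z : Phase) :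
    IsMotion M.a₂ (fun t => q₂ (M.Φ t 0 z)) (fun t => p₂ (M.Φ t 0 z)) where
  dq t := (M.hasDerivAt_coords 0 z t).2.2.1
  dp t := (M.hasDerivAt_coords 0 z t).2.2.2.congr_deriv (by simp [field, M.κ_zero])

variable {M}

lemma angQ_add (a θ t : ℝ) (ha : a ∈ M.Amp) :
    M.angQ (θ + π / M.half a * t) a = M.Q a (t + M.half a * θ / π) ∧
    M.angP (θ + π / M.half a * t) a = M.P a (t + M.half a * θ / π) := by
  have := half_pos ha
  have e : M.half a * (θ + π / M.half a * t) / π = t + M.half a * θ / π := by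
    field_simp; ring
  rw [angQ, angP, e]
  exact ⟨rfl, rfl⟩

lemma Φ_zero_vertical {a : ℝ} (ha : a ∈ M.Amp) (θ x p t : ℝ) :
    q₂ (M.Φ t 0 (x, p, M.angQ θ a, M.angP θ a)) = M.angQ (θ + π / M.half a * t) a ∧
    p₂ (M.Φ t 0 (x, p, M.angQ θ a, M.angP θ a)) = M.angP (θ + π / M.half a * t) a := by
  obtain ⟨K, hK⟩ := M.core2.lipschitz
  rw [(angQ_add a θ t ha).1, (angQ_add a θ t ha).2]
  obtain ⟨h1, h2⟩ := (M.motion2 (x, p, M.angQ θ a, M.angP θ a)).unique hK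
    ((M.motion a).shift (M.half a * θ / π)) (t0 := 0)
    (by simp [M.Φ_zero, angQ]) (by simp [M.Φ_zero, angP])
  exact ⟨congrFun h1 t, congrFun h2 t⟩

/-- The unperturbed orbits through the tangency at the right wall. -/
structure Base (M : Model S h) where
  (aS xS τ : ℝ)
  aS_mem : aS ∈ M.Amp
  level2 : M.W2 aS = h - S.V₁ S.w₁
  w₁_mem : S.w₁ ∈ Ioo M.l₁ 0
  w₂_mem : S.w₂ ∈ Ioo M.l₂ 0
  w2_lt : M.W2 S.w₂ < M.W2 aS
  xS_mem : xS ∈ Ioo 0 M.r₁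
  level1 : M.W1 S.w₁ = M.W1 xS
  swing : ∀ c d, HalfSwing M.a₁ M.W1 M.l₁ M.r₁ (fun t => q₁ (M.Φ t 0 (xS, 0, c, d)))
    (fun t => p₁ (M.Φ t 0 (xS, 0, c, d))) xS S.w₁ τ

lemma exists_base (M : Model S h) (hh : S.V₁ S.w₁ + S.V₂ S.w₂ < h) : Nonempty (Base M) := by
  have w1 := M.core1.well
  have w2 := M.core2.well
  have hV1 := S.V1_pos S.w₁_mem S.w₁_neg.ne
  have hV2 := S.V2_pos S.w₂_mem S.w₂_neg.ne
  have hl1 := M.core1.lt_level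
  have hl2 := M.core2.lt_level
  have m1 := M.core1.mem_of_lt _ S.w₁_mem (by linarith)
  have m2 := M.core2.mem_of_lt _ S.w₂_mem (by linarith)
  have e1 := M.core1.W_eq _ (Ioo_subset_Icc_self m1)
  have e2 := M.core2.W_eq _ (Ioo_subset_Icc_self m2)
  obtain ⟨xS, hx, hxw⟩ := w1.exists_right ⟨m1.1, S.w₁_neg⟩
    (show M.W1 S.w₁ < M.W1 M.r₁ by linarith [(level_le_W1 (M := M)).2])
  obtain ⟨aS, ha, haE⟩ := intermediate_value_Ioo w2.r_pos.le w2.continuous.continuousOn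
    (show h - S.V₁ S.w₁ ∈ Ioo (M.W2 0) (M.W2 M.r₂) by
      rw [W2_zero]; exact ⟨by linarith, by linarith [(level_le_W2 (M := M)).2]⟩)
  obtain ⟨K, hK⟩ := M.core1.lipschitz
  have hy : S.w₁ ∈ Ioo M.l₁ 0 := ⟨m1.1, S.w₁_neg⟩
  obtain ⟨τ, h0, hneg, hp, hq⟩ := (M.motion1 (xS, 0, 0, 0)).exists_half_period w1 hx hy hxw
    (by simp [M.Φ_zero]) (by simp [M.Φ_zero])
  refine ⟨⟨aS, xS, τ, ⟨ha, by rw [haE]; linarith⟩, haE, hy, ⟨m2.1, S.w₂_neg⟩, by rw [haE]; linarith, hx,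
    hxw, fun c d => ?_⟩⟩
  obtain ⟨k1, k2⟩ := (M.motion1 (xS, 0, c, d)).unique hK (M.motion1 (xS, 0, 0, 0)) (t0 := 0)
    (by simp [M.Φ_zero]) (by simp [M.Φ_zero])
  rw [k1, k2]
  exact ⟨w1, M.motion1 _, hx, hy, hxw, by simp [M.Φ_zero], by simp [M.Φ_zero], h0, hneg, hp, hq⟩

end Model

namespace Model

variable {S : StepSystem} {h : ℝ} {M : Model S h}

lemma Base.h_pos (b : Base M) : 0 < h := by
  have h1 := S.V1_pos S.w₁_mem S.w₁_neg.ne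
  have h2 := S.V2_pos S.w₂_mem S.w₂_neg.ne
  have h3 := M.core2.W_eq S.w₂ ⟨b.w₂_mem.1.le, b.w₂_mem.2.le.trans M.core2.well.r_pos.le⟩
  have h4 := b.level2
  have h5 := b.w2_lt
  linarith

/-- A parametrization of the section near the unperturbed torus by angle and amplitude. -/
structure SectionChart (b : Base M) where
  η : ℝ
  η_pos : 0 < η
  X : ℝ³ → ℝ
  η_le : η ≤ 1
  amp : ∀ a, |a - b.aS| < η → a ∈ M.Amp
  bound : M.B * η < M.h₂ - h
  contDiffAt : ∀ ε θ a, |ε| < η → |a - b.aS| < η → ContDiffAt ℝ 2 X (ε, θ, a)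
  X_mem : ∀ ε θ a, |ε| < η → |a - b.aS| < η → X (ε, θ, a) ∈ Ioo 0 M.r₁
  X_base : ∀ θ, X (0, θ, b.aS) = b.xS
  mem_section : ∀ ε θ a, |ε| < η → |a - b.aS| < η →
    (X (ε, θ, a), 0, M.angQ θ a, M.angP θ a) ∈ S.section_ ε h
  eq_of_mem : ∀ ε θ a, |ε| < η → |a - b.aS| < η → ∀ z ∈ S.section_ ε h, q₂ z = M.angQ θ a →
    p₂ z = M.angP θ a → z = (X (ε, θ, a), 0, M.angQ θ a, M.angP θ a)

lemma exists_sectionChart (b : Base M) : Nonempty (SectionChart b) := by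
  have w1 := M.core1.well
  have hx0 := b.xS_mem
  have hr : M.W1 b.xS < M.W1 M.r₁ := w1.strictMonoOn ⟨hx0.1.le, hx0.2.le⟩ ⟨w1.r_pos.le, le_rfl⟩ hx0.2
  have h0 : 0 < M.W1 b.xS := by
    rw [← W1_zero (M := M)]; exact w1.strictMonoOn ⟨le_rfl, w1.r_pos.le⟩ ⟨hx0.1.le, hx0.2.le⟩ hx0.1
  have hV : S.V₁ S.w₁ = M.W1 b.xS := by
    rw [← b.level1, M.core1.W_eq _ ⟨b.w₁_mem.1.le, b.w₁_mem.2.le.trans w1.r_pos.le⟩]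
  have hxh : M.W1 b.xS < M.h₁ := by
    have h1 := b.level2
    have h2 := b.w2_lt
    have h3 := M.core2.well.zero_le ⟨b.w₂_mem.1.le, b.w₂_mem.2.le.trans M.core2.well.r_pos.le⟩
    rw [W2_zero] at h3
    have := M.core1.lt_level
    linarith
  obtain ⟨g, hg0, hlt⟩ := exists_between (lt_min h0 (sub_pos.2 hxh))
  obtain ⟨hg1, hg2⟩ := lt_min_iff.1 hlt
  rw [lt_sub_iff_add_lt'] at hg2
  have hlr := level_le_W1 (M := M)
  obtain ⟨c, hc, hcW⟩ := intermediate_value_Ioo w1.r_pos.le w1.continuous.continuousOn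
    (show M.W1 b.xS - g ∈ Ioo (M.W1 0) (M.W1 M.r₁) by
      rw [W1_zero]; exact ⟨by linarith, by linarith⟩)
  obtain ⟨d, hd, hdW⟩ := intermediate_value_Ioo w1.r_pos.le w1.continuous.continuousOn
    (show M.W1 b.xS + g ∈ Ioo (M.W1 0) (M.W1 M.r₁) by
      rw [W1_zero]; exact ⟨by linarith, by linarith⟩)
  have hcd : c < d := by
    rw [← w1.strictMonoOn.lt_iff_lt ⟨hc.1.le, hc.2.le⟩ ⟨hd.1.le, hd.2.le⟩]; linarith
  set K : Set ℝ := Icc M.l₁ M.r₁ ∩ {x | |M.W1 x - M.W1 b.xS| ≤ g} with hK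
  have hKc : IsCompact K := isCompact_Icc.inter_right
    (isClosed_le ((w1.continuous.sub continuous_const).abs) continuous_const)
  have hKcd : Icc c d ⊆ K := fun x hx => by
    have hxr : x ∈ Icc 0 M.r₁ := ⟨hc.1.le.trans hx.1, hx.2.trans hd.2.le⟩
    have h1 := w1.strictMonoOn.monotoneOn ⟨hc.1.le, hc.2.le⟩ hxr hx.1
    have h2 := w1.strictMonoOn.monotoneOn hxr ⟨hd.1.le, hd.2.le⟩ hx.2
    exact ⟨⟨w1.l_neg.le.trans hxr.1, hxr.2⟩,
      show |M.W1 x - M.W1 b.xS| ≤ g from abs_le.2 ⟨by linarith, by linarith⟩⟩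
  have hKne : ∀ x ∈ K, M.a₁ x ≠ 0 := fun x hx => by
    rcases lt_trichotomy x 0 with h1 | h1 | h1
    · exact (w1.pos x ⟨hx.1.1, h1⟩).ne'
    · exfalso
      have : |M.W1 x - M.W1 b.xS| ≤ g := hx.2
      rw [h1, W1_zero, abs_le] at this
      linarith [this.1]
    · exact (w1.neg x ⟨h1, hx.1.2⟩).ne
  obtain ⟨m, hm0, hm⟩ : ∃ m > 0, ∀ x ∈ K, m ≤ |M.a₁ x| := by
    obtain ⟨x, hx, hmin⟩ := hKc.exists_isMinOn ⟨c, hKcd ⟨le_rfl, hcd.le⟩⟩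
      (w1.cont.abs.continuousOn (s := K))
    exact ⟨|M.a₁ x|, abs_pos.2 (hKne x hx), fun y hy => hmin hy⟩
  obtain ⟨B1, hB1⟩ := ((isCompact_Icc (a := M.l₁) (b := M.r₁)).prod
    (isCompact_Icc (a := M.l₂) (b := M.r₂))).exists_bound_of_continuousOn M.b1_cont.continuousOn
  simp only [Real.norm_eq_abs] at hB1
  have hB10 : 0 ≤ B1 := (abs_nonneg _).trans (hB1 (S.w₁, S.w₂)
    ⟨⟨b.w₁_mem.1.le, b.w₁_mem.2.le.trans w1.r_pos.le⟩, b.w₂_mem.1.le,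
      b.w₂_mem.2.le.trans M.core2.well.r_pos.le⟩)
  have hB0 := M.B_nonneg
  have hl2 := M.core2.lt_level
  have hev : ∀ᶠ a in 𝓝 b.aS, |M.W2 a - M.W2 b.aS| < g / 2 :=
    (M.core2.well.continuous.sub continuous_const).abs.continuousAt.eventually (gt_mem_nhds (by simpa using hg0))
  replace hev := (show ∀ᶠ a in 𝓝 b.aS, a ∈ M.Amp from M.isOpen_amp.mem_nhds b.aS_mem).and hev
  obtain ⟨e, he, hev⟩ := Metric.eventually_nhds_iff.1 hev
  have key (C v : ℝ) (hv : 0 < v) : ∀ᶠ e in 𝓝[>] (0 : ℝ), C * e < v :=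
    (((continuous_const.mul continuous_id).continuousAt.eventually (gt_mem_nhds (by simpa using hv))).filter_mono
      nhdsWithin_le_nhds)
  obtain ⟨η, hB_η, hε2, hε3, hlt, hη0⟩ := ((key M.B (M.h₂ - h) (by linarith)).and ((key M.B (g / 2)
    (by linarith)).and ((key B1 m hm0).and (((gt_mem_nhds (lt_min he zero_lt_one)).filter_mono
    nhdsWithin_le_nhds).and self_mem_nhdsWithin)))).exists
  obtain ⟨hηe, hη1⟩ := lt_min_iff.1 hlt
  have hamp (a) (ha : |a - b.aS| < η) : a ∈ M.Amp := (hev (ha.trans hηe)).1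
  have hW2 (a) (ha : |a - b.aS| < η) := (hev (ha.trans hηe)).2
  set F : (ℝ³) × ℝ → ℝ := fun p =>
    S.V₁ p.2 + p.1.1 * S.Vc (p.2, M.angQ p.1.2.1 p.1.2.2) + M.W2 p.1.2.2 - h with hF
  set N : Set (ℝ³) := {u | |u.1| < η ∧ |u.2.2 - b.aS| < η} with hN
  have hNo : IsOpen N := (isOpen_lt (f := fun u : ℝ³ => |u.1|) (by fun_prop) continuous_const).inter
    (isOpen_lt (f := fun u : ℝ³ => |u.2.2 - b.aS|) (by fun_prop) continuous_const)
  have hangI {θ a : ℝ} (ha : a ∈ M.Amp) : M.angQ θ a ∈ Icc M.l₂ M.r₂ := Ioo_subset_Icc_self (Q_mem ha _).2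
  have hr2 : (2 : WithTop ℕ∞) ≤ S.r := by have := S.four_lt_r; norm_cast; omega
  have hW2C : ContDiffOn ℝ 2 M.W2 (Ioo M.l₂ M.r₂) := by
    refine (S.smooth_V₂.of_le hr2).mono (Ioo_subset_Icc_self.trans M.core2.subset) |>.congr fun q hq => ?_
    exact M.core2.W_eq q (Ioo_subset_Icc_self hq)
  have hcU : ∀ x ∈ Icc c d, x ∈ S.U₁ := fun x hx => M.core1.subset (hKcd hx).1
  have hFC : ∀ u ∈ N, ∀ y ∈ Icc c d, ContDiffAt ℝ 2 F (u, y) := fun u hu y hy => by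
    have ha := hamp _ hu.2
    have hang : ContDiffAt ℝ 2 (fun p : (ℝ³) × ℝ => M.angQ p.1.2.1 p.1.2.2) (u, y) :=
      ContDiffAt.comp (g := fun p : ℝ × ℝ => M.angQ p.1 p.2) (f := fun p : (ℝ³) × ℝ => p.1.2)
        (u, y) (contDiffAt_ang ha u.2.1).1 (by fun_prop)
    have h1 : ContDiffAt ℝ 2 (fun p : (ℝ³) × ℝ => S.V₁ p.2) (u, y) :=
      ContDiffAt.comp (g := S.V₁) (u, y)
        ((S.smooth_V₁.contDiffAt (S.isOpen_U₁.mem_nhds (hcU y hy))).of_le hr2) contDiffAt_snd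
    have h2 : ContDiffAt ℝ 2 (fun p : (ℝ³) × ℝ => S.Vc (p.2, M.angQ p.1.2.1 p.1.2.2)) (u, y) :=
      ContDiffAt.comp (g := S.Vc) (f := fun p : (ℝ³) × ℝ => (p.2, M.angQ p.1.2.1 p.1.2.2)) (u, y)
        ((S.smooth_Vc.contDiffAt ((S.isOpen_U₁.prod S.isOpen_U₂).mem_nhds
          ⟨hcU y hy, M.core2.subset (hangI ha)⟩)).of_le hr2) (contDiffAt_snd.prodMk hang)
    have h3 : ContDiffAt ℝ 2 (fun p : (ℝ³) × ℝ => M.W2 p.1.2.2) (u, y) :=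
      ContDiffAt.comp (g := M.W2) (f := fun p : (ℝ³) × ℝ => p.1.2.2) (u, y)
        (hW2C.contDiffAt (Ioo_mem_nhds (M.core2.well.l_neg.trans ha.1.1) ha.1.2)) (by fun_prop)
    have h4 : ContDiffAt ℝ 2 (fun p : (ℝ³) × ℝ => p.1.1) (u, y) := by fun_prop
    exact ((h1.add (h4.mul h2)).add h3).sub contDiffAt_const
  have hVcd {x q : ℝ} (hx : x ∈ Icc M.l₁ M.r₁) (hq : q ∈ Icc M.l₂ M.r₂) :
      HasDerivAt (fun x => S.Vc (x, q)) (-M.b₁ (x, q)) x := by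
    rw [M.b1_eq (x, q) ⟨hx, hq⟩, neg_neg]
    exact ((S.hasFDerivAt_Vc (q := (x, q)) ⟨M.core1.subset hx, M.core2.subset hq⟩).comp_hasDerivAt x
      ((hasDerivAt_id x).prodMk (hasDerivAt_const _ _))).differentiableAt.hasDerivAt
  have hFy {u : ℝ³} {y : ℝ} (hy : y ∈ S.U₁) (hyI : y ∈ Icc M.l₁ M.r₁)
      (ha : M.angQ u.2.1 u.2.2 ∈ Icc M.l₂ M.r₂) :
      HasDerivAt (fun y => F (u, y)) (-M.a₁ y + u.1 * -M.b₁ (y, M.angQ u.2.1 u.2.2)) y := by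
    rw [M.core1.a_eq y hyI, neg_neg]
    exact (((S.hasDerivAt_V1 hy).add ((hVcd hyI ha).const_mul u.1)).add_const (M.W2 u.2.2)).sub_const h
  have hb1 {ε x q : ℝ} (hε : |ε| < η) (hx : x ∈ Icc M.l₁ M.r₁) (hq : q ∈ Icc M.l₂ M.r₂) :
      |ε * M.b₁ (x, q)| < m := by
    rw [abs_mul, mul_comm]
    exact (mul_le_mul (hB1 _ ⟨hx, hq⟩) hε.le (abs_nonneg _) hB10).trans_lt hε3
  have hFd : ∀ u ∈ N, ∀ y ∈ Icc c d, 0 < fderiv ℝ F (u, y) (0, 1) := fun u hu y hy => by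
    have ha := hamp _ hu.2
    have hyI := (hKcd hy).1
    rw [((hFC u hu y hy).differentiableAt (by norm_num)).hasFDerivAt.comp_hasDerivAt y
      ((hasDerivAt_const y u).prodMk (hasDerivAt_id y)) |>.unique (hFy (hcU y hy) hyI (hangI ha))]
    have h3 := hm y (hKcd hy)
    rw [abs_of_neg (w1.neg y ⟨hc.1.trans_le hy.1, hyI.2⟩)] at h3
    linarith [(abs_lt.1 (hb1 hu.1 hyI (hangI (θ := u.2.1) ha))).2]
  have hVc {ε x q : ℝ} (hε : |ε| < η) (hx : x ∈ S.U₁) (hq : q ∈ S.U₂) : |ε * S.Vc (x, q)| < g / 2 := by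
    rw [abs_mul]
    rw [mul_comm]; exact (mul_le_mul (M.Vc_le _ ⟨hx, hq⟩) hε.le (abs_nonneg _) hB0).trans_lt hε2
  have hlev := b.level2
  have hVW : ∀ y ∈ Icc c d, S.V₁ y = M.W1 y := fun y hy => (M.core1.W_eq y (hKcd hy).1).symm
  obtain ⟨X, hX⟩ := ImplicitScalar.exists_on_box hNo hcd (n := 2) (by norm_num) hFC hFd
    (fun u hu => by
      have h1 := (abs_lt.1 (hVc (q := M.angQ u.2.1 u.2.2) hu.1 (hcU c ⟨le_rfl, hcd.le⟩)
        (M.core2.subset (hangI (hamp _ hu.2))))).2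
      have h2 := (abs_lt.1 (hW2 _ hu.2)).2
      simp only [hF]
      rw [hVW c ⟨le_rfl, hcd.le⟩]; linarith)
    (fun u hu => by
      have h1 := (abs_lt.1 (hVc (q := M.angQ u.2.1 u.2.2) hu.1 (hcU d ⟨hcd.le, le_rfl⟩)
        (M.core2.subset (hangI (hamp _ hu.2))))).1
      have h2 := (abs_lt.1 (hW2 _ hu.2)).1
      simp only [hF]
      rw [hVW d ⟨hcd.le, le_rfl⟩]; linarith)
  have henergy {θ a : ℝ} (ha : a ∈ M.Amp) : M.angP θ a ^ 2 / 2 + S.V₂ (M.angQ θ a) = M.W2 a :=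
    energy2_QP ha _
  refine ⟨⟨η, hη0, X, hη1.le, hamp, hB_η,
    fun ε θ a hε ha => (hX (ε, θ, a) ⟨hε, ha⟩).2.1, fun ε θ a hε ha => ?_, fun θ => ?_,
    fun ε θ a hε ha => ?_, fun ε θ a hε ha z hz hzq hzp => ?_⟩⟩
  · have := (hX (ε, θ, a) ⟨hε, ha⟩).1
    exact ⟨hc.1.trans this.1, this.2.trans hd.2⟩
  · have h1 : ((0 : ℝ), θ, b.aS) ∈ N := ⟨by simpa using hη0, by simpa using hη0⟩
    have hxI : b.xS ∈ Icc c d := by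
      constructor
      · rw [← w1.strictMonoOn.le_iff_le ⟨hc.1.le, hc.2.le⟩ ⟨hx0.1.le, hx0.2.le⟩]; linarith
      · rw [← w1.strictMonoOn.le_iff_le ⟨hx0.1.le, hx0.2.le⟩ ⟨hd.1.le, hd.2.le⟩]; linarith
    refine (((hX _ h1).2.2.2 b.xS hxI).2.1 ?_).symm
    simp only [hF]
    rw [hVW _ hxI, hlev, hV]; ring
  · have hu : (ε, θ, a) ∈ N := ⟨hε, ha⟩
    have hXu := hX _ hu
    have hA := hamp _ ha
    have hXI := Ioo_subset_Icc_self hXu.1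
    refine ⟨hcU _ hXI, M.core2.subset (hangI hA), rfl, ?_, ?_⟩
    · have h1 := hFd _ hu _ hXI
      have h2 := ((hFC _ hu _ hXI).differentiableAt (by norm_num)).hasFDerivAt.comp_hasDerivAt
        (X (ε, θ, a)) ((hasDerivAt_const _ (ε, θ, a)).prodMk (hasDerivAt_id _))
      rw [h2.unique (hFy (hcU _ hXI) (hKcd hXI).1 (hangI hA)), M.core1.a_eq _ (hKcd hXI).1] at h1
      simp only [StepSystem.force₁, q1_mk, q2_mk]
      rw [(hVcd (hKcd hXI).1 (hangI (θ := θ) hA)).deriv]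
      linarith
    · have h1 := hXu.2.2.1
      simp only [hF] at h1
      simp only [StepSystem.hamiltonian, q1_mk, p1_mk, q2_mk, p2_mk]
      have := henergy (θ := θ) hA
      linarith
  · have hu : (ε, θ, a) ∈ N := ⟨hε, ha⟩
    have hXu := hX _ hu
    have hA := hamp _ ha
    obtain ⟨x, p, q, p'⟩ := z
    obtain ⟨hz1, hz2, hz3, hz4, hz5⟩ := hz
    simp only [q1_mk, p1_mk, q2_mk, p2_mk, StepSystem.force₁, StepSystem.hamiltonian] at *
    subst hzq hzp hz3
    have h1 := abs_lt.1 (hVc hε hz1 hz2)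
    have h2 := abs_lt.1 (hW2 _ ha)
    have h3 := henergy (θ := θ) hA
    have hxm := M.core1.mem_of_lt x hz1 (by linarith [h1.1, h2.1])
    have hxI := Ioo_subset_Icc_self hxm
    have hxW := M.core1.W_eq x hxI
    have hxK : x ∈ K := ⟨hxI, show |M.W1 x - M.W1 b.xS| ≤ g from
      abs_le.2 ⟨by linarith [h1.2, h2.2], by linarith [h1.1, h2.1]⟩⟩
    have ha1 : M.a₁ x < 0 := by
      by_contra! hge
      have h4 := hm x hxK
      rw [abs_of_nonneg hge, M.core1.a_eq x hxI] at h4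
      rw [(hVcd hxI (hangI (θ := θ) hA)).deriv] at hz4
      linarith [(abs_lt.1 (hb1 hε hxI (hangI (θ := θ) hA))).1]
    have hx0 : 0 ≤ x := by
      by_contra! hneg
      exact absurd (w1.pos x ⟨hxI.1, hneg⟩) (not_lt.2 ha1.le)
    have hxcd : x ∈ Icc c d := by
      have := abs_le.1 (show |M.W1 x - M.W1 b.xS| ≤ g from hxK.2)
      constructor
      · rw [← w1.strictMonoOn.le_iff_le ⟨hc.1.le, hc.2.le⟩ ⟨hx0, hxI.2⟩]; linarith
      · rw [← w1.strictMonoOn.le_iff_le ⟨hx0, hxI.2⟩ ⟨hd.1.le, hd.2.le⟩]; linarith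
    have := ((hXu.2.2.2 x hxcd).2).1 (by simp only [hF]; linarith)
    rw [this]

end Model

namespace Model

variable {S : StepSystem} {h : ℝ} (M : Model S h) {ε τ δ b : ℝ} {z : Phase}

/-! ### Stretches of the flow outside the step -/

/-- A stretch of the flow outside the closed step, along which `p₁` vanishes only while it increases. -/
structure Clear (ε : ℝ) (z : Phase) (b : ℝ) : Prop where
  pos : 0 < b
  core : ∀ s ∈ Icc 0 b, M.InCore (M.Φ s ε z)
  outside : ∀ s ∈ Ioo 0 b, S.Outside (M.Φ s ε z)
  turning : ∀ s ∈ Ioo 0 b, p₁ (M.Φ s ε z) ≠ 0 ∨ 0 < p₁ (M.field ε (M.Φ s ε z))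

variable {M}

lemma not_section_of_turning (hε : |ε| ≤ 1) (hc : M.InCore z)
    (ht : p₁ z ≠ 0 ∨ 0 < p₁ (M.field ε z)) (h' : ℝ) : z ∉ S.section_ ε h' := fun hs => by
  rcases ht with ht | ht
  · exact ht hs.2.2.1
  · rw [field_eq hε hc] at ht
    exact absurd ht (not_lt.2 hs.2.2.2.1.le)

lemma Clear.leg (hε : |ε| ≤ 1) (hc : M.Clear ε z b) (h' : ℝ) : M.Leg ε h' z b :=
  ⟨hc.pos, hc.core, fun s hs => (hc.outside s hs).interior (hc.core s (Ioo_subset_Icc_self hs)).mem_U.1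
    (hc.core s (Ioo_subset_Icc_self hs)).mem_U.2,
    fun s hs => not_section_of_turning hε (hc.core s (Ioo_subset_Icc_self hs)) (hc.turning s hs) h'⟩

@[simp] lemma q1_timeRev (z : Phase) : q₁ (timeRev z) = q₁ z := rfl
@[simp] lemma q2_timeRev (z : Phase) : q₂ (timeRev z) = q₂ z := rfl
@[simp] lemma p1_timeRev (z : Phase) : p₁ (timeRev z) = -p₁ z := rfl
@[simp] lemma p2_timeRev (z : Phase) : p₂ (timeRev z) = -p₂ z := rfl

lemma Φ_timeRev_Φ (s b ε : ℝ) (z : Phase) :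
    M.Φ s ε (timeRev (M.Φ b ε z)) = timeRev (M.Φ (b - s) ε z) := by
  rw [M.Φ_timeRev, ← M.Φ_add]; congr 2; ring

lemma Clear.reverse (hc : M.Clear ε z b) : M.Clear ε (timeRev (M.Φ b ε z)) b := by
  refine ⟨hc.pos, fun s hs => ?_, fun s hs => ?_, fun s hs => ?_⟩ <;> rw [Φ_timeRev_Φ]
  · exact hc.core (b - s) ⟨by linarith [hs.2], by linarith [hs.1]⟩
  · exact hc.outside (b - s) ⟨by linarith [hs.2], by linarith [hs.1]⟩
  · have := hc.turning (b - s) ⟨by linarith [hs.2], by linarith [hs.1]⟩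
    rcases this with h | h
    · left; simpa using h
    · right; exact h

lemma Clear.reverse' (hc : M.Clear ε (timeRev (M.Φ b ε z)) b) : M.Clear ε z b := by
  have := hc.reverse
  rwa [Φ_timeRev_Φ, sub_self, M.Φ_zero, timeRev_timeRev] at this

lemma hamiltonian_timeRev (ε : ℝ) (z : Phase) : S.hamiltonian ε (timeRev z) = S.hamiltonian ε z := by
  simp [hamiltonian]

lemma timeRev_mem_section {h' : ℝ} (hz : z ∈ S.section_ ε h') : timeRev z ∈ S.section_ ε h' := by
  obtain ⟨h1, h2, h3, h4, h5⟩ := hz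
  exact ⟨h1, h2, by simp [h3], h4, by rw [hamiltonian_timeRev]; exact h5⟩

lemma hamiltonian_Φ (hε : |ε| ≤ 1) (hb : 0 ≤ b) (hc : ∀ s ∈ Icc 0 b, M.InCore (M.Φ s ε z)) :
    S.hamiltonian ε (M.Φ b ε z) = S.hamiltonian ε z := by
  have hd (s) (hs : s ∈ Icc 0 b) (A : Set ℝ) :
      HasDerivWithinAt (fun s => S.hamiltonian ε (M.Φ s ε z)) 0 A s :=
    hasDerivWithinAt_hamiltonian (hc s hs).mem_U.1 (hc s hs).mem_U.2
      (hasDerivAt_Φ_of_inCore hε (hc s hs)).hasDerivWithinAt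
  have := constant_of_has_deriv_right_zero (f := fun s => S.hamiltonian ε (M.Φ s ε z)) (a := 0) (b := b)
    (fun s hs => (hd s hs _).continuousWithinAt) (fun s hs => hd s ⟨hs.1, hs.2.le⟩ _) b ⟨hb, le_rfl⟩
  simpa [M.Φ_zero] using this

/-- The vertical energy changes slowly. -/
lemma energy_drift {T : ℝ} (hε : |ε| ≤ 1) (hb : 0 ≤ b) (hT : b ≤ T) (hc : ∀ s ∈ Icc 0 b, M.InCore (M.Φ s ε z))
    (hH : S.hamiltonian ε z = h) :
    |S.energy₂ (q₂ (M.Φ b ε z)) (p₂ (M.Φ b ε z)) - S.energy₂ (q₂ z) (p₂ z)| ≤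
      M.B * √(2 * (h + M.B)) * |ε| * T := by
  have hB0 := M.B_nonneg
  set E : ℝ → ℝ := fun s => p₂ (M.Φ s ε z) ^ 2 / 2 + M.W2 (q₂ (M.Φ s ε z)) with hE
  have hEd (s : ℝ) : HasDerivAt E (p₂ (M.Φ s ε z) * (M.κ ε * M.b₂ (q₁ (M.Φ s ε z), q₂ (M.Φ s ε z)))) s := by
    obtain ⟨-, -, d3, d4⟩ := M.hasDerivAt_coords ε z s
    have := ((d4.pow 2).div_const 2).add ((M.core2.well.deriv (q₂ (M.Φ s ε z))).comp s d3)
    refine this.congr_deriv ?_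
    simp only [field, p2_mk]; push_cast; ring
  have hbound (s) (hs : s ∈ Icc 0 b) :
      ‖p₂ (M.Φ s ε z) * (M.κ ε * M.b₂ (q₁ (M.Φ s ε z), q₂ (M.Φ s ε z)))‖ ≤
        M.B * √(2 * (h + M.B)) * |ε| := by
    have hH' : S.hamiltonian ε (M.Φ s ε z) = h :=
      (hamiltonian_Φ hε hs.1 fun u hu => hc u ⟨hu.1, hu.2.trans hs.2⟩).trans hH
    obtain ⟨m1, m2⟩ := (hc s hs).mem_U
    have v1 := S.V1_nonneg m1
    have v2 := S.V2_nonneg m2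
    have v3 : |ε * S.Vc (q₁ (M.Φ s ε z), q₂ (M.Φ s ε z))| ≤ M.B := by
      rw [abs_mul]
      exact (mul_le_mul hε (M.Vc_le _ ⟨m1, m2⟩) (abs_nonneg _) zero_le_one).trans (one_mul _).le
    have v4 := (abs_le.1 v3).1
    have hp : |p₂ (M.Φ s ε z)| ≤ √(2 * (h + M.B)) := by
      refine Real.abs_le_sqrt ?_
      unfold hamiltonian at hH'
      nlinarith [sq_nonneg (p₁ (M.Φ s ε z))]
    rw [Real.norm_eq_abs, abs_mul, abs_mul, M.κ_eq ε hε]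
    calc _ ≤ √(2 * (h + M.B)) * (|ε| * M.B) := mul_le_mul hp
          (mul_le_mul_of_nonneg_left (M.b2_le _) (abs_nonneg _)) (by positivity) (Real.sqrt_nonneg _)
      _ = _ := by ring
  have key := (convex_Icc 0 b).norm_image_sub_le_of_norm_hasDerivWithin_le (f := E)
    (fun s _ => (hEd s).hasDerivWithinAt) hbound ⟨le_rfl, hb⟩ ⟨hb, le_rfl⟩
  rw [energy2_eq (Ioo_subset_Icc_self (hc b ⟨hb, le_rfl⟩).2),
    energy2_eq (M := M) (q := q₂ z) (Ioo_subset_Icc_self (by simpa [M.Φ_zero] using (hc 0 ⟨le_rfl, hb⟩).2))]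
  refine (by simpa [hE, M.Φ_zero, Real.norm_eq_abs, abs_of_nonneg hb] using key :
    _ ≤ M.B * √(2 * (h + M.B)) * |ε| * b).trans (by gcongr)

/-! ### The return to the section -/

variable (M) in
/-- The behaviour of the flow near the unperturbed tangent orbits, from the tangency onwards. -/
structure Facts (τ δ ε : ℝ) (z : Phase) : Prop where
  core : ∀ s ∈ Icc 0 (τ + δ), M.InCore (M.Φ s ε z)
  conv : ∀ s ∈ Icc 0 δ, 0 < p₁ (M.field ε (M.Φ s ε z))
  pos : ∀ s ∈ Icc δ (τ - δ), 0 < p₁ (M.Φ s ε z)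
  conc : ∀ s ∈ I(τ,δ), p₁ (M.field ε (M.Φ s ε z)) < 0
  end_neg : p₁ (M.Φ (τ + δ) ε z) < 0
  right : ∀ s ∈ Icc δ (τ + δ), S.w₁ < q₁ (M.Φ s ε z)
  vert : q₂ z = S.w₂ → ∀ s ∈ Icc 0 δ, 0 < p₂ z * p₂ (M.Φ s ε z)

namespace Facts

lemma strictMonoOn (f : M.Facts τ δ ε z) : StrictMonoOn (fun s => p₁ (M.Φ s ε z)) (Icc 0 δ) :=
  strictMonoOn_Icc (fun s _ => (M.hasDerivAt_coords ε z s).2.1) fun s hs => f.conv s (Ioo_subset_Icc_self hs)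

lemma strictAntiOn (f : M.Facts τ δ ε z) :
    StrictAntiOn (fun s => p₁ (M.Φ s ε z)) (I(τ,δ)) :=
  strictAntiOn_Icc (fun s _ => (M.hasDerivAt_coords ε z s).2.1) fun s hs => f.conc s (Ioo_subset_Icc_self hs)

lemma exists_return (f : M.Facts τ δ ε z) (hδ : 0 < δ) (hτ : 2 * δ < τ) :
    ∃ t ∈ Ioo (τ - δ) (τ + δ), p₁ (M.Φ t ε z) = 0 := by
  obtain ⟨t, ht, h0⟩ := intermediate_value_Ioo' (show τ - δ ≤ τ + δ by linarith)
    (f := fun s => p₁ (M.Φ s ε z))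
    (fun s _ => (M.hasDerivAt_coords ε z s).2.1.continuousAt.continuousWithinAt)
    ⟨f.end_neg, f.pos _ ⟨by linarith, le_rfl⟩⟩
  exact ⟨t, ht, h0⟩

lemma pos_of_zero (f : M.Facts τ δ ε z) {t : ℝ} (ht : t ∈ I(τ,δ))
    (h0 : p₁ (M.Φ t ε z) = 0) {s : ℝ} (hs : s ∈ Ico δ t) : 0 < p₁ (M.Φ s ε z) := by
  rcases le_total s (τ - δ) with h | h
  · exact f.pos s ⟨hs.1, h⟩
  · have := f.strictAntiOn ⟨h, hs.2.le.trans ht.2⟩ ht hs.2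
    simp only [h0] at this
    exact this

lemma right_of_nonneg (f : M.Facts τ δ ε z) (hq : q₁ z = S.w₁) (hp : 0 ≤ p₁ z) {s : ℝ}
    (hs : s ∈ Ioc 0 δ) : S.w₁ < q₁ (M.Φ s ε z) := by
  have hmono : StrictMonoOn (fun s => q₁ (M.Φ s ε z)) (Icc 0 δ) :=
    strictMonoOn_Icc (fun s _ => (M.hasDerivAt_coords ε z s).1) fun s hs => by
        have := f.strictMonoOn ⟨le_rfl, (hs.1.trans hs.2).le⟩ (Ioo_subset_Icc_self hs) hs.1
        simp only [M.Φ_zero] at this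
        linarith
  have := hmono ⟨le_rfl, hs.1.le.trans hs.2⟩ ⟨hs.1.le, hs.2⟩ hs.1
  simp only [M.Φ_zero] at this
  rwa [hq] at this

lemma above_of_pos (f : M.Facts τ δ ε z) (hq : q₂ z = S.w₂) (hp : 0 < p₂ z) {s : ℝ}
    (hs : s ∈ Ioc 0 δ) : S.w₂ < q₂ (M.Φ s ε z) := by
  have hmono : StrictMonoOn (fun s => q₂ (M.Φ s ε z)) (Icc 0 δ) :=
    strictMonoOn_Icc (fun s _ => (M.hasDerivAt_coords ε z s).2.2.1) fun s hs =>
      pos_of_mul_pos_right (f.vert hq s (Ioo_subset_Icc_self hs)) hp.le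
  have := hmono ⟨le_rfl, hs.1.le.trans hs.2⟩ ⟨hs.1.le, hs.2⟩ hs.1
  simp only [M.Φ_zero] at this
  rwa [hq] at this

lemma clear (f : M.Facts τ δ ε z) (hδ : 0 < δ) (hτ : 2 * δ < τ) {t : ℝ}
    (ht : t ∈ I(τ,δ)) (h0 : p₁ (M.Φ t ε z) = 0)
    (hloc : ∀ s ∈ Ioo 0 δ, S.Outside (M.Φ s ε z)) : M.Clear ε z t := by
  refine ⟨by linarith [ht.1], fun s hs => f.core s ⟨hs.1, hs.2.trans ht.2⟩, fun s hs => ?_, fun s hs => ?_⟩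
  · rcases lt_or_ge s δ with h | h
    · exact hloc s ⟨hs.1, h⟩
    · exact fun h' => absurd (f.right s ⟨h, hs.2.le.trans ht.2⟩) (not_lt.2 h'.1)
  · rcases lt_or_ge s δ with h | h
    · exact .inr (f.conv s ⟨hs.1.le, h.le⟩)
    · exact .inl (f.pos_of_zero ht h0 ⟨h, hs.2⟩).ne'

lemma mem_section (f : M.Facts τ δ ε z) (hε : |ε| ≤ 1) (hτ : 2 * δ < τ) (hδ : 0 < δ) {t : ℝ}
    (ht : t ∈ I(τ,δ)) (h0 : p₁ (M.Φ t ε z) = 0) (hH : S.hamiltonian ε z = h) :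
    M.Φ t ε z ∈ S.section_ ε h := by
  have hc := f.core t ⟨by linarith [ht.1], ht.2⟩
  refine ⟨hc.mem_U.1, hc.mem_U.2, h0, ?_, ?_⟩
  · have := f.conc t ht
    rw [field_eq hε hc] at this
    exact this
  · rw [hamiltonian_Φ hε (by linarith [ht.1]) fun s hs => f.core s ⟨hs.1, hs.2.trans ht.2⟩, hH]

end Facts

lemma continuous_field1 (M : Model S h) : Continuous fun p : ℝ × Phase => p₁ (M.field p.1 p.2) := by
  have h1 := M.core1.well.cont
  have h2 := M.b1_cont
  have h3 := M.κ_cont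
  simp only [field, p1_mk]
  fun_prop

/-- The unperturbed horizontal motion from the wall. -/
lemma Base.motion_from_wall (B : Base M) (c d t : ℝ) :
    q₁ (M.Φ t 0 (S.w₁, 0, c, d)) = q₁ (M.Φ (t + B.τ) 0 (B.xS, 0, 0, 0)) ∧
    p₁ (M.Φ t 0 (S.w₁, 0, c, d)) = p₁ (M.Φ (t + B.τ) 0 (B.xS, 0, 0, 0)) := by
  obtain ⟨K, hK⟩ := M.core1.lipschitz
  have s := B.swing 0 0
  obtain ⟨h1, h2⟩ := (M.motion1 (S.w₁, 0, c, d)).unique hK ((M.motion1 (B.xS, 0, 0, 0)).shift B.τ)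
    (t0 := 0) (by simpa [M.Φ_zero] using s.q_τ.symm) (by simpa [M.Φ_zero] using s.p_τ.symm)
  exact ⟨congrFun h1 t, congrFun h2 t⟩

/-- Near the unperturbed tangent orbits the flow behaves as the unperturbed flow. -/
lemma Base.exists_facts (B : Base M) : ∃ δ0 > 0, ∀ δ, 0 < δ → δ ≤ δ0 → ∀ θ,
    ∀ᶠ p : ℝ × Phase in 𝓝 (0, (S.w₁, 0, M.angQ θ B.aS, M.angP θ B.aS)), M.Facts B.τ δ p.1 p.2 := by
  obtain ⟨K1, hK1⟩ := M.core1.lipschitz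
  have s := B.swing 0 0
  set q : ℝ → ℝ := fun t => q₁ (M.Φ t 0 (B.xS, 0, 0, 0)) with hq
  set p : ℝ → ℝ := fun t => p₁ (M.Φ t 0 (B.xS, 0, 0, 0)) with hp
  have hτ := s.τ_pos
  have w1 := M.core1.well
  have hqc : Continuous fun t => M.a₁ (q t) := w1.cont.comp s.motion.contq
  have near {f : ℝ → ℝ} (hf : Continuous f) (h0 : 0 < f 0) : ∃ d > 0, ∀ t, |t| < d → 0 < f t := by
    obtain ⟨d, hd, h⟩ := Metric.eventually_nhds_iff.1 (hf.continuousAt.eventually (lt_mem_nhds h0))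
    exact ⟨d, hd, fun t ht => h (by rwa [Real.dist_eq, sub_zero])⟩
  obtain ⟨d1, hd1, h₁⟩ := near (f := fun t => M.a₁ (q (t + B.τ))) (hqc.comp (by fun_prop)) (by
    simp only [zero_add]
    rw [s.q_τ]; exact w1.pos _ ⟨B.w₁_mem.1.le, B.w₁_mem.2⟩)
  obtain ⟨d2, hd2, h₂⟩ := near (f := fun t => -M.a₁ (q (t + 2 * B.τ))) (hqc.comp (by fun_prop)).neg (by
    rw [neg_pos, (s.periodic hK1 0).1, s.q_zero]; exact w1.neg _ ⟨B.xS_mem.1, B.xS_mem.2.le⟩)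
  obtain ⟨A, hA⟩ := (isCompact_Icc (a := M.l₂) (b := M.r₂)).exists_bound_of_continuousOn
    M.core2.well.cont.continuousOn
  have hA0 : 0 ≤ A := (norm_nonneg _).trans
    (hA 0 ⟨M.core2.well.l_neg.le, M.core2.well.r_pos.le⟩)
  set g := M.W2 B.aS - M.W2 S.w₂ with hg
  have hg0 : 0 < g := by have := B.w2_lt; linarith
  obtain ⟨d3, hd3, h3⟩ : ∃ d > 0, A * d < √(2 * g) := by
    have h1 : 0 < √(2 * g) := Real.sqrt_pos.2 (by linarith)
    refine ⟨√(2 * g) / (A + 1), by positivity, ?_⟩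
    rw [← mul_div_assoc, div_lt_iff₀ (by linarith)]; nlinarith
  obtain ⟨δ0, hδ0, l⟩ := exists_between (show 0 < min (min d1 d2) (min d3 (B.τ / 4)) by positivity)
  simp only [lt_min_iff] at l
  obtain ⟨⟨l1, l2⟩, l3, l4⟩ := l
  refine ⟨δ0, hδ0, fun δ hδ hδle θ => ?_⟩
  set o : Phase := (S.w₁, 0, M.angQ θ B.aS, M.angP θ B.aS) with ho
  have hqo (t : ℝ) : q₁ (M.Φ t 0 o) = q (t + B.τ) := (B.motion_from_wall _ _ t).1
  have hpo (t : ℝ) : p₁ (M.Φ t 0 o) = p (t + B.τ) := (B.motion_from_wall _ _ t).2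
  have hfo (t : ℝ) : p₁ (M.field 0 (M.Φ t 0 o)) = M.a₁ (q (t + B.τ)) := by
    simp [field, M.κ_zero, hqo]
  have hcΦ : Continuous fun x : (ℝ × Phase) × ℝ => M.Φ x.2 x.1.1 x.1.2 :=
    M.continuous_Φ.comp (f := fun x : (ℝ × Phase) × ℝ => (x.2, x.1.1, x.1.2)) (by fun_prop)
  have hcf : Continuous fun x : (ℝ × Phase) × ℝ => p₁ (M.field x.1.1 (M.Φ x.2 x.1.1 x.1.2)) :=
    M.continuous_field1.comp ((continuous_fst.comp continuous_fst).prodMk hcΦ)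
  have hcq : Continuous fun x : (ℝ × Phase) × ℝ => q₁ (M.Φ x.2 x.1.1 x.1.2) := continuous_q1.comp hcΦ
  have hcp : Continuous fun x : (ℝ × Phase) × ℝ => p₁ (M.Φ x.2 x.1.1 x.1.2) := continuous_p1.comp hcΦ
  have hcp2 : Continuous fun x : (ℝ × Phase) × ℝ => p₂ (M.Φ x.2 x.1.1 x.1.2) := continuous_p2.comp hcΦ
  have hlt (t : ℝ) (ht : t ∈ Ioo 0 (2 * B.τ)) : S.w₁ < q (t + B.τ) := by
    rcases le_or_gt B.τ t with h | h
    · have h5 : q (t + B.τ) = q (t - B.τ) := by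
        rw [← (s.periodic hK1 (t - B.τ)).1]; congr 1; ring
      rw [h5, ← s.q_τ]
      exact s.strictAntiOn ⟨by linarith, by linarith [ht.2]⟩ ⟨hτ.le, le_rfl⟩ (by linarith [ht.2])
    · have h5 : q (t + B.τ) = q (B.τ - t) := by
        rw [← (s.even hK1 (B.τ - t)).1, ← (s.periodic hK1 (-(B.τ - t))).1]; congr 1; ring
      rw [h5, ← s.q_τ]
      exact s.strictAntiOn ⟨by linarith, by linarith [ht.1]⟩ ⟨hτ.le, le_rfl⟩ (by linarith [ht.1])
  have e1 : ∀ᶠ x : ℝ × Phase in 𝓝 (0, o), ∀ t ∈ Icc 0 (B.τ + δ), M.InCore (M.Φ t x.1 x.2) := by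
    refine isCompact_Icc.eventually_forall_of_forall_eventually fun t _ => ?_
    refine hcΦ.continuousAt.eventually (M.isOpen_inCore.mem_nhds ⟨?_, ?_⟩)
    · rw [hqo]; have := s.mem_Icc (t + B.τ); exact ⟨s.hy.1.trans_le this.1, this.2.trans_lt s.hx.2⟩
    · rw [ho, (Φ_zero_vertical B.aS_mem θ _ _ t).1]; exact (Q_mem B.aS_mem _).2
  have ev {f : (ℝ × Phase) × ℝ → ℝ} {a b : ℝ} (hf : Continuous f) (h0 : ∀ t ∈ Icc a b, 0 < f ((0, o), t)) :
      ∀ᶠ x in 𝓝 ((0 : ℝ), o), ∀ t ∈ Icc a b, 0 < f (x, t) :=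
    isCompact_Icc.eventually_forall_of_forall_eventually fun t ht =>
      hf.continuousAt.eventually (lt_mem_nhds (h0 t ht))
  have e2 := ev (a := 0) (b := δ) hcf fun t ht => by
    simp only [hfo]
    exact h₁ t (by rw [abs_of_nonneg ht.1]; linarith [ht.2])
  have e3 := ev (a := δ) (b := B.τ - δ) hcp fun t ht => by
    simp only [hpo]
    exact s.pos_of_mem hK1 ⟨by linarith [ht.1], by linarith [ht.2]⟩
  have e4 := ev (a := B.τ - δ) (b := B.τ + δ) hcf.neg fun t ht => by
    change 0 < -p₁ (M.field 0 (M.Φ t 0 o))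
    rw [hfo]
    have := h₂ (t - B.τ) (abs_lt.2 ⟨by linarith [ht.1], by linarith [ht.2]⟩)
    rwa [show t - B.τ + 2 * B.τ = t + B.τ by ring] at this
  have e5 := ev (a := B.τ + δ) (b := B.τ + δ) hcp.neg fun t ht => by
    obtain rfl : t = B.τ + δ := le_antisymm ht.2 ht.1
    change 0 < -p₁ (M.Φ _ 0 o)
    rw [hpo]
    rw [show B.τ + δ + B.τ = δ + 2 * B.τ by ring, (s.periodic hK1 δ).2]
    linarith [s.neg δ ⟨hδ, by linarith⟩]
  have e6 := ev (a := δ) (b := B.τ + δ) (hcq.sub (continuous_const (y := S.w₁))) fun t ht => by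
    change 0 < q₁ (M.Φ t 0 o) - S.w₁
    rw [hqo]
    exact sub_pos.2 (hlt t ⟨by linarith [ht.1], by linarith [ht.2]⟩)
  have e7 : ∀ᶠ x : ℝ × Phase in 𝓝 (0, o), ∀ t ∈ Icc 0 δ,
      q₂ x.2 = S.w₂ → 0 < p₂ x.2 * p₂ (M.Φ t x.1 x.2) := by
    refine isCompact_Icc.eventually_forall_of_forall_eventually fun t ht => ?_
    by_cases hw : M.angQ θ B.aS = S.w₂
    · have hc : Continuous fun x : (ℝ × Phase) × ℝ => p₂ x.1.2 * p₂ (M.Φ x.2 x.1.1 x.1.2) :=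
        (continuous_p2.comp (by fun_prop)).mul hcp2
      refine (hc.continuousAt.eventually (lt_mem_nhds ?_)).mono fun x hx _ => hx
      simp only
      rw [ho, (Φ_zero_vertical B.aS_mem θ _ _ t).2, (angQ_add B.aS θ t B.aS_mem).2]
      change 0 < M.angP θ B.aS * _
      set v := M.half B.aS * θ / π
      have hE := (halfSwing B.aS_mem).energy v
      change M.Q B.aS v = S.w₂ at hw
      change 0 < M.P B.aS v * _
      rw [hw] at hE
      have hv : M.P B.aS v ^ 2 = 2 * g := by rw [hg]; linarith
      have hdiff := (convex_univ (𝕜 := ℝ) (E := ℝ)).norm_image_sub_le_of_norm_hasDerivWithin_le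
        (f := M.P B.aS) (C := A) (fun x _ => ((M.motion B.aS).dp x).hasDerivWithinAt)
        (fun x _ => hA _ (Ioo_subset_Icc_self (Q_mem B.aS_mem x).2)) (mem_univ v) (mem_univ (t + v))
      rw [add_sub_cancel_right, Real.norm_eq_abs, Real.norm_eq_abs, abs_of_nonneg ht.1] at hdiff
      have h6 : |M.P B.aS (t + v) - M.P B.aS v| < √(2 * g) :=
        (hdiff.trans (mul_le_mul_of_nonneg_left (ht.2.trans (hδle.trans l3.le)) hA0)).trans_lt h3
      have h7 : |M.P B.aS v| = √(2 * g) := by rw [← hv, Real.sqrt_sq_eq_abs]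
      rw [← h7] at h6
      rcases lt_or_ge (M.P B.aS v) 0 with h8 | h8
      · rw [abs_of_neg h8, abs_lt] at h6; exact mul_pos_of_neg_of_neg h8 (by linarith [h6.2])
      · have h9 : 0 < M.P B.aS v := lt_of_le_of_ne h8 fun h0 => by rw [← h0] at hv; nlinarith
        rw [abs_of_pos h9, abs_lt] at h6; exact mul_pos h9 (by linarith [h6.1])
    · have hc : Continuous fun x : (ℝ × Phase) × ℝ => q₂ x.1.2 := continuous_q2.comp (by fun_prop)
      exact ((hc.continuousAt (x := ((0, o), t))).eventually_ne (show q₂ o ≠ S.w₂ from hw)).mono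
        fun x hx h0 => absurd h0 hx
  filter_upwards [e1, e2, e3, e4, e5, e6, e7] with x x1 x2 x3 x4 x5 x6 x7
  exact ⟨x1, x2, x3, fun t ht => neg_pos.1 (x4 t ht), neg_pos.1 (x5 _ ⟨le_rfl, le_rfl⟩),
    fun t ht => sub_pos.1 (x6 t ht), fun h0 t ht => x7 t ht h0⟩

end Model

end OscStep

/-! ### Level crossings of a family of strictly concave functions -/

lemma continuous_of_unique_mem {X : Type*} [TopologicalSpace X] {α β : ℝ} {T : X → ℝ}
    {R : X → ℝ → Prop} (hR : IsClosed {p : X × Icc α β | R p.1 p.2}) (hT : ∀ x, T x ∈ Icc α β)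
    (hiff : ∀ x, ∀ t ∈ Icc α β, R x t ↔ t = T x) : Continuous T := by
  rw [continuous_iff_isClosed]
  intro F hF
  have h1 : IsClosed ({p : X × Icc α β | R p.1 p.2} ∩ {p | (p.2 : ℝ) ∈ F}) :=
    hR.inter (hF.preimage (continuous_subtype_val.comp continuous_snd))
  have h2 := isClosedMap_fst_of_compactSpace _ h1
  convert h2 using 1
  ext x
  constructor
  · intro hx
    exact ⟨(x, ⟨T x, hT x⟩), ⟨(hiff x _ (hT x)).2 rfl, hx⟩, rfl⟩
  · rintro ⟨⟨x', t⟩, ⟨h3, h4⟩, rfl⟩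
    have h3' := (hiff x' t t.2).1 h3
    have h4' : (t : ℝ) ∈ F := h4
    rw [h3'] at h4'
    exact h4'

lemma pos_on_of_ne_zero {f : ℝ → ℝ} {a b c : ℝ} (hf : ContinuousOn f (Ioo a b))
    (h0 : ∀ x ∈ Ioo a b, f x ≠ 0) (hc : c ∈ Ioo a b) (hpos : 0 < f c) {x : ℝ} (hx : x ∈ Ioo a b) :
    0 < f x := by
  by_contra! hle
  obtain ⟨y, hy, hy0⟩ := isPreconnected_Ioo.intermediate_value hx hc hf ⟨hle, hpos.le⟩
  exact h0 y hy hy0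

/-- A family `B · θ` of strictly concave functions on `[α, β]` with derivative `D · θ` which depends
little on `θ`. -/
structure ConcaveFamily (B D : ℝ → ℝ → ℝ) (α β c μ L Δ : ℝ) : Prop where
  αβ : α < β
  μ_nonneg : 0 ≤ μ
  L_nonneg : 0 ≤ L
  small : μ * L < c / 2
  Δ_nonneg : 0 ≤ Δ
  B_cont : Continuous fun p : ℝ × Icc α β => B p.2 p.1
  D_cont : Continuous fun p : ℝ × Icc α β => D p.2 p.1
  deriv : ∀ θ, ∀ t ∈ Icc α β, HasDerivAt (fun t => B t θ) (D t θ) t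
  anti : ∀ θ, ∀ t ∈ Icc α β, ∀ t' ∈ Icc α β, t ≤ t' → c * (t' - t) ≤ D t θ - D t' θ
  lip : ∀ t ∈ Icc α β, ∀ θ θ', |D t θ - D t θ'| ≤ μ * |θ - θ'|
  low : ∀ θ, ∃ t ∈ Icc α β, B α θ < B t θ - Δ ∧ B β θ < B t θ - Δ
  per : ∀ t ∈ Icc α β, ∀ θ, B t (θ + 2 * π) = B t θ

namespace ConcaveFamily

variable {B D : ℝ → ℝ → ℝ} {α β c μ L Δ : ℝ} (F : ConcaveFamily B D α β c μ L Δ)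
include F

lemma c_pos : 0 < c := by
  have := mul_nonneg F.μ_nonneg F.L_nonneg
  have := F.small
  linarith

lemma contOn (θ : ℝ) : ContinuousOn (fun t => B t θ) (Icc α β) := fun t ht =>
  (F.deriv θ t ht).continuousAt.continuousWithinAt

/-- The time reversed family. -/
lemma reverse : ConcaveFamily (fun t θ => B (-t) θ) (fun t θ => -D (-t) θ) (-β) (-α) c μ L Δ := by
  have hm {t : ℝ} (ht : t ∈ Icc (-β) (-α)) : -t ∈ Icc α β := ⟨by linarith [ht.2], by linarith [ht.1]⟩
  have hc : Continuous fun p : ℝ × Icc (-β) (-α) => ((p.1, ⟨-(p.2 : ℝ), hm p.2.2⟩) : ℝ × Icc α β) := by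
    fun_prop
  refine ⟨by linarith [F.αβ], F.μ_nonneg, F.L_nonneg, F.small, F.Δ_nonneg, F.B_cont.comp hc,
    (F.D_cont.comp hc).neg, fun θ t ht => ?_, fun θ t ht t' ht' h => ?_, fun t ht θ θ' => ?_,
    fun θ => ?_, fun t ht θ => F.per _ (hm ht) _⟩
  · have := (F.deriv θ (-t) (hm ht)).scomp t (hasDerivAt_neg t)
    simpa [Function.comp_def] using this
  · have := F.anti θ (-t') (hm ht') (-t) (hm ht) (by linarith)
    linarith
  · rw [show -D (-t) θ - -D (-t) θ' = -(D (-t) θ - D (-t) θ') by ring, abs_neg]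
    exact F.lip _ (hm ht) θ θ'
  · obtain ⟨t, ht, h1, h2⟩ := F.low θ
    exact ⟨-t, ⟨by linarith [ht.2], by linarith [ht.1]⟩, by simpa using ⟨h2, h1⟩⟩

/-- The maximum and where it is attained. -/
lemma exists_max : ∃ Mx tm : ℝ → ℝ, Continuous Mx ∧ (∀ θ, Mx (θ + 2 * π) = Mx θ) ∧
    (∀ θ, tm θ ∈ Ioo α β ∧ D (tm θ) θ = 0 ∧ B (tm θ) θ = Mx θ) ∧
    (∀ θ, ∀ t ∈ Icc α β, B t θ ≤ Mx θ) ∧ (∀ θ, B α θ < Mx θ - Δ ∧ B β θ < Mx θ - Δ) := by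
  have hmax (θ : ℝ) : ∃ t ∈ Icc α β, ∀ s ∈ Icc α β, B s θ ≤ B t θ := by
    obtain ⟨t, ht, h⟩ := isCompact_Icc.exists_isMaxOn ⟨α, le_rfl, F.αβ.le⟩ (F.contOn θ)
    exact ⟨t, ht, fun s hs => h hs⟩
  choose tm htm hle using hmax
  have hlow (θ : ℝ) : B α θ < B (tm θ) θ - Δ ∧ B β θ < B (tm θ) θ - Δ := by
    obtain ⟨t, ht, h1, h2⟩ := F.low θ
    have := hle θ t ht
    constructor <;> linarith
  have hΔ := F.Δ_nonneg
  have hin (θ : ℝ) : tm θ ∈ Ioo α β := by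
    refine ⟨lt_of_le_of_ne (htm θ).1 fun h => ?_, lt_of_le_of_ne (htm θ).2 fun h => ?_⟩
    · have := (hlow θ).1; rw [← h] at this; linarith
    · have := (hlow θ).2; rw [h] at this; linarith
  refine ⟨fun θ => B (tm θ) θ, tm, ?_, fun θ => ?_, fun θ => ⟨hin θ, ?_, rfl⟩, hle, hlow⟩
  · have h1 : Continuous fun θ => sSup ((fun t : Icc α β => B t θ) '' univ) :=
      isCompact_univ.continuous_sSup (f := fun θ (t : Icc α β) => B t θ) F.B_cont
    convert h1 using 2 with θ
    have h2 : IsGreatest ((fun t : Icc α β => B t θ) '' univ) (B (tm θ) θ) := by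
      refine ⟨⟨⟨tm θ, htm θ⟩, mem_univ _, rfl⟩, ?_⟩
      rintro _ ⟨t, -, rfl⟩
      exact hle θ t t.2
    exact h2.csSup_eq.symm
  · have hp := fun θ' => F.per _ (htm θ') θ
    refine le_antisymm ((hp _).trans_le (hle θ _ (htm _))) ?_
    have := hle (θ + 2 * π) _ (htm θ)
    rwa [hp] at this
  · have h1 : IsLocalMax (fun t => B t θ) (tm θ) := by
      filter_upwards [Icc_mem_nhds (hin θ).1 (hin θ).2] with s hs using hle θ s hs
    exact h1.hasDerivAt_eq_zero (F.deriv θ _ (htm θ))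

variable {Mx tm : ℝ → ℝ}
  (htm : ∀ θ, tm θ ∈ Ioo α β ∧ D (tm θ) θ = 0 ∧ B (tm θ) θ = Mx θ)
  (hle : ∀ θ, ∀ t ∈ Icc α β, B t θ ≤ Mx θ) (hlow : ∀ θ, B α θ < Mx θ - Δ ∧ B β θ < Mx θ - Δ)

lemma D_lt {θ t t' : ℝ} (ht : t ∈ Icc α β) (ht' : t' ∈ Icc α β) (h : t < t') : D t' θ < D t θ := by
  have h1 := F.anti θ t ht t' ht' h.le
  have h2 := mul_pos F.c_pos (sub_pos.2 h)
  linarith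

include htm in
lemma D_pos_iff {θ t : ℝ} (ht : t ∈ Icc α β) : (0 < D t θ ↔ t < tm θ) ∧ (0 ≤ D t θ ↔ t ≤ tm θ) := by
  obtain ⟨h1, h2, -⟩ := htm θ
  have h1' := Ioo_subset_Icc_self h1
  rcases lt_trichotomy t (tm θ) with h | h | h
  · have := F.D_lt (θ := θ) ht h1' h
    rw [h2] at this
    exact ⟨⟨fun _ => h, fun _ => this⟩, ⟨fun _ => h.le, fun _ => this.le⟩⟩
  · rw [h, h2]; simp
  · have := F.D_lt (θ := θ) h1' ht h
    rw [h2] at this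
    exact ⟨⟨fun h' => absurd h' (not_lt.2 this.le), fun h' => absurd h' (not_lt.2 h.le)⟩,
      ⟨fun h' => absurd h' (not_le.2 this), fun h' => absurd h' (not_le.2 h)⟩⟩

include htm in
lemma strictMonoOn_left (θ : ℝ) : StrictMonoOn (fun t => B t θ) (Icc α (tm θ)) := by
  have hs : Icc α (tm θ) ⊆ Icc α β := Icc_subset_Icc_right (htm θ).1.2.le
  exact strictMonoOn_Icc (fun t ht => F.deriv θ t (hs ht)) fun t ht =>
    (F.D_pos_iff htm (hs (Ioo_subset_Icc_self ht))).1.2 ht.2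

include htm hlow in
/-- Crossing of a level below the maximum, before the maximum. -/
lemma exists_left : ∃ tl : ℝ → ℝ → ℝ, ∀ k ∈ Icc (-Δ) 0, (Continuous Mx → Continuous tm →
      Continuous (tl k)) ∧ ∀ θ,
    tl k θ ∈ Ioc α (tm θ) ∧ B (tl k θ) θ = Mx θ + k ∧ (k < 0 → tl k θ < tm θ) ∧
    ∀ t ∈ Icc α (tm θ), (Mx θ + k ≤ B t θ ↔ tl k θ ≤ t) ∧ (B t θ = Mx θ + k ↔ t = tl k θ) := by
  have hex (k θ : ℝ) : k ∈ Icc (-Δ) 0 → ∃ t ∈ Icc α (tm θ), B t θ = Mx θ + k := fun hk => by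
    have hs : Icc α (tm θ) ⊆ Icc α β := Icc_subset_Icc_right (htm θ).1.2.le
    have := intermediate_value_Icc (htm θ).1.1.le ((F.contOn θ).mono hs)
    obtain ⟨t, ht, h⟩ := this (show Mx θ + k ∈ Icc (B α θ) (B (tm θ) θ) from
      ⟨by linarith [(hlow θ).1, hk.1], by rw [(htm θ).2.2]; linarith [hk.2]⟩)
    exact ⟨t, ht, h⟩
  choose! tl h1 h2 using hex
  have hiff (k) (hk : k ∈ Icc (-Δ) 0) (θ t) (ht : t ∈ Icc α (tm θ)) :
      (Mx θ + k ≤ B t θ ↔ tl k θ ≤ t) ∧ (B t θ = Mx θ + k ↔ t = tl k θ) := by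
    have hm := F.strictMonoOn_left htm θ
    rw [← h2 k θ hk]
    exact ⟨hm.le_iff_le (h1 k θ hk) ht, hm.injOn.eq_iff ht (h1 k θ hk)⟩
  refine ⟨tl, fun k hk => ⟨fun hMc htc => ?_, fun θ => ⟨⟨lt_of_le_of_ne (h1 k θ hk).1 fun h => ?_,
    (h1 k θ hk).2⟩, h2 k θ hk, fun h0 => lt_of_le_of_ne (h1 k θ hk).2 fun h => ?_, hiff k hk θ⟩⟩⟩
  · refine continuous_of_unique_mem (α := α) (β := β)
      (R := fun θ t => B t θ = Mx θ + k ∧ t ≤ tm θ) ?_ (fun θ => ?_) fun θ t ht => ?_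
    · exact (isClosed_eq F.B_cont ((hMc.comp continuous_fst).add continuous_const)).inter
        (isClosed_le (continuous_subtype_val.comp continuous_snd) (htc.comp continuous_fst))
    · exact ⟨(h1 k θ hk).1, (h1 k θ hk).2.trans (htm θ).1.2.le⟩
    · constructor
      · rintro ⟨h3, h4⟩; exact (hiff k hk θ t ⟨ht.1, h4⟩).2.1 h3
      · rintro rfl; exact ⟨h2 k θ hk, (h1 k θ hk).2⟩
  · have := h2 k θ hk; rw [← h] at this; linarith [(hlow θ).1, hk.1]
  · have := h2 k θ hk; rw [h, (htm θ).2.2] at this; linarith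

include htm in
lemma continuous_tm : Continuous tm := by
  refine continuous_of_unique_mem (α := α) (β := β) (R := fun θ t => D t θ = 0) ?_
    (fun θ => Ioo_subset_Icc_self (htm θ).1) fun θ t ht => ?_
  · exact isClosed_eq F.D_cont continuous_const
  · constructor
    · intro h
      have := F.D_pos_iff htm (θ := θ) ht
      rw [h] at this
      simp only [lt_irrefl, le_refl, false_iff, not_lt, true_iff] at this
      exact le_antisymm this.2 this.1
    · rintro rfl; exact (htm θ).2.1

include htm hle in
/-- Along a curve `θ = g t` the depth below the maximum is strictly monotone before the maximum. -/
lemma depth_lt {g : ℝ → ℝ} (hg : ∀ t ∈ Icc α β, ∀ t' ∈ Icc α β, |g t - g t'| ≤ L * |t - t'|) {t1 t2 : ℝ}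
    (h₁ : t1 ∈ Icc α β) (h₂ : t2 ∈ Icc α β) (h : t1 < t2) (hD : t2 ≤ tm (g t2)) :
    B t1 (g t1) - Mx (g t1) < B t2 (g t2) - Mx (g t2) := by
  set θ1 := g t1
  set θ2 := g t2
  set s := tm θ2 with hs
  have hsI : s ∈ Icc α β := Ioo_subset_Icc_self (htm θ2).1
  have hD2 : c * (s - t2) ≤ D t2 θ2 := by
    have := F.anti θ2 t2 h₂ s hsI hD
    rw [(htm θ2).2.1] at this; linarith
  have hθ : |θ1 - θ2| ≤ L * (t2 - t1) := by
    have := hg t1 h₁ t2 h₂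
    rwa [abs_sub_comm t1, abs_of_pos (sub_pos.2 h)] at this
  have hμ (t) (ht : t ∈ Icc α β) : |D t θ1 - D t θ2| ≤ μ * L * (t2 - t1) :=
    (F.lip t ht θ1 θ2).trans (by
      rw [mul_assoc]; exact mul_le_mul_of_nonneg_left hθ F.μ_nonneg)
  -- the increment of `B · θ1` from `t1` to `t2`
  have e1 : D t2 θ1 * (t2 - t1) + c / 2 * (t2 - t1) ^ 2 ≤ B t2 θ1 - B t1 θ1 := by
    have hsub : Icc t1 t2 ⊆ Icc α β := Icc_subset_Icc h₁.1 h₂.2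
    have hd (t) (ht : t ∈ Icc t1 t2) : HasDerivAt
        (fun t => B t θ1 + c / 2 * t ^ 2 - (D t2 θ1 + c * t2) * t)
        (D t θ1 + c * t - (D t2 θ1 + c * t2)) t := by
      have := ((F.deriv θ1 t (hsub ht)).add (((hasDerivAt_id t).pow 2).const_mul (c / 2))).sub
        ((hasDerivAt_id t).const_mul (D t2 θ1 + c * t2))
      refine this.congr_deriv ?_
      simp; ring
    have := monotoneOn_Icc hd (fun t ht => by
      have := F.anti θ1 t (hsub (Ioo_subset_Icc_self ht)) t2 h₂ ht.2.le
      linarith) ⟨le_rfl, h.le⟩ ⟨h.le, le_rfl⟩ h.le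
    simp only at this
    nlinarith
  -- the change of the increment from `t2` to `s`
  have e2 : (B s θ2 - B t2 θ2) - (B s θ1 - B t2 θ1) ≤ μ * L * (t2 - t1) * (s - t2) := by
    have hsub : Icc t2 s ⊆ Icc α β := Icc_subset_Icc h₂.1 hsI.2
    have hd (t) (ht : t ∈ Icc t2 s) : HasDerivAt
        (fun t => μ * L * (t2 - t1) * t - (B t θ2 - B t θ1)) (μ * L * (t2 - t1) - (D t θ2 - D t θ1)) t := by
      have := ((hasDerivAt_id t).const_mul (μ * L * (t2 - t1))).sub
        ((F.deriv θ2 t (hsub ht)).sub (F.deriv θ1 t (hsub ht)))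
      exact this.congr_deriv (by ring)
    have := monotoneOn_Icc hd (fun t ht => by
      linarith [(abs_le.1 (hμ t (hsub (Ioo_subset_Icc_self ht)))).1]) ⟨le_rfl, hD⟩ ⟨hD, le_rfl⟩ hD
    simp only at this
    linarith
  have e3 := hle θ1 s hsI
  have e4 := (htm θ2).2.2
  have e5 := (abs_le.1 (hμ t2 h₂)).1
  have hpos := sub_pos.2 h
  have hsm := F.small
  have hc := F.c_pos
  have e6 : 0 ≤ (c - μ * L) * ((s - t2) * (t2 - t1)) :=
    mul_nonneg (by linarith) (mul_nonneg (sub_nonneg.2 hD) hpos.le)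
  have e7 : 0 < (c / 2 - μ * L) * (t2 - t1) ^ 2 := mul_pos (by linarith) (by positivity)
  have e8 : (c * (s - t2) - μ * L * (t2 - t1)) * (t2 - t1) ≤ D t2 θ1 * (t2 - t1) :=
    mul_le_mul_of_nonneg_right (by linarith) hpos.le
  rw [← hs] at e4
  nlinarith

include htm in
/-- Along a curve `θ = g t` the maximum is passed once. -/
lemma drift {g : ℝ → ℝ} (hg : ∀ t ∈ Icc α β, ∀ t' ∈ Icc α β, |g t - g t'| ≤ L * |t - t'|) {t1 t2 : ℝ}
    (h₁ : t1 ∈ Icc α β) (h₂ : t2 ∈ Icc α β) (h : t1 < t2) (hD : t2 ≤ tm (g t2)) : t1 < tm (g t1) := by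
  have h3 := F.anti (g t1) t1 h₁ t2 h₂ h.le
  have h4 := F.lip t2 h₂ (g t1) (g t2)
  have h5 := (F.D_pos_iff htm h₂).2.2 hD
  have h6 := hg t1 h₁ t2 h₂
  rw [abs_sub_comm t1, abs_of_pos (sub_pos.2 h)] at h6
  have h7 := mul_le_mul_of_nonneg_left h6 F.μ_nonneg
  have h8 := (abs_le.1 h4).1
  have h9 := F.small
  have h10 := F.c_pos
  refine (F.D_pos_iff htm h₁).1.1 ?_
  have h11 : μ * (L * (t2 - t1)) < c * (t2 - t1) := by
    rw [← mul_assoc]; exact mul_lt_mul_of_pos_right (by linarith) (sub_pos.2 h)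
  linarith

include htm hle hlow in
/-- On each level there is exactly one point of the curve `θ = g t` before the maximum. -/
lemma exists_corner (hMc : Continuous Mx) {g : ℝ → ℝ} (hgc : ContinuousOn g (Icc α β))
    (hg : ∀ t ∈ Icc α β, ∀ t' ∈ Icc α β, |g t - g t'| ≤ L * |t - t'|) :
    ∃ T : ℝ → ℝ, ContinuousOn T (Icc (-Δ) 0) ∧ ∀ k ∈ Icc (-Δ) 0, T k ∈ Icc α β ∧
      ∀ t ∈ Icc α β, (t ≤ tm (g t) ∧ B t (g t) = Mx (g t) + k) ↔ t = T k := by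
  have htmc := F.continuous_tm htm
  have hgc' : Continuous fun t : Icc α β => g t := continuousOn_iff_continuous_domRestrict.1 hgc
  set κ : ℝ → ℝ := fun t => B t (g t) - Mx (g t) with hκ
  have hκc : ContinuousOn κ (Icc α β) := by
    rw [continuousOn_iff_continuous_domRestrict]
    exact (F.B_cont.comp (hgc'.prodMk continuous_id)).sub (hMc.comp hgc')
  -- the last time before the maximum
  obtain ⟨t0, ht₀, h₀⟩ : ∃ t ∈ Icc α β, tm (g t) = t := by
    have hc : ContinuousOn (fun t => tm (g t) - t) (Icc α β) :=
      (htmc.comp_continuousOn hgc).sub continuousOn_id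
    obtain ⟨t, ht, h⟩ := intermediate_value_Icc' F.αβ.le hc (show (0 : ℝ) ∈ Icc _ _ from
      ⟨by linarith [(htm (g β)).1.2], by linarith [(htm (g α)).1.1]⟩)
    exact ⟨t, ht, by linarith⟩
  have hκ0 : κ t0 = 0 := by
    have := (htm (g t0)).2.2
    rw [h₀] at this
    simp only [hκ]; linarith
  have hex (k) (hk : k ∈ Icc (-Δ) 0) : ∃ t ∈ Icc α t0, κ t = k := by
    have := intermediate_value_Icc ht₀.1 (hκc.mono (Icc_subset_Icc_right ht₀.2))
    obtain ⟨t, ht, h⟩ := this (show k ∈ Icc (κ α) (κ t0) from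
      ⟨by have := (hlow (g α)).1; simp only [hκ]; linarith [hk.1], by rw [hκ0]; exact hk.2⟩)
    exact ⟨t, ht, h⟩
  choose! T hT1 hT2 using hex
  have hTI (k) (hk : k ∈ Icc (-Δ) 0) : T k ∈ Icc α β := ⟨(hT1 k hk).1, (hT1 k hk).2.trans ht₀.2⟩
  have hTl (k) (hk : k ∈ Icc (-Δ) 0) : T k ≤ tm (g (T k)) := by
    rcases (hT1 k hk).2.eq_or_lt with h | h
    · rw [h, h₀]
    · exact (F.drift htm hg (hTI k hk) ht₀ h h₀.ge).le
  have huniq (k) (hk : k ∈ Icc (-Δ) 0) (t) (ht : t ∈ Icc α β) :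
      (t ≤ tm (g t) ∧ B t (g t) = Mx (g t) + k) ↔ t = T k := by
    constructor
    · rintro ⟨h1, h2⟩
      have h3 : κ t = k := by simp only [hκ]; linarith
      rcases lt_trichotomy t (T k) with h | h | h
      · have := F.depth_lt htm hle hg ht (hTI k hk) h (hTl k hk)
        exact absurd (h3.trans (hT2 k hk).symm) this.ne
      · exact h
      · have := F.depth_lt htm hle hg (hTI k hk) ht h h1
        exact absurd (h3.trans (hT2 k hk).symm) this.ne'
    · rintro rfl
      have := hT2 k hk
      simp only [hκ] at this
      exact ⟨hTl k hk, by linarith⟩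
  refine ⟨T, ?_, fun k hk => ⟨hTI k hk, huniq k hk⟩⟩
  rw [continuousOn_iff_continuous_domRestrict]
  refine continuous_of_unique_mem (X := Icc (-Δ) 0) (α := α) (β := β)
    (R := fun k t => t ≤ tm (g t) ∧ B t (g t) = Mx (g t) + k) ?_ (fun k => hTI k k.2)
    fun k t ht => huniq k k.2 t ht
  have hg2 : Continuous fun p : Icc (-Δ) 0 × Icc α β => g p.2 := hgc'.comp continuous_snd
  exact (isClosed_le (continuous_subtype_val.comp continuous_snd) (htmc.comp hg2)).inter
    (isClosed_eq (F.B_cont.comp (hg2.prodMk continuous_snd))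
      ((hMc.comp hg2).add (continuous_subtype_val.comp continuous_fst)))

end ConcaveFamily

namespace OscStep

open Oscillator StepSystem

/-- A concave family together with a function `y` with two zeros on each circle. -/
structure CornerFamily (B D y : ℝ → ℝ → ℝ) (α β c μ L Δ : ℝ) (θp θm : ℝ → ℝ) (m0 m1 : ℝ) : Prop
    extends ConcaveFamily B D α β c μ L Δ where
  y_cont : Continuous fun p : ℝ × Icc α β => y p.2 p.1
  y_per : ∀ t ∈ Icc α β, ∀ θ, y t (θ + 2 * π) = y t θ
  lip_p : ∀ t ∈ Icc α β, ∀ t' ∈ Icc α β, |θp t - θp t'| ≤ L * |t - t'|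
  lip_m : ∀ t ∈ Icc α β, ∀ t' ∈ Icc α β, |θm t - θm t'| ≤ L * |t - t'|
  anti_p : StrictAntiOn θp (Icc α β)
  anti_m : StrictAntiOn θm (Icc α β)
  range : ∀ t ∈ Icc α β, θp t < m0 ∧ m0 < θm t ∧ θm t < m1 ∧ m1 < θp t + 2 * π
  y_zero : ∀ t ∈ Icc α β, y t (θp t) = 0 ∧ y t (θm t) = 0
  y_pos : ∀ t ∈ Icc α β, ∀ θ ∈ Ioo (θp t) (θm t), 0 < y t θ
  y_neg : ∀ t ∈ Icc α β, ∀ θ ∈ Ioo (θm t) (θp t + 2 * π), y t θ < 0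

/-- The geometry of level crossings: `tm` is the time of the maximum `Mx`, `tl` and `tr` are the times at
which the depth `k` is crossed, and `x` are the corner points. -/
structure Corners (B D y : ℝ → ℝ → ℝ) (α β Δ : ℝ) (θp θm Mx tm : ℝ → ℝ) (tl tr : ℝ → ℝ → ℝ)
    (x : Label → ℝ → ℝ) : Prop where
  Mx_cont : Continuous Mx
  Mx_per : ∀ θ, Mx (θ + 2 * π) = Mx θ
  tm_mem : ∀ θ, tm θ ∈ Ioo α β ∧ D (tm θ) θ = 0 ∧ B (tm θ) θ = Mx θ
  le_Mx : ∀ θ, ∀ t ∈ Icc α β, B t θ ≤ Mx θ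
  D_pos_iff : ∀ θ, ∀ t ∈ Icc α β, (0 < D t θ ↔ t < tm θ) ∧ (0 ≤ D t θ ↔ t ≤ tm θ)
  cross : ∀ k ∈ Icc (-Δ) 0, ∀ θ, α < tl k θ ∧ tl k θ ≤ tm θ ∧ tm θ ≤ tr k θ ∧ tr k θ < β ∧
    (k < 0 → tl k θ < tm θ ∧ tm θ < tr k θ) ∧ B (tl k θ) θ = Mx θ + k ∧ B (tr k θ) θ = Mx θ + k
  cross_iff : ∀ k ∈ Icc (-Δ) 0, ∀ θ, ∀ t ∈ Icc α β, Mx θ + k ≤ B t θ ↔ t ∈ Icc (tl k θ) (tr k θ)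
  cross_eq : ∀ k ∈ Icc (-Δ) 0, ∀ θ, ∀ t ∈ Icc α β, B t θ = Mx θ + k → t = tl k θ ∨ t = tr k θ
  y_zero_iff : ∀ t ∈ Icc α β, ∀ θ, y t θ = 0 → (θ : Angle) = θp t ∨ (θ : Angle) = θm t
  x_cont : ∀ b, ContinuousOn (x b) (Icc (-Δ) 0)
  corner : ∀ k ∈ Icc (-Δ) 0, ∀ θ : ℝ, ((θ : Angle) = x .R k ↔ (θ : Angle) = θp (tl k θ)) ∧
    ((θ : Angle) = x .one k ↔ (θ : Angle) = θm (tl k θ)) ∧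
    ((θ : Angle) = x .zero k ↔ (θ : Angle) = θm (tr k θ))
  order : ∀ k ∈ Ioo (-Δ) 0, x .R k < x .zero k ∧ x .zero k < x .one k ∧ x .one k < x .R k + 2 * π
  arcs : ∀ k ∈ Ioo (-Δ) 0, ∀ θ : ℝ,
    ((θ : Angle) ∈ cIoo (x .one k : Angle) (x .R k) ↔ y (tl k θ) θ < 0) ∧
    ((θ : Angle) ∈ cIoo (x .R k : Angle) (x .zero k) ↔
      0 < y (tl k θ) θ ∧ 0 < y (tr k θ) θ) ∧
    ((θ : Angle) ∈ cIoo (x .zero k : Angle) (x .one k) ↔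
      0 < y (tl k θ) θ ∧ y (tr k θ) θ < 0)

lemma continuousOn_of_lip {f : ℝ → ℝ} {s : Set ℝ} {L : ℝ} (hL : 0 ≤ L)
    (h : ∀ t ∈ s, ∀ t' ∈ s, |f t - f t'| ≤ L * |t - t'|) : ContinuousOn f s :=
  (LipschitzOnWith.of_dist_le_mul (K := ⟨L, hL⟩) fun x hx y hy => by
    rw [Real.dist_eq, Real.dist_eq]; exact h x hx y hy).continuousOn

lemma periodic_int {f : ℝ → ℝ} (h : ∀ θ, f (θ + 2 * π) = f θ) {θ θ' : ℝ}
    (hθ : (θ : Angle) = θ') : f θ = f θ' := by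
  obtain ⟨n, hn⟩ := Angle.angle_eq_iff_two_pi_dvd_sub.1 hθ
  have h1 : Function.Periodic f (2 * π) := h
  have h2 := h1.int_mul n θ'
  rw [← h2]; congr 1; linarith

lemma eq_of_coe_eq {u v a : ℝ} (h : (u : Angle) = v) (hu : u ∈ Ico a (a + 2 * π))
    (hv : v ∈ Ico a (a + 2 * π)) : u = v := by
  obtain ⟨n, hn⟩ := Angle.angle_eq_iff_two_pi_dvd_sub.1 h
  have hpi := Real.pi_pos
  have h1 : (n : ℝ) < 1 := by
    by_contra! hge
    nlinarith [hu.2, hv.1]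
  have h2 : (-1 : ℝ) < n := by
    by_contra! hge
    nlinarith [hu.1, hv.2]
  have h3 : n = 0 := by
    have h1' : n < 1 := by exact_mod_cast h1
    have h2' : -1 < n := by exact_mod_cast h2
    omega
  rw [h3] at hn
  simp at hn
  linarith

lemma sign_on_arcs {f : ℝ → ℝ} (hf : Continuous f) {a b c d : ℝ}
    (h0 : ∀ v : ℝ, f v = 0 → (v : Angle) = a ∨ (v : Angle) = b) (hb : b < a + 2 * π)
    (hc : c ∈ Ioo a b) (hd : d ∈ Ioo b (a + 2 * π)) (hfc : 0 < f c) (hfd : f d < 0) :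
    (∀ v ∈ Ioo a b, 0 < f v) ∧ ∀ v ∈ Ioo b (a + 2 * π), f v < 0 := by
  have hab := hc.1.trans hc.2
  have key (v : ℝ) (hv : v ∈ Ioo a (a + 2 * π)) (hvb : v ≠ b) : f v ≠ 0 := fun h => by
    rcases h0 v h with h | h
    · exact hv.1.ne' (eq_of_coe_eq h ⟨hv.1.le, hv.2⟩ ⟨le_rfl, by linarith⟩)
    · exact hvb (eq_of_coe_eq h ⟨hv.1.le, hv.2⟩ ⟨hab.le, hb⟩)
  refine ⟨fun v hv => pos_on_of_ne_zero hf.continuousOn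
    (fun v hv => key v ⟨hv.1, hv.2.trans hb⟩ hv.2.ne) hc hfc hv, fun v hv => ?_⟩
  have := pos_on_of_ne_zero (f := fun v => -f v) hf.neg.continuousOn
    (fun v hv => neg_ne_zero.2 (key v ⟨hab.trans hv.1, hv.2⟩ hv.1.ne')) hd (neg_pos.2 hfd) hv
  linarith

lemma CornerFamily.exists_corners {B D y : ℝ → ℝ → ℝ} {α β c μ L Δ : ℝ} {θp θm : ℝ → ℝ} {m0 m1 : ℝ}
    (F : CornerFamily B D y α β c μ L Δ θp θm m0 m1) :
    ∃ Mx tm tl tr x, Corners B D y α β Δ θp θm Mx tm tl tr x := by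
  have G := F.toConcaveFamily
  obtain ⟨Mx, tm, hMc, hMper, htm, hle, hlow⟩ := G.exists_max
  have htmc := G.continuous_tm htm
  have G' := G.reverse
  have htm' : ∀ θ, -tm θ ∈ Ioo (-β) (-α) ∧ -D (- -tm θ) θ = 0 ∧ B (- -tm θ) θ = Mx θ := fun θ => by
    obtain ⟨h1, h2, h3⟩ := htm θ
    rw [neg_neg, h2, neg_zero]
    exact ⟨⟨by linarith [h1.2], by linarith [h1.1]⟩, rfl, h3⟩
  have hm {t : ℝ} (ht : t ∈ Icc (-β) (-α)) : -t ∈ Icc α β := ⟨by linarith [ht.2], by linarith [ht.1]⟩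
  have hm' {t : ℝ} (ht : t ∈ Icc α β) : -t ∈ Icc (-β) (-α) := ⟨by linarith [ht.2], by linarith [ht.1]⟩
  have hle' : ∀ θ, ∀ t ∈ Icc (-β) (-α), B (-t) θ ≤ Mx θ := fun θ t ht => hle θ _ (hm ht)
  have hlow' : ∀ θ, B (- -β) θ < Mx θ - Δ ∧ B (- -α) θ < Mx θ - Δ := fun θ => by
    simpa using (hlow θ).symm
  obtain ⟨tl, htl⟩ := G.exists_left htm hlow
  obtain ⟨tl', htl'⟩ := G'.exists_left htm' hlow'
  have hL := F.L_nonneg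
  have lip' {g : ℝ → ℝ} (hg : ∀ t ∈ Icc α β, ∀ t' ∈ Icc α β, |g t - g t'| ≤ L * |t - t'|) :
      ∀ t ∈ Icc (-β) (-α), ∀ t' ∈ Icc (-β) (-α), |g (-t) - g (-t')| ≤ L * |t - t'| := fun t ht t' ht' => by
    have := hg _ (hm ht) _ (hm ht')
    rwa [show -t - -t' = -(t - t') by ring, abs_neg] at this
  have hcp := continuousOn_of_lip hL F.lip_p
  have hcm := continuousOn_of_lip hL F.lip_m
  obtain ⟨Tp, hTpc, hTp⟩ := G.exists_corner htm hle hlow hMc hcp F.lip_p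
  obtain ⟨Tm, hTmc, hTm⟩ := G.exists_corner htm hle hlow hMc hcm F.lip_m
  obtain ⟨Tp', -, hTp'⟩ := G'.exists_corner htm' hle' hlow' hMc
    (continuousOn_of_lip hL (lip' F.lip_p)) (lip' F.lip_p)
  obtain ⟨Tm', hTmc', hTm'⟩ := G'.exists_corner htm' hle' hlow' hMc
    (continuousOn_of_lip hL (lip' F.lip_m)) (lip' F.lip_m)
  set tr : ℝ → ℝ → ℝ := fun k θ => -tl' k θ with htr
  -- crossings
  have hcross : ∀ k ∈ Icc (-Δ) 0, ∀ θ, α < tl k θ ∧ tl k θ ≤ tm θ ∧ tm θ ≤ tr k θ ∧ tr k θ < β ∧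
      (k < 0 → tl k θ < tm θ ∧ tm θ < tr k θ) ∧ B (tl k θ) θ = Mx θ + k ∧ B (tr k θ) θ = Mx θ + k := by
    intro k hk θ
    obtain ⟨h1, h2, h3, h4⟩ := (htl k hk).2 θ
    obtain ⟨h1', h2', h3', h4'⟩ := (htl' k hk).2 θ
    exact ⟨h1.1, h1.2, by simp only [htr]; linarith [h1'.2], by simp only [htr]; linarith [h1'.1],
      fun h => ⟨h3 h, by simp only [htr]; linarith [h3' h]⟩, h2, h2'⟩
  have hside : ∀ k ∈ Icc (-Δ) 0, ∀ θ, ∀ t ∈ Icc α β,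
      (t ≤ tm θ → (Mx θ + k ≤ B t θ ↔ tl k θ ≤ t) ∧ (B t θ = Mx θ + k ↔ t = tl k θ)) ∧
      (tm θ ≤ t → (Mx θ + k ≤ B t θ ↔ t ≤ tr k θ) ∧ (B t θ = Mx θ + k ↔ t = tr k θ)) := by
    intro k hk θ t ht
    refine ⟨fun h => ((htl k hk).2 θ).2.2.2 t ⟨ht.1, h⟩, fun h => ?_⟩
    have := ((htl' k hk).2 θ).2.2.2 (-t) ⟨(hm' ht).1, by linarith⟩
    rw [neg_neg] at this
    refine ⟨this.1.trans ?_, this.2.trans ?_⟩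
    · simp only [htr]; constructor <;> intro h <;> linarith
    · simp only [htr]; constructor <;> intro h <;> linarith
  have tlI : ∀ k ∈ Icc (-Δ) 0, ∀ θ, tl k θ ∈ Icc α β := fun k hk θ => by
    obtain ⟨h1, h2, h3, h4, -⟩ := hcross k hk θ
    exact ⟨h1.le, h2.trans (h3.trans h4.le)⟩
  have trI : ∀ k ∈ Icc (-Δ) 0, ∀ θ, tr k θ ∈ Icc α β := fun k hk θ => by
    obtain ⟨h1, h2, h3, h4, -⟩ := hcross k hk θ
    exact ⟨h1.le.trans (h2.trans h3), h4.le⟩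
  -- corner points on a branch
  have tm_per (θ : ℝ) : tm (θ + 2 * π) = tm θ := by
    have h1 := (htm (θ + 2 * π)).2.2
    rw [F.per _ (Ioo_subset_Icc_self (htm _).1), hMper] at h1
    have hk : (0 : ℝ) ∈ Icc (-Δ) 0 := ⟨by linarith [F.Δ_nonneg], le_rfl⟩
    have hI := Ioo_subset_Icc_self (htm (θ + 2 * π)).1
    have e1 := (hside 0 hk θ _ (Ioo_subset_Icc_self (htm θ).1))
    have e2 := hside 0 hk θ _ hI
    have h5 := (htm θ).2.2
    have f1 := ((e1.1 le_rfl).2).1 (by linarith)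
    have f2 := ((e1.2 le_rfl).2).1 (by linarith)
    rcases le_total (tm (θ + 2 * π)) (tm θ) with h | h
    · rw [((e2.1 h).2).1 (by linarith)]; exact f1.symm
    · rw [((e2.2 h).2).1 (by linarith)]; exact f2.symm
  have hl (k) (hk : k ∈ Icc (-Δ) 0) (θ : ℝ) : ∀ t ∈ Icc α β, (t ≤ tm θ ∧ B t θ = Mx θ + k) ↔ t = tl k θ :=
    fun t ht => ⟨fun h => (((hside k hk θ t ht).1 h.1).2).1 h.2, fun h =>
      h ▸ ⟨(hcross k hk θ).2.1, (hcross k hk θ).2.2.2.2.2.1⟩⟩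
  have hr (k) (hk : k ∈ Icc (-Δ) 0) (θ : ℝ) : ∀ t ∈ Icc α β, (tm θ ≤ t ∧ B t θ = Mx θ + k) ↔ t = tr k θ :=
    fun t ht => ⟨fun h => (((hside k hk θ t ht).2 h.1).2).1 h.2, fun h =>
      h ▸ ⟨(hcross k hk θ).2.2.1, (hcross k hk θ).2.2.2.2.2.2⟩⟩
  have branch_iff {R : ℝ → ℝ → Prop} {g f : ℝ → ℝ} {T k : ℝ} (hf : ∀ θ, f θ ∈ Icc α β)
      (hR : ∀ θ, ∀ t ∈ Icc α β, (R t (tm θ) ∧ B t θ = Mx θ + k) ↔ t = f θ) (hTI : T ∈ Icc α β)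
      (hT : ∀ t ∈ Icc α β, (R t (tm (g t)) ∧ B t (g t) = Mx (g t) + k) ↔ t = T) (θ : ℝ) :
      (θ : Angle) = g T ↔ (θ : Angle) = g (f θ) := by
    have key {t θ' : ℝ} (ht : t ∈ Icc α β) (h : (θ : Angle) = θ') :
        (R t (tm θ') ∧ B t θ' = Mx θ' + k) ↔ t = f θ := by
      rw [← hR θ t ht, periodic_int tm_per h, periodic_int hMper h, periodic_int (F.per _ ht) h]
    refine ⟨fun h => ?_, fun h => ?_⟩
    · rwa [← (key hTI h).1 ((hT T hTI).2 rfl)]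
    · rwa [← (hT _ (hf θ)).1 ((key (hf θ) h).2 rfl)]
  have reflect {g T : ℝ → ℝ} (hT : ∀ k ∈ Icc (-Δ) 0, T k ∈ Icc (-β) (-α) ∧ ∀ t ∈ Icc (-β) (-α),
      (t ≤ -tm (g (-t)) ∧ B (-t) (g (-t)) = Mx (g (-t)) + k) ↔ t = T k) (k) (hk : k ∈ Icc (-Δ) 0) :
      -T k ∈ Icc α β ∧ ∀ t ∈ Icc α β, (tm (g t) ≤ t ∧ B t (g t) = Mx (g t) + k) ↔ t = -T k := by
    refine ⟨hm (hT k hk).1, fun t ht => ?_⟩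
    rw [← neg_eq_iff_eq_neg, ← (hT k hk).2 _ (hm' ht), neg_neg, neg_le_neg_iff]
  replace hTp' := reflect hTp'
  replace hTm' := reflect hTm'
  set x : Label → ℝ → ℝ := fun b k => match b with
    | .R => θp (Tp k)
    | .zero => θm (-Tm' k)
    | .one => θm (Tm k)
  have cR (k) (hk : k ∈ Icc (-Δ) 0) := branch_iff (tlI k hk) (hl k hk) (hTp k hk).1 (hTp k hk).2
  have cO (k) (hk : k ∈ Icc (-Δ) 0) := branch_iff (tlI k hk) (hl k hk) (hTm k hk).1 (hTm k hk).2
  have cZ (k) (hk : k ∈ Icc (-Δ) 0) := branch_iff (R := (· ≥ ·)) (trI k hk) (hr k hk) (hTm' k hk).1 (hTm' k hk).2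
  have cW (k) (hk : k ∈ Icc (-Δ) 0) := branch_iff (R := (· ≥ ·)) (trI k hk) (hr k hk) (hTp' k hk).1 (hTp' k hk).2
  -- on a branch the left corner point precedes the right one in time
  have left_lt_right {g : ℝ → ℝ} {T T' k : ℝ}
      (hg : ∀ t ∈ Icc α β, ∀ t' ∈ Icc α β, |g t - g t'| ≤ L * |t - t'|)
      (hT : T ∈ Icc α β ∧ ∀ t ∈ Icc α β, (t ≤ tm (g t) ∧ B t (g t) = Mx (g t) + k) ↔ t = T)
      (hT' : T' ∈ Icc α β ∧ ∀ t ∈ Icc α β, (tm (g t) ≤ t ∧ B t (g t) = Mx (g t) + k) ↔ t = T')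
      (hk : k < 0) : T < T' := by
    obtain ⟨h1, h2⟩ := (hT.2 _ hT.1).2 rfl
    obtain ⟨h3, h4⟩ := (hT'.2 _ hT'.1).2 rfl
    by_contra! hge
    rcases hge.eq_or_lt with h | h
    · rw [h] at h3
      have h6 := (htm (g T)).2.2
      rw [← le_antisymm h1 h3, h2] at h6
      linarith
    · have := G.drift htm hg hT'.1 hT.1 h h1
      linarith
  have hpt (k) (hk : k ∈ Icc (-Δ) 0) := F.range _ (hTp k hk).1
  have hmt (k) (hk : k ∈ Icc (-Δ) 0) := F.range _ (hTm k hk).1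
  have hzt (k) (hk : k ∈ Icc (-Δ) 0) := F.range _ (hTm' k hk).1
  have hwt (k) (hk : k ∈ Icc (-Δ) 0) := F.range _ (hTp' k hk).1
  have horder : ∀ k ∈ Ioo (-Δ) 0, x .R k < x .zero k ∧ x .zero k < x .one k ∧
      x .one k < x .R k + 2 * π := fun k hk => by
    have hk' := Ioo_subset_Icc_self hk
    refine ⟨?_, F.anti_m (hTm k hk').1 (hTm' k hk').1
      (left_lt_right F.lip_m (hTm k hk') (hTm' k hk') hk.2), ?_⟩
    · exact (hpt k hk').1.trans (hzt k hk').2.1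
    · exact (hmt k hk').2.2.1.trans (hpt k hk').2.2.2
  have y_zero_iff (t) (ht : t ∈ Icc α β) (θ : ℝ) (h0 : y t θ = 0) :
      (θ : Angle) = θp t ∨ (θ : Angle) = θm t := by
    obtain ⟨v, hv1, hv2, hv⟩ := CircleArc.exists_lift (θp t) (θ : Angle)
    rw [periodic_int (F.y_per t ht) hv.symm] at h0
    rcases hv1.eq_or_lt with h | h
    · left; rw [← hv, h]
    · right
      rcases lt_trichotomy v (θm t) with h' | h' | h'
      · exact absurd h0 (F.y_pos t ht v ⟨h, h'⟩).ne'
      · rw [← hv, h']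
      · exact absurd h0 (F.y_neg t ht v ⟨h', hv2⟩).ne
  have tl_per (k) (hk : k ∈ Icc (-Δ) 0) {θ θ' : ℝ} (h : (θ : Angle) = θ') :
      tl k θ = tl k θ' ∧ tr k θ = tr k θ' := by
    have hlI := tlI k hk θ
    have hrI := trI k hk θ
    rw [← hl k hk θ' _ hlI, ← hr k hk θ' _ hrI, ← periodic_int tm_per h, ← periodic_int hMper h,
      ← periodic_int (F.per _ hlI) h, ← periodic_int (F.per _ hrI) h]
    exact ⟨(hl k hk θ _ hlI).2 rfl, (hr k hk θ _ hrI).2 rfl⟩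
  refine ⟨Mx, tm, tl, tr, x, hMc, hMper, htm, hle, fun θ t ht => G.D_pos_iff htm ht, hcross,
    fun k hk θ t ht => ?_, fun k hk θ t ht h => ?_, y_zero_iff, fun b => ?_,
    fun k hk θ => ⟨cR k hk θ, cO k hk θ, cZ k hk θ⟩, horder, fun k hk θ => ?_⟩
  · obtain ⟨-, h2, h3, -⟩ := hcross k hk θ
    rcases le_total t (tm θ) with h | h
    · rw [(((hside k hk θ t ht).1 h).1)]
      exact ⟨fun h' => ⟨h', h.trans h3⟩, fun h' => h'.1⟩
    · rw [(((hside k hk θ t ht).2 h).1)]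
      exact ⟨fun h' => ⟨h2.trans h, h'⟩, fun h' => h'.2⟩
  · rcases le_total t (tm θ) with h' | h'
    · exact .inl ((((hside k hk θ t ht).1 h').2).1 h)
    · exact .inr ((((hside k hk θ t ht).2 h').2).1 h)
  · cases b
    · exact hcp.comp hTpc fun k hk => (hTp k hk).1
    · exact hcm.comp hTmc'.neg fun k hk => (hTm' k hk).1
    · exact hcm.comp hTmc fun k hk => (hTm k hk).1
  · have hk' := Ioo_subset_Icc_self hk
    obtain ⟨o1, o2, o3⟩ := horder k hk
    set xR := x .R k
    set xZ := x .zero k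
    set xO := x .one k
    have hp := hpt k hk'
    have hz := hzt k hk'
    have hw := hwt k hk'
    have ho := hmt k hk'
    change xR < m0 ∧ _ ∧ _ ∧ m1 < xR + 2 * π at hp
    change _ ∧ m0 < xZ ∧ xZ < m1 ∧ _ at hz
    change _ ∧ m0 < xO ∧ xO < m1 ∧ _ at ho
    set w := θp (-Tp' k)
    have hwR : w < xR := F.anti_p (hTp k hk').1 (hTp' k hk').1
      (left_lt_right F.lip_p (hTp k hk') (hTp' k hk') hk.2)
    have hcl : Continuous fun θ => y (tl k θ) θ :=
      F.y_cont.comp (f := fun θ => ((θ, ⟨tl k θ, tlI k hk' θ⟩) : ℝ × Icc α β))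
        (continuous_id.prodMk (((htl k hk').1 hMc htmc).subtype_mk _))
    have htrc : Continuous (tr k) := ((htl' k hk').1 hMc htmc.neg).neg
    have hcr : Continuous fun θ => y (tr k θ) θ :=
      F.y_cont.comp (f := fun θ => ((θ, ⟨tr k θ, trI k hk' θ⟩) : ℝ × Icc α β))
        (continuous_id.prodMk (htrc.subtype_mk _))
    -- zeros at the left crossing
    have zl (v : ℝ) (h0 : y (tl k v) v = 0) : (v : Angle) = xR ∨ (v : Angle) = xO := by
      rcases y_zero_iff _ (tlI k hk' v) v h0 with h | h
      · exact .inl ((cR k hk' v).2 h)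
      · exact .inr ((cO k hk' v).2 h)
    have zr (v : ℝ) (h0 : y (tr k v) v = 0) : (v : Angle) = w ∨ (v : Angle) = xZ := by
      rcases y_zero_iff _ (trI k hk' v) v h0 with h | h
      · exact .inl ((cW k hk' v).2 h)
      · exact .inr ((cZ k hk' v).2 h)
    have hpos (t) (ht : t ∈ Icc α β) : 0 < y t m0 ∧ y t m1 < 0 :=
      have h := F.range t ht
      ⟨F.y_pos t ht _ ⟨h.1, h.2.1⟩, F.y_neg t ht _ ⟨h.2.2.1, h.2.2.2⟩⟩
    have sl := sign_on_arcs hcl zl o3 ⟨hp.1, ho.2.1⟩ ⟨ho.2.2.1, hp.2.2.2⟩ (hpos _ (tlI k hk' _)).1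
      (hpos _ (tlI k hk' _)).2
    have sr := sign_on_arcs hcr zr (by linarith) ⟨hw.1, hz.2.1⟩ ⟨hz.2.2.1, hw.2.2.2⟩
      (hpos _ (trI k hk' _)).1 (hpos _ (trI k hk' _)).2
    have y0 (t v : ℝ) (ht : t ∈ Icc α β) (h : (v : Angle) = θp t ∨ (v : Angle) = θm t) :
        y t v = 0 := by
      rcases h with h | h
      · rw [periodic_int (F.y_per t ht) h]; exact (F.y_zero t ht).1
      · rw [periodic_int (F.y_per t ht) h]; exact (F.y_zero t ht).2
    obtain ⟨v, hv1, hv2, hv⟩ := CircleArc.exists_lift xR (θ : Angle)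
    obtain ⟨e1, e2⟩ := tl_per k hk' hv
    rw [← e1, ← e2, ← periodic_int (F.y_per (tl k v) (tlI k hk' v)) hv, ← periodic_int (F.y_per (tr k v) (trI k hk' v)) hv, ← hv]
    rw [← CircleArc.coe_add_two_pi xR, CircleArc.mem_cIoo_coe o3 (by linarith), CircleArc.coe_add_two_pi xR,
      CircleArc.mem_cIoo_coe o1 (by linarith), CircleArc.mem_cIoo_coe o2 (by linarith)]
    have lift (a b : ℝ) (ha : xR ≤ a) (hb : b ≤ xR + 2 * π) :
        (∃ u ∈ Ioo a b, (u : Angle) = v) ↔ v ∈ Ioo a b := by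
      constructor
      · rintro ⟨u, hu, h⟩
        rwa [← eq_of_coe_eq h (a := xR) ⟨ha.trans hu.1.le, hu.2.trans_le hb⟩ ⟨hv1, hv2⟩]
      · intro h; exact ⟨v, h, rfl⟩
    rw [lift _ _ (by linarith) le_rfl, lift _ _ le_rfl (by linarith), lift _ _ (by linarith) (by linarith)]
    have e1 : v = xR → y (tl k v) v = 0 := fun h => y0 _ _ (tlI k hk' v) (.inl ((cR k hk' v).1 (by rw [h])))
    have e2 : v = xO → y (tl k v) v = 0 := fun h => y0 _ _ (tlI k hk' v) (.inr ((cO k hk' v).1 (by rw [h])))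
    have e3 : v = xZ → y (tr k v) v = 0 := fun h => y0 _ _ (trI k hk' v) (.inr ((cZ k hk' v).1 (by rw [h])))
    have a1 := sl.1 v
    have a2 := sl.2 v
    have a3 : v ∈ Ioo xR xZ → 0 < y (tr k v) v := fun h => sr.1 v ⟨hwR.trans h.1, h.2⟩
    have a4 : v ∈ Ioo xZ xO → y (tr k v) v < 0 := fun h => sr.2 v ⟨h.1, by linarith [h.2, hw.2.2.2]⟩
    simp only [mem_Ioo] at *
    clear_value xR xZ xO
    generalize y (tl k v) v = yl at *
    generalize y (tr k v) v = yr at *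
    clear * - e1 e2 e3 a1 a2 a3 a4 o1 o2 o3 hv1 hv2
    grind

end OscStep

lemma fderiv_add_eq_of_forall {E F : Type*} [NormedAddCommGroup E] [NormedSpace ℝ E]
    [NormedAddCommGroup F] [NormedSpace ℝ F] {f : E → F} {N : Set E} (hN : IsOpen N) {v : E}
    (h : ∀ x ∈ N, f (x + v) = f x) {x : E} (hx : x ∈ N) : fderiv ℝ f (x + v) = fderiv ℝ f x := by
  rw [← fderiv_comp_add_right]
  refine Filter.EventuallyEq.fderiv_eq ?_
  filter_upwards [hN.mem_nhds hx] with y hy using h y hy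

namespace OscStep

open Oscillator StepSystem

namespace Model

namespace SectionChart

variable {S : StepSystem} {h : ℝ} {M : Model S h} {B : Base M} (C : SectionChart B)

/-- The point of the section with given angle and amplitude. -/
def pt (ε θ a : ℝ) : Phase := (C.X (ε, θ, a), 0, M.angQ θ a, M.angP θ a)

/-- The flow from the section, as a function of `((ε, t, θ), a)`. -/
def orb (p : (ℝ³) × ℝ) : Phase := M.Φ p.1.2.1 p.1.1 (C.pt p.1.1 p.1.2.2 p.2)

/-- The parameters covered by the chart. -/
def dom : Set ((ℝ³) × ℝ) := {p | |p.1.1| < C.η ∧ |p.2 - B.aS| < C.η}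

lemma isOpen_dom : IsOpen C.dom :=
  (isOpen_lt (f := fun p : (ℝ³) × ℝ => |p.1.1|) (by fun_prop) continuous_const).inter
    (isOpen_lt (f := fun p : (ℝ³) × ℝ => |p.2 - B.aS|) (by fun_prop) continuous_const)

variable {C}

lemma contDiffAt_orb {p : (ℝ³) × ℝ} (hp : p ∈ C.dom) : ContDiffAt ℝ 2 C.orb p := by
  have hang := contDiffAt_ang (C.amp _ hp.2) p.1.2.2
  have h1 : ContDiffAt ℝ 2 (fun p : (ℝ³) × ℝ => M.angQ p.1.2.2 p.2) p :=
    ContDiffAt.comp (g := fun p : ℝ × ℝ => M.angQ p.1 p.2)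
      (f := fun p : (ℝ³) × ℝ => (p.1.2.2, p.2)) p hang.1 (by fun_prop)
  have h2 : ContDiffAt ℝ 2 (fun p : (ℝ³) × ℝ => M.angP p.1.2.2 p.2) p :=
    ContDiffAt.comp (g := fun p : ℝ × ℝ => M.angP p.1 p.2)
      (f := fun p : (ℝ³) × ℝ => (p.1.2.2, p.2)) p hang.2 (by fun_prop)
  have h3 : ContDiffAt ℝ 2 (fun p : (ℝ³) × ℝ => C.X (p.1.1, p.1.2.2, p.2)) p :=
    ContDiffAt.comp (g := C.X)
      (f := fun p : (ℝ³) × ℝ => (p.1.1, p.1.2.2, p.2)) p (C.contDiffAt _ _ _ hp.1 hp.2) (by fun_prop)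
  have h4 : ContDiffAt ℝ 2 (fun p : (ℝ³) × ℝ =>
      ((p.1.2.1, p.1.1, C.pt p.1.1 p.1.2.2 p.2) : ℝ × ℝ × Phase)) p := by
    unfold pt
    exact ContDiffAt.prodMk (by fun_prop) (ContDiffAt.prodMk (by fun_prop)
      (h3.prodMk (contDiffAt_const.prodMk (h1.prodMk h2))))
  exact ContDiffAt.comp (g := fun p : ℝ × ℝ × Phase => M.Φ p.1 p.2.1 p.2.2) p
    M.Φ_contDiff.contDiffAt h4

lemma pt_add (ε θ a : ℝ) (hε : |ε| < C.η) (ha : |a - B.aS| < C.η) (n : ℤ) :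
    C.pt ε (θ + n * (2 * π)) a = C.pt ε θ a := by
  obtain ⟨h1, h2⟩ := ang_periodic (C.amp _ ha) θ n
  exact C.eq_of_mem ε θ a hε ha _ (C.mem_section ε _ a hε ha) h1 h2

/-- The shift of the angle by a multiple of `2π`. -/
abbrev turn (n : ℤ) : ℝ³ := (0, 0, n * (2 * π))

lemma orb_turn {p : (ℝ³) × ℝ} (hp : p ∈ C.dom) (n : ℤ) : C.orb (p + (turn n, 0)) = C.orb p := by
  simp only [orb, Prod.fst_add, Prod.snd_add, add_zero]
  rw [pt_add _ _ _ hp.1 hp.2]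

lemma coords_contDiffAt {p : (ℝ³) × ℝ} (hp : p ∈ C.dom) :
    ContDiffAt ℝ 2 (fun p => q₁ (C.orb p)) p ∧ ContDiffAt ℝ 2 (fun p => p₁ (C.orb p)) p ∧
    ContDiffAt ℝ 2 (fun p => q₂ (C.orb p)) p ∧ ContDiffAt ℝ 2 (fun p => p₂ (C.orb p)) p :=
  ⟨contDiff_q1.contDiffAt.comp p (contDiffAt_orb hp), contDiff_p1.contDiffAt.comp p (contDiffAt_orb hp),
    contDiff_q2.contDiffAt.comp p (contDiffAt_orb hp), contDiff_p2.contDiffAt.comp p (contDiffAt_orb hp)⟩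

lemma hasDerivAt_time {f : Phase → ℝ} {p : (ℝ³) × ℝ} {f' : ℝ}
    (hf : DifferentiableAt ℝ (fun p => f (C.orb p)) p)
    (hd : HasDerivAt (fun t => f (M.Φ t p.1.1 (C.pt p.1.1 p.1.2.2 p.2))) f' p.1.2.1) :
    fderiv ℝ (fun p => f (C.orb p)) p ((0, 1, 0), 0) = f' := by
  have h1 : HasDerivAt (fun t : ℝ => (((p.1.1, t, p.1.2.2), p.2) : (ℝ³) × ℝ)) ((0, 1, 0), 0) p.1.2.1 :=
    ((hasDerivAt_const _ _).prodMk ((hasDerivAt_id _).prodMk (hasDerivAt_const _ _))).prodMk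
      (hasDerivAt_const _ _)
  have h2 := HasFDerivAt.comp_hasDerivAt (f := fun t : ℝ => (((p.1.1, t, p.1.2.2), p.2) : (ℝ³) × ℝ))
    p.1.2.1 hf.hasFDerivAt h1
  exact h2.unique hd

lemma fderiv_time {p : (ℝ³) × ℝ} (hp : p ∈ C.dom) :
    fderiv ℝ (fun p => q₁ (C.orb p)) p ((0, 1, 0), 0) = p₁ (C.orb p) ∧
    fderiv ℝ (fun p => p₁ (C.orb p)) p ((0, 1, 0), 0) = p₁ (M.field p.1.1 (C.orb p)) ∧
    fderiv ℝ (fun p => q₂ (C.orb p)) p ((0, 1, 0), 0) = p₂ (C.orb p) := by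
  obtain ⟨c1, c2, c3, -⟩ := coords_contDiffAt hp
  obtain ⟨d1, d2, d3, -⟩ := M.hasDerivAt_coords p.1.1 (C.pt p.1.1 p.1.2.2 p.2) p.1.2.1
  exact ⟨hasDerivAt_time (c1.differentiableAt two_ne_zero) d1,
    hasDerivAt_time (c2.differentiableAt two_ne_zero) d2,
    hasDerivAt_time (c3.differentiableAt two_ne_zero) d3⟩

/-! ### The unperturbed orbits -/

lemma zero_mem_dom (t θ : ℝ) {a : ℝ} (ha : |a - B.aS| < C.η) : ((0, t, θ), a) ∈ C.dom :=
  ⟨by simpa using C.η_pos, ha⟩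

lemma base_mem_dom (t θ : ℝ) : ((0, t, θ), B.aS) ∈ C.dom :=
  zero_mem_dom t θ (by simpa using C.η_pos)

lemma energy1 (t θ : ℝ) {a : ℝ} (ha : |a - B.aS| < C.η) :
    p₁ (C.orb ((0, t, θ), a)) ^ 2 / 2 + M.W1 (q₁ (C.orb ((0, t, θ), a))) + M.W2 a = h := by
  have h0 : |(0 : ℝ)| < C.η := by simpa using C.η_pos
  have h1 := (M.motion1 (C.pt 0 θ a)).energy M.core1.well t 0
  have h2 := (C.mem_section 0 θ a h0 ha).2.2.2.2
  have h3 := C.X_mem 0 θ a h0 ha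
  have h4 := M.core1.W_eq (C.X (0, θ, a)) ⟨M.core1.well.l_neg.le.trans h3.1.le, h3.2.le⟩
  have h5 : S.energy₂ (M.angQ θ a) (M.angP θ a) = M.W2 a := energy2_QP (C.amp a ha) _
  simp only [M.Φ_zero, pt, q1_mk, p1_mk] at h1
  simp only [hamiltonian, q1_mk, p1_mk, q2_mk, p2_mk] at h2
  rw [energy₂] at h5
  simp only [orb, pt]
  linarith

lemma X_zero_eq (θ θ' : ℝ) {a : ℝ} (ha : |a - B.aS| < C.η) : C.X (0, θ, a) = C.X (0, θ', a) := by
  have h0 : |(0 : ℝ)| < C.η := by simpa using C.η_pos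
  have h1 := C.X_mem 0 θ a h0 ha
  have h2 := C.X_mem 0 θ' a h0 ha
  have e1 := energy1 (C := C) 0 θ ha
  have e2 := energy1 (C := C) 0 θ' ha
  simp only [orb, pt, M.Φ_zero, q1_mk, p1_mk] at e1 e2
  exact M.core1.well.strictMonoOn.injOn ⟨h1.1.le, h1.2.le⟩ ⟨h2.1.le, h2.2.le⟩ (by linarith)

lemma orb_zero_eq (t θ θ' : ℝ) {a : ℝ} (ha : |a - B.aS| < C.η) :
    q₁ (C.orb ((0, t, θ), a)) = q₁ (C.orb ((0, t, θ'), a)) ∧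
    p₁ (C.orb ((0, t, θ), a)) = p₁ (C.orb ((0, t, θ'), a)) := by
  obtain ⟨K, hK⟩ := M.core1.lipschitz
  obtain ⟨h1, h2⟩ := (M.motion1 (C.pt 0 θ a)).unique hK (M.motion1 (C.pt 0 θ' a)) (t0 := 0)
    (by simpa [M.Φ_zero, pt] using X_zero_eq θ θ' ha) (by simp [M.Φ_zero, pt])
  exact ⟨congrFun h1 t, congrFun h2 t⟩

/-- The angular velocity of the unperturbed vertical motion. -/
def _root_.OscStep.Model.Base.ω (B : Base M) : ℝ := π / M.half B.aS

lemma _root_.OscStep.Model.Base.ω_pos (B : Base M) : 0 < B.ω := div_pos pi_pos (half_pos B.aS_mem)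

lemma orb_vertical (t θ : ℝ) : q₂ (C.orb ((0, t, θ), B.aS)) = M.angQ (θ + B.ω * t) B.aS ∧
    p₂ (C.orb ((0, t, θ), B.aS)) = M.angP (θ + B.ω * t) B.aS :=
  Φ_zero_vertical B.aS_mem θ _ _ t

lemma orb_base (θ : ℝ) : C.orb ((0, B.τ, θ), B.aS) =
    (S.w₁, 0, M.angQ (θ + B.ω * B.τ) B.aS, M.angP (θ + B.ω * B.τ) B.aS) := by
  obtain ⟨h1, h2⟩ := orb_vertical (C := C) B.τ θ
  have s := B.swing (M.angQ θ B.aS) (M.angP θ B.aS)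
  have h3 := s.q_τ
  have h4 := s.p_τ
  have h5 : C.orb ((0, B.τ, θ), B.aS) = M.Φ B.τ 0 (B.xS, 0, M.angQ θ B.aS, M.angP θ B.aS) := by
    simp only [orb, pt, C.X_base]
  rw [← h5] at h3 h4
  exact Prod.ext h3 (Prod.ext h4 (Prod.ext h1 h2))

lemma fderiv_amp_pos (θ : ℝ) :
    0 < fderiv ℝ (fun p => q₁ (C.orb p)) ((0, B.τ, θ), B.aS) (0, 1) := by
  have hp := base_mem_dom (C := C) B.τ θ
  obtain ⟨c1, c2, -, -⟩ := coords_contDiffAt hp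
  have hpath : HasDerivAt (fun a : ℝ => ((((0 : ℝ), B.τ, θ), a) : (ℝ³) × ℝ)) (0, 1) B.aS :=
    (hasDerivAt_const _ _).prodMk (hasDerivAt_id _)
  have d1 := (c1.differentiableAt two_ne_zero).hasFDerivAt.comp_hasDerivAt B.aS hpath
  have d2 := (c2.differentiableAt two_ne_zero).hasFDerivAt.comp_hasDerivAt B.aS hpath
  set x := fderiv ℝ (fun p => q₁ (C.orb p)) ((0, B.τ, θ), B.aS) (0, 1)
  have d3 := (((d2.pow 2).div_const 2).add ((M.core1.well.deriv _).comp B.aS d1)).add (M.core2.well.deriv B.aS)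
  have d4 : HasDerivAt (fun _ : ℝ => h) 0 B.aS := hasDerivAt_const _ _
  have hev : ∀ᶠ a in 𝓝 B.aS, |a - B.aS| < C.η :=
    (continuous_id.sub continuous_const).abs.continuousAt.eventually_lt continuousAt_const
      (by simpa using C.η_pos)
  have h5 := (d3.congr_of_eventuallyEq (f₁ := fun _ => h) (hev.mono fun a ha =>
    (energy1 (C := C) B.τ θ ha).symm)).unique d4
  have ho := orb_base (C := C) θ
  simp only [Function.comp_apply, ho, q1_mk, p1_mk] at h5
  have n1 := M.core1.well.pos S.w₁ ⟨B.w₁_mem.1.le, B.w₁_mem.2⟩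
  have n2 := M.core2.well.neg B.aS ⟨B.aS_mem.1.1, B.aS_mem.1.2.le⟩
  have h6 : M.a₁ S.w₁ * x = -M.a₂ B.aS := by
    norm_num at h5; linarith
  by_contra! hx
  nlinarith

/-! ### The amplitude at which the wall is reached at a given time -/

/-- `A (ε, t, θ)` is the amplitude of the orbit with initial angle `θ` that is at `q₁ = w₁` at time `t`. -/
structure Level (C : SectionChart B) (ρ d : ℝ) (A : ℝ³ → ℝ) : Prop where
  ρ_pos : 0 < ρ
  ρ_lt : ρ < C.η
  d_pos : 0 < d
  d_le : d ≤ C.η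
  mem : ∀ u : ℝ³, |u.1| < d → |u.2.1 - B.τ| < d → |A u - B.aS| < ρ
  contDiffAt : ∀ u : ℝ³, |u.1| < d → |u.2.1 - B.τ| < d → ContDiffAt ℝ 2 A u
  lt_iff : ∀ u : ℝ³, |u.1| < d → |u.2.1 - B.τ| < d → ∀ a, |a - B.aS| ≤ ρ →
    (q₁ (C.orb (u, a)) < S.w₁ ↔ a < A u)
  eq_iff : ∀ u : ℝ³, |u.1| < d → |u.2.1 - B.τ| < d → ∀ a, |a - B.aS| ≤ ρ →
    (q₁ (C.orb (u, a)) = S.w₁ ↔ a = A u)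
  slope : ∀ u : ℝ³, |u.1| < d → |u.2.1 - B.τ| < d → ∀ a, |a - B.aS| ≤ ρ →
    0 < fderiv ℝ (fun p => q₁ (C.orb p)) (u, a) (0, 1)

lemma eventually_slope : ∀ᶠ x : ℝ³ in 𝓝 (0, B.τ, B.aS), ∀ θ,
    0 < fderiv ℝ (fun p => q₁ (C.orb p)) ((x.1, x.2.1, θ), x.2.2) (0, 1) := by
  have hdom : ∀ᶠ x : ℝ³ in 𝓝 (0, B.τ, B.aS), ∀ θ, ((x.1, x.2.1, θ), x.2.2) ∈ C.dom := by
    have h1 : ∀ᶠ x : ℝ³ in 𝓝 (0, B.τ, B.aS), ((x.1, x.2.1, (0 : ℝ)), x.2.2) ∈ C.dom :=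
      ContinuousAt.eventually_mem (f := fun x : ℝ³ => ((x.1, x.2.1, (0 : ℝ)), x.2.2)) (by fun_prop)
        (C.isOpen_dom.mem_nhds (base_mem_dom B.τ 0))
    exact h1.mono fun x hx θ => hx
  refine eventually_forall_of_periodic (c := 2 * π) (by positivity) ?_ fun θ => ?_
  · filter_upwards [hdom] with x hx θ n hP
    have := fderiv_add_eq_of_forall (f := fun p => q₁ (C.orb p)) C.isOpen_dom (v := (turn n, 0))
      (fun p hp => by rw [orb_turn hp]) (hx θ)
    simp only [turn, Prod.mk_add_mk, add_zero] at this
    rwa [this]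
  · have hc : ContinuousAt (fun p : (ℝ³) × ℝ => fderiv ℝ (fun p => q₁ (C.orb p)) p (0, 1))
        ((0, B.τ, θ), B.aS) :=
      ((coords_contDiffAt (base_mem_dom B.τ θ)).1.fderiv_right (m := 1) (by norm_num)).continuousAt.clm_apply
        continuousAt_const
    exact ((hc.comp (f := fun z : (ℝ³) × ℝ => (((z.1.1, z.1.2.1, z.2), z.1.2.2) : (ℝ³) × ℝ))
      (x := ((0, B.τ, B.aS), θ)) (by fun_prop)).eventually (lt_mem_nhds (fderiv_amp_pos θ)))

lemma exists_level (C : SectionChart B) {ρ0 : ℝ} (hρ₀ : 0 < ρ0) : ∃ ρ ≤ ρ0, ∃ d A, Level C ρ d A := by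
  obtain ⟨e, he, hs⟩ := Metric.eventually_nhds_iff.1 (eventually_slope (C := C))
  have hη := C.η_pos
  obtain ⟨ρ, hρ0, hlt⟩ := exists_between (lt_min (lt_min hρ₀ hη) he)
  simp only [lt_min_iff] at hlt
  obtain ⟨⟨hρ1, hρ2⟩, hρ3⟩ := hlt
  set F : (ℝ³) × ℝ → ℝ := fun p => q₁ (C.orb p) - S.w₁ with hF
  have hF' (p) : fderiv ℝ F p = fderiv ℝ (fun p => q₁ (C.orb p)) p := fderiv_sub_const ..
  have hIcc {a : ℝ} : a ∈ I(B.aS,ρ) ↔ |a - B.aS| ≤ ρ := by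
    rw [abs_le, mem_Icc]; constructor <;> rintro ⟨_, _⟩ <;> constructor <;> linarith
  have slope0 {u : ℝ³} (h1 : |u.1| < e) (h2 : |u.2.1 - B.τ| < e) {a : ℝ}
      (ha : a ∈ I(B.aS,ρ)) :
      0 < fderiv ℝ (fun p => q₁ (C.orb p)) (u, a) (0, 1) := by
    refine hs (y := (u.1, u.2.1, a)) ?_ u.2.2
    simp only [Prod.dist_eq, Real.dist_eq, sub_zero]
    exact max_lt h1 (max_lt h2 ((hIcc.1 ha).trans_lt (by linarith)))
  have hmono (θ : ℝ) : StrictMonoOn (fun a => F ((0, B.τ, θ), a)) (I(B.aS,ρ)) := by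
    have hd (a) (ha : a ∈ I(B.aS,ρ)) : HasDerivAt (fun a => F ((0, B.τ, θ), a))
        (fderiv ℝ (fun p => q₁ (C.orb p)) ((0, B.τ, θ), a) (0, 1)) a := by
      have hp := zero_mem_dom (C := C) B.τ θ (a := a) ((hIcc.1 ha).trans_lt (by linarith))
      exact (((coords_contDiffAt hp).1.differentiableAt two_ne_zero).hasFDerivAt.comp_hasDerivAt a
        ((hasDerivAt_const _ _).prodMk (hasDerivAt_id _))).sub_const _
    exact strictMonoOn_Icc hd fun a ha => slope0 (by simpa using he) (by simpa using he) (Ioo_subset_Icc_self ha)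
  have hF0 (θ : ℝ) : F ((0, B.τ, θ), B.aS) = 0 := by simp only [hF, orb_base, q1_mk, sub_self]
  have edge : ∀ᶠ x : ℝ × ℝ in 𝓝 (0, B.τ), ∀ θ,
      F ((x.1, x.2, θ), B.aS - ρ) < 0 ∧ 0 < F ((x.1, x.2, θ), B.aS + ρ) := by
    have hm (x : ℝ × ℝ) (hx : |x.1| < C.η) (θ s : ℝ) (hsρ : |s| ≤ ρ) :
        ((x.1, x.2, θ), B.aS + s) ∈ C.dom := ⟨hx, by rw [add_sub_cancel_left]; linarith⟩
    have e1 : |-ρ| ≤ ρ := by rw [abs_neg, abs_of_pos hρ0]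
    have e2 : |ρ| ≤ ρ := by rw [abs_of_pos hρ0]
    refine eventually_forall_of_periodic (c := 2 * π) (by positivity) ?_ fun θ => ?_
    · have h1 : ∀ᶠ x : ℝ × ℝ in 𝓝 (0, B.τ), |x.1| < C.η :=
        ContinuousAt.eventually_lt (f := fun x : ℝ × ℝ => |x.1|) (by fun_prop) continuousAt_const (by simpa using hη)
      filter_upwards [h1] with x hx θ n hP
      have t1 := orb_turn (hm x hx θ _ e1) n
      have t2 := orb_turn (hm x hx θ _ e2) n
      rw [← sub_eq_add_neg] at t1
      simp only [Prod.mk_add_mk, add_zero] at t1 t2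
      simp only [hF, t1, t2]
      exact hP
    · have hz (s : ℝ) (hsρ : |s| ≤ ρ) : ContinuousAt (fun z : (ℝ × ℝ) × ℝ => F ((z.1.1, z.1.2, z.2), B.aS + s))
          ((0, B.τ), θ) :=
        ((((coords_contDiffAt (hm (0, B.τ) (by simpa using hη) θ s hsρ)).1.sub contDiffAt_const).continuousAt
          (n := 2)).comp (f := fun z : (ℝ × ℝ) × ℝ => (((z.1.1, z.1.2, z.2), B.aS + s) : (ℝ³) × ℝ))
          (x := ((0, B.τ), θ)) (by fun_prop))
      have k1 := hmono θ ⟨le_rfl, by linarith⟩ ⟨by linarith, by linarith⟩ (show B.aS - ρ < B.aS by linarith)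
      have k2 := hmono θ ⟨by linarith, by linarith⟩ ⟨by linarith, le_rfl⟩ (show B.aS < B.aS + ρ by linarith)
      simp only [hF0] at k1 k2
      rw [sub_eq_add_neg] at k1
      have z1 := (hz (-ρ) e1).eventually (gt_mem_nhds k1)
      have z2 := (hz ρ e2).eventually (lt_mem_nhds k2)
      filter_upwards [z1, z2] with z y1 y2
      rw [← sub_eq_add_neg] at y1
      exact ⟨y1, y2⟩
  obtain ⟨e', he', hedge⟩ := Metric.eventually_nhds_iff.1 edge
  obtain ⟨d, hd0, hlt⟩ := exists_between (lt_min (lt_min he he') hη)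
  simp only [lt_min_iff] at hlt
  obtain ⟨⟨hd1, hd2⟩, hd3⟩ := hlt
  set N : Set (ℝ³) := {u | |u.1| < d ∧ |u.2.1 - B.τ| < d} with hN
  have hNo : IsOpen N := (isOpen_lt (f := fun u : ℝ³ => |u.1|) (by fun_prop) continuous_const).inter
    (isOpen_lt (f := fun u : ℝ³ => |u.2.1 - B.τ|) (by fun_prop) continuous_const)
  have hedge' (u) (hu : u ∈ N) := hedge (y := (u.1, u.2.1)) (by
    simp only [Prod.dist_eq, Real.dist_eq, sub_zero]
    exact max_lt (hu.1.trans hd2) (hu.2.trans hd2)) u.2.2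
  obtain ⟨A, hA⟩ := ImplicitScalar.exists_on_box hNo (c := B.aS - ρ) (d := B.aS + ρ) (by linarith)
    (n := 2) two_ne_zero (f := F)
    (fun u hu a ha => (coords_contDiffAt (p := (u, a)) ⟨hu.1.trans hd3, (hIcc.1 ha).trans_lt (by linarith)⟩).1.sub
      contDiffAt_const)
    (fun u hu a ha => by rw [hF']; exact slope0 (hu.1.trans hd1) (hu.2.trans hd1) ha)
    (fun u hu => (hedge' u hu).1) (fun u hu => (hedge' u hu).2)
  refine ⟨ρ, hρ1.le, d, A, hρ0, by linarith, hd0, hd3.le, fun u h1 h2 => ?_,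
    fun u h1 h2 => (hA u ⟨h1, h2⟩).2.1, fun u h1 h2 a ha => ?_, fun u h1 h2 a ha => ?_, fun u h1 h2 a ha =>
    slope0 (h1.trans hd1) (h2.trans hd1) (hIcc.2 ha)⟩
  · have := (hA u ⟨h1, h2⟩).1
    rw [abs_lt]; constructor <;> linarith [this.1, this.2]
  · rw [← ((hA u ⟨h1, h2⟩).2.2.2 a (hIcc.2 ha)).1]; simp only [hF, sub_neg]
  · rw [← ((hA u ⟨h1, h2⟩).2.2.2 a (hIcc.2 ha)).2]; simp only [hF, sub_eq_zero]

end SectionChart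

end Model

namespace Model

namespace SectionChart

namespace Level

variable {S : StepSystem} {h : ℝ} {M : Model S h} {B : Base M} {C : SectionChart B} {ρ d : ℝ}
  {A : ℝ³ → ℝ} (L : Level C ρ d A)

/-- The parameters `(ε, t, θ)` near the unperturbed tangencies. -/
def nbhd (B : Base M) (d : ℝ) : Set (ℝ³) := {u | |u.1| < d ∧ |u.2.1 - B.τ| < d}

lemma isOpen_nbhd (B : Base M) (d : ℝ) : IsOpen (nbhd B d) :=
  (isOpen_lt (f := fun u : ℝ³ => |u.1|) (by fun_prop) continuous_const).inter
    (isOpen_lt (f := fun u : ℝ³ => |u.2.1 - B.τ|) (by fun_prop) continuous_const)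

/-- The state at the wall. -/
def state (C : SectionChart B) (A : ℝ³ → ℝ) (u : ℝ³) : Phase := C.orb (u, A u)

/-- The ratio of the derivatives of the action and of the position with respect to the amplitude. -/
def ratio (C : SectionChart B) (A : ℝ³ → ℝ) (u : ℝ³) : ℝ :=
  deriv M.act (A u) / fderiv ℝ (fun p => q₁ (C.orb p)) (u, A u) (0, 1)

/-- The time derivative of the action at the wall. -/
def rate (C : SectionChart B) (A : ℝ³ → ℝ) (u : ℝ³) : ℝ := -p₁ (state C A u) * ratio C A u

include L

lemma mem_dom {u : ℝ³} (hu : u ∈ nbhd B d) {a : ℝ} (ha : |a - B.aS| ≤ ρ) : (u, a) ∈ C.dom :=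
  ⟨hu.1.trans_le L.d_le, ha.trans_lt L.ρ_lt⟩

lemma self_mem_dom {u : ℝ³} (hu : u ∈ nbhd B d) : (u, A u) ∈ C.dom :=
  L.mem_dom hu (L.mem u hu.1 hu.2).le

lemma base_mem (θ : ℝ) : (0, B.τ, θ) ∈ nbhd B d :=
  ⟨by simpa using L.d_pos, by simpa using L.d_pos⟩

lemma amp_mem {u : ℝ³} (hu : u ∈ nbhd B d) : A u ∈ M.Amp := C.amp _ (L.self_mem_dom hu).2

lemma q1_state {u : ℝ³} (hu : u ∈ nbhd B d) : q₁ (state C A u) = S.w₁ :=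
  (L.eq_iff u hu.1 hu.2 _ (L.mem u hu.1 hu.2).le).2 rfl

omit L in
lemma turn_mem {u : ℝ³} (hu : u ∈ nbhd B d) (n : ℤ) : u + turn n ∈ nbhd B d := by
  have h1 : (u + turn n).1 = u.1 := add_zero _
  have h2 : (u + turn n).2.1 = u.2.1 := add_zero _
  exact ⟨by rw [h1]; exact hu.1, by rw [h2]; exact hu.2⟩

lemma A_turn {u : ℝ³} (hu : u ∈ nbhd B d) (n : ℤ) : A (u + turn n) = A u := by
  have hm := (L.mem u hu.1 hu.2).le
  have hu' := turn_mem hu n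
  refine ((L.eq_iff _ hu'.1 hu'.2 _ hm).1 ?_).symm
  have := orb_turn (L.self_mem_dom hu) n
  rw [Prod.mk_add_mk, add_zero] at this
  rw [this]
  exact L.q1_state hu

lemma state_turn {u : ℝ³} (hu : u ∈ nbhd B d) (n : ℤ) : state C A (u + turn n) = state C A u := by
  have := orb_turn (L.self_mem_dom hu) n
  rw [Prod.mk_add_mk, add_zero] at this
  rw [state, L.A_turn hu, this, state]

lemma A_base (θ : ℝ) : A (0, B.τ, θ) = B.aS := by
  have hu := L.base_mem θ
  refine ((L.eq_iff _ hu.1 hu.2 B.aS (by simpa using L.ρ_pos.le)).1 ?_).symm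
  rw [orb_base, q1_mk]

lemma A_zero {t : ℝ} (ht : |t - B.τ| < d) (θ θ' : ℝ) : A (0, t, θ) = A (0, t, θ') := by
  have hu (θ : ℝ) : (0, t, θ) ∈ nbhd B d := ⟨by simpa using L.d_pos, ht⟩
  have hm := L.mem _ (hu θ).1 (hu θ).2
  refine (L.eq_iff _ (hu θ').1 (hu θ').2 _ hm.le).1 ?_
  rw [(orb_zero_eq t θ' θ (hm.trans L.ρ_lt)).1]
  exact L.q1_state (hu θ)

lemma state_base (θ : ℝ) : state C A (0, B.τ, θ) =
    (S.w₁, 0, M.angQ (θ + B.ω * B.τ) B.aS, M.angP (θ + B.ω * B.τ) B.aS) := by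
  rw [state, L.A_base, orb_base]

lemma contDiffAt_pair {u : ℝ³} (hu : u ∈ nbhd B d) : ContDiffAt ℝ 2 (fun u => (u, A u)) u :=
  contDiffAt_id.prodMk (L.contDiffAt u hu.1 hu.2)

lemma contDiffAt_state {u : ℝ³} (hu : u ∈ nbhd B d) : ContDiffAt ℝ 2 (state C A) u :=
  (contDiffAt_orb (L.self_mem_dom hu)).comp u (L.contDiffAt_pair hu)

/-- The chain rule for a function of the state at the wall. -/
lemma fderiv_state {f : Phase → ℝ} {u : ℝ³} (hu : u ∈ nbhd B d)
    (hf : DifferentiableAt ℝ (fun p => f (C.orb p)) (u, A u)) (v : ℝ³) :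
    fderiv ℝ (fun u => f (state C A u)) u v =
      fderiv ℝ (fun p => f (C.orb p)) (u, A u) (v, 0) +
        fderiv ℝ A u v * fderiv ℝ (fun p => f (C.orb p)) (u, A u) (0, 1) := by
  have hA := ((L.contDiffAt u hu.1 hu.2).differentiableAt two_ne_zero).hasFDerivAt
  have h1 : HasFDerivAt (fun u => f (state C A u)) _ u :=
    HasFDerivAt.comp (f := fun u => (u, A u)) u hf.hasFDerivAt ((hasFDerivAt_id u).prodMk hA)
  rw [h1.fderiv]
  have h2 : (v, fderiv ℝ A u v) = (v, (0 : ℝ)) + fderiv ℝ A u v • ((0 : ℝ³), (1 : ℝ)) := by simp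
  simp only [ContinuousLinearMap.comp_apply, ContinuousLinearMap.prod_apply, ContinuousLinearMap.id_apply]
  rw [h2, map_add, map_smul, smul_eq_mul]

lemma fderiv_A {u : ℝ³} (hu : u ∈ nbhd B d) :
    fderiv ℝ A u (0, 1, 0) * fderiv ℝ (fun p => q₁ (C.orb p)) (u, A u) (0, 1) = -p₁ (state C A u) := by
  have hp := L.self_mem_dom hu
  have h1 := L.fderiv_state (f := q₁) hu ((coords_contDiffAt hp).1.differentiableAt two_ne_zero) (0, 1, 0)
  rw [(fderiv_time hp).1] at h1
  have h2 : (fun u => q₁ (state C A u)) =ᶠ[𝓝 u] fun _ => S.w₁ := by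
    filter_upwards [(isOpen_nbhd B d).mem_nhds hu] with v hv using L.q1_state hv
  rw [h2.fderiv_eq, fderiv_fun_const] at h1
  change (0 : ℝ) = p₁ (state C A u) + _ at h1
  linarith

lemma slope_pos {u : ℝ³} (hu : u ∈ nbhd B d) :
    0 < fderiv ℝ (fun p => q₁ (C.orb p)) (u, A u) (0, 1) :=
  L.slope u hu.1 hu.2 _ (L.mem u hu.1 hu.2).le

lemma ratio_pos {u : ℝ³} (hu : u ∈ nbhd B d) : 0 < ratio C A u :=
  div_pos (deriv_act_pos (L.amp_mem hu)) (L.slope_pos hu)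

lemma fderiv_A_base (θ : ℝ) : fderiv ℝ A (0, B.τ, θ) (0, 1, 0) = 0 := by
  have h1 := L.fderiv_A (L.base_mem θ)
  rw [L.state_base, p1_mk, neg_zero] at h1
  exact (mul_eq_zero.1 h1).resolve_right (L.slope_pos (L.base_mem θ)).ne'

lemma contDiffAt_action {u : ℝ³} (hu : u ∈ nbhd B d) : ContDiffAt ℝ 2 (fun u => M.act (A u)) u :=
  (contDiffAt_act (L.amp_mem hu)).comp u (L.contDiffAt u hu.1 hu.2)

lemma fderiv_action {u : ℝ³} (hu : u ∈ nbhd B d) :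
    fderiv ℝ (fun u => M.act (A u)) u (0, 1, 0) = rate C A u := by
  have hA := ((L.contDiffAt u hu.1 hu.2).differentiableAt two_ne_zero).hasFDerivAt
  have hact := ((contDiffAt_act (L.amp_mem hu)).differentiableAt two_ne_zero).hasDerivAt
  have h1 : HasFDerivAt (fun u => M.act (A u)) _ u := hact.comp_hasFDerivAt u hA
  rw [h1.fderiv, _root_.smul_apply, smul_eq_mul, rate, ratio, ← L.fderiv_A hu]
  have := (L.slope_pos hu).ne'
  field_simp

lemma contDiffAt_ratio {u : ℝ³} (hu : u ∈ nbhd B d) : ContDiffAt ℝ 1 (ratio C A) u := by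
  have h1 : ContDiffAt ℝ 1 (fun u => deriv M.act (A u)) u :=
    (ContDiffAt.derivWithin (contDiffAt_act (L.amp_mem hu)) (m := 1) (by norm_num)).comp u
      ((L.contDiffAt u hu.1 hu.2).of_le (by norm_num))
  have h2 : ContDiffAt ℝ 1 (fun u => fderiv ℝ (fun p => q₁ (C.orb p)) (u, A u) (0, 1)) u :=
    ContDiffAt.clm_apply (ContDiffAt.comp (f := fun u => (u, A u)) u
      ((coords_contDiffAt (L.self_mem_dom hu)).1.fderiv_right (m := 1) (by norm_num))
      ((L.contDiffAt_pair hu).of_le (by norm_num))) contDiffAt_const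
  exact h1.div h2 (L.slope_pos hu).ne'

lemma contDiffAt_rate {u : ℝ³} (hu : u ∈ nbhd B d) : ContDiffAt ℝ 1 (rate C A) u := by
  have h1 : ContDiffAt ℝ 1 (fun u => p₁ (state C A u)) u :=
    (contDiff_p1.contDiffAt.comp u (L.contDiffAt_state hu)).of_le (by norm_num)
  exact h1.neg.mul (L.contDiffAt_ratio hu)

lemma rate_iff {u : ℝ³} (hu : u ∈ nbhd B d) :
    (0 < rate C A u ↔ p₁ (state C A u) < 0) ∧ (rate C A u = 0 ↔ p₁ (state C A u) = 0) := by
  have := L.ratio_pos hu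
  constructor
  · rw [rate, mul_pos_iff_of_pos_right this, neg_pos]
  · rw [rate, mul_eq_zero, or_iff_left this.ne', neg_eq_zero]

lemma rate_turn {u : ℝ³} (hu : u ∈ nbhd B d) (n : ℤ) : rate C A (u + turn n) = rate C A u := by
  rw [← L.fderiv_action hu, ← L.fderiv_action (turn_mem hu n),
    fderiv_add_eq_of_forall (f := fun u => M.act (A u)) (isOpen_nbhd B d)
      (fun v hv => by rw [L.A_turn hv n]) hu]

lemma rate_zero {t : ℝ} (ht : |t - B.τ| < d) (θ θ' : ℝ) : rate C A (0, t, θ) = rate C A (0, t, θ') := by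
  have hu (θ : ℝ) : (0, t, θ) ∈ nbhd B d := ⟨by simpa using L.d_pos, ht⟩
  have key (θ : ℝ) : HasDerivAt (fun t => M.act (A (0, t, θ))) (rate C A (0, t, θ)) t := by
    rw [← L.fderiv_action (hu θ)]
    exact HasFDerivAt.comp_hasDerivAt (l := fun u => M.act (A u)) (f := fun t : ℝ => ((0 : ℝ), t, θ)) t
      ((L.contDiffAt_action (hu θ)).differentiableAt two_ne_zero).hasFDerivAt
      ((hasDerivAt_const _ _).prodMk ((hasDerivAt_id _).prodMk (hasDerivAt_const _ _)))
  refine (key θ).unique ((key θ').congr_of_eventuallyEq ?_)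
  have : ∀ᶠ s in 𝓝 t, |s - B.τ| < d :=
    (continuous_id.sub continuous_const).abs.continuousAt.eventually_lt continuousAt_const ht
  filter_upwards [this] with s hs
  rw [L.A_zero hs θ θ']

/-- The action at the wall is a strictly concave function of time at the unperturbed tangency. -/
lemma fderiv_rate_base (θ : ℝ) : fderiv ℝ (rate C A) (0, B.τ, θ) (0, 1, 0) < 0 := by
  have hu := L.base_mem θ
  have hp := L.self_mem_dom hu
  have h1 := L.fderiv_state (f := p₁) hu ((coords_contDiffAt hp).2.1.differentiableAt two_ne_zero) (0, 1, 0)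
  rw [L.fderiv_A_base, zero_mul, add_zero, (fderiv_time hp).2.1] at h1
  have h2 : p₁ (M.field (0 : ℝ) (C.orb ((0, B.τ, θ), A (0, B.τ, θ)))) = M.a₁ S.w₁ := by
    rw [L.A_base, orb_base]; simp [field, M.κ_zero]
  have d1 := (((contDiff_p1 (n := 2)).contDiffAt.comp _ (L.contDiffAt_state hu)).differentiableAt
    two_ne_zero).hasFDerivAt
  have d2 := ((L.contDiffAt_ratio hu).differentiableAt one_ne_zero).hasFDerivAt
  have d3 : HasFDerivAt (rate C A) _ (0, B.τ, θ) := d1.neg.mul d2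
  rw [d3.fderiv]
  change _ * _ + _ * (-(fderiv ℝ (fun u => p₁ (state C A u)) (0, B.τ, θ) (0, 1, 0))) < 0
  rw [h1, h2]
  change -p₁ (state C A (0, B.τ, θ)) * _ + _ < 0
  rw [L.state_base, p1_mk, neg_zero, zero_mul, zero_add]
  have n1 := M.core1.well.pos S.w₁ ⟨B.w₁_mem.1.le, B.w₁_mem.2⟩
  have n2 := L.ratio_pos hu
  nlinarith [mul_pos n1 n2]

lemma eventually_forall {P : ℝ³ → Prop}
    (hturn : ∀ u ∈ nbhd B d, ∀ n : ℤ, P u → P (u + turn n)) (hP : ∀ θ, ∀ᶠ u in 𝓝 (0, B.τ, θ), P u) :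
    ∀ᶠ x : ℝ × ℝ in 𝓝 (0, B.τ), ∀ θ, P (x.1, x.2, θ) := by
  refine eventually_forall_of_periodic (c := 2 * π) (by positivity) ?_ fun θ => ?_
  · have : ∀ᶠ x : ℝ × ℝ in 𝓝 (0, B.τ), (x.1, x.2, (0 : ℝ)) ∈ nbhd B d :=
      ContinuousAt.eventually_mem (f := fun x : ℝ × ℝ => (x.1, x.2, (0 : ℝ))) (by fun_prop)
        ((isOpen_nbhd B d).mem_nhds (L.base_mem 0))
    filter_upwards [this] with x hx θ n hθ
    have := hturn (x.1, x.2, θ) hx n hθ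
    simpa [turn] using this
  · have : ContinuousAt (fun z : (ℝ × ℝ) × ℝ => (z.1.1, z.1.2, z.2)) ((0, B.τ), θ) := by fun_prop
    exact this.eventually (hP θ)

lemma eventually_rate_time : ∃ c > 0, ∀ᶠ x : ℝ × ℝ in 𝓝 (0, B.τ), ∀ θ,
    fderiv ℝ (rate C A) (x.1, x.2, θ) (0, 1, 0) < -c := by
  set c := -fderiv ℝ (rate C A) (0, B.τ, 0) (0, 1, 0) / 2 with hc
  have hc0 : 0 < c := by have := L.fderiv_rate_base 0; linarith
  refine ⟨c, hc0, L.eventually_forall (P := fun u => fderiv ℝ (rate C A) u (0, 1, 0) < -c)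
    (fun u hu n hP => ?_) fun θ => ?_⟩
  · rwa [fderiv_add_eq_of_forall (isOpen_nbhd B d) (fun v hv => L.rate_turn hv n) hu]
  · have hu := L.base_mem θ
    have key (θ : ℝ) : HasDerivAt (fun t => rate C A (0, t, θ)) (fderiv ℝ (rate C A) (0, B.τ, θ) (0, 1, 0)) B.τ :=
      HasFDerivAt.comp_hasDerivAt (f := fun t : ℝ => ((0 : ℝ), t, θ)) B.τ
        ((L.contDiffAt_rate (L.base_mem θ)).differentiableAt one_ne_zero).hasFDerivAt
        ((hasDerivAt_const _ _).prodMk ((hasDerivAt_id _).prodMk (hasDerivAt_const _ _)))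
    have heq : fderiv ℝ (rate C A) (0, B.τ, θ) (0, 1, 0) = fderiv ℝ (rate C A) (0, B.τ, 0) (0, 1, 0) := by
      refine (key θ).unique ((key 0).congr_of_eventuallyEq ?_)
      have : ∀ᶠ s in 𝓝 B.τ, |s - B.τ| < d :=
        (continuous_id.sub continuous_const).abs.continuousAt.eventually_lt continuousAt_const
          (by simpa using L.d_pos)
      filter_upwards [this] with s hs using L.rate_zero hs θ 0
    have hcont : ContinuousAt (fun u => fderiv ℝ (rate C A) u (0, 1, 0)) (0, B.τ, θ) :=
      ((L.contDiffAt_rate hu).fderiv_right (m := 0) (by norm_num)).continuousAt.clm_apply continuousAt_const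
    refine hcont.eventually (gt_mem_nhds ?_)
    change fderiv ℝ (rate C A) (0, B.τ, θ) (0, 1, 0) < -c
    rw [heq]; linarith

lemma eventually_rate_angle {μ : ℝ} (hμ : 0 < μ) : ∀ᶠ x : ℝ × ℝ in 𝓝 (0, B.τ), ∀ θ,
    |fderiv ℝ (rate C A) (x.1, x.2, θ) (0, 0, 1)| < μ := by
  refine L.eventually_forall (P := fun u => |fderiv ℝ (rate C A) u (0, 0, 1)| < μ)
    (fun u hu n hP => ?_) fun θ => ?_
  · rwa [fderiv_add_eq_of_forall (isOpen_nbhd B d) (fun v hv => L.rate_turn hv n) hu]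
  · have hu := L.base_mem θ
    have key : HasDerivAt (fun θ => rate C A (0, B.τ, θ)) (fderiv ℝ (rate C A) (0, B.τ, θ) (0, 0, 1)) θ :=
      HasFDerivAt.comp_hasDerivAt (f := fun θ : ℝ => ((0 : ℝ), B.τ, θ)) θ
        ((L.contDiffAt_rate hu).differentiableAt one_ne_zero).hasFDerivAt
        ((hasDerivAt_const _ _).prodMk ((hasDerivAt_const _ _).prodMk (hasDerivAt_id _)))
    have h0 : fderiv ℝ (rate C A) (0, B.τ, θ) (0, 0, 1) = 0 :=
      key.unique ((hasDerivAt_const θ (rate C A (0, B.τ, θ))).congr_of_eventuallyEq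
        (Eventually.of_forall fun θ' => L.rate_zero (by simpa using L.d_pos) θ' θ))
    have hcont : ContinuousAt (fun u => |fderiv ℝ (rate C A) u (0, 0, 1)|) (0, B.τ, θ) :=
      (((L.contDiffAt_rate hu).fderiv_right (m := 0) (by norm_num)).continuousAt.clm_apply
        continuousAt_const).abs
    exact hcont.eventually (gt_mem_nhds (show |fderiv ℝ (rate C A) (0, B.τ, θ) (0, 0, 1)| < μ by
      rw [h0, abs_zero]; exact hμ))

/-- At the unperturbed tangencies the height moves with the vertical momentum. -/
lemma fderiv_height_base (θ : ℝ) :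
    fderiv ℝ (fun u => q₂ (state C A u)) (0, B.τ, θ) (0, 1, 0) = M.angP (θ + B.ω * B.τ) B.aS ∧
    fderiv ℝ (fun u => q₂ (state C A u)) (0, B.τ, θ) (0, 0, 1) = M.angP (θ + B.ω * B.τ) B.aS / B.ω := by
  have hu := L.base_mem θ
  have hp := L.self_mem_dom hu
  have h1 := L.fderiv_state (f := q₂) hu ((coords_contDiffAt hp).2.2.1.differentiableAt two_ne_zero) (0, 1, 0)
  rw [L.fderiv_A_base, zero_mul, add_zero, (fderiv_time hp).2.2, L.A_base, orb_base, p2_mk] at h1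
  refine ⟨h1, ?_⟩
  have d1 : HasDerivAt (fun θ => q₂ (state C A (0, B.τ, θ)))
      (fderiv ℝ (fun u => q₂ (state C A u)) (0, B.τ, θ) (0, 0, 1)) θ :=
    HasFDerivAt.comp_hasDerivAt (f := fun θ : ℝ => ((0 : ℝ), B.τ, θ)) θ
      (((contDiff_q2 (n := 2)).contDiffAt.comp _ (L.contDiffAt_state hu)).differentiableAt
        two_ne_zero).hasFDerivAt
      ((hasDerivAt_const _ _).prodMk ((hasDerivAt_const _ _).prodMk (hasDerivAt_id _)))
  have d2 : HasDerivAt (fun θ => M.angQ (θ + B.ω * B.τ) B.aS) (M.angP (θ + B.ω * B.τ) B.aS / B.ω) θ := by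
    have e1 : HasDerivAt (fun θ => M.half B.aS * (θ + B.ω * B.τ) / π) (M.half B.aS * 1 / π) θ :=
      (((hasDerivAt_id θ).add_const _).const_mul _).div_const _
    have e2 := ((M.motion B.aS).dq _).comp θ e1
    refine e2.congr_deriv ?_
    have := half_pos B.aS_mem
    have := pi_pos
    rw [Base.ω, angP]; field_simp
  exact d1.unique (d2.congr_of_eventuallyEq (Eventually.of_forall fun θ' => by
    change q₂ (state C A (0, B.τ, θ')) = _; rw [L.state_base, q2_mk]))

end Level

end SectionChart

end Model

end OscStep

/-- The zeros of a function `f ((ε, t), θ)` that increases with `θ` and with `t`. -/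
lemma ImplicitScalar.exists_root_branch {f : (ℝ × ℝ) × ℝ → ℝ} {x0 : ℝ × ℝ} {θ0 ρ0 : ℝ} (hρ₀ : 0 < ρ0)
    (hf : ContDiffAt ℝ 2 f (x0, θ0)) (h0 : f (x0, θ0) = 0) (hs : 0 < fderiv ℝ f (x0, θ0) (0, 1))
    (ht : 0 < fderiv ℝ f (x0, θ0) ((0, 1), 0)) :
    ∃ ρ > 0, ρ ≤ ρ0 ∧ ∃ g : ℝ × ℝ → ℝ, ∃ K ≥ 0, ∃ r > 0, ∀ x, dist x x0 < r →
      |g x - θ0| < ρ ∧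
      (∀ θ, |θ - θ0| ≤ ρ → (f (x, θ) < 0 ↔ θ < g x) ∧ (f (x, θ) = 0 ↔ θ = g x)) ∧
      (∀ x', dist x' x0 < r → |g x - g x'| ≤ K * dist x x') ∧
      ∀ x', dist x' x0 < r → x.1 = x'.1 → x.2 < x'.2 → g x' < g x := by
  have hc := (hf.fderiv_right (m := 1) (by norm_num)).continuousAt
  have ev : ∀ᶠ p in 𝓝 (x0, θ0), ContDiffAt ℝ 2 f p ∧ 0 < fderiv ℝ f p (0, 1) ∧
      0 < fderiv ℝ f p ((0, 1), 0) :=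
    (hf.eventually (by simp)).and (((hc.clm_apply continuousAt_const).eventually (lt_mem_nhds hs)).and
      ((hc.clm_apply continuousAt_const).eventually (lt_mem_nhds ht)))
  obtain ⟨e, he, hev⟩ := Metric.eventually_nhds_iff.1 ev
  obtain ⟨ρ, hρ0, hlt⟩ := exists_between (lt_min hρ₀ he)
  obtain ⟨hρ1, hρ2⟩ := lt_min_iff.1 hlt
  have hIcc {θ : ℝ} : θ ∈ I(θ0,ρ) ↔ |θ - θ0| ≤ ρ := by
    rw [abs_le, mem_Icc]; constructor <;> rintro ⟨_, _⟩ <;> constructor <;> linarith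
  have hbox {x : ℝ × ℝ} (hx : dist x x0 < e) {θ : ℝ} (hθ : θ ∈ I(θ0,ρ)) :=
    hev (y := (x, θ)) (by
      rw [Prod.dist_eq, Real.dist_eq θ]; exact max_lt hx ((hIcc.1 hθ).trans_lt (by linarith)))
  have hmono : StrictMonoOn (fun θ => f (x0, θ)) (I(θ0,ρ)) := by
    have hd (θ) (hθ : θ ∈ I(θ0,ρ)) :
        HasDerivAt (fun θ => f (x0, θ)) (fderiv ℝ f (x0, θ) (0, 1)) θ :=
      ((hbox (by simpa using he) hθ).1.differentiableAt two_ne_zero).hasFDerivAt.comp_hasDerivAt θ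
        ((hasDerivAt_const _ _).prodMk (hasDerivAt_id _))
    exact strictMonoOn_Icc hd fun θ hθ => (hbox (by simpa using he) (Ioo_subset_Icc_self hθ)).2.1
  have mem0 : θ0 ∈ I(θ0,ρ) := ⟨by linarith, by linarith⟩
  have meml : θ0 - ρ ∈ I(θ0,ρ) := ⟨le_rfl, by linarith⟩
  have memr : θ0 + ρ ∈ I(θ0,ρ) := ⟨by linarith, le_rfl⟩
  have k1 := hmono meml mem0 (by linarith)
  have k2 := hmono mem0 memr (by linarith)
  simp only [h0] at k1 k2
  have hcx {θ : ℝ} (hθ : θ ∈ I(θ0,ρ)) : ContinuousAt (fun x => f (x, θ)) x0 :=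
    (hbox (by simpa using he) hθ).1.continuousAt.comp (f := fun x => (x, θ)) (by fun_prop)
  obtain ⟨e', he', hedge⟩ := Metric.eventually_nhds_iff.1
    (((hcx meml).eventually (gt_mem_nhds k1)).and ((hcx memr).eventually (lt_mem_nhds k2)))
  obtain ⟨r₁, hr1, hlt⟩ := exists_between (lt_min he he')
  obtain ⟨hr1e, hr1e'⟩ := lt_min_iff.1 hlt
  obtain ⟨g, hg⟩ := exists_on_box (N := Metric.ball x0 r₁) Metric.isOpen_ball (c := θ0 - ρ) (d := θ0 + ρ)
    (by linarith) (n := 2) two_ne_zero (f := f)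
    (fun x hx θ hθ => (hbox (hx.trans hr1e) hθ).1)
    (fun x hx θ hθ => (hbox (hx.trans hr1e) hθ).2.1)
    (fun x hx => (hedge (hx.trans hr1e')).1)
    (fun x hx => (hedge (hx.trans hr1e')).2)
  obtain ⟨K, U, hU, hK⟩ := ((hg x0 (Metric.mem_ball_self hr1)).2.1.of_le (by norm_num)).exists_lipschitzOnWith
  obtain ⟨r₂, hr2, hrU⟩ := Metric.mem_nhds_iff.1 hU
  refine ⟨ρ, hρ0, hρ1.le, g, K, K.2, min r₁ r₂, by positivity, fun x hx => ?_⟩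
  have hx1 : x ∈ Metric.ball x0 r₁ := hx.trans_le (min_le_left _ _)
  have hx2 := hrU (show x ∈ Metric.ball x0 r₂ from hx.trans_le (min_le_right _ _))
  have hgx := hg x hx1
  refine ⟨by rw [abs_lt]; constructor <;> linarith [hgx.1.1, hgx.1.2], fun θ hθ => hgx.2.2.2 θ (hIcc.2 hθ),
    fun x' hx' => ?_, fun x' hx' h1 h2 => ?_⟩
  · rw [← Real.dist_eq]
    exact hK.dist_le_mul x hx2 x' (hrU (hx'.trans_le (min_le_right _ _)))
  · have hx1' : x' ∈ Metric.ball x0 r₁ := hx'.trans_le (min_le_left _ _)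
    have hgI := Ioo_subset_Icc_self hgx.1
    have hseg (t) (ht : t ∈ Icc x.2 x'.2) : dist (x.1, t) x0 < e := by
      have q1 := Metric.mem_ball.1 hx1 |>.trans hr1e
      have q2 := Metric.mem_ball.1 hx1' |>.trans hr1e
      rw [Prod.dist_eq, max_lt_iff, Real.dist_eq, Real.dist_eq, abs_lt, abs_lt] at q1 q2 ⊢
      exact ⟨q1.1, by linarith [q1.2.1, ht.1], by linarith [q2.2.2, ht.2]⟩
    have hd (t) (ht : t ∈ Icc x.2 x'.2) :
        HasDerivAt (fun t => f ((x.1, t), g x)) (fderiv ℝ f ((x.1, t), g x) ((0, 1), 0)) t :=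
      HasFDerivAt.comp_hasDerivAt (f := fun t : ℝ => ((x.1, t), g x)) t
        ((hbox (hseg t ht) hgI).1.differentiableAt two_ne_zero).hasFDerivAt
        (((hasDerivAt_const _ _).prodMk (hasDerivAt_id _)).prodMk (hasDerivAt_const _ _))
    have k3 := strictMonoOn_Icc hd (fun t ht => (hbox (hseg t (Ioo_subset_Icc_self ht)) hgI).2.2)
      ⟨le_rfl, h2.le⟩ ⟨h2.le, le_rfl⟩ h2
    simp only at k3
    rw [show (x.1, x.2) = x from rfl, hgx.2.2.1, h1, show (x'.1, x'.2) = x' from rfl] at k3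
    by_contra! hle
    have k4 := (hg x' hx1').2.2.2 (g x) hgI
    rcases hle.lt_or_eq with h3 | h3
    · linarith [k4.1.2 h3]
    · linarith [k4.2.2 h3]

namespace OscStep

open Oscillator StepSystem Model.SectionChart

namespace Model

variable {S : StepSystem} {h : ℝ} {M : Model S h}

/-- The angles at which the unperturbed vertical motion is at the height of the corner. -/
lemma Base.exists_corner_angle (B : Base M) : ∃ β ∈ Ioo 0 π, M.angQ β B.aS = S.w₂ ∧ M.angP β B.aS < 0 ∧
    M.angQ (-β) B.aS = S.w₂ ∧ 0 < M.angP (-β) B.aS ∧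
    (∀ φ ∈ Ioo (-β) β, S.w₂ < M.angQ φ B.aS) ∧ (∀ φ ∈ Ioo β (2 * π - β), M.angQ φ B.aS < S.w₂) := by
  have s := halfSwing B.aS_mem
  have hτ := half_pos B.aS_mem
  have hpi := pi_pos
  have hlow : M.Q B.aS (M.half B.aS) < S.w₂ := by
    have h1 := B.w2_lt
    rw [← s.hxy] at h1
    exact (M.core2.well.strictAntiOn.lt_iff_gt ⟨B.w₂_mem.1.le, B.w₂_mem.2.le⟩ ⟨s.hy.1.le, s.hy.2.le⟩).1 h1
  have hanti : StrictAntiOn (fun φ => M.angQ φ B.aS) (Icc 0 π) := fun x hx y hy hxy => by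
    refine (s.strictAntiOn : StrictAntiOn (M.Q B.aS) _)
      (show M.half B.aS * x / π ∈ _ from ?_) (show M.half B.aS * y / π ∈ _ from ?_) ?_
    · exact ⟨by have := hx.1; positivity, by rw [div_le_iff₀ hpi]; nlinarith [hx.2]⟩
    · exact ⟨by have := hy.1; positivity, by rw [div_le_iff₀ hpi]; nlinarith [hy.2]⟩
    · gcongr
  have e0 : M.angQ 0 B.aS = B.aS := by simp [angQ, M.Q_zero]
  have eπ : M.angQ π B.aS = M.Q B.aS (M.half B.aS) := by rw [angQ, mul_div_cancel_right₀ _ hpi.ne']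
  have hc : Continuous fun φ => M.angQ φ B.aS :=
    M.continuous_Q.comp (f := fun φ => (B.aS, M.half B.aS * φ / π)) (by fun_prop)
  obtain ⟨β, hβ, hβw⟩ := intermediate_value_Ioo' hpi.le hc.continuousOn
    (show S.w₂ ∈ Ioo (M.angQ π B.aS) (M.angQ 0 B.aS) by
      rw [e0, eπ]; exact ⟨hlow, B.w₂_mem.2.trans B.aS_mem.1.1⟩)
  have hβI := Ioo_subset_Icc_self hβ
  have hPβ : M.angP β B.aS < 0 := s.neg _
    ⟨by have := hβ.1; positivity, by rw [div_lt_iff₀ hpi]; nlinarith [hβ.2]⟩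
  obtain ⟨n1, n2⟩ := ang_neg B.aS_mem β
  have abs_eq (φ : ℝ) : M.angQ |φ| B.aS = M.angQ φ B.aS := by
    rcases abs_choice φ with h | h <;> rw [h]
    exact (ang_neg B.aS_mem φ).1
  simp only at hβw
  refine ⟨β, hβ, hβw, hPβ, n1.trans hβw, by rw [n2]; linarith, fun φ hφ => ?_, fun φ hφ => ?_⟩
  · have h1 : |φ| < β := abs_lt.2 hφ
    rw [← abs_eq, ← hβw]
    exact hanti ⟨abs_nonneg _, h1.le.trans hβI.2⟩ hβI h1
  · have h1 : |φ - π| < π - β := abs_lt.2 ⟨by linarith [hφ.1], by linarith [hφ.2]⟩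
    have h2 : M.angQ φ B.aS = M.angQ (π - |φ - π|) B.aS := by
      rcases abs_choice (φ - π) with h | h <;> rw [h]
      · rw [show π - (φ - π) = -φ + 2 * π by ring, (ang_add_two_pi B.aS_mem _).1, (ang_neg B.aS_mem φ).1]
      · congr 1; ring
    rw [h2, ← hβw]
    exact hanti hβI ⟨by linarith [hβ.1], by linarith [abs_nonneg (φ - π)]⟩ (by linarith)

end Model

namespace Model

namespace SectionChart

namespace Level

variable {S : StepSystem} {h : ℝ} {M : Model S h} {B : Base M} {C : SectionChart B} {ρ d : ℝ}
  {A : ℝ³ → ℝ} (L : Level C ρ d A)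

/-- The height above the corner of the state at the wall. -/
def height (C : SectionChart B) (A : ℝ³ → ℝ) (u : ℝ³) : ℝ := q₂ (state C A u) - S.w₂

/-- The zeros `θp`, `θm` of the height for parameters `(ε, t)` near the unperturbed tangencies. -/
structure Roots (C : SectionChart B) (A : ℝ³ → ℝ) (θp θm : ℝ × ℝ → ℝ) (m0 m1 K r : ℝ) : Prop where
  K_nonneg : 0 ≤ K
  r_pos : 0 < r
  lip_p : ∀ x, dist x (0, B.τ) < r → ∀ x', dist x' (0, B.τ) < r → |θp x - θp x'| ≤ K * dist x x'
  lip_m : ∀ x, dist x (0, B.τ) < r → ∀ x', dist x' (0, B.τ) < r → |θm x - θm x'| ≤ K * dist x x'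
  anti_p : ∀ x, dist x (0, B.τ) < r → ∀ x', dist x' (0, B.τ) < r → x.1 = x'.1 → x.2 < x'.2 → θp x' < θp x
  anti_m : ∀ x, dist x (0, B.τ) < r → ∀ x', dist x' (0, B.τ) < r → x.1 = x'.1 → x.2 < x'.2 → θm x' < θm x
  range : ∀ x, dist x (0, B.τ) < r → θp x < m0 ∧ m0 < θm x ∧ θm x < m1 ∧ m1 < θp x + 2 * π
  zero : ∀ x, dist x (0, B.τ) < r → height C A (x.1, x.2, θp x) = 0 ∧ height C A (x.1, x.2, θm x) = 0
  pos : ∀ x, dist x (0, B.τ) < r → ∀ θ ∈ Ioo (θp x) (θm x), 0 < height C A (x.1, x.2, θ)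
  neg : ∀ x, dist x (0, B.τ) < r → ∀ θ ∈ Ioo (θm x) (θp x + 2 * π), height C A (x.1, x.2, θ) < 0
  p2_pos : ∀ x, dist x (0, B.τ) < r → 0 < p₂ (state C A (x.1, x.2, θp x))
  p2_neg : ∀ x, dist x (0, B.τ) < r → p₂ (state C A (x.1, x.2, θm x)) < 0

include L

lemma contDiffAt_height {u : ℝ³} (hu : u ∈ nbhd B d) : ContDiffAt ℝ 2 (height C A) u :=
  (contDiff_q2.contDiffAt.comp u (L.contDiffAt_state hu)).sub contDiffAt_const

lemma height_base (θ : ℝ) : height C A (0, B.τ, θ) = M.angQ (θ + B.ω * B.τ) B.aS - S.w₂ := by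
  rw [height, L.state_base, q2_mk]

lemma height_turn {u : ℝ³} (hu : u ∈ nbhd B d) (n : ℤ) :
    height C A (u + turn n) = height C A u := by
  rw [height, L.state_turn hu, height]

lemma exists_roots : ∃ θp θm m0 m1 K r, Roots C A θp θm m0 m1 K r := by
  obtain ⟨β, hβ, b1, b2, b3, b4, b5, b6⟩ := B.exists_corner_angle
  have hpi := pi_pos
  have hω := B.ω_pos
  set e := B.ω * B.τ with he
  obtain ⟨ρ0, hρ00, hlt⟩ := exists_between (lt_min (_root_.half_pos hβ.1) (_root_.half_pos (sub_pos.2 hβ.2)))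
  obtain ⟨hρ01, hρ02⟩ := lt_min_iff.1 hlt
  set f : (ℝ × ℝ) × ℝ → ℝ := fun p => height C A (p.1.1, p.1.2, p.2) with hf
  let l : ((ℝ × ℝ) × ℝ) ≃L[ℝ] ℝ³ := ContinuousLinearEquiv.prodAssoc ℝ ℝ ℝ ℝ
  have hfC (θ : ℝ) : ContDiffAt ℝ 2 f ((0, B.τ), θ) :=
    ContDiffAt.comp (g := height C A) (f := l) ((0, B.τ), θ) (L.contDiffAt_height (L.base_mem θ))
      l.contDiff.contDiffAt
  have hfd (θ : ℝ) : fderiv ℝ f ((0, B.τ), θ) (0, 1) = M.angP (θ + e) B.aS / B.ω ∧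
      fderiv ℝ f ((0, B.τ), θ) ((0, 1), 0) = M.angP (θ + e) B.aS := by
    have h1 : HasFDerivAt f _ ((0, B.τ), θ) := HasFDerivAt.comp (g := height C A) (f := l) ((0, B.τ), θ)
      ((L.contDiffAt_height (L.base_mem θ)).differentiableAt two_ne_zero).hasFDerivAt l.hasFDerivAt
    obtain ⟨h2, h3⟩ := L.fderiv_height_base θ
    have h4 : fderiv ℝ (height C A) (0, B.τ, θ) = fderiv ℝ (fun u => q₂ (state C A u)) (0, B.τ, θ) :=
      fderiv_sub_const ..
    rw [h1.fderiv, ContinuousLinearMap.comp_apply, ContinuousLinearMap.comp_apply]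
    change fderiv ℝ (height C A) (0, B.τ, θ) (0, 0, 1) = _ ∧ fderiv ℝ (height C A) (0, B.τ, θ) (0, 1, 0) = _
    rw [h4]
    exact ⟨h3, h2⟩
  have hf0 (θ : ℝ) : f ((0, B.τ), θ) = M.angQ (θ + e) B.aS - S.w₂ := L.height_base θ
  obtain ⟨ρp, hρp, hρp1, θp, Kp, hKp, rp, hrp, hp⟩ := ImplicitScalar.exists_root_branch (f := f)
    (θ0 := -β - e) hρ00 (hfC _) (by rw [hf0, sub_add_cancel, b3, sub_self])
    (by rw [(hfd _).1, sub_add_cancel]; positivity) (by rw [(hfd _).2, sub_add_cancel]; exact b4)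
  have hneg (p) : fderiv ℝ (fun p => -f p) p = -fderiv ℝ f p := fderiv_fun_neg
  obtain ⟨ρm, hρm, hρm1, θm, Km, hKm, rm, hrm, hm⟩ := ImplicitScalar.exists_root_branch (f := fun p => -f p)
    (θ0 := β - e) hρ00 (hfC _).neg (by simp only [hf0, sub_add_cancel, b1, sub_self, neg_zero])
    (by rw [hneg, _root_.neg_apply, (hfd _).1, sub_add_cancel, neg_pos]; exact div_neg_of_neg_of_pos b2 hω)
    (by rw [hneg, _root_.neg_apply, (hfd _).2, sub_add_cancel, neg_pos]; exact b2)
  have hcf (θ : ℝ) : ContinuousAt f ((0, B.τ), θ) := (hfC θ).continuousAt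
  have ep : ∀ᶠ x : ℝ × ℝ in 𝓝 (0, B.τ), ∀ θ ∈ Icc (-β - e + ρp) (β - e - ρm), 0 < f (x, θ) :=
    isCompact_Icc.eventually_forall_of_forall_eventually fun θ hθ => by
      refine (hcf θ).eventually (lt_mem_nhds ?_)
      rw [hf0]; linarith [b5 (θ + e) ⟨by linarith [hθ.1], by linarith [hθ.2]⟩]
  have em : ∀ᶠ x : ℝ × ℝ in 𝓝 (0, B.τ), ∀ θ ∈ Icc (β - e + ρm) (-β - e + 2 * π - ρp), f (x, θ) < 0 :=
    isCompact_Icc.eventually_forall_of_forall_eventually fun θ hθ => by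
      refine (hcf θ).eventually (gt_mem_nhds ?_)
      rw [hf0]; linarith [b6 (θ + e) ⟨by linarith [hθ.1], by linarith [hθ.2]⟩]
  have en : ∀ᶠ x : ℝ × ℝ in 𝓝 (0, B.τ), (x.1, x.2, (0 : ℝ)) ∈ nbhd B d :=
    ContinuousAt.eventually_mem (f := fun x : ℝ × ℝ => (x.1, x.2, (0 : ℝ))) (by fun_prop)
      ((isOpen_nbhd B d).mem_nhds (L.base_mem 0))
  -- the sign of the vertical momentum at the zeros
  have hx0 (r : ℝ) (hr : 0 < r) : dist ((0 : ℝ), B.τ) (0, B.τ) < r := by simpa using hr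
  have cont {g : ℝ × ℝ → ℝ} {K r : ℝ} (hr : 0 < r)
      (hg : ∀ x, dist x (0, B.τ) < r → ∀ x', dist x' (0, B.τ) < r → |g x - g x'| ≤ K * dist x x') :
      ContinuousAt (fun x : ℝ × ℝ => p₂ (state C A (x.1, x.2, g x))) (0, B.τ) := by
    have hgc : ContinuousAt g (0, B.τ) := by
      rw [ContinuousAt, tendsto_iff_dist_tendsto_zero]
      have h1 : Tendsto (fun x : ℝ × ℝ => K * dist x (0, B.τ)) (𝓝 (0, B.τ)) (𝓝 0) := by
        have : Continuous fun x : ℝ × ℝ => K * dist x (0, B.τ) := by fun_prop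
        simpa using this.tendsto (0, B.τ)
      refine squeeze_zero' (Eventually.of_forall fun x => dist_nonneg) ?_ h1
      filter_upwards [Metric.ball_mem_nhds _ hr] with x hx
      rw [Real.dist_eq]; exact hg x hx _ (hx0 r hr)
    exact ContinuousAt.comp (g := fun u => p₂ (state C A u)) (f := fun x : ℝ × ℝ => (x.1, x.2, g x))
      (continuous_p2.continuousAt.comp (L.contDiffAt_state (L.base_mem _)).continuousAt) (by fun_prop)
  have root0p : θp (0, B.τ) = -β - e :=
    (((hp _ (hx0 rp hrp)).2.1 (-β - e) (by simpa using hρp.le)).2.1 (by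
      rw [hf0, sub_add_cancel, b3, sub_self])).symm
  have root0m : θm (0, B.τ) = β - e :=
    (((hm _ (hx0 rm hrm)).2.1 (β - e) (by simpa using hρm.le)).2.1 (by
      rw [hf0, sub_add_cancel, b1, sub_self, neg_zero])).symm
  have epp := (cont hrp fun x hx x' hx' => (hp x hx).2.2.1 x' hx').eventually (Ioi_mem_nhds (by
    change 0 < p₂ (state C A (0, B.τ, θp (0, B.τ)))
    rw [root0p, L.state_base, p2_mk, sub_add_cancel]; exact b4))
  have epm := (cont hrm fun x hx x' hx' => (hm x hx).2.2.1 x' hx').eventually (Iio_mem_nhds (by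
    change p₂ (state C A (0, B.τ, θm (0, B.τ))) < 0
    rw [root0m, L.state_base, p2_mk, sub_add_cancel]; exact b2))
  obtain ⟨r, hr, hev⟩ := Metric.eventually_nhds_iff.1 (ep.and (em.and (en.and (epp.and epm))))
  obtain ⟨R, hR, hlt⟩ := exists_between (lt_min hr (lt_min hrp hrm))
  obtain ⟨hR1, hlt⟩ := lt_min_iff.1 hlt
  obtain ⟨hR2, hR3⟩ := lt_min_iff.1 hlt
  have bp {x} (hx : dist x (0, B.τ) < R) := abs_lt.1 (hp x (hx.trans hR2)).1
  have bm {x} (hx : dist x (0, B.τ) < R) := abs_lt.1 (hm x (hx.trans hR3)).1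
  have sp {x} (hx : dist x (0, B.τ) < R) {θ : ℝ} (hθ : |θ - (-β - e)| ≤ ρp) :=
    (hp x (hx.trans hR2)).2.1 θ hθ
  have sm {x} (hx : dist x (0, B.τ) < R) {θ : ℝ} (hθ : |θ - (β - e)| ≤ ρm) :=
    (hm x (hx.trans hR3)).2.1 θ hθ
  refine ⟨θp, θm, -e, π - e, max Kp Km, R, le_max_of_le_left hKp, hR, fun x hx x' hx' => ?_,
    fun x hx x' hx' => ?_, fun x hx x' hx' => (hp x (hx.trans hR2)).2.2.2 x' (hx'.trans hR2),
    fun x hx x' hx' => (hm x (hx.trans hR3)).2.2.2 x' (hx'.trans hR3), fun x hx => ?_,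
    fun x hx => ⟨?_, ?_⟩, fun x hx θ hθ => ?_, fun x hx θ hθ => ?_,
    fun x hx => (hev (hx.trans hR1)).2.2.2.1, fun x hx => (hev (hx.trans hR1)).2.2.2.2⟩
  · exact ((hp x (hx.trans hR2)).2.2.1 x' (hx'.trans hR2)).trans
      (mul_le_mul_of_nonneg_right (le_max_left _ _) dist_nonneg)
  · exact ((hm x (hx.trans hR3)).2.2.1 x' (hx'.trans hR3)).trans
      (mul_le_mul_of_nonneg_right (le_max_right _ _) dist_nonneg)
  · have h1 := bp hx; have h2 := bm hx
    refine ⟨?_, ?_, ?_, ?_⟩ <;> linarith [hβ.1, hβ.2]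
  · exact (sp hx (hp x (hx.trans hR2)).1.le).2.2 rfl
  · exact neg_eq_zero.1 ((sm hx (hm x (hx.trans hR3)).1.le).2.2 rfl)
  · have h1 := bp hx; have h2 := bm hx
    rcases le_or_gt θ (-β - e + ρp) with h3 | h3
    · have h4 := sp hx (θ := θ) (abs_le.2 ⟨by linarith [hθ.1], by linarith⟩)
      have h5 : ¬ f (x, θ) < 0 := fun h => absurd (h4.1.1 h) hθ.1.not_gt
      have h6 : f (x, θ) ≠ 0 := fun h => absurd (h4.2.1 h) hθ.1.ne'
      exact lt_of_le_of_ne (not_lt.1 h5) (Ne.symm h6)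
    rcases le_or_gt θ (β - e - ρm) with h4 | h4
    · exact (hev (hx.trans hR1)).1 θ ⟨h3.le, h4⟩
    · exact neg_lt_zero.1 ((sm hx (θ := θ) (abs_le.2 ⟨by linarith, by linarith [hθ.2]⟩)).1.2 hθ.2)
  · have h1 := bp hx; have h2 := bm hx
    have hxn : (x.1, x.2, θ - 2 * π) ∈ nbhd B d := (hev (hx.trans hR1)).2.2.1
    have hturn : f (x, θ - 2 * π) = f (x, θ) := by
      have := L.height_turn hxn 1
      simp only [turn, Prod.mk_add_mk, add_zero, Int.cast_one, one_mul, sub_add_cancel] at this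
      exact this.symm
    rcases le_or_gt θ (β - e + ρm) with h3 | h3
    · have h4 := sm hx (θ := θ) (abs_le.2 ⟨by linarith [hθ.1], by linarith⟩)
      have h5 : ¬ -f (x, θ) < 0 := fun h => absurd (h4.1.1 h) hθ.1.not_gt
      have h6 : -f (x, θ) ≠ 0 := fun h => absurd (h4.2.1 h) hθ.1.ne'
      exact neg_pos.1 (lt_of_le_of_ne (not_lt.1 h5) (Ne.symm h6))
    rcases le_or_gt θ (-β - e + 2 * π - ρp) with h4 | h4
    · exact (hev (hx.trans hR1)).2.1 θ ⟨h3.le, h4⟩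
    · change f (x, θ) < 0
      rw [← hturn]
      exact (sp hx (θ := θ - 2 * π) (abs_le.2 ⟨by linarith, by linarith [hθ.2]⟩)).1.2 (by linarith [hθ.2])

end Level

end SectionChart

end Model

namespace Model

namespace SectionChart

namespace Level

variable {S : StepSystem} {h : ℝ} {M : Model S h} {B : Base M} {C : SectionChart B} {ρ d : ℝ}
  {A : ℝ³ → ℝ} (L : Level C ρ d A)

include L

lemma hasDerivAt_action {ε t θ : ℝ} (hu : (ε, t, θ) ∈ nbhd B d) :
    HasDerivAt (fun t => M.act (A (ε, t, θ))) (rate C A (ε, t, θ)) t := by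
  rw [← L.fderiv_action hu]
  exact HasFDerivAt.comp_hasDerivAt (l := fun u => M.act (A u)) (f := fun t : ℝ => (ε, t, θ)) t
    ((L.contDiffAt_action hu).differentiableAt two_ne_zero).hasFDerivAt
    ((hasDerivAt_const _ _).prodMk ((hasDerivAt_id _).prodMk (hasDerivAt_const _ _)))

lemma hasDerivAt_rate_time {ε t θ : ℝ} (hu : (ε, t, θ) ∈ nbhd B d) :
    HasDerivAt (fun t => rate C A (ε, t, θ)) (fderiv ℝ (rate C A) (ε, t, θ) (0, 1, 0)) t :=
  HasFDerivAt.comp_hasDerivAt (f := fun t : ℝ => (ε, t, θ)) t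
    ((L.contDiffAt_rate hu).differentiableAt one_ne_zero).hasFDerivAt
    ((hasDerivAt_const _ _).prodMk ((hasDerivAt_id _).prodMk (hasDerivAt_const _ _)))

lemma hasDerivAt_rate_angle {ε t θ : ℝ} (hu : (ε, t, θ) ∈ nbhd B d) :
    HasDerivAt (fun θ => rate C A (ε, t, θ)) (fderiv ℝ (rate C A) (ε, t, θ) (0, 0, 1)) θ :=
  HasFDerivAt.comp_hasDerivAt (f := fun θ : ℝ => (ε, t, θ)) θ
    ((L.contDiffAt_rate hu).differentiableAt one_ne_zero).hasFDerivAt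
    ((hasDerivAt_const _ _).prodMk ((hasDerivAt_const _ _).prodMk (hasDerivAt_id _)))

/-- The level crossings form a family of strictly concave functions. -/
lemma exists_family : ∃ (θp θm : ℝ × ℝ → ℝ) (m0 m1 c μ K : ℝ), ∃ e > 0, e ≤ d ∧ ∀ ε, |ε| < e → ∀ δ, 0 < δ → δ < e → ∀ Δ, 0 ≤ Δ →
    (∀ θ, M.act (A (ε, B.τ - δ, θ)) < M.act (A (ε, B.τ, θ)) - Δ ∧
      M.act (A (ε, B.τ + δ, θ)) < M.act (A (ε, B.τ, θ)) - Δ) →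
    CornerFamily (fun t θ => M.act (A (ε, t, θ))) (fun t θ => rate C A (ε, t, θ))
      (fun t θ => height C A (ε, t, θ)) (B.τ - δ) (B.τ + δ) c μ K Δ (fun t => θp (ε, t))
      (fun t => θm (ε, t)) m0 m1 ∧
    ∀ t ∈ I(B.τ,δ), 0 < p₂ (state C A (ε, t, θp (ε, t))) ∧
      p₂ (state C A (ε, t, θm (ε, t))) < 0 := by
  obtain ⟨θp, θm, m0, m1, K, r, R⟩ := L.exists_roots
  obtain ⟨c, hc, ec⟩ := L.eventually_rate_time
  have hK := R.K_nonneg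
  set μ := c / (4 * (K + 1)) with hμ
  have hμ0 : 0 < μ := by positivity
  have hsmall : μ * K < c / 2 := by
    rw [hμ, div_mul_eq_mul_div, div_lt_div_iff₀ (by positivity) (by norm_num)]; nlinarith
  obtain ⟨e', he', hev⟩ := Metric.eventually_nhds_iff.1 (ec.and (L.eventually_rate_angle hμ0))
  have hr := R.r_pos
  have hd := L.d_pos
  refine ⟨θp, θm, m0, m1, c, μ, K, min (min e' r) d, by positivity, min_le_right _ _,
    fun ε hε δ hδ hδe Δ hΔ hlow => ?_⟩
  have hdist {t : ℝ} (ht : t ∈ I(B.τ,δ)) : dist (ε, t) (0, B.τ) < min (min e' r) d := by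
    rw [Prod.dist_eq, Real.dist_eq, Real.dist_eq, sub_zero]
    exact max_lt hε ((abs_le.2 ⟨by linarith [ht.1], by linarith [ht.2]⟩ : |t - B.τ| ≤ δ).trans_lt hδe)
  simp only [lt_min_iff] at hdist
  have h1 {t : ℝ} (ht : t ∈ I(B.τ,δ)) := (hdist ht).1.1
  have h2 {t : ℝ} (ht : t ∈ I(B.τ,δ)) := (hdist ht).1.2
  have hn {t : ℝ} (ht : t ∈ I(B.τ,δ)) (θ : ℝ) : (ε, t, θ) ∈ nbhd B d := by
    have := (hdist ht).2
    rw [Prod.dist_eq, max_lt_iff, Real.dist_eq, Real.dist_eq, sub_zero] at this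
    exact this
  have hdt (t t' : ℝ) : dist (ε, t) (ε, t') = |t - t'| := by
    rw [Prod.dist_eq, dist_self, Real.dist_eq, max_eq_right (abs_nonneg _)]
  have hcont {f : ℝ³ → ℝ} (hf : ∀ u ∈ nbhd B d, ContinuousAt f u) :
      Continuous fun p : ℝ × I(B.τ,δ) => f (ε, p.2, p.1) :=
    continuous_iff_continuousAt.2 fun p => ContinuousAt.comp (g := f)
      (f := fun p : ℝ × I(B.τ,δ) => (ε, (p.2 : ℝ), p.1)) (hf _ (hn p.2.2 _)) (by fun_prop)
  have hmem : B.τ ∈ I(B.τ,δ) := ⟨by linarith, by linarith⟩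
  have hturn (θ : ℝ) (t : ℝ) : (ε, t, θ + 2 * π) = (ε, t, θ) + turn 1 := by simp [turn]
  refine ⟨⟨⟨by linarith, hμ0.le, hK, hsmall, hΔ, ?_, ?_, fun θ t ht => L.hasDerivAt_action (hn ht θ),
    fun θ t ht t' ht' htt => ?_, fun t ht θ θ' => ?_, fun θ => ⟨B.τ, hmem, hlow θ⟩, fun t ht θ => ?_⟩, ?_,
    fun t ht θ => ?_, fun t ht t' ht' => ?_, fun t ht t' ht' => ?_,
    fun t ht t' ht' h => R.anti_p _ (h2 ht) _ (h2 ht') rfl h,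
    fun t ht t' ht' h => R.anti_m _ (h2 ht) _ (h2 ht') rfl h, fun t ht => R.range _ (h2 ht),
    fun t ht => R.zero _ (h2 ht), fun t ht θ hθ => R.pos _ (h2 ht) θ hθ,
    fun t ht θ hθ => R.neg _ (h2 ht) θ hθ⟩, fun t ht => ⟨R.p2_pos _ (h2 ht), R.p2_neg _ (h2 ht)⟩⟩
  · exact hcont fun u hu => (L.contDiffAt_action hu).continuousAt
  · exact hcont fun u hu => (L.contDiffAt_rate hu).continuousAt
  · have hsub : Icc t t' ⊆ I(B.τ,δ) := Icc_subset_Icc ht.1 ht'.2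
    have key := (convex_Icc t t').mul_sub_le_image_sub_of_le_deriv (f := fun t => -rate C A (ε, t, θ)) (C := c)
      (fun s hs => (L.hasDerivAt_rate_time (hn (hsub hs) θ)).neg.continuousAt.continuousWithinAt)
      (fun s hs => (L.hasDerivAt_rate_time (hn (hsub (interior_subset hs)) θ)).neg.differentiableAt.differentiableWithinAt)
      (fun s hs => by
        rw [(L.hasDerivAt_rate_time (hn (hsub (interior_subset hs)) θ)).fun_neg.deriv]
        have := (hev (h1 (hsub (interior_subset hs)))).1 θ
        simp only at this
        linarith) t ⟨le_rfl, htt⟩ t' ⟨htt, le_rfl⟩ htt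
    linarith
  · have key := (convex_univ (𝕜 := ℝ) (E := ℝ)).norm_image_sub_le_of_norm_hasDerivWithin_le
      (f := fun θ => rate C A (ε, t, θ)) (C := μ)
      (fun s _ => (L.hasDerivAt_rate_angle (hn ht s)).hasDerivWithinAt)
      (fun s _ => ((hev (h1 ht)).2 s).le) (mem_univ θ') (mem_univ θ)
    exact key
  · simp only [hturn]; rw [L.A_turn (hn ht θ)]
  · exact hcont fun u hu => (L.contDiffAt_height hu).continuousAt
  · simp only [hturn]; rw [L.height_turn (hn ht θ)]
  · have := R.lip_p _ (h2 ht) _ (h2 ht')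
    rwa [hdt] at this
  · have := R.lip_m _ (h2 ht) _ (h2 ht')
    rwa [hdt] at this

/-- Before and after the unperturbed tangency the action at the wall is smaller by a gap. -/
lemma exists_gap : ∃ δ1 > 0, ∀ δ, 0 < δ → δ ≤ δ1 → ∃ G > 0, ∀ᶠ ε in 𝓝 (0 : ℝ), ∀ θ,
    M.act (A (ε, B.τ - δ, θ)) < M.act (A (ε, B.τ, θ)) - G ∧
    M.act (A (ε, B.τ + δ, θ)) < M.act (A (ε, B.τ, θ)) - G ∧
    0 < rate C A (ε, B.τ - δ, θ) ∧ rate C A (ε, B.τ + δ, θ) < 0 := by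
  obtain ⟨c, hc, ec⟩ := L.eventually_rate_time
  obtain ⟨e, he, hev⟩ := Metric.eventually_nhds_iff.1 ec
  have hd := L.d_pos
  obtain ⟨δ1, hδ1, hlt⟩ := exists_between (lt_min he hd)
  obtain ⟨h1, h2⟩ := lt_min_iff.1 hlt
  refine ⟨δ1, hδ1, fun δ hδ hδle => ?_⟩
  have hδe := hδle.trans_lt h1
  have hδd := hδle.trans_lt h2
  have habs {t : ℝ} (ht : t ∈ I(B.τ,δ)) : |t - B.τ| ≤ δ :=
    abs_le.2 ⟨by linarith [ht.1], by linarith [ht.2]⟩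
  have hn {t : ℝ} (ht : t ∈ I(B.τ,δ)) (θ : ℝ) : (0, t, θ) ∈ nbhd B d :=
    ⟨by simpa using hd, (habs ht).trans_lt hδd⟩
  have hanti (θ : ℝ) : StrictAntiOn (fun t => rate C A (0, t, θ)) (I(B.τ,δ)) := by
    refine strictAntiOn_Icc (fun t ht => L.hasDerivAt_rate_time (hn ht θ)) fun t ht => ?_
    have := hev (y := (0, t)) (by
      rw [Prod.dist_eq, dist_self, Real.dist_eq, max_eq_right (abs_nonneg _)]
      exact (habs (Ioo_subset_Icc_self ht)).trans_lt hδe) θ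
    exact this.trans (by linarith)
  have h0 (θ : ℝ) : rate C A (0, B.τ, θ) = 0 :=
    (L.rate_iff (L.base_mem θ)).2.2 (by rw [L.state_base, p1_mk])
  have ml : B.τ - δ ∈ I(B.τ,δ) := ⟨le_rfl, by linarith⟩
  have mr : B.τ + δ ∈ I(B.τ,δ) := ⟨by linarith, le_rfl⟩
  have m0 : B.τ ∈ I(B.τ,δ) := ⟨by linarith, by linarith⟩
  have k1 : M.act (A (0, B.τ - δ, 0)) < M.act (A (0, B.τ, 0)) := by
    have : StrictMonoOn (fun t => M.act (A (0, t, 0))) (Icc (B.τ - δ) B.τ) := by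
      have hs : Icc (B.τ - δ) B.τ ⊆ I(B.τ,δ) := Icc_subset_Icc_right (by linarith)
      exact strictMonoOn_Icc (fun t ht => L.hasDerivAt_action (hn (hs ht) 0)) fun t ht =>
        (h0 0).symm.trans_lt (hanti 0 (hs (Ioo_subset_Icc_self ht)) m0 ht.2)
    exact this ⟨le_rfl, by linarith⟩ ⟨by linarith, le_rfl⟩ (by linarith)
  have k2 : M.act (A (0, B.τ + δ, 0)) < M.act (A (0, B.τ, 0)) := by
    have : StrictAntiOn (fun t => M.act (A (0, t, 0))) (Icc B.τ (B.τ + δ)) := by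
      have hs : Icc B.τ (B.τ + δ) ⊆ I(B.τ,δ) := Icc_subset_Icc_left (by linarith)
      exact strictAntiOn_Icc (fun t ht => L.hasDerivAt_action (hn (hs ht) 0)) fun t ht =>
        (hanti 0 m0 (hs (Ioo_subset_Icc_self ht)) ht.1).trans_eq (h0 0)
    exact this ⟨le_rfl, by linarith⟩ ⟨by linarith, le_rfl⟩ (by linarith)
  have hz {t : ℝ} (ht : t ∈ I(B.τ,δ)) (θ : ℝ) : A (0, t, θ) = A (0, t, 0) :=
    L.A_zero ((habs ht).trans_lt hδd) θ 0
  obtain ⟨G, hG, hlt⟩ := exists_between (lt_min (sub_pos.2 k1) (sub_pos.2 k2))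
  obtain ⟨g1, g2⟩ := lt_min_iff.1 hlt
  rw [lt_sub_comm] at g1 g2
  refine ⟨G, hG, eventually_forall_of_periodic (c := 2 * π) (by positivity) ?_ fun θ => ?_⟩
  · have : ∀ᶠ ε in 𝓝 (0 : ℝ), |ε| < d :=
      continuous_abs.continuousAt.eventually_lt continuousAt_const (by simpa using hd)
    filter_upwards [this] with ε hε θ n hP
    have hm {t : ℝ} (ht : t ∈ I(B.τ,δ)) : (ε, t, θ) ∈ nbhd B d := ⟨hε, (habs ht).trans_lt hδd⟩
    have e1 (t : ℝ) : (ε, t, θ + n * (2 * π)) = (ε, t, θ) + turn n := by simp [turn]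
    rw [e1, e1, e1, L.A_turn (hm ml), L.A_turn (hm mr), L.A_turn (hm m0), L.rate_turn (hm ml),
      L.rate_turn (hm mr)]
    exact hP
  · have c1 {t : ℝ} (ht : t ∈ I(B.τ,δ)) :
        ContinuousAt (fun z : ℝ × ℝ => M.act (A (z.1, t, z.2))) (0, θ) :=
      ContinuousAt.comp (g := fun u => M.act (A u)) (f := fun z : ℝ × ℝ => (z.1, t, z.2))
        (L.contDiffAt_action (hn ht θ)).continuousAt (by fun_prop)
    have c2 {t : ℝ} (ht : t ∈ I(B.τ,δ)) :
        ContinuousAt (fun z : ℝ × ℝ => rate C A (z.1, t, z.2)) (0, θ) :=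
      ContinuousAt.comp (g := rate C A) (f := fun z : ℝ × ℝ => (z.1, t, z.2))
        (L.contDiffAt_rate (hn ht θ)).continuousAt (by fun_prop)
    have r1 := hanti θ ml m0 (by linarith)
    have r2 := hanti θ m0 mr (by linarith)
    simp only [h0] at r1 r2
    exact ((c1 ml).eventually_lt ((c1 m0).sub continuousAt_const) (by
        change M.act (A (0, B.τ - δ, θ)) < M.act (A (0, B.τ, θ)) - G; rw [hz ml, hz m0]; exact g1)).and
      (((c1 mr).eventually_lt ((c1 m0).sub continuousAt_const) (by
        change M.act (A (0, B.τ + δ, θ)) < M.act (A (0, B.τ, θ)) - G; rw [hz mr, hz m0]; exact g2)).and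
        ((continuousAt_const.eventually_lt (c2 ml) r1).and ((c2 mr).eventually_lt continuousAt_const r2)))

end Level

end SectionChart

end Model

/-- Change of the signs of the momenta. -/
def flip (s1 s2 : ℝ) (z : Phase) : Phase := (q₁ z, s1 * p₁ z, q₂ z, s2 * p₂ z)

lemma timeRev_eq_flip (z : Phase) : timeRev z = flip (-1) (-1) z := by simp [timeRev, flip]

lemma flip_one_one (z : Phase) : flip 1 1 z = z := by simp [flip]; rfl

namespace Model

variable {S : StepSystem} {h : ℝ} {M : Model S h}

/-- The admissible signs. -/
def Sign (s : ℝ) : Prop := s = 1 ∨ s = -1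

lemma Base.energy2_tangent (B : Base M) {ε : ℝ} {z : Phase} (h1 : q₁ z = S.w₁) (h2 : p₁ z = 0)
    (h3 : q₂ z ∈ S.U₂) (h4 : S.hamiltonian ε z = h) :
    |S.energy₂ (q₂ z) (p₂ z) - M.W2 B.aS| ≤ M.B * |ε| := by
  have v3 : |ε * S.Vc (q₁ z, q₂ z)| ≤ M.B * |ε| := by
    rw [abs_mul, mul_comm]
    exact mul_le_mul_of_nonneg_right (M.Vc_le _ ⟨by rw [h1]; exact S.w₁_mem, h3⟩) (abs_nonneg _)
  have hl := B.level2
  have hen : S.energy₂ (q₂ z) (p₂ z) = M.W2 B.aS - ε * S.Vc (q₁ z, q₂ z) := by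
    rw [hamiltonian, h2, h1] at h4
    rw [energy₂, h1]; linarith
  rwa [hen, sub_sub_cancel_left, abs_neg]

lemma amp_near {B : Base M} {e : ℝ} (he : 0 < e) : ∃ E > 0, ∀ a ∈ M.Amp,
    |M.W2 a - M.W2 B.aS| < E → |a - B.aS| < e := by
  have w := M.core2.well
  have ha := B.aS_mem.1
  obtain ⟨e', he', hlt⟩ := exists_between (lt_min he (lt_min ha.1 (sub_pos.2 ha.2)))
  simp only [lt_min_iff, lt_sub_iff_add_lt'] at hlt
  obtain ⟨h1, h2, h3⟩ := hlt
  replace h2 := sub_pos.2 h2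
  have k1 := w.strictMonoOn ⟨h2.le, by linarith⟩ ⟨ha.1.le, ha.2.le⟩ (show B.aS - e' < B.aS by linarith)
  have k2 := w.strictMonoOn ⟨ha.1.le, ha.2.le⟩ ⟨by linarith, h3.le⟩ (show B.aS < B.aS + e' by linarith)
  refine ⟨min (M.W2 B.aS - M.W2 (B.aS - e')) (M.W2 (B.aS + e') - M.W2 B.aS),
    lt_min (sub_pos.2 k1) (sub_pos.2 k2), fun a haA hlt => ?_⟩
  obtain ⟨l1, l2⟩ := lt_min_iff.1 hlt
  have haI : a ∈ Icc 0 M.r₂ := Ioo_subset_Icc_self haA.1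
  have m1 : B.aS - e' < a := (w.strictMonoOn.lt_iff_lt ⟨h2.le, by linarith⟩ haI).1 (by
    linarith [(abs_lt.1 l1).1])
  have m2 : a < B.aS + e' := (w.strictMonoOn.lt_iff_lt haI ⟨by linarith, h3.le⟩).1 (by
    linarith [(abs_lt.1 l2).2])
  rw [abs_lt]; constructor <;> linarith

lemma W2_near {B : Base M} {E : ℝ} (hE : 0 < E) : ∃ e > 0, ∀ a, |a - B.aS| < e →
    |M.W2 a - M.W2 B.aS| < E := by
  obtain ⟨e, he, h1⟩ := Metric.continuousAt_iff.1 (M.core2.well.continuous.continuousAt (x := B.aS)) E hE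
  exact ⟨e, he, fun a ha => h1 ha⟩

/-- The action takes all values near its value at the unperturbed tangency. -/
lemma act_surj {B : Base M} {e : ℝ} (he : 0 < e) : ∃ κ > 0, ∀ I, |I - M.act B.aS| < κ →
    ∃ a, |a - B.aS| < e ∧ a ∈ M.Amp ∧ M.act a = I := by
  obtain ⟨r, hr, hrA⟩ := Metric.isOpen_iff.1 M.isOpen_amp _ B.aS_mem
  obtain ⟨e', he0, hlt⟩ := exists_between (lt_min he hr)
  obtain ⟨h1, h2⟩ := lt_min_iff.1 hlt
  have hA {a : ℝ} (ha : a ∈ I(B.aS,e')) : a ∈ M.Amp := hrA (by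
    rw [Metric.mem_ball, Real.dist_eq, abs_lt]; constructor <;> linarith [ha.1, ha.2])
  have m0 : B.aS ∈ I(B.aS,e') := ⟨by linarith, by linarith⟩
  have ml : B.aS - e' ∈ I(B.aS,e') := ⟨le_rfl, by linarith⟩
  have mr : B.aS + e' ∈ I(B.aS,e') := ⟨by linarith, le_rfl⟩
  have k1 := act_strictMonoOn (hA ml) (hA m0) (show B.aS - e' < B.aS by linarith)
  have k2 := act_strictMonoOn (hA m0) (hA mr) (show B.aS < B.aS + e' by linarith)
  have hc : ContinuousOn M.act (I(B.aS,e')) := fun a ha =>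
    (contDiffAt_act (hA ha)).continuousAt.continuousWithinAt
  refine ⟨min (M.act B.aS - M.act (B.aS - e')) (M.act (B.aS + e') - M.act B.aS),
    lt_min (sub_pos.2 k1) (sub_pos.2 k2), fun I hI => ?_⟩
  obtain ⟨l1, l2⟩ := lt_min_iff.1 hI
  obtain ⟨a, ha, haI⟩ := intermediate_value_Icc (show B.aS - e' ≤ B.aS + e' by linarith) hc
    (show I ∈ Icc (M.act (B.aS - e')) (M.act (B.aS + e')) from
      ⟨by linarith [(abs_lt.1 l1).1], by linarith [(abs_lt.1 l2).2]⟩)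
  exact ⟨a, (abs_le.2 ⟨by linarith [ha.1], by linarith [ha.2]⟩ : |a - B.aS| ≤ e').trans_lt h1, hA ha, haI⟩

/-- The action is a Lipschitz function of the energy. -/
lemma act_lipschitz (B : Base M) : ∃ K ≥ 0, ∃ e > 0, ∀ a a', |a - B.aS| < e → |a' - B.aS| < e →
    |M.act a - M.act a'| ≤ K * |M.W2 a - M.W2 a'| := by
  obtain ⟨K, U, hU, hK⟩ := ((contDiffAt_act B.aS_mem).of_le (m := 1) (by norm_num)).exists_lipschitzOnWith
  set m := -M.a₂ B.aS / 2 with hm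
  have hneg := M.core2.well.neg B.aS ⟨B.aS_mem.1.1, B.aS_mem.1.2.le⟩
  have hm0 : 0 < m := by linarith
  have hev : ∀ᶠ a in 𝓝 B.aS, m < -M.a₂ a :=
    M.core2.well.cont.neg.continuousAt.eventually (lt_mem_nhds (show m < -M.a₂ B.aS by linarith))
  obtain ⟨e, he, hball⟩ := Metric.mem_nhds_iff.1 (inter_mem hU hev)
  refine ⟨K / m, by have := K.2; positivity, e, he, ?_⟩
  have key : ∀ a a', |a - B.aS| < e → |a' - B.aS| < e → a ≤ a' →
      |M.act a - M.act a'| ≤ K / m * |M.W2 a - M.W2 a'| := fun a a' ha ha' hle => by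
    have h1 := hK.dist_le_mul a (hball ha).1 a' (hball ha').1
    rw [Real.dist_eq, Real.dist_eq] at h1
    have hsub : ∀ s ∈ Icc a a', m < -M.a₂ s := fun s hs => by
      refine (hball (show dist s B.aS < e from ?_)).2
      rw [Real.dist_eq, abs_lt]; rw [abs_lt] at ha ha'
      constructor <;> linarith [hs.1, hs.2, ha.1, ha'.2]
    have h2 := (convex_Icc a a').mul_sub_le_image_sub_of_le_deriv (f := M.W2) (C := m)
      (fun s _ => (M.core2.well.deriv s).continuousAt.continuousWithinAt)
      (fun s _ => (M.core2.well.deriv s).differentiableAt.differentiableWithinAt)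
      (fun s hs => by rw [(M.core2.well.deriv s).deriv]; exact (hsub s (interior_subset hs)).le)
      a ⟨le_rfl, hle⟩ a' ⟨hle, le_rfl⟩ hle
    have h3 : m * |a - a'| ≤ |M.W2 a - M.W2 a'| := by
      rw [abs_sub_comm, abs_sub_comm (M.W2 a), abs_of_nonneg (sub_nonneg.2 hle)]
      exact h2.trans (le_abs_self _)
    calc _ ≤ K * |a - a'| := h1
      _ = K / m * (m * |a - a'|) := by field_simp
      _ ≤ _ := mul_le_mul_of_nonneg_left h3 (by have := K.2; positivity)
  intro a a' ha ha'
  rcases le_total a a' with h | h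
  · exact key a a' ha ha' h
  · rw [abs_sub_comm, abs_sub_comm (M.W2 a)]; exact key a' a ha' ha h

/-- Near the unperturbed tangent states the flow behaves as the unperturbed flow, uniformly in the angle. -/
lemma Base.facts_at_tangency (B : Base M) {δ : ℝ}
    (hF : ∀ θ, ∀ᶠ p : ℝ × Phase in 𝓝 (0, (S.w₁, 0, M.angQ θ B.aS, M.angP θ B.aS)),
      M.Facts B.τ δ p.1 p.2) :
    ∃ e > 0, ∀ ε, |ε| < e → ∀ a, |a - B.aS| < e → ∀ θ,
      M.Facts B.τ δ ε (S.w₁, 0, M.angQ θ a, M.angP θ a) := by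
  have key : ∀ᶠ x : ℝ × ℝ in 𝓝 (0, B.aS), ∀ θ, M.Facts B.τ δ x.1 (S.w₁, 0, M.angQ θ x.2, M.angP θ x.2) := by
    refine eventually_forall_of_periodic (c := 2 * π) (by positivity) ?_ fun θ => ?_
    · have : ∀ᶠ x : ℝ × ℝ in 𝓝 (0, B.aS), x.2 ∈ M.Amp :=
        continuousAt_snd.eventually_mem (amp_mem_nhds B.aS_mem)
      filter_upwards [this] with x hx θ n hP
      rw [(ang_periodic hx θ n).1, (ang_periodic hx θ n).2]; exact hP
    · obtain ⟨c1, c2⟩ := contDiffAt_ang B.aS_mem θ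
      have d1 : ContinuousAt (fun z : (ℝ × ℝ) × ℝ => M.angQ z.2 z.1.2) ((0, B.aS), θ) :=
        c1.continuousAt.comp (f := fun z : (ℝ × ℝ) × ℝ => (z.2, z.1.2)) (x := ((0, B.aS), θ)) (by fun_prop)
      have d2 : ContinuousAt (fun z : (ℝ × ℝ) × ℝ => M.angP z.2 z.1.2) ((0, B.aS), θ) :=
        c2.continuousAt.comp (f := fun z : (ℝ × ℝ) × ℝ => (z.2, z.1.2)) (x := ((0, B.aS), θ)) (by fun_prop)
      have d3 : ContinuousAt (fun z : (ℝ × ℝ) × ℝ =>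
          ((z.1.1, (S.w₁, 0, M.angQ z.2 z.1.2, M.angP z.2 z.1.2)) : ℝ × Phase)) ((0, B.aS), θ) :=
        ContinuousAt.prodMk (by fun_prop) (continuousAt_const.prodMk (continuousAt_const.prodMk (d1.prodMk d2)))
      exact d3.eventually (hF θ)
  obtain ⟨e, he, hev⟩ := Metric.eventually_nhds_iff.1 key
  refine ⟨e, he, fun ε hε a ha θ => hev (y := (ε, a)) ?_ θ⟩
  rw [Prod.dist_eq, Real.dist_eq, Real.dist_eq, sub_zero]; exact max_lt hε ha

namespace SectionChart

variable {B : Base M} {C : SectionChart B}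

/-- Near the unperturbed tangencies the flow behaves as the unperturbed flow, also after a change of the
signs of the momenta. -/
lemma facts_of_orb (C : SectionChart B) {δ : ℝ}
    (hF : ∀ θ, ∀ᶠ p : ℝ × Phase in 𝓝 (0, (S.w₁, 0, M.angQ θ B.aS, M.angP θ B.aS)),
      M.Facts B.τ δ p.1 p.2) :
    ∃ e > 0, ∀ ε, |ε| < e → ∀ t, |t - B.τ| < e → ∀ a, |a - B.aS| < e → ∀ θ, ∀ s1 s2, Sign s1 → Sign s2 →
      M.Facts B.τ δ ε (flip s1 s2 (C.orb ((ε, t, θ), a))) := by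
  have key (s1 s2 : ℝ) (h2 : Sign s2) : ∀ᶠ x : ℝ³ in 𝓝 (0, B.τ, B.aS), ∀ θ,
      M.Facts B.τ δ x.1 (flip s1 s2 (C.orb ((x.1, x.2.1, θ), x.2.2))) := by
    refine eventually_forall_of_periodic (c := 2 * π) (by positivity) ?_ fun θ => ?_
    · have : ∀ᶠ x : ℝ³ in 𝓝 (0, B.τ, B.aS), ((x.1, x.2.1, (0 : ℝ)), x.2.2) ∈ C.dom :=
        ContinuousAt.eventually_mem (f := fun x : ℝ³ => ((x.1, x.2.1, (0 : ℝ)), x.2.2)) (by fun_prop)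
          (C.isOpen_dom.mem_nhds (base_mem_dom B.τ 0))
      filter_upwards [this] with x hx θ n hP
      have := orb_turn (p := ((x.1, x.2.1, θ), x.2.2)) hx n
      simp only [turn, Prod.mk_add_mk, add_zero] at this
      rw [this]; exact hP
    · have c1 : ContinuousAt (fun z : (ℝ³) × ℝ => C.orb ((z.1.1, z.1.2.1, z.2), z.1.2.2))
          ((0, B.τ, B.aS), θ) :=
        (contDiffAt_orb (base_mem_dom B.τ θ)).continuousAt.comp
          (f := fun z : (ℝ³) × ℝ => (((z.1.1, z.1.2.1, z.2), z.1.2.2) : (ℝ³) × ℝ))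
          (x := ((0, B.τ, B.aS), θ)) (by fun_prop)
      have cf : Continuous (flip s1 s2) := by unfold flip; fun_prop
      have c2 : ContinuousAt (fun z : (ℝ³) × ℝ =>
          ((z.1.1, flip s1 s2 (C.orb ((z.1.1, z.1.2.1, z.2), z.1.2.2))) : ℝ × Phase)) ((0, B.τ, B.aS), θ) :=
        ContinuousAt.prodMk (by fun_prop) (cf.continuousAt.comp c1)
      obtain ⟨φ, hφ⟩ : ∃ φ, flip s1 s2 (C.orb ((0, B.τ, θ), B.aS)) =
          (S.w₁, 0, M.angQ φ B.aS, M.angP φ B.aS) := by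
        rw [orb_base]
        rcases h2 with rfl | rfl
        · exact ⟨θ + B.ω * B.τ, by simp [flip]⟩
        · obtain ⟨n1, n2⟩ := ang_neg B.aS_mem (θ + B.ω * B.τ)
          exact ⟨-(θ + B.ω * B.τ), by rw [n1, n2]; simp [flip]⟩
      exact c2.eventually (by simp only; rw [hφ]; exact hF φ)
  have h1 : Sign 1 := .inl rfl
  have h2 : Sign (-1) := .inr rfl
  obtain ⟨e, he, hev⟩ := Metric.eventually_nhds_iff.1
    ((key 1 1 h1).and ((key 1 (-1) h2).and ((key (-1) 1 h1).and (key (-1) (-1) h2))))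
  refine ⟨e, he, fun ε hε t ht a ha θ s1 s2 hs1 hs2 => ?_⟩
  obtain ⟨f1, f2, f3, f4⟩ := hev (y := (ε, t, a)) (by
    rw [Prod.dist_eq, Prod.dist_eq, Real.dist_eq, Real.dist_eq, Real.dist_eq, sub_zero]
    exact max_lt hε (max_lt ht ha))
  rcases hs1 with rfl | rfl <;> rcases hs2 with rfl | rfl
  exacts [f1 θ, f2 θ, f3 θ, f4 θ]

/-- When the orbit passes the height of the corner, the vertical momentum does not change its sign. -/
lemma momentum_of_height (C : SectionChart B) {δ : ℝ} (hδ : 0 < δ)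
    (hF : ∀ θ, ∀ᶠ p : ℝ × Phase in 𝓝 (0, (S.w₁, 0, M.angQ θ B.aS, M.angP θ B.aS)),
      M.Facts B.τ δ p.1 p.2) :
    ∃ e > 0, ∀ ε, |ε| < e → ∀ a, |a - B.aS| < e → ∀ t, |t - B.τ| < e → ∀ t', |t' - B.τ| < e → ∀ θ,
      q₂ (C.orb ((ε, t, θ), a)) = S.w₂ → 0 < p₂ (C.orb ((ε, t, θ), a)) * p₂ (C.orb ((ε, t', θ), a)) := by
  obtain ⟨e, he, F⟩ := C.facts_of_orb hF
  obtain ⟨m, hm, hlt⟩ := exists_between (lt_min he (_root_.half_pos hδ))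
  obtain ⟨m1, m2⟩ := lt_min_iff.1 hlt
  refine ⟨m, hm, fun ε hε a ha t ht t' ht' θ hq => ?_⟩
  have key (s) (hs : Sign s) := F ε (hε.trans m1) t (ht.trans m1) a (ha.trans m1) θ s s hs hs
  have e1 : C.orb ((ε, t', θ), a) = M.Φ (t' - t) ε (C.orb ((ε, t, θ), a)) := by
    simp only [orb]; rw [← M.Φ_add, sub_add_cancel]
  rw [abs_lt] at ht ht'
  rw [e1]
  rcases le_total t t' with h | h
  · have := (key 1 (.inl rfl)).vert (by simpa [flip] using hq) (t' - t) ⟨by linarith, by linarith⟩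
    simpa [flip_one_one] using this
  · have := (key (-1) (.inr rfl)).vert (by simpa [flip] using hq) (t - t') ⟨by linarith, by linarith⟩
    rw [← timeRev_eq_flip, M.Φ_timeRev, neg_sub] at this
    simpa using this

/-! ### Coordinates on the section -/

lemma energy2_lt (hε : |ε| < C.η) {z : Phase} (hz : z ∈ S.section_ ε h) :
    S.energy₂ (q₂ z) (p₂ z) < M.h₂ := by
  obtain ⟨h1, h2, h3, -, h5⟩ := hz
  have v1 := S.V1_nonneg h1
  have v3 : |ε * S.Vc (q₁ z, q₂ z)| ≤ M.B * C.η := by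
    rw [abs_mul, mul_comm]
    exact mul_le_mul (M.Vc_le _ ⟨h1, h2⟩) hε.le (abs_nonneg _) M.B_nonneg
  have v4 := (abs_le.1 v3).1
  have v5 := C.bound
  rw [hamiltonian, h3] at h5
  rw [energy₂]; linarith

lemma eq_pt_of_ang (hε : |ε| < C.η) {z : Phase} (hz : z ∈ S.section_ ε h) {θ a : ℝ}
    (ha : |a - B.aS| < C.η) (hq : q₂ z = M.angQ θ a) (hp : p₂ z = M.angP θ a) : z = C.pt ε θ a :=
  C.eq_of_mem ε θ a hε ha z hz hq hp

lemma coord_pt (ε θ : ℝ) {a : ℝ} (ha : |a - B.aS| < C.η) : S.coord (C.pt ε θ a) = (↑θ, M.act a) :=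
  coord_ang (C.amp a ha) θ _ _

lemma timeRev_pt {ε : ℝ} (hε : |ε| < C.η) (θ : ℝ) {a : ℝ} (ha : |a - B.aS| < C.η) :
    timeRev (C.pt ε θ a) = C.pt ε (-θ) a := by
  refine eq_pt_of_ang hε (timeRev_mem_section (C.mem_section ε θ a hε ha)) ha ?_ ?_
  · exact (ang_neg (C.amp a ha) θ).1.symm
  · exact (ang_neg (C.amp a ha) θ).2.symm

/-- A point of the section is determined by its coordinates. -/
lemma eq_pt (hε : |ε| < C.η) {z : Phase} (hz : z ∈ S.section_ ε h) {θ a : ℝ} (ha : |a - B.aS| < C.η)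
    (hc : S.coord z = (↑θ, M.act a)) : z = C.pt ε θ a := by
  have hA := C.amp a ha
  have hE : 0 < S.energy₂ (q₂ z) (p₂ z) := by
    have h0 : 0 ≤ S.energy₂ (q₂ z) (p₂ z) := by
      have := S.V2_nonneg hz.2.1; rw [energy₂]; positivity
    refine lt_of_le_of_ne h0 fun h0 => ?_
    have h1 : S.action₂ (S.energy₂ (q₂ z) (p₂ z)) = M.act a := congrArg Prod.snd hc
    rw [← h0, action2_zero M B.h_pos] at h1
    exact absurd h1 (act_pos hA).ne
  obtain ⟨a', ha', θ', e1, e2, -⟩ := exists_ang hz.2.1 hE (energy2_lt hε hz)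
  have h1 : S.coord z = (↑θ', M.act a') := by
    rw [← coord_ang ha' θ' (q₁ z) (p₁ z), ← e1, ← e2]; rfl
  rw [h1, Prod.mk.injEq] at hc
  obtain rfl := act_strictMonoOn.injOn ha' hA hc.2
  obtain ⟨k1, k2⟩ := ang_congr ha' hc.1
  exact eq_pt_of_ang hε hz ha (e1.trans k1) (e2.trans k2)

/-- A point of the section with vertical energy near that of the unperturbed tangency is covered by the
chart. -/
lemma exists_pt (C : SectionChart B) {σ : ℝ} (hσ : 0 < σ) (hση : σ ≤ C.η) : ∃ E > 0, ∀ ε, |ε| < C.η →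
    ∀ z ∈ S.section_ ε h, |S.energy₂ (q₂ z) (p₂ z) - M.W2 B.aS| < E →
      ∃ θ a, |a - B.aS| < σ ∧ z = C.pt ε θ a := by
  obtain ⟨E, hE, hnear⟩ := amp_near (B := B) hσ
  have hpos : 0 < M.W2 B.aS := by
    rw [← W2_zero (M := M)]
    exact M.core2.well.strictMonoOn ⟨le_rfl, M.core2.well.r_pos.le⟩
      ⟨B.aS_mem.1.1.le, B.aS_mem.1.2.le⟩ B.aS_mem.1.1
  refine ⟨min E (M.W2 B.aS), by positivity, fun ε hε z hz hlt => ?_⟩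
  obtain ⟨l1, l2⟩ := lt_min_iff.1 hlt
  obtain ⟨a, ha, θ, e1, e2, e3⟩ := exists_ang hz.2.1 (by linarith [(abs_lt.1 l2).1]) (energy2_lt hε hz)
  have := hnear a ha (by rwa [e3])
  exact ⟨θ, a, this, eq_pt_of_ang hε hz (this.trans_le hση) e1 e2⟩

/-- A state of tangency has vertical energy near that of the unperturbed tangency. -/
lemma exists_tangent (C : SectionChart B) {σ : ℝ} (hσ : 0 < σ) : ∃ E > 0, ∀ ε, |ε| < C.η →
    M.B * |ε| < E → ∀ z : Phase, q₁ z = S.w₁ → p₁ z = 0 → q₂ z ∈ S.U₂ → S.hamiltonian ε z = h →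
      ∃ θ a, |a - B.aS| < σ ∧ z = (S.w₁, 0, M.angQ θ a, M.angP θ a) := by
  obtain ⟨E, hE, hnear⟩ := amp_near (B := B) hσ
  have hpos : 0 < M.W2 B.aS := by
    rw [← W2_zero (M := M)]
    exact M.core2.well.strictMonoOn ⟨le_rfl, M.core2.well.r_pos.le⟩
      ⟨B.aS_mem.1.1.le, B.aS_mem.1.2.le⟩ B.aS_mem.1.1
  refine ⟨min E (M.W2 B.aS), by positivity, fun ε hε hεE z h1 h2 h3 h4 => ?_⟩
  have hle := B.energy2_tangent h1 h2 h3 h4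
  have hlt := hle.trans_lt hεE
  obtain ⟨l1, l2⟩ := lt_min_iff.1 hlt
  have hV1 := S.V1_pos S.w₁_mem S.w₁_neg.ne
  have hl := B.level2
  have hBη := mul_le_mul_of_nonneg_left hε.le M.B_nonneg
  have hbd := C.bound
  obtain ⟨a, ha, θ, e1, e2, e3⟩ := exists_ang h3 (by linarith [(abs_lt.1 l2).1])
    (by linarith [(abs_le.1 hle).2])
  refine ⟨θ, a, hnear a ha (by rwa [e3]), ?_⟩
  rw [← e1, ← e2, ← h1, ← h2]; rfl

end SectionChart

end Model

@[simp] lemma q1_flip (s1 s2 : ℝ) (z : Phase) : q₁ (flip s1 s2 z) = q₁ z := rfl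
@[simp] lemma p1_flip (s1 s2 : ℝ) (z : Phase) : p₁ (flip s1 s2 z) = s1 * p₁ z := rfl
@[simp] lemma q2_flip (s1 s2 : ℝ) (z : Phase) : q₂ (flip s1 s2 z) = q₂ z := rfl
@[simp] lemma p2_flip (s1 s2 : ℝ) (z : Phase) : p₂ (flip s1 s2 z) = s2 * p₂ z := rfl

namespace Model

variable {S : StepSystem} {h : ℝ} {M : Model S h} {B : Base M}

lemma Sign.sq {s : ℝ} (hs : Sign s) (p : ℝ) : (s * p) ^ 2 = p ^ 2 := by
  rcases hs with rfl | rfl <;> ring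

lemma hamiltonian_flip (ε : ℝ) {s1 s2 : ℝ} (h₁ : Sign s1) (h₂ : Sign s2) (z : Phase) :
    S.hamiltonian ε (flip s1 s2 z) = S.hamiltonian ε z := by
  simp only [hamiltonian, q1_flip, p1_flip, q2_flip, p2_flip, h₁.sq, h₂.sq]

lemma energy2_flip (s1 : ℝ) {s2 : ℝ} (h₂ : Sign s2) (z : Phase) :
    S.energy₂ (q₂ (flip s1 s2 z)) (p₂ (flip s1 s2 z)) = S.energy₂ (q₂ z) (p₂ z) := by
  simp only [energy₂, q2_flip, p2_flip, h₂.sq]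

lemma Facts.clear_of_right {τ δ ε : ℝ} {z : Phase} (f : M.Facts τ δ ε z) (hδ : 0 < δ) (hτ : 2 * δ < τ)
    {t : ℝ} (ht : t ∈ I(τ,δ)) (h0 : p₁ (M.Φ t ε z) = 0) (hq : q₁ z = S.w₁) (hp : 0 ≤ p₁ z) :
    M.Clear ε z t :=
  f.clear hδ hτ ht h0 fun _ hs h' => absurd (f.right_of_nonneg hq hp ⟨hs.1, hs.2.le⟩) (not_lt.2 h'.1)

lemma Facts.clear_of_above {τ δ ε : ℝ} {z : Phase} (f : M.Facts τ δ ε z) (hδ : 0 < δ) (hτ : 2 * δ < τ)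
    {t : ℝ} (ht : t ∈ I(τ,δ)) (h0 : p₁ (M.Φ t ε z) = 0) (hq : q₂ z = S.w₂) (hp : 0 < p₂ z) :
    M.Clear ε z t :=
  f.clear hδ hτ ht h0 fun _ hs h' => absurd (f.above_of_pos hq hp ⟨hs.1, hs.2.le⟩) (not_lt.2 h'.2)

/-- The description of the dynamics at a fixed value of the perturbation parameter: `Bf t θ` is the action
of the orbit with initial angle `θ` that is at `q₁ = w₁` at time `t`, `D` is its time derivative, and
`y` the height above the corner. -/
structure Window (C : SectionChart B) (ε δ σ σ' E Δ K : ℝ) (Bf D y : ℝ → ℝ → ℝ)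
    (θp θm Mx tm : ℝ → ℝ) (tl tr : ℝ → ℝ → ℝ) (x : Label → ℝ → ℝ) : Prop where
  ε_lt : |ε| < C.η
  δ_pos : 0 < δ
  three_δ : 3 * δ < B.τ
  σ_le : σ ≤ C.η
  σ'_le : σ' ≤ σ
  Δ_nonneg : 0 ≤ Δ
  K_nonneg : 0 ≤ K
  deriv : ∀ θ, ∀ t ∈ I(B.τ,δ), HasDerivAt (fun t => Bf t θ) (D t θ) t
  corners : Corners Bf D y (B.τ - δ) (B.τ + δ) Δ θp θm Mx tm tl tr x
  crossing : ∀ t ∈ I(B.τ,δ), ∀ θ a, |a - B.aS| < σ →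
    (q₁ (M.Φ t ε (C.pt ε θ a)) < S.w₁ ↔ M.act a < Bf t θ) ∧
    (q₁ (M.Φ t ε (C.pt ε θ a)) = S.w₁ ↔ M.act a = Bf t θ)
  momentum : ∀ t ∈ I(B.τ,δ), ∀ θ a, |a - B.aS| < σ → M.act a = Bf t θ →
    (0 < D t θ ↔ p₁ (M.Φ t ε (C.pt ε θ a)) < 0) ∧ (D t θ = 0 ↔ p₁ (M.Φ t ε (C.pt ε θ a)) = 0) ∧
    q₂ (M.Φ t ε (C.pt ε θ a)) = S.w₂ + y t θ ∧
    ((θ : Angle) = θp t → y t θ = 0 ∧ 0 < p₂ (M.Φ t ε (C.pt ε θ a))) ∧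
    ((θ : Angle) = θm t → y t θ = 0 ∧ p₂ (M.Φ t ε (C.pt ε θ a)) < 0)
  vert : ∀ t ∈ I(B.τ,δ), ∀ t' ∈ I(B.τ,δ), ∀ θ a, |a - B.aS| < σ →
    q₂ (M.Φ t ε (C.pt ε θ a)) = S.w₂ → 0 < p₂ (M.Φ t ε (C.pt ε θ a)) * p₂ (M.Φ t' ε (C.pt ε θ a))
  facts : ∀ k ∈ Icc (-Δ) 0, ∀ θ, ∀ t ∈ Icc (tl k θ) (tr k θ), ∀ a, |a - B.aS| < σ → ∀ s1 s2,
    Sign s1 → Sign s2 → M.Facts B.τ δ ε (flip s1 s2 (M.Φ t ε (C.pt ε θ a)))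
  range : ∀ θ, ∀ k ∈ Icc (-Δ) 0, ∃ a, |a - B.aS| < σ' ∧ M.act a = Mx θ + k
  near : ∀ a, |a - B.aS| < σ' → |M.W2 a - M.W2 B.aS| < E
  back : ∀ z ∈ S.section_ ε h, |S.energy₂ (q₂ z) (p₂ z) - M.W2 B.aS| < 2 * E →
    ∃ θ a, |a - B.aS| < σ ∧ z = C.pt ε θ a
  drift : M.B * √(2 * (h + M.B)) * |ε| * (4 * B.τ) + M.B * |ε| ≤ E
  tangent : ∀ z : Phase, q₁ z = S.w₁ → p₁ z = 0 → q₂ z ∈ S.U₂ → S.hamiltonian ε z = h →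
    M.Facts B.τ δ ε z ∧ M.Facts B.τ δ ε (timeRev z) ∧
      |S.energy₂ (q₂ z) (p₂ z) - M.W2 B.aS| ≤ M.B * |ε|
  lip : ∀ a a', |a - B.aS| < σ → |a' - B.aS| < σ → |M.act a - M.act a'| ≤ K * |M.W2 a - M.W2 a'|

/-- The change of a state while it passes the step: a reflection at the right wall, a free passage above the
upper wall, or a reflection at the upper wall. -/
def Kind (S : StepSystem) : Label → Phase → Phase → Prop
  | .R, z, zo => q₁ z = S.w₁ ∧ p₁ z < 0 ∧ q₂ z < S.w₂ ∧ zo = flip (-1) 1 z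
  | .zero, z, zo => q₁ z < S.w₁ ∧ S.w₂ < q₂ z ∧ zo = z
  | .one, z, zo => q₂ z = S.w₂ ∧ p₂ z < 0 ∧ q₁ z < S.w₁ ∧ zo = flip 1 (-1) z

/-- A path from the section to the section, along two stretches outside the step. -/
structure Path (C : SectionChart B) (ε δ σ θ a θ' a' t1 t2 : ℝ) (zo : Phase) : Prop where
  amp : |a - B.aS| < σ
  amp' : |a' - B.aS| < σ
  t1_mem : t1 ∈ I(B.τ,δ)
  t2_mem : t2 ∈ I(B.τ,δ)
  arrival : M.Φ t2 ε zo = C.pt ε θ' a'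
  clear1 : M.Clear ε (C.pt ε θ a) t1
  clear2 : M.Clear ε zo t2
  turning : p₁ (M.Φ t1 ε (C.pt ε θ a)) ≠ 0 ∨ 0 < p₁ (M.field ε (M.Φ t1 ε (C.pt ε θ a)))
  flip_eq : ∃ s1 s2, Sign s1 ∧ Sign s2 ∧ zo = flip s1 s2 (M.Φ t1 ε (C.pt ε θ a))

/-- The transitions between the initial conditions and their first returns, by type of passage. -/
def Transition (C : SectionChart B) (ε δ σ : ℝ) (b : Label) (u v : Cyl) : Prop :=
  ∃ θ a θ' a' t1 t2 zo, Path C ε δ σ θ a θ' a' t1 t2 zo ∧ u = (↑θ, M.act a) ∧ v = (↑θ', M.act a') ∧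
    Kind S b (M.Φ t1 ε (C.pt ε θ a)) zo

/-- Along two stretches outside the step the vertical energy changes slowly. -/
lemma energy_of_clear {C : SectionChart B} {ε δ θ a t1 t2 s1 s2 : ℝ} {zo : Phase} (hε : |ε| < C.η)
    (hδ : δ < B.τ) (ha : |a - B.aS| < C.η) (ht1 : t1 ∈ I(B.τ,δ)) (ht2 : t2 ∈ I(B.τ,δ))
    (c1 : M.Clear ε (C.pt ε θ a) t1) (h1 : Sign s1) (h2 : Sign s2)
    (h3 : zo = flip s1 s2 (M.Φ t1 ε (C.pt ε θ a))) (c2 : M.Clear ε zo t2) :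
    |S.energy₂ (q₂ (M.Φ t2 ε zo)) (p₂ (M.Φ t2 ε zo)) - M.W2 a| ≤
    M.B * √(2 * (h + M.B)) * |ε| * (4 * B.τ) := by
  have hε1 : |ε| ≤ 1 := hε.le.trans C.η_le
  have hH : S.hamiltonian ε (C.pt ε θ a) = h := (C.mem_section ε θ a hε ha).2.2.2.2
  have d1 := energy_drift hε1 c1.pos.le (T := 2 * B.τ) (by linarith [ht1.2]) c1.core hH
  have hH2 : S.hamiltonian ε zo = h := by
    rw [h3, hamiltonian_flip ε h1 h2, hamiltonian_Φ hε1 c1.pos.le c1.core, hH]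
  have d2 := energy_drift hε1 c2.pos.le (T := 2 * B.τ) (by linarith [ht2.2]) c2.core hH2
  have e0 : S.energy₂ (q₂ zo) (p₂ zo) =
      S.energy₂ (q₂ (M.Φ t1 ε (C.pt ε θ a))) (p₂ (M.Φ t1 ε (C.pt ε θ a))) := by
    rw [h3]; exact energy2_flip s1 h2 _
  rw [e0] at d2
  have e1 : S.energy₂ (q₂ (C.pt ε θ a)) (p₂ (C.pt ε θ a)) = M.W2 a := energy2_QP (C.amp a ha) _
  rw [e1] at d1
  rw [abs_le] at d1 d2 ⊢
  constructor <;> linarith [d1.1, d1.2, d2.1, d2.2]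

namespace Path

variable {C : SectionChart B} {ε δ σ θ a θ' a' t1 t2 : ℝ} {zo : Phase}
  (P : Path C ε δ σ θ a θ' a' t1 t2 zo)
include P

lemma turning_flip : p₁ zo ≠ 0 ∨ 0 < p₁ (M.field ε zo) := by
  obtain ⟨s1, s2, h1, -, rfl⟩ := P.flip_eq
  rcases P.turning with h | h
  · left
    rw [p1_flip]
    exact mul_ne_zero (by rcases h1 with rfl | rfl <;> norm_num) h
  · exact .inr h

lemma reverse (hε : |ε| < C.η) (hσ : σ ≤ C.η) :
    Path C ε δ σ (-θ') a' (-θ) a t2 t1 (timeRev (M.Φ t1 ε (C.pt ε θ a))) ∧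
    M.Φ t2 ε (C.pt ε (-θ') a') = timeRev zo := by
  have ha := P.amp.trans_le hσ
  have ha' := P.amp'.trans_le hσ
  have e1 : C.pt ε (-θ') a' = timeRev (M.Φ t2 ε zo) := by
    rw [P.arrival, timeRev_pt hε _ ha']
  have e2 : M.Φ t2 ε (C.pt ε (-θ') a') = timeRev zo := by
    rw [e1, Φ_timeRev_Φ, sub_self, M.Φ_zero]
  refine ⟨⟨P.amp', P.amp, P.t2_mem, P.t1_mem, ?_, e1 ▸ P.clear2.reverse, P.clear1.reverse, ?_, ?_⟩, e2⟩
  · rw [Φ_timeRev_Φ, sub_self, M.Φ_zero, timeRev_pt hε _ ha]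
  · rw [e2]
    rcases P.turning_flip with h | h
    · left; simpa using h
    · exact .inr h
  · obtain ⟨s1, s2, h1, h2, h3⟩ := P.flip_eq
    refine ⟨s1, s2, h1, h2, ?_⟩
    rw [e2, h3]
    rcases h1 with rfl | rfl <;> rcases h2 with rfl | rfl <;> simp [timeRev, flip, q₁, q₂, p₁, p₂]

/-- Along a path the vertical energy changes slowly. -/
lemma energy (hε : |ε| < C.η) (hσ : σ ≤ C.η) (hδ : δ < B.τ) : |M.W2 a' - M.W2 a| ≤
    M.B * √(2 * (h + M.B)) * |ε| * (4 * B.τ) := by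
  obtain ⟨s1, s2, h1, h2, h3⟩ := P.flip_eq
  have := energy_of_clear hε hδ (P.amp.trans_le hσ) P.t1_mem P.t2_mem P.clear1 h1 h2 h3 P.clear2
  rw [P.arrival] at this
  have e2 : S.energy₂ (q₂ (C.pt ε θ' a')) (p₂ (C.pt ε θ' a')) = M.W2 a' :=
    energy2_QP (C.amp a' (P.amp'.trans_le hσ)) _
  rwa [e2] at this

lemma route (hε : |ε| < C.η)
    (hk : S.Impact (M.Φ t1 ε (C.pt ε θ a)) zo ∨ (S.Interior (M.Φ t1 ε (C.pt ε θ a)) ∧ zo = M.Φ t1 ε (C.pt ε θ a))) :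
    M.Route ε h (C.pt ε θ a) (C.pt ε θ' a') := by
  have hε1 : |ε| ≤ 1 := hε.le.trans C.η_le
  have hc1 := P.clear1.core t1 ⟨P.clear1.pos.le, le_rfl⟩
  have hc2 := P.clear2.core 0 ⟨le_rfl, P.clear2.pos.le⟩
  rw [M.Φ_zero] at hc2
  have n1 := not_section_of_turning hε1 hc1 P.turning h
  rcases hk with hk | ⟨hk, hz⟩
  · exact .inr ⟨t1, t2, zo, P.clear1.leg hε1 h, hk, n1,
      not_section_of_turning hε1 hc2 (P.turning_flip) h, P.clear2.leg hε1 h, P.arrival.symm⟩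
  · refine .inl ⟨t1 + t2, (P.clear1.leg hε1 h).append hk n1 (hz ▸ P.clear2.leg hε1 h), ?_⟩
    rw [add_comm, M.Φ_add, ← hz, P.arrival]

end Path

lemma Kind.passage {b : Label} {z zo : Phase} (hk : Kind S b z zo) (hz : M.InCore z) :
    S.Impact z zo ∨ (S.Interior z ∧ zo = z) := by
  cases b with
  | R => exact .inl (.inl ⟨hk.1, hk.2.1, hk.2.2.1, by rw [hk.2.2.2]; simp [flip]⟩)
  | zero => exact .inr ⟨Outside.interior (fun h' => absurd hk.2.1 (not_lt.2 h'.2)) hz.mem_U.1 hz.mem_U.2, hk.2.2⟩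
  | one => exact .inl (.inr ⟨hk.1, hk.2.1, hk.2.2.1, by rw [hk.2.2.2]; simp [flip]⟩)

end Model

namespace Model

variable {S : StepSystem} {h : ℝ} {M : Model S h} {B : Base M}

namespace Window

variable {C : SectionChart B} {ε δ σ σ' E Δ K : ℝ} {Bf D y : ℝ → ℝ → ℝ} {θp θm Mx tm : ℝ → ℝ}
  {tl tr : ℝ → ℝ → ℝ} {x : Label → ℝ → ℝ} (W : Window C ε δ σ σ' E Δ K Bf D y θp θm Mx tm tl tr x)
include W

lemma two_δ : 2 * δ < B.τ := by linarith [W.three_δ, W.δ_pos]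

lemma ε_le : |ε| ≤ 1 := W.ε_lt.le.trans C.η_le

lemma lt_Mx {θ t : ℝ} (ht : t ∈ I(B.τ,δ)) (hne : t ≠ tm θ) : Bf t θ < Mx θ := by
  obtain ⟨hm, -, hB⟩ := W.corners.tm_mem θ
  rw [← hB]
  have hd := W.deriv θ
  rcases lt_or_gt_of_ne hne with h | h
  · have hs {s : ℝ} (hs : s ∈ Icc t (tm θ)) : s ∈ I(B.τ,δ) := ⟨ht.1.trans hs.1, hs.2.trans hm.2.le⟩
    exact strictMonoOn_Icc (fun s h' => hd s (hs h')) (fun s h' =>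
      (W.corners.D_pos_iff θ s (hs (Ioo_subset_Icc_self h'))).1.2 h'.2) ⟨le_rfl, h.le⟩ ⟨h.le, le_rfl⟩ h
  · have hs {s : ℝ} (hs : s ∈ Icc (tm θ) t) : s ∈ I(B.τ,δ) := ⟨hm.1.le.trans hs.1, hs.2.trans ht.2⟩
    exact strictAntiOn_Icc (fun s h' => hd s (hs h')) (fun s h' => lt_of_not_ge fun h0 =>
      absurd ((W.corners.D_pos_iff θ s (hs (Ioo_subset_Icc_self h'))).2.1 h0) (not_le.2 h'.1))
      ⟨le_rfl, h.le⟩ ⟨h.le, le_rfl⟩ h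

variable {k θ a t : ℝ} (hk : k ∈ Icc (-Δ) 0)
include hk

lemma mem_window (ht : t ∈ Icc (tl k θ) (tr k θ)) : t ∈ I(B.τ,δ) := by
  obtain ⟨h1, -, -, h4, -⟩ := W.corners.cross k hk θ
  exact ⟨h1.le.trans ht.1, ht.2.trans h4.le⟩

lemma tl_mem : tl k θ ∈ Icc (tl k θ) (tr k θ) := by
  obtain ⟨-, h2, h3, -⟩ := W.corners.cross k hk θ
  exact ⟨le_rfl, h2.trans h3⟩

lemma tr_mem : tr k θ ∈ Icc (tl k θ) (tr k θ) := by
  obtain ⟨-, h2, h3, -⟩ := W.corners.cross k hk θ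
  exact ⟨h2.trans h3, le_rfl⟩

lemma tm_mem' : tm θ ∈ Icc (tl k θ) (tr k θ) := by
  obtain ⟨-, h2, h3, -⟩ := W.corners.cross k hk θ
  exact ⟨h2, h3⟩

omit hk in
lemma zero_mem : (0 : ℝ) ∈ Icc (-Δ) 0 := ⟨by linarith [W.Δ_nonneg], le_rfl⟩

omit hk in
lemma eq_tm_of_zero : tl 0 θ = tm θ ∧ tr 0 θ = tm θ := by
  obtain ⟨-, -, -, -, -, h6, h7⟩ := W.corners.cross 0 W.zero_mem θ
  rw [add_zero] at h6 h7
  constructor <;> by_contra hne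
  · exact (W.lt_Mx (W.mem_window W.zero_mem (W.tl_mem W.zero_mem)) hne).ne h6
  · exact (W.lt_Mx (W.mem_window W.zero_mem (W.tr_mem W.zero_mem)) hne).ne h7

variable (ha : |a - B.aS| < σ) (hak : M.act a = Mx θ + k)
include ha hak

/-- The position relative to the line of the right wall. -/
lemma left_iff (ht : t ∈ I(B.τ,δ)) :
    q₁ (M.Φ t ε (C.pt ε θ a)) ≤ S.w₁ ↔ t ∈ Icc (tl k θ) (tr k θ) := by
  rw [← W.corners.cross_iff k hk θ t ht, ← hak]
  obtain ⟨h1, h2⟩ := W.crossing t ht θ a ha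
  rw [le_iff_lt_or_eq, le_iff_lt_or_eq, h1, h2]

omit ha in
lemma at_wall_left : M.act a = Bf (tl k θ) θ := by
  rw [hak]; exact (W.corners.cross k hk θ).2.2.2.2.2.1.symm

omit ha in
lemma at_wall_right : M.act a = Bf (tr k θ) θ := by
  rw [hak]; exact (W.corners.cross k hk θ).2.2.2.2.2.2.symm

lemma q1_tl : q₁ (M.Φ (tl k θ) ε (C.pt ε θ a)) = S.w₁ :=
  (W.crossing _ (W.mem_window hk (W.tl_mem hk)) θ a ha).2.2 (W.at_wall_left hk hak)

lemma q1_tr : q₁ (M.Φ (tr k θ) ε (C.pt ε θ a)) = S.w₁ :=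
  (W.crossing _ (W.mem_window hk (W.tr_mem hk)) θ a ha).2.2 (W.at_wall_right hk hak)

lemma q2_tl : q₂ (M.Φ (tl k θ) ε (C.pt ε θ a)) = S.w₂ + y (tl k θ) θ :=
  (W.momentum _ (W.mem_window hk (W.tl_mem hk)) θ a ha (W.at_wall_left hk hak)).2.2.1

lemma q2_tr : q₂ (M.Φ (tr k θ) ε (C.pt ε θ a)) = S.w₂ + y (tr k θ) θ :=
  (W.momentum _ (W.mem_window hk (W.tr_mem hk)) θ a ha (W.at_wall_right hk hak)).2.2.1

lemma p1_tl : p₁ (M.Φ (tl k θ) ε (C.pt ε θ a)) ≤ 0 ∧ (k < 0 → p₁ (M.Φ (tl k θ) ε (C.pt ε θ a)) < 0) ∧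
    (k = 0 → p₁ (M.Φ (tl k θ) ε (C.pt ε θ a)) = 0) := by
  have hw := W.mem_window hk (W.tl_mem (θ := θ) hk)
  obtain ⟨m1, m2, -⟩ := W.momentum _ hw θ a ha (W.at_wall_left hk hak)
  obtain ⟨d1, d2⟩ := W.corners.D_pos_iff θ _ hw
  have n0 : k = 0 → p₁ (M.Φ (tl k θ) ε (C.pt ε θ a)) = 0 := fun h0 => by
    refine m2.1 ?_
    subst h0
    rw [W.eq_tm_of_zero.1]; exact (W.corners.tm_mem θ).2.1
  have n1 : k < 0 → p₁ (M.Φ (tl k θ) ε (C.pt ε θ a)) < 0 := fun h0 =>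
    m1.1 (d1.2 ((W.corners.cross k hk θ).2.2.2.2.1 h0).1)
  exact ⟨hk.2.lt_or_eq.elim (fun h => (n1 h).le) fun h => (n0 h).le, n1, n0⟩

lemma p1_tr : 0 ≤ p₁ (M.Φ (tr k θ) ε (C.pt ε θ a)) ∧ (k < 0 → p₁ (M.Φ (tr k θ) ε (C.pt ε θ a)) ≠ 0) := by
  have hw := W.mem_window hk (W.tr_mem (θ := θ) hk)
  obtain ⟨m1, m2, -⟩ := W.momentum _ hw θ a ha (W.at_wall_right hk hak)
  obtain ⟨d1, d2⟩ := W.corners.D_pos_iff θ _ hw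
  refine ⟨not_lt.1 fun h0 => absurd (d1.1 (m1.2 h0)) (not_lt.2 (W.corners.cross k hk θ).2.2.1), fun h0 h1 => ?_⟩
  exact absurd (d2.1 (m2.2 h1).ge) (not_le.2 ((W.corners.cross k hk θ).2.2.2.2.1 h0).2)

omit hak in
lemma facts_self (ht : t ∈ Icc (tl k θ) (tr k θ)) : M.Facts B.τ δ ε (M.Φ t ε (C.pt ε θ a)) := by
  have := W.facts k hk θ t ht a ha 1 1 (.inl rfl) (.inl rfl)
  rwa [flip_one_one] at this

omit hak in
lemma facts_rev (ht : t ∈ Icc (tl k θ) (tr k θ)) : M.Facts B.τ δ ε (timeRev (M.Φ t ε (C.pt ε θ a))) := by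
  rw [timeRev_eq_flip]
  exact W.facts k hk θ t ht a ha (-1) (-1) (.inr rfl) (.inr rfl)

omit W hk ha hak in
lemma rev_arrival : p₁ (M.Φ t ε (timeRev (M.Φ t ε (C.pt ε θ a)))) = 0 := by
  rw [Φ_timeRev_Φ, sub_self, M.Φ_zero, p1_timeRev]
  exact neg_zero

omit hak in
lemma turning_at (ht : t ∈ Icc (tl k θ) (tr k θ)) : 0 < p₁ (M.field ε (M.Φ t ε (C.pt ε θ a))) := by
  have := (W.facts_self hk ha ht).conv 0 ⟨le_rfl, W.δ_pos.le⟩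
  rwa [M.Φ_zero] at this

omit hak in
lemma core_at (ht : t ∈ Icc (tl k θ) (tr k θ)) : M.InCore (M.Φ t ε (C.pt ε θ a)) := by
  have := (W.facts_self hk ha ht).core 0 ⟨le_rfl, by have := W.δ_pos; have := W.two_δ; linarith⟩
  rwa [M.Φ_zero] at this

omit hak in
lemma clear_from_right (ht : t ∈ Icc (tl k θ) (tr k θ)) (hq : q₁ (M.Φ t ε (C.pt ε θ a)) = S.w₁)
    (hp : p₁ (M.Φ t ε (C.pt ε θ a)) ≤ 0) : M.Clear ε (C.pt ε θ a) t :=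
  ((W.facts_rev hk ha ht).clear_of_right W.δ_pos W.two_δ (W.mem_window hk ht) (rev_arrival) hq
    (by rw [p1_timeRev]; linarith)).reverse'

omit hak in
lemma clear_from_above (ht : t ∈ Icc (tl k θ) (tr k θ)) (hq : q₂ (M.Φ t ε (C.pt ε θ a)) = S.w₂)
    (hp : p₂ (M.Φ t ε (C.pt ε θ a)) < 0) : M.Clear ε (C.pt ε θ a) t :=
  ((W.facts_rev hk ha ht).clear_of_above W.δ_pos W.two_δ (W.mem_window hk ht) (rev_arrival) hq
    (by rw [p2_timeRev]; linarith)).reverse'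

omit hak in
/-- After the passage of the step the trajectory returns to the section. -/
lemma exists_path (hσ' : |a - B.aS| < σ') (ht : t ∈ Icc (tl k θ) (tr k θ)) {s1 s2 : ℝ} (h1 : Sign s1)
    (h2 : Sign s2) (c1 : M.Clear ε (C.pt ε θ a) t)
    (c2 : ∀ t2 ∈ I(B.τ,δ), p₁ (M.Φ t2 ε (flip s1 s2 (M.Φ t ε (C.pt ε θ a)))) = 0 →
      M.Clear ε (flip s1 s2 (M.Φ t ε (C.pt ε θ a))) t2) :
    ∃ θ' a' t2, Path C ε δ σ θ a θ' a' t t2 (flip s1 s2 (M.Φ t ε (C.pt ε θ a))) := by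
  have f := W.facts k hk θ t ht a ha s1 s2 h1 h2
  obtain ⟨t2, ht2, h0⟩ := f.exists_return W.δ_pos W.two_δ
  have ht2' := Ioo_subset_Icc_self ht2
  have hc := c2 t2 ht2' h0
  have haη := ha.trans_le W.σ_le
  have hH : S.hamiltonian ε (flip s1 s2 (M.Φ t ε (C.pt ε θ a))) = h := by
    rw [hamiltonian_flip ε h1 h2, hamiltonian_Φ W.ε_le c1.pos.le c1.core]
    exact (C.mem_section ε θ a W.ε_lt haη).2.2.2.2
  have hs := f.mem_section W.ε_le W.two_δ W.δ_pos ht2' h0 hH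
  have hδ := W.δ_pos
  have h2δ := W.two_δ
  have e1 := energy_of_clear W.ε_lt (by linarith) haη (W.mem_window hk ht) ht2' c1 h1 h2 rfl hc
  have e2 := W.near a hσ'
  have e3 := W.drift
  have hB : 0 ≤ M.B * |ε| := mul_nonneg M.B_nonneg (abs_nonneg _)
  obtain ⟨θ', a', ha', hz⟩ := W.back _ hs (by
    rw [abs_le] at e1; rw [abs_lt] at e2 ⊢; constructor <;> linarith [e1.1, e1.2, e2.1, e2.2])
  exact ⟨θ', a', t2, ha, ha', W.mem_window hk ht, ht2', hz, c1, hc, .inr (W.turning_at hk ha ht),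
    s1, s2, h1, h2, rfl⟩

lemma exists_reflection_right (hk0 : k < 0) (hσ' : |a - B.aS| < σ') (hy : y (tl k θ) θ < 0) :
    ∃ v, Transition C ε δ σ .R (↑θ, M.act a) v := by
  have ht := W.tl_mem (θ := θ) hk
  have hq := W.q1_tl hk ha hak
  have hp := (W.p1_tl hk ha hak).2.1 hk0
  obtain ⟨θ', a', t2, P⟩ := W.exists_path hk ha hσ' ht (s1 := -1) (s2 := 1) (.inr rfl) (.inl rfl)
    (W.clear_from_right hk ha ht hq hp.le) fun t2 ht2 h0 =>
      (W.facts k hk θ _ ht a ha (-1) 1 (.inr rfl) (.inl rfl)).clear_of_right W.δ_pos W.two_δ ht2 h0 hq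
        (by rw [p1_flip]; linarith)
  exact ⟨_, θ, a, θ', a', _, t2, _, P, rfl, rfl, hq, hp, by rw [W.q2_tl hk ha hak]; linarith, rfl⟩

omit hk hak in
/-- The vertical momentum has the same sign throughout if the height of the corner is passed. -/
lemma monotone_height (ht : t ∈ I(B.τ,δ)) (hq : q₂ (M.Φ t ε (C.pt ε θ a)) = S.w₂) :
    (0 < p₂ (M.Φ t ε (C.pt ε θ a)) →
      StrictMonoOn (fun s => q₂ (M.Φ s ε (C.pt ε θ a))) (I(B.τ,δ))) ∧
    (p₂ (M.Φ t ε (C.pt ε θ a)) < 0 →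
      StrictAntiOn (fun s => q₂ (M.Φ s ε (C.pt ε θ a))) (I(B.τ,δ))) := by
  have hd (s) := (M.hasDerivAt_coords ε (C.pt ε θ a) s).2.2.1
  have hv (s) (hs : s ∈ I(B.τ,δ)) := W.vert t ht s hs θ a ha hq
  exact ⟨fun hp => strictMonoOn_Icc (fun s _ => hd s) fun s hs =>
    pos_of_mul_pos_right (hv s (Ioo_subset_Icc_self hs)) hp.le, fun hp => strictAntiOn_Icc (fun s _ => hd s) fun s hs =>
    (neg_iff_neg_of_mul_pos (hv s (Ioo_subset_Icc_self hs))).1 hp⟩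

omit hk hak in
lemma momentum_ne (ht : t ∈ I(B.τ,δ)) (hq : q₂ (M.Φ t ε (C.pt ε θ a)) = S.w₂) :
    p₂ (M.Φ t ε (C.pt ε θ a)) ≠ 0 := fun h0 => by
  have := W.vert t ht t ht θ a ha hq
  rw [h0] at this
  simp at this

/-- If the orbit is above the corner when it crosses the line of the wall in both directions, it is so in
between. -/
lemma above_between (hl : 0 < y (tl k θ) θ) (hr : 0 < y (tr k θ) θ) (ht : t ∈ Icc (tl k θ) (tr k θ)) :
    S.w₂ < q₂ (M.Φ t ε (C.pt ε θ a)) := by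
  have el := W.q2_tl hk ha hak
  have er := W.q2_tr hk ha hak
  by_contra! hle
  have hc : ContinuousOn (fun s => q₂ (M.Φ s ε (C.pt ε θ a))) (Icc (tl k θ) t) := fun s _ =>
    (M.hasDerivAt_coords ε (C.pt ε θ a) s).2.2.1.continuousAt.continuousWithinAt
  obtain ⟨s, hs, hs0⟩ := intermediate_value_Icc' ht.1 hc (show S.w₂ ∈ Icc _ _ from ⟨hle, by rw [el]; linarith⟩)
  have hsI : s ∈ Icc (tl k θ) (tr k θ) := ⟨hs.1, hs.2.trans ht.2⟩
  have hsw := W.mem_window hk hsI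
  obtain ⟨m1, m2⟩ := W.monotone_height ha hsw hs0
  rcases lt_or_gt_of_ne (W.momentum_ne ha hsw hs0) with hp | hp
  · have := (m2 hp).antitoneOn hsw (W.mem_window hk (W.tr_mem hk)) hsI.2
    simp only [er, hs0] at this; linarith
  · have := (m1 hp).monotoneOn (W.mem_window hk (W.tl_mem hk)) hsw hsI.1
    simp only [el, hs0] at this; linarith

lemma outside_after (ht : t ∈ Icc (tl k θ) (tr k θ)) (hy : ∀ s ∈ Icc (tl k θ) (tr k θ),
    S.w₂ < q₂ (M.Φ s ε (C.pt ε θ a))) {s : ℝ} (hs : s ∈ Ioo 0 δ) :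
    S.Outside (M.Φ s ε (M.Φ t ε (C.pt ε θ a))) := by
  rw [← M.Φ_add]
  intro h'
  rcases le_or_gt (s + t) (tr k θ) with h1 | h1
  · exact absurd (hy _ ⟨by linarith [ht.1, hs.1], h1⟩) (not_lt.2 h'.2)
  · have := (W.facts_self hk ha (W.tr_mem (θ := θ) hk)).right_of_nonneg (W.q1_tr hk ha hak)
      (W.p1_tr hk ha hak).1 (s := s + t - tr k θ) ⟨by linarith, by linarith [ht.2, hs.2]⟩
    rw [← M.Φ_add, sub_add_cancel] at this
    exact absurd this (not_lt.2 h'.1)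

lemma outside_before (ht : t ∈ Icc (tl k θ) (tr k θ)) (hy : ∀ s ∈ Icc (tl k θ) (tr k θ),
    S.w₂ < q₂ (M.Φ s ε (C.pt ε θ a))) {s : ℝ} (hs : s ∈ Ioo 0 δ) :
    S.Outside (M.Φ s ε (timeRev (M.Φ t ε (C.pt ε θ a)))) := by
  rw [Φ_timeRev_Φ]
  intro h'
  rcases le_or_gt (tl k θ) (t - s) with h1 | h1
  · exact absurd (hy _ ⟨h1, by linarith [ht.2, hs.1]⟩) (not_lt.2 h'.2)
  · have := (W.facts_rev hk ha (W.tl_mem (θ := θ) hk)).right_of_nonneg (W.q1_tl hk ha hak)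
      (by rw [p1_timeRev]; linarith [(W.p1_tl hk ha hak).1]) (s := tl k θ - (t - s))
      ⟨by linarith, by linarith [ht.1, hs.2]⟩
    rw [Φ_timeRev_Φ, sub_sub_cancel] at this
    exact absurd this (not_lt.2 h'.1)

/-- Orbits that are above the corner when crossing the line of the wall pass the step freely. -/
lemma exists_passage (hσ' : |a - B.aS| < σ') (hl : 0 < y (tl k θ) θ) (hr : 0 < y (tr k θ) θ) :
    ∃ θ' a' t2, Path C ε δ σ θ a θ' a' (tm θ) t2 (M.Φ (tm θ) ε (C.pt ε θ a)) := by
  have ht := W.tm_mem' (θ := θ) hk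
  have hy := fun s hs => W.above_between hk ha hak hl hr (t := s) hs
  have c1 : M.Clear ε (C.pt ε θ a) (tm θ) := ((W.facts_rev hk ha ht).clear W.δ_pos W.two_δ (W.mem_window hk ht)
    (rev_arrival) fun s hs => W.outside_before hk ha hak ht hy hs).reverse'
  have := W.exists_path hk ha hσ' ht (s1 := 1) (s2 := 1) (.inl rfl) (.inl rfl) c1 fun t2 ht2 h0 =>
    (W.facts k hk θ _ ht a ha 1 1 (.inl rfl) (.inl rfl)).clear W.δ_pos W.two_δ ht2 h0 fun s hs => by
      rw [flip_one_one]; exact W.outside_after hk ha hak ht hy hs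
  rwa [flip_one_one] at this

lemma left_of_mem_Ioo (ht : t ∈ Ioo (tl k θ) (tr k θ)) : q₁ (M.Φ t ε (C.pt ε θ a)) < S.w₁ := by
  have hw := W.mem_window hk (Ioo_subset_Icc_self ht)
  refine lt_of_le_of_ne ((W.left_iff hk ha hak hw).2 (Ioo_subset_Icc_self ht)) fun h0 => ?_
  have := (W.crossing t hw θ a ha).2.1 h0
  rcases W.corners.cross_eq k hk θ t hw (by rw [← hak, this]) with h1 | h1
  · exact ht.1.ne' h1
  · exact ht.2.ne h1

lemma exists_transition_zero (hk0 : k < 0) (hσ' : |a - B.aS| < σ') (hl : 0 < y (tl k θ) θ)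
    (hr : 0 < y (tr k θ) θ) : ∃ v, Transition C ε δ σ .zero (↑θ, M.act a) v := by
  obtain ⟨θ', a', t2, P⟩ := W.exists_passage hk ha hak hσ' hl hr
  obtain ⟨h1, h2⟩ := (W.corners.cross k hk θ).2.2.2.2.1 hk0
  exact ⟨_, θ, a, θ', a', _, t2, _, P, rfl, rfl, W.left_of_mem_Ioo hk ha hak ⟨h1, h2⟩,
    W.above_between hk ha hak hl hr (W.tm_mem' hk), rfl⟩

lemma exists_reflection_above (hσ' : |a - B.aS| < σ') (hl : 0 < y (tl k θ) θ)
    (hr : y (tr k θ) θ < 0) : ∃ v, Transition C ε δ σ .one (↑θ, M.act a) v := by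
  have el := W.q2_tl hk ha hak
  have er := W.q2_tr hk ha hak
  have hc : ContinuousOn (fun s => q₂ (M.Φ s ε (C.pt ε θ a))) (Icc (tl k θ) (tr k θ)) := fun s _ =>
    (M.hasDerivAt_coords ε (C.pt ε θ a) s).2.2.1.continuousAt.continuousWithinAt
  obtain ⟨t, ht, hq⟩ := intermediate_value_Ioo' (W.tl_mem hk).2 hc
    (show S.w₂ ∈ Ioo _ _ from ⟨by rw [er]; linarith, by rw [el]; linarith⟩)
  have ht' := Ioo_subset_Icc_self ht
  have hw := W.mem_window hk ht'
  have hp : p₂ (M.Φ t ε (C.pt ε θ a)) < 0 := by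
    by_contra! hp
    have := (W.monotone_height ha hw hq).1 (lt_of_le_of_ne hp (W.momentum_ne ha hw hq).symm)
      (W.mem_window hk (W.tl_mem hk)) hw ht.1
    simp only [el, hq] at this; linarith
  obtain ⟨θ', a', t2, P⟩ := W.exists_path hk ha hσ' ht' (s1 := 1) (s2 := -1) (.inl rfl) (.inr rfl)
    (W.clear_from_above hk ha ht' hq hp) fun t2 ht2 h0 =>
      (W.facts k hk θ _ ht' a ha 1 (-1) (.inl rfl) (.inr rfl)).clear_of_above W.δ_pos W.two_δ ht2 h0 hq
        (by rw [p2_flip]; linarith)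
  exact ⟨_, θ, a, θ', a', _, t2, _, P, rfl, rfl, hq, hp, W.left_of_mem_Ioo hk ha hak ht, rfl⟩

end Window

end Model

lemma exists_angle_function {f : ℝ → ℝ} (hc : Continuous f) (hp : ∀ θ, f (θ + 2 * π) = f θ) :
    ∃ F : Angle → ℝ, Continuous F ∧ ∀ θ : ℝ, F θ = f θ := by
  have hp' : Function.Periodic f (2 * π) := hp
  exact ⟨hp'.lift, continuous_coinduced_dom.2 hc, fun θ => hp'.lift_coe θ⟩

namespace Model

variable {S : StepSystem} {h : ℝ} {M : Model S h} {B : Base M}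

lemma SectionChart.interior_pt {C : SectionChart B} {ε θ a : ℝ} (hε : |ε| < C.η) (ha : |a - B.aS| < C.η) :
    S.Interior (C.pt ε θ a) := by
  have hs := C.mem_section ε θ a hε ha
  refine Outside.interior (fun h' => ?_) hs.1 hs.2.1
  have := C.X_mem ε θ a hε ha
  have h1 : C.X (ε, θ, a) ≤ S.w₁ := h'.1
  linarith [this.1, S.w₁_neg]

namespace Window

variable {C : SectionChart B} {ε δ σ σ' E Δ K : ℝ} {Bf D y : ℝ → ℝ → ℝ} {θp θm Mx tm : ℝ → ℝ}
  {tl tr : ℝ → ℝ → ℝ} {x : Label → ℝ → ℝ} (W : Window C ε δ σ σ' E Δ K Bf D y θp θm Mx tm tl tr x)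
include W

lemma δ_lt : δ < B.τ := by linarith [W.three_δ, W.δ_pos]

/-! ### Properties of the transitions -/

lemma transition_reverse {b : Label} {u v : Cyl} (ht : Transition C ε δ σ b u v) :
    Transition C ε δ σ b (reflect v) (reflect u) := by
  obtain ⟨θ, a, θ', a', t1, t2, zo, P, rfl, rfl, hk⟩ := ht
  obtain ⟨P', e⟩ := P.reverse W.ε_lt W.σ_le
  refine ⟨_, _, _, _, _, _, _, P', rfl, rfl, ?_⟩
  rw [e]
  cases b with
  | R =>
    obtain ⟨h1, h2, h3, rfl⟩ := hk
    exact ⟨h1, by simpa using h2, h3, by simp [timeRev, flip, q₁, q₂, p₁, p₂]⟩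
  | zero =>
    obtain ⟨h1, h2, rfl⟩ := hk
    exact ⟨h1, h2, rfl⟩
  | one =>
    obtain ⟨h1, h2, h3, rfl⟩ := hk
    exact ⟨h1, by simpa using h2, h3, by simp [timeRev, flip, q₁, q₂, p₁, p₂]⟩

lemma transition_lt {b : Label} {u v : Cyl} (ht : Transition C ε δ σ b u v) :
    ∃ θ : ℝ, u.1 = θ ∧ u.2 < Mx θ := by
  obtain ⟨θ, a, θ', a', t1, t2, zo, P, rfl, rfl, hk⟩ := ht
  refine ⟨θ, rfl, ?_⟩
  have hc := W.crossing t1 P.t1_mem θ a P.amp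
  have hle := W.corners.le_Mx θ t1 P.t1_mem
  change M.act a < Mx θ
  cases b with
  | R =>
    obtain ⟨h1, h2, h3, -⟩ := hk
    have e := hc.2.1 h1
    have hD := (W.momentum t1 P.t1_mem θ a P.amp e).1.2 h2
    rw [e]
    exact W.lt_Mx P.t1_mem ((W.corners.D_pos_iff θ t1 P.t1_mem).1.1 hD).ne
  | zero => exact (hc.1.1 hk.1).trans_le hle
  | one => exact (hc.1.1 hk.2.2.1).trans_le hle

lemma transition_route {b : Label} {θ a : ℝ} {v : Cyl} (ha : |a - B.aS| < C.η)
    (ht : Transition C ε δ σ b (↑θ, M.act a) v) : ∃ θ' a' : ℝ, |a' - B.aS| < σ ∧ v = (↑θ', M.act a') ∧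
      M.Route ε h (C.pt ε θ a) (C.pt ε θ' a') := by
  obtain ⟨θ1, a₁, θ', a', t1, t2, zo, P, e1, rfl, hk⟩ := ht
  have hs := C.mem_section ε θ a W.ε_lt ha
  have e2 : C.pt ε θ a = C.pt ε θ1 a₁ :=
    eq_pt W.ε_lt hs (P.amp.trans_le W.σ_le) ((coord_pt ε θ ha).trans e1)
  refine ⟨θ', a', P.amp', rfl, ?_⟩
  rw [e2]
  exact P.route W.ε_lt (hk.passage (P.clear1.core t1 ⟨P.clear1.pos.le, le_rfl⟩))

lemma transition_returns {b : Label} {u v : Cyl} (ht : Transition C ε δ σ b u v) : S.ReturnsTo ε h u v := by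
  obtain ⟨θ, a, θ', a', t1, t2, zo, P, rfl, rfl, hk⟩ := ht
  have ha := P.amp.trans_le W.σ_le
  have ha' := P.amp'.trans_le W.σ_le
  have hr := P.route W.ε_lt (hk.passage (P.clear1.core t1 ⟨P.clear1.pos.le, le_rfl⟩))
  exact ⟨_, _, hr.reaches W.ε_le (C.mem_section ε θ a W.ε_lt ha) (interior_pt W.ε_lt ha)
    (interior_pt W.ε_lt ha').free, C.mem_section ε θ' a' W.ε_lt ha',
    coord_pt ε θ ha, coord_pt ε θ' ha'⟩

lemma transition_unique {b : Label} {u v v' : Cyl} (ht : Transition C ε δ σ b u v)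
    (hr : S.ReturnsTo ε h u v') : v' = v := by
  have ht' := ht
  obtain ⟨θ, a, θ', a', t1, t2, zo, P, rfl, rfl, hk⟩ := ht'
  have ha := P.amp.trans_le W.σ_le
  have ha' := P.amp'.trans_le W.σ_le
  obtain ⟨z₀, z₁, hz, hz1, c0, rfl⟩ := hr
  obtain rfl := eq_pt W.ε_lt hz.1 ha c0
  have hroute := P.route W.ε_lt (hk.passage (P.clear1.core t1 ⟨P.clear1.pos.le, le_rfl⟩))
  rcases hroute.unique W.ε_le (.inl ⟨C.mem_section ε θ' a' W.ε_lt ha', interior_pt W.ε_lt ha'⟩) hz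
    with h1 | h1
  · rw [h1, coord_pt ε θ' ha']
  · exact absurd hz1 h1.1

/-! ### The types of passage and the position of the corner -/

variable {k θ a : ℝ}

lemma transition_height {θ' a' t1 t2 : ℝ} {zo : Phase} {b : Label} (hk : k ∈ Ioo (-Δ) 0)
    (P : Path C ε δ σ θ a θ' a' t1 t2 zo) (hak : M.act a = Mx θ + k)
    (hb : Kind S b (M.Φ t1 ε (C.pt ε θ a)) zo) :
    match b with
    | .R => y (tl k θ) θ < 0
    | .zero => 0 < y (tl k θ) θ ∧ 0 < y (tr k θ) θ
    | .one => 0 < y (tl k θ) θ ∧ y (tr k θ) θ < 0 := by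
  have hk' := Ioo_subset_Icc_self hk
  have ha := P.amp
  obtain ⟨c1, c2⟩ := W.crossing t1 P.t1_mem θ a ha
  have el := W.q2_tl hk' ha hak
  have er := W.q2_tr hk' ha hak
  have mem_of_lt (hq : q₁ (M.Φ t1 ε (C.pt ε θ a)) < S.w₁) : t1 ∈ Ioo (tl k θ) (tr k θ) := by
    have hm := (W.left_iff hk' ha hak P.t1_mem).1 hq.le
    refine ⟨lt_of_le_of_ne hm.1 fun h0 => ?_, lt_of_le_of_ne hm.2 fun h0 => ?_⟩
    · rw [← h0, W.q1_tl hk' ha hak] at hq; exact lt_irrefl _ hq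
    · rw [h0, W.q1_tr hk' ha hak] at hq; exact lt_irrefl _ hq
  have hmw := W.mem_window (θ := θ) hk' (W.tl_mem hk')
  have hmr := W.mem_window (θ := θ) hk' (W.tr_mem hk')
  have h3 := W.three_δ
  have hδ := W.δ_pos
  cases b with
  | R =>
    obtain ⟨h1, h2, h3, -⟩ := hb
    have e := c2.1 h1
    have hD := (W.momentum t1 P.t1_mem θ a ha e).1.2 h2
    have hlt := (W.corners.D_pos_iff θ t1 P.t1_mem).1.1 hD
    rcases W.corners.cross_eq k hk' θ t1 P.t1_mem (by rw [← e, hak]) with rfl | rfl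
    · change y (tl k θ) θ < 0
      linarith
    · exact absurd hlt (not_lt.2 (W.corners.cross k hk' θ).2.2.1)
  | zero =>
    obtain ⟨h1, h2, rfl⟩ := hb
    have hm := mem_of_lt h1
    have o1 := P.clear1.outside (tl k θ) ⟨by linarith [hmw.1], hm.1⟩
    have o2 := P.clear2.outside (tr k θ - t1) ⟨by linarith [hm.2], by
      linarith [hmr.2, P.t1_mem.1, P.t2_mem.1]⟩
    rw [← M.Φ_add, sub_add_cancel] at o2
    constructor
    · by_contra! hle
      exact o1 ⟨(W.q1_tl hk' ha hak).le, by linarith⟩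
    · by_contra! hle
      exact o2 ⟨(W.q1_tr hk' ha hak).le, by linarith⟩
  | one =>
    obtain ⟨h1, h2, h3, -⟩ := hb
    have hm := mem_of_lt h3
    have anti := (W.monotone_height ha P.t1_mem h1).2 h2
    have a1 := anti hmw P.t1_mem hm.1
    have a2 := anti P.t1_mem hmr hm.2
    simp only [el, er, h1] at a1 a2
    exact ⟨by linarith, by linarith⟩

lemma arc_iff {Itan : Angle → ℝ} (hI : ∀ θ : ℝ, Itan θ = Mx θ) (b : Label) (hk : k ∈ Ioo (-Δ) 0)
    (θ : Angle) : θ ∈ cIoo (x b.next.next k : Angle) (x b k : Angle) ↔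
      ∃ v, Transition C ε δ σ b (θ, Itan θ + k) v := by
  have hk' := Ioo_subset_Icc_self hk
  constructor
  · induction θ using Angle.induction_on with | _ θ => ?_
    intro hθ
    obtain ⟨a, ha, hak⟩ := W.range θ k hk'
    have ha' := ha.trans_le W.σ'_le
    rw [hI, ← hak]
    obtain ⟨a1, a2, a3⟩ := W.corners.arcs k hk θ
    cases b with
    | R => exact W.exists_reflection_right hk' ha' hak hk.2 ha (a1.1 hθ)
    | zero => exact W.exists_transition_zero hk' ha' hak hk.2 ha (a2.1 hθ).1 (a2.1 hθ).2
    | one => exact W.exists_reflection_above hk' ha' hak ha (a3.1 hθ).1 (a3.1 hθ).2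
  · rintro ⟨v, θ1, a, θ', a', t1, t2, zo, P, e, -, hb⟩
    obtain ⟨rfl, e2⟩ := Prod.mk.inj e
    rw [hI] at e2
    obtain ⟨a1, a2, a3⟩ := W.corners.arcs k hk θ1
    have := W.transition_height hk P e2.symm hb
    cases b with
    | R => exact a1.2 this
    | zero => exact a2.2 this
    | one => exact a3.2 this

/-! ### The corner -/

variable (hk : k ∈ Icc (-Δ) 0) (ha : |a - B.aS| < σ) (hak : M.act a = Mx θ + k)
include hk ha hak

lemma route_tl : M.Route ε h (C.pt ε θ a) (M.Φ (tl k θ) ε (C.pt ε θ a)) :=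
  .inl ⟨_, (W.clear_from_right hk ha (W.tl_mem hk) (W.q1_tl hk ha hak) (W.p1_tl hk ha hak).1).leg W.ε_le h, rfl⟩

lemma p2_tl : ((θ : Angle) = θp (tl k θ) → y (tl k θ) θ = 0 ∧ 0 < p₂ (M.Φ (tl k θ) ε (C.pt ε θ a))) ∧
    ((θ : Angle) = θm (tl k θ) → y (tl k θ) θ = 0 ∧ p₂ (M.Φ (tl k θ) ε (C.pt ε θ a)) < 0) :=
  (W.momentum _ (W.mem_window hk (W.tl_mem hk)) θ a ha (W.at_wall_left hk hak)).2.2.2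

lemma p2_tr : ((θ : Angle) = θp (tr k θ) → y (tr k θ) θ = 0 ∧ 0 < p₂ (M.Φ (tr k θ) ε (C.pt ε θ a))) ∧
    ((θ : Angle) = θm (tr k θ) → y (tr k θ) θ = 0 ∧ p₂ (M.Φ (tr k θ) ε (C.pt ε θ a)) < 0) :=
  (W.momentum _ (W.mem_window hk (W.tr_mem hk)) θ a ha (W.at_wall_right hk hak)).2.2.2

lemma route_tr (hθ : (θ : Angle) = θm (tr k θ)) :
    M.Route ε h (C.pt ε θ a) (M.Φ (tr k θ) ε (C.pt ε θ a)) := by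
  obtain ⟨h1, h2⟩ := (W.p2_tr hk ha hak).2 hθ
  exact .inl ⟨_, (W.clear_from_above hk ha (W.tr_mem hk) (by rw [W.q2_tr hk ha hak, h1, add_zero]) h2).leg
    W.ε_le h, rfl⟩

/-- Orbits that do not meet the corner return to the section. -/
lemma exists_route (hσ' : |a - B.aS| < σ')
    (hy : y (tl k θ) θ < 0 ∨ (0 < y (tl k θ) θ ∧ y (tr k θ) θ ≠ 0)) :
    ∃ θ' a', |a' - B.aS| < σ ∧ M.Route ε h (C.pt ε θ a) (C.pt ε θ' a') := by
  have haη := ha.trans_le W.σ_le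
  rcases hy with hy | ⟨hl, hr⟩
  · rcases hk.2.lt_or_eq with hk0 | hk0
    · obtain ⟨v, hv⟩ := W.exists_reflection_right hk ha hak hk0 hσ' hy
      obtain ⟨θ', a', h1, -, h2⟩ := W.transition_route haη hv
      exact ⟨θ', a', h1, h2⟩
    · have ht := W.tl_mem (θ := θ) hk
      have hp := (W.p1_tl hk ha hak).2.2 hk0
      have hq := W.q1_tl hk ha hak
      have hq2 := W.q2_tl hk ha hak
      have hc := W.core_at hk ha ht
      obtain ⟨θ', a', t2, P⟩ := W.exists_path hk ha hσ' ht (s1 := 1) (s2 := 1) (.inl rfl) (.inl rfl)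
        (W.clear_from_right hk ha ht hq hp.le) fun t2 ht2 h0 =>
          (W.facts k hk θ _ ht a ha 1 1 (.inl rfl) (.inl rfl)).clear_of_right W.δ_pos W.two_δ ht2 h0 hq
            (by rw [p1_flip, hp, mul_zero])
      refine ⟨θ', a', P.amp', P.route W.ε_lt (.inr ⟨⟨⟨hc.mem_U.1, hc.mem_U.2, fun h' => h'.1.ne hq⟩,
        fun h' => ?_, fun z' h' => ?_⟩, flip_one_one _⟩)⟩
      · linarith [h'.2]
      · rcases h' with ⟨-, h1, -⟩ | ⟨-, -, h1, -⟩
        · linarith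
        · linarith
  · rcases lt_or_gt_of_ne hr with hr | hr
    · obtain ⟨v, hv⟩ := W.exists_reflection_above hk ha hak hσ' hl hr
      obtain ⟨θ', a', h1, -, h2⟩ := W.transition_route haη hv
      exact ⟨θ', a', h1, h2⟩
    · obtain ⟨θ', a', t2, P⟩ := W.exists_passage hk ha hak hσ' hl hr
      have hc := W.core_at hk ha (W.tm_mem' (θ := θ) hk)
      exact ⟨θ', a', P.amp', P.route W.ε_lt (.inr ⟨Outside.interior (fun h' =>
        absurd (W.above_between hk ha hak hl hr (W.tm_mem' hk)) (not_lt.2 h'.2)) hc.mem_U.1 hc.mem_U.2, rfl⟩)⟩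

/-- The corner is reached when the orbit first crosses the line of the wall, or, in downward motion, when it
does so for the second time. -/
lemma corner_state (hσ' : |a - B.aS| < σ') {zc : Phase} (hz : S.Reaches ε h (C.pt ε θ a) zc)
    (hc : S.AtCorner zc) :
    (zc = M.Φ (tl k θ) ε (C.pt ε θ a) ∧ ((θ : Angle) = θp (tl k θ) ∨ (θ : Angle) = θm (tl k θ))) ∨
    (zc = M.Φ (tr k θ) ε (C.pt ε θ a) ∧ (θ : Angle) = θm (tr k θ) ∧ 0 < y (tl k θ) θ) := by
  have no_route (hy : y (tl k θ) θ < 0 ∨ (0 < y (tl k θ) θ ∧ y (tr k θ) θ ≠ 0)) : False := by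
    obtain ⟨θ', a', h1, h2⟩ := W.exists_route hk ha hak hσ' hy
    have h1' := h1.trans_le W.σ_le
    have hi := interior_pt (θ := θ') W.ε_lt h1'
    rcases h2.unique W.ε_le (.inl ⟨C.mem_section ε θ' a' W.ε_lt h1', hi⟩) hz with h3 | h3
    · rw [h3] at hc; exact hi.not_corner hc
    · exact h3.2 hc
  have hmw := W.mem_window (θ := θ) hk (W.tl_mem hk)
  have hmr := W.mem_window (θ := θ) hk (W.tr_mem hk)
  have el := W.q2_tl hk ha hak
  have er := W.q2_tr hk ha hak
  rcases lt_trichotomy (y (tl k θ) θ) 0 with hl | hl | hl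
  · exact (no_route (.inl hl)).elim
  · left
    refine ⟨?_, W.corners.y_zero_iff _ hmw θ hl⟩
    have hc' : S.AtCorner (M.Φ (tl k θ) ε (C.pt ε θ a)) := ⟨W.q1_tl hk ha hak, by rw [el, hl, add_zero]⟩
    exact ((W.route_tl hk ha hak).unique W.ε_le (.inr hc') hz).resolve_right fun h3 => h3.2 hc
  · by_cases hr : y (tr k θ) θ = 0
    · right
      have hq : q₂ (M.Φ (tr k θ) ε (C.pt ε θ a)) = S.w₂ := by rw [er, hr, add_zero]
      have hθ : (θ : Angle) = θm (tr k θ) := by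
        refine (W.corners.y_zero_iff _ hmr θ hr).resolve_left fun hp => ?_
        have := ((W.monotone_height ha hmr hq).1 ((W.p2_tr hk ha hak).1 hp).2).monotoneOn hmw hmr
          (W.tl_mem hk).2
        simp only [el, hq] at this
        linarith
      refine ⟨?_, hθ, hl⟩
      exact ((W.route_tr hk ha hak hθ).unique W.ε_le (.inr ⟨W.q1_tr hk ha hak, hq⟩) hz).resolve_right
        fun h3 => h3.2 hc
    · exact (no_route (.inr ⟨hl, hr⟩)).elim

end Window

end Model

namespace Model

variable {S : StepSystem} {h : ℝ} {M : Model S h} {B : Base M}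

namespace Window

variable {C : SectionChart B} {ε δ σ σ' E Δ K : ℝ} {Bf D y : ℝ → ℝ → ℝ} {θp θm Mx tm : ℝ → ℝ}
  {tl tr : ℝ → ℝ → ℝ} {x : Label → ℝ → ℝ} (W : Window C ε δ σ σ' E Δ K Bf D y θp θm Mx tm tl tr x)
include W

/-- An initial condition reaches the corner in the direction `b` iff its angle is the corner point. -/
lemma corner_iff {Itan : Angle → ℝ} (hI : ∀ θ : ℝ, Itan θ = Mx θ) (b : Label) {k : ℝ}
    (hk : k ∈ Icc (-Δ) 0) (θ : Angle) :
    (θ, Itan θ + k) ∈ S.cornerCurve ε h b b.next ↔ θ = x b k := by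
  induction θ using Angle.induction_on with | _ θ => ?_
  obtain ⟨a, hσ', hak⟩ := W.range θ k hk
  have ha := hσ'.trans_le W.σ'_le
  have haη := ha.trans_le W.σ_le
  rw [hI, ← hak]
  obtain ⟨c1, c2, c3⟩ := W.corners.corner k hk θ
  have hcl := W.core_at hk ha (W.tl_mem (θ := θ) hk)
  have hcr := W.core_at hk ha (W.tr_mem (θ := θ) hk)
  have hql := W.q1_tl hk ha hak
  have hqr := W.q1_tr hk ha hak
  have el := W.q2_tl hk ha hak
  have er := W.q2_tr hk ha hak
  have hpl := W.p1_tl hk ha hak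
  have hpr := W.p1_tr hk ha hak
  obtain ⟨ml, ml'⟩ := W.p2_tl hk ha hak
  obtain ⟨mr, mr'⟩ := W.p2_tr hk ha hak
  have h0 := W.eq_tm_of_zero (θ := θ)
  constructor
  · rintro ⟨z₀, zc, hz, hc, hdir, hcoord⟩
    obtain rfl := eq_pt W.ε_lt hz.1 haη hcoord
    rcases W.corner_state hk ha hak hσ' hz hc with ⟨rfl, hθ | hθ⟩ | ⟨rfl, hθ, hl⟩
    · have hp := (ml hθ).2
      cases b with
      | R => exact c1.2 hθ
      | zero => exact absurd hdir.2 (not_le.2 hp)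
      | one => exact absurd hdir.2 (not_le.2 hp)
    · have hp := (ml' hθ).2
      cases b with
      | R => exact absurd hdir.2 (not_le.2 hp)
      | zero =>
        have hk0 : k = 0 := by
          by_contra hne
          exact absurd hdir.1 (not_le.2 (hpl.2.1 (lt_of_le_of_ne hk.2 hne)))
        subst hk0
        rw [h0.1, ← h0.2] at hθ
        exact c3.2 hθ
      | one => exact c2.2 hθ
    · have hp := (mr' hθ).2
      cases b with
      | R => exact absurd hdir.2 (not_le.2 hp)
      | zero => exact c3.2 hθ
      | one =>
        have hk0 : k = 0 := by
          by_contra hne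
          exact hpr.2 (lt_of_le_of_ne hk.2 hne) (le_antisymm hdir.1 hpr.1)
        subst hk0
        rw [h0.1, ← h0.2, (mr' hθ).1] at hl
        exact absurd hl (lt_irrefl _)
  · have h₀ := C.mem_section ε θ a W.ε_lt haη
    have hi := interior_pt (θ := θ) W.ε_lt haη
    have hcoord := coord_pt ε θ haη
    have reach_l := (W.route_tl hk ha hak).reaches W.ε_le h₀ hi
      ⟨hcl.mem_U.1, hcl.mem_U.2, fun h' => h'.1.ne hql⟩
    intro hθ
    cases b with
    | R =>
      obtain ⟨y0, hp⟩ := ml (c1.1 hθ)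
      exact ⟨_, _, reach_l, ⟨hql, by rw [el, y0, add_zero]⟩, ⟨hpl.1, hp.le⟩, hcoord⟩
    | zero =>
      obtain ⟨y0, hp⟩ := mr' (c3.1 hθ)
      exact ⟨_, _, (W.route_tr hk ha hak (c3.1 hθ)).reaches W.ε_le h₀ hi
        ⟨hcr.mem_U.1, hcr.mem_U.2, fun h' => h'.1.ne hqr⟩, ⟨hqr, by rw [er, y0, add_zero]⟩,
        ⟨hpr.1, hp.le⟩, hcoord⟩
    | one =>
      obtain ⟨y0, hp⟩ := ml' (c2.1 hθ)
      exact ⟨_, _, reach_l, ⟨hql, by rw [el, y0, add_zero]⟩, ⟨hpl.1, hp.le⟩, hcoord⟩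

/-! ### The tangential curve -/

lemma tangent_state {θ a : ℝ} (ha : |a - B.aS| < σ) (hak : M.act a = Mx θ) :
    q₁ (M.Φ (tm θ) ε (C.pt ε θ a)) = S.w₁ ∧ p₁ (M.Φ (tm θ) ε (C.pt ε θ a)) = 0 ∧
    M.Leg ε h (C.pt ε θ a) (tm θ) := by
  have hk := W.zero_mem
  have hak0 : M.act a = Mx θ + 0 := by rw [hak, add_zero]
  have h1 := W.q1_tl hk ha hak0
  have h2 := (W.p1_tl hk ha hak0).2.2 rfl
  have h3 := W.clear_from_right hk ha (W.tl_mem hk) h1 h2.le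
  rw [W.eq_tm_of_zero.1] at h1 h2 h3
  exact ⟨h1, h2, h3.leg W.ε_le h⟩

lemma tangential_of_eq {θ : ℝ} : ((θ : Angle), Mx θ) ∈ S.tangentialCurve ε h := by
  have hk := W.zero_mem
  obtain ⟨a, hσ', hak⟩ := W.range θ 0 hk
  rw [add_zero] at hak
  have ha := hσ'.trans_le W.σ'_le
  have haη := ha.trans_le W.σ_le
  obtain ⟨h1, h2, h3⟩ := W.tangent_state ha hak
  have hm := W.tm_mem' (θ := θ) hk
  have hc := W.core_at hk ha hm
  refine ⟨_, _, Route.reaches (M := M) W.ε_le (C.mem_section ε θ a W.ε_lt haη)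
    (interior_pt W.ε_lt haη) ⟨hc.mem_U.1, hc.mem_U.2, fun h' => h'.1.ne h1⟩
    (.inl ⟨_, h3, rfl⟩), not_section_of_turning W.ε_le hc (.inr (W.turning_at hk ha hm)) h, h1, h2, ?_⟩
  exact hak ▸ coord_pt ε θ haη

lemma eq_of_tangential {u : Cyl} (hu : u ∈ S.tangentialCurve ε h) : ∃ θ : ℝ, u = (↑θ, Mx θ) := by
  obtain ⟨z₀, z₁, ⟨hz₀, T, hT, z, hits, hz, rfl, rfl, hs⟩, hn, hq, hp, rfl⟩ := hu
  have hδ := W.δ_pos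
  have hH : S.hamiltonian ε (z T) = h := (hz.hamiltonian_eq ⟨hT.le, le_rfl⟩).trans hz₀.2.2.2.2
  obtain ⟨-, f, hE⟩ := W.tangent (z T) hq hp (hz.free T ⟨hT.le, le_rfl⟩).2.1 hH
  obtain ⟨t, ht, h0⟩ := f.exists_return W.δ_pos W.two_δ
  have ht' := Ioo_subset_Icc_self ht
  have hcl := f.clear_of_right W.δ_pos W.two_δ ht' h0 hq (by rw [p1_timeRev, hp, neg_zero])
  have hHr : S.hamiltonian ε (timeRev (z T)) = h := by rw [hamiltonian_timeRev, hH]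
  have hsec := f.mem_section W.ε_le W.two_δ W.δ_pos ht' h0 hHr
  have back (s : ℝ) : M.Φ (-s) ε (z T) = timeRev (M.Φ s ε (timeRev (z T))) := by
    rw [M.Φ_timeRev, timeRev_timeRev]
  have core (s : ℝ) (hs : s ∈ Icc 0 t) : M.InCore (M.Φ (-s) ε (z T)) := by
    rw [back]; exact hcl.core s hs
  have out (s : ℝ) (hs : s ∈ Ioo 0 t) : S.Outside (M.Φ (-s) ε (z T)) := by
    rw [back]; exact hcl.outside s hs
  have hTt : T = t := by
    rcases lt_trichotomy T t with h1 | h1 | h1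
    · exfalso
      have := M.eq_flow_backward W.ε_le hz hT.le le_rfl (fun s hs => core s ⟨hs.1, hs.2.le.trans h1.le⟩)
        fun s hs => out s ⟨hs.1, hs.2.trans h1⟩
      rw [sub_self, back] at this
      have hmem := timeRev_mem_section hz₀
      rw [this, timeRev_timeRev] at hmem
      exact not_section_of_turning W.ε_le (hcl.core T ⟨hT.le, h1.le⟩) (hcl.turning T ⟨hT, h1⟩) h hmem
    · exact h1
    · exfalso
      have := M.eq_flow_backward W.ε_le hz hcl.pos.le h1.le (fun s hs => core s ⟨hs.1, hs.2.le⟩) out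
      refine hs (T - t) ⟨by linarith, by linarith [hcl.pos]⟩ ?_
      rw [this, back]
      exact timeRev_mem_section hsec
  subst hTt
  have hz0 : z 0 = timeRev (M.Φ T ε (timeRev (z T))) := by
    have := M.eq_flow_backward W.ε_le hz hT.le le_rfl (fun s hs => core s ⟨hs.1, hs.2.le⟩) out
    rwa [sub_self, back] at this
  have hfwd : M.Φ T ε (z 0) = z T := by
    rw [hz0, Φ_timeRev_Φ, sub_self, M.Φ_zero, timeRev_timeRev]
  have hd := energy_drift W.ε_le hT.le (T := 4 * B.τ) (by linarith [ht.2, W.δ_lt]) hcl.core hHr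
  have en (z : Phase) : S.energy₂ (q₂ (timeRev z)) (p₂ (timeRev z)) = S.energy₂ (q₂ z) (p₂ z) := by
    simp [energy₂]
  have e0 : S.energy₂ (q₂ (M.Φ T ε (timeRev (z T)))) (p₂ (M.Φ T ε (timeRev (z T)))) =
      S.energy₂ (q₂ (z 0)) (p₂ (z 0)) := by rw [hz0, en]
  rw [en, e0] at hd
  have hdr := W.drift
  have hEpos : 0 < E := by
    obtain ⟨a, ha, -⟩ := W.range 0 0 W.zero_mem
    exact (abs_nonneg _).trans_lt (W.near a ha)
  obtain ⟨θ, a, ha, hpt⟩ := W.back _ hz₀ (by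
    rw [abs_le] at hd hE; rw [abs_lt]; constructor <;> linarith [hd.1, hd.2, hE.1, hE.2])
  rw [hpt] at hfwd
  have e1 := (W.crossing T ht' θ a ha).2.1 (by rw [hfwd, hq])
  have e2 := (W.momentum T ht' θ a ha e1).2.1.2 (by rw [hfwd, hp])
  have e3 : T = tm θ := by
    obtain ⟨d1, d2⟩ := W.corners.D_pos_iff θ T ht'
    exact le_antisymm (d2.1 e2.ge) (not_lt.1 fun h' => (d1.2 h').ne' e2)
  refine ⟨θ, ?_⟩
  rw [hpt, coord_pt ε θ (ha.trans_le W.σ_le), e1, e3, (W.corners.tm_mem θ).2.2]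

/-- The tangential curve is close to the unperturbed torus. -/
lemma abs_Mx_sub_le (θ : ℝ) : |Mx θ - M.act B.aS| ≤
    K * ((M.B * √(2 * (h + M.B)) * (4 * B.τ) + M.B) * |ε|) := by
  obtain ⟨a, hσ', hak⟩ := W.range θ 0 W.zero_mem
  rw [add_zero] at hak
  have ha := hσ'.trans_le W.σ'_le
  have haη := ha.trans_le W.σ_le
  obtain ⟨h1, h2, h3⟩ := W.tangent_state ha hak
  have hH : S.hamiltonian ε (C.pt ε θ a) = h := (C.mem_section ε θ a W.ε_lt haη).2.2.2.2
  have hm := W.tm_mem' (θ := θ) W.zero_mem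
  have hc := W.core_at W.zero_mem ha hm
  have hE := (W.tangent _ h1 h2 hc.mem_U.2 (by rw [hamiltonian_Φ W.ε_le h3.pos.le h3.core, hH])).2.2
  have hd := energy_drift W.ε_le h3.pos.le (T := 4 * B.τ)
    (by linarith [(W.corners.tm_mem θ).1.2, W.δ_lt, W.δ_pos]) h3.core hH
  have e1 : S.energy₂ (q₂ (C.pt ε θ a)) (p₂ (C.pt ε θ a)) = M.W2 a := energy2_QP (C.amp a haη) _
  rw [e1] at hd
  rw [← hak]
  refine (W.lip a B.aS ha (by rw [sub_self, abs_zero]; exact (abs_nonneg _).trans_lt ha)).trans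
    (mul_le_mul_of_nonneg_left ?_ W.K_nonneg)
  rw [abs_le] at hd hE ⊢
  constructor <;> nlinarith [hd.1, hd.2, hE.1, hE.2]

lemma transition_close {Itan : Angle → ℝ} (hI : ∀ θ : ℝ, Itan θ = Mx θ) {b : Label} {u v : Cyl}
    (ht : Transition C ε δ σ b u v) : |(v.2 - Itan (-v.1)) - (u.2 - Itan u.1)| ≤
      3 * K * (M.B * √(2 * (h + M.B)) * (4 * B.τ) + M.B) * |ε| := by
  obtain ⟨θ, a, θ', a', t1, t2, zo, P, rfl, rfl, -⟩ := ht
  have hB : 0 ≤ M.B * |ε| := mul_nonneg M.B_nonneg (abs_nonneg _)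
  have h1 : |M.act a' - M.act a| ≤ K * ((M.B * √(2 * (h + M.B)) * (4 * B.τ) + M.B) * |ε|) := by
    refine (W.lip a' a P.amp' P.amp).trans (mul_le_mul_of_nonneg_left ?_ W.K_nonneg)
    refine (P.energy W.ε_lt W.σ_le W.δ_lt).trans ?_
    linarith
  have h2 := W.abs_Mx_sub_le θ
  have h3 := W.abs_Mx_sub_le (-θ')
  simp only [← Angle.coe_neg, hI]
  rw [abs_le] at h1 h2 h3 ⊢
  constructor <;> linarith [h1.1, h1.2, h2.1, h2.2, h3.1, h3.2]

end Window

end Model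

namespace Model

variable {S : StepSystem} {h : ℝ} {M : Model S h} {B : Base M}

/-- The action at the wall is near that of the unperturbed tangency. -/
lemma SectionChart.Level.act_near {C : SectionChart B} {ρ d : ℝ} {A : ℝ³ → ℝ} (L : Level C ρ d A)
    {κ : ℝ} (hκ : 0 < κ) : ∃ e > 0, ∀ ε, |ε| < e → ∀ t, |t - B.τ| < e → ∀ θ,
      |M.act (A (ε, t, θ)) - M.act B.aS| < κ := by
  obtain ⟨e, he, hev⟩ := Metric.eventually_nhds_iff.1
    (L.eventually_forall (P := fun u => |M.act (A u) - M.act B.aS| < κ) (fun u hu n hP => by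
      rwa [L.A_turn hu]) fun θ => by
        have hc := (L.contDiffAt_action (L.base_mem θ)).continuousAt
        refine (hc.sub continuousAt_const).abs.eventually_lt continuousAt_const ?_
        change |M.act (A (0, B.τ, θ)) - M.act B.aS| < κ
        rw [L.A_base, sub_self, abs_zero]; exact hκ)
  refine ⟨e, he, fun ε hε t ht θ => hev (y := (ε, t)) ?_ θ⟩
  rw [Prod.dist_eq, Real.dist_eq, Real.dist_eq, sub_zero]
  exact max_lt hε ht

/-- For a small perturbation the dynamics near the tangency is as described by `Window`. -/
lemma exists_window (C : SectionChart B) : ∃ δ σ σ' E Δ K : ℝ, 0 < Δ ∧ 0 ≤ K ∧ ∃ ε0 > 0, ∀ ε, |ε| < ε0 →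
    ∃ (Bf D y : ℝ → ℝ → ℝ) (θp θm Mx tm : ℝ → ℝ) (tl tr : ℝ → ℝ → ℝ) (x : Label → ℝ → ℝ),
      Window C ε δ σ σ' E Δ K Bf D y θp θm Mx tm tl tr x := by
  obtain ⟨δ0, hδ0, facts⟩ := B.exists_facts
  obtain ⟨em, hem, hmom⟩ := C.momentum_of_height hδ0 (facts δ0 hδ0 le_rfl)
  obtain ⟨ρ, hρ, d, A, L⟩ := exists_level C hem
  obtain ⟨θp, θm, m0, m1, c, μ, Kl, ef, hef, hefd, fam⟩ := L.exists_family
  obtain ⟨δ1, hδ1, gap⟩ := L.exists_gap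
  have hτ : 0 < B.τ := (B.swing 0 0).τ_pos
  obtain ⟨δ, hδ, l⟩ := exists_between (show 0 < min (min δ0 δ1) (min (min ef em) (B.τ / 3)) by positivity)
  simp only [lt_min_iff, lt_div_iff₀' (zero_lt_three' ℝ)] at l
  obtain ⟨⟨l0, l1⟩, ⟨lf, lm⟩, lτ⟩ := l
  replace l0 := l0.le
  replace l1 := l1.le
  obtain ⟨e1, he1, F1⟩ := facts_of_orb C (facts δ hδ l0)
  obtain ⟨e2, he2, F2⟩ := B.facts_at_tangency (facts δ hδ l0)
  obtain ⟨K, hK, e3, he3, lip⟩ := act_lipschitz B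
  have hη := C.η_pos
  have hρ0 := L.ρ_pos
  obtain ⟨σ, hσ0, l⟩ := exists_between (lt_min (lt_min hρ0 he1) he3)
  simp only [lt_min_iff] at l
  obtain ⟨⟨σρ, σ1⟩, σ3⟩ := l
  have ση : σ ≤ C.η := (σρ.trans L.ρ_lt).le
  obtain ⟨E1, hE1, back⟩ := exists_pt C hσ0 ση
  obtain ⟨E2, hE2, tang⟩ := exists_tangent C (lt_min he2 hη)
  obtain ⟨e4, he4, near⟩ := W2_near (B := B) (_root_.half_pos hE1)
  obtain ⟨κ, hκ, surj⟩ := act_surj (B := B) (lt_min hσ0 he4)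
  obtain ⟨e5, he5, anear⟩ := L.act_near (_root_.half_pos hκ)
  obtain ⟨ι, hι, l⟩ := exists_between (lt_min hδ (lt_min he1 he5))
  simp only [lt_min_iff] at l
  obtain ⟨ιδ, ι1, ι5⟩ := l
  obtain ⟨G1, hG1, gap1⟩ := gap δ hδ l1
  obtain ⟨G2, hG2, gap2⟩ := gap ι hι (ιδ.le.trans l1)
  obtain ⟨e6, he6, hgap⟩ := Metric.eventually_nhds_iff.1 (gap1.and gap2)
  obtain ⟨Δ, hΔ0, l⟩ := exists_between (lt_min (lt_min hG1 hG2) (_root_.half_pos hκ))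
  simp only [lt_min_iff] at l
  obtain ⟨⟨Δ1, Δ2⟩, Δκ⟩ := l
  set N := M.B * √(2 * (h + M.B)) * (4 * B.τ) + M.B with hN
  have hB := M.B_nonneg
  have hBN : M.B ≤ N := by rw [hN]; linarith [show 0 ≤ M.B * √(2 * (h + M.B)) * (4 * B.τ) by positivity]
  have hd := L.d_pos
  obtain ⟨Em, hEm0, l⟩ := exists_between (lt_min (_root_.half_pos hE1) hE2)
  obtain ⟨Em1, Em2⟩ := lt_min_iff.1 l
  refine ⟨δ, σ, min σ e4, E1 / 2, Δ, K, hΔ0, hK, min (min (min d ef) (min em e1)) (min (min (min e2 e5) e6) (Em / (N + 1))),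
    by positivity, fun ε hε => ?_⟩
  simp only [lt_min_iff] at hε
  obtain ⟨⟨⟨εd, εf⟩, εm, ε1⟩, ⟨⟨ε2, ε5⟩, ε6⟩, εN⟩ := hε
  have εη : |ε| < C.η := εd.trans_le L.d_le
  have hN1 : N * |ε| < Em := by
    rw [lt_div_iff₀ (by linarith)] at εN
    nlinarith [abs_nonneg ε]
  have hBε : M.B * |ε| ≤ N * |ε| := mul_le_mul_of_nonneg_right hBN (abs_nonneg _)
  have n1 : N * |ε| < E1 / 2 := hN1.trans Em1
  have n2 : N * |ε| < E2 := hN1.trans Em2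
  obtain ⟨g1, g2⟩ := hgap (y := ε) (by rwa [Real.dist_eq, sub_zero])
  obtain ⟨F, hp2⟩ := fam ε εf δ hδ lf Δ hΔ0.le fun θ => ⟨by linarith [(g1 θ).1], by linarith [(g1 θ).2.1]⟩
  obtain ⟨Mx, tm, tl, tr, x, Cn⟩ := F.exists_corners
  have habs {t : ℝ} (ht : t ∈ I(B.τ,δ)) : |t - B.τ| ≤ δ :=
    abs_le.2 ⟨by linarith [ht.1], by linarith [ht.2]⟩
  have nb {t : ℝ} (ht : t ∈ I(B.τ,δ)) (θ : ℝ) : (ε, t, θ) ∈ Level.nbhd B d :=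
    ⟨εd, (habs ht).trans_lt (lf.trans_le hefd)⟩
  have tangent (z : Phase) (h1 : q₁ z = S.w₁) (h2 : p₁ z = 0) (h3 : q₂ z ∈ S.U₂)
      (h4 : S.hamiltonian ε z = h) : M.Facts B.τ δ ε z ∧ M.Facts B.τ δ ε (timeRev z) := by
    obtain ⟨θ, a, ha, rfl⟩ := tang ε εη (hBε.trans_lt n2) z h1 h2 h3 h4
    obtain ⟨ha2, haη⟩ := lt_min_iff.1 ha
    refine ⟨F2 ε ε2 a ha2 θ, ?_⟩
    have h5 : timeRev (S.w₁, 0, M.angQ θ a, M.angP θ a) = (S.w₁, 0, M.angQ (-θ) a, M.angP (-θ) a) := by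
      rw [(ang_neg (C.amp a haη) θ).1, (ang_neg (C.amp a haη) θ).2]
      simp [timeRev]
    rw [h5]
    exact F2 ε ε2 a ha2 (-θ)
  have ml : B.τ - ι ∈ I(B.τ,δ) := ⟨by linarith, by linarith⟩
  have mr : B.τ + ι ∈ I(B.τ,δ) := ⟨by linarith, by linarith⟩
  have near_tm (θ : ℝ) : B.τ - ι < tm θ ∧ tm θ < B.τ + ι :=
    ⟨(Cn.D_pos_iff θ _ ml).1.1 (g2 θ).2.2.1,
      lt_of_not_ge fun h' => absurd ((Cn.D_pos_iff θ _ mr).2.2 h') (not_le.2 (g2 θ).2.2.2)⟩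
  have inner : ∀ k ∈ Icc (-Δ) 0, ∀ θ, ∀ t ∈ Icc (tl k θ) (tr k θ), |t - B.τ| < e1 := fun k hk θ t ht => by
    obtain ⟨-, k2, k3, -⟩ := Cn.cross k hk θ
    obtain ⟨b1, b2, -⟩ := g2 θ
    obtain ⟨c1, c2⟩ := near_tm θ
    have hmax := Cn.le_Mx θ B.τ ⟨by linarith, by linarith⟩
    have c3 : B.τ - ι < tl k θ := lt_of_not_ge fun h' => by
      have := (Cn.cross_iff k hk θ _ ml).2 ⟨h', c1.le.trans k3⟩
      linarith [hk.1]
    have c4 : tr k θ < B.τ + ι := lt_of_not_ge fun h' => by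
      have := (Cn.cross_iff k hk θ _ mr).2 ⟨k2.trans c2.le, h'⟩
      linarith [hk.1]
    exact abs_lt.2 ⟨by linarith [ht.1], by linarith [ht.2]⟩
  have Mx_near (θ : ℝ) : |Mx θ - M.act B.aS| < κ / 2 := by
    obtain ⟨c1, c2⟩ := near_tm θ
    rw [← (Cn.tm_mem θ).2.2]
    exact anear ε ε5 _ (abs_lt.2 ⟨by linarith, by linarith⟩) θ
  refine ⟨_, _, _, _, _, Mx, tm, tl, tr, x, εη, hδ, lτ, ση, min_le_left _ _, hΔ0.le, hK, F.deriv, Cn,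
    fun t ht θ a ha => ?_, fun t ht θ a ha hact => ?_, fun t ht t' ht' θ a ha => ?_,
    fun k hk θ t ht a ha s1 s2 h1 h2 => ?_, fun θ k hk => ?_, fun a ha => near a (ha.trans_le (min_le_right _ _)),
    fun z hz hlt => back ε εη z hz (by linarith), ?_, fun z h1 h2 h3 h4 => ?_, fun a a' ha ha' =>
    lip a a' (ha.trans σ3) (ha'.trans σ3)⟩
  · have hu := nb ht θ
    have hA := L.amp_mem hu
    have haA := C.amp a (ha.trans_le ση)
    have hle := (ha.trans σρ).le
    exact ⟨(L.lt_iff _ hu.1 hu.2 a hle).trans (act_strictMonoOn.lt_iff_lt haA hA).symm,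
      (L.eq_iff _ hu.1 hu.2 a hle).trans (act_strictMonoOn.injOn.eq_iff haA hA).symm⟩
  · have hu := nb ht θ
    obtain rfl := act_strictMonoOn.injOn (C.amp a (ha.trans_le ση)) (L.amp_mem hu) hact
    obtain ⟨r1, r2⟩ := L.rate_iff hu
    have turn (θ' : ℝ) (he : (θ : Angle) = θ') :
        Level.height C A (ε, t, θ) = Level.height C A (ε, t, θ') ∧
        Level.state C A (ε, t, θ) = Level.state C A (ε, t, θ') := by
      obtain ⟨n, hn⟩ := Angle.angle_eq_iff_two_pi_dvd_sub.1 he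
      have e : (ε, t, θ) = (ε, t, θ') + turn n := by
        simp [turn]; linarith
      rw [e]
      exact ⟨L.height_turn (nb ht θ') n, L.state_turn (nb ht θ') n⟩
    refine ⟨r1, r2, ?_, fun he => ?_, fun he => ?_⟩
    · change q₂ (Level.state C A (ε, t, θ)) = _
      simp only [Level.height]; ring
    · obtain ⟨t1, t2⟩ := turn _ he
      refine ⟨t1.trans (F.y_zero t ht).1, ?_⟩
      change 0 < p₂ (Level.state C A (ε, t, θ))
      rw [t2]; exact (hp2 t ht).1
    · obtain ⟨t1, t2⟩ := turn _ he
      refine ⟨t1.trans (F.y_zero t ht).2, ?_⟩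
      change p₂ (Level.state C A (ε, t, θ)) < 0
      rw [t2]; exact (hp2 t ht).2
  · exact hmom ε εm a (ha.trans (σρ.trans_le hρ)) t ((habs ht).trans_lt lm) t' ((habs ht').trans_lt lm) θ
  · exact F1 ε ε1 t (inner k hk θ t ht) a (ha.trans σ1) θ s1 s2 h1 h2
  · obtain ⟨a, ha, -, hI⟩ := surj (Mx θ + k) (by
      have := Mx_near θ
      rw [abs_lt] at this ⊢
      constructor <;> linarith [hk.1, hk.2, this.1, this.2])
    exact ⟨a, ha, hI⟩
  · have : M.B * √(2 * (h + M.B)) * |ε| * (4 * B.τ) + M.B * |ε| = N * |ε| := by rw [hN]; ring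
    rw [this]; exact n1.le
  · obtain ⟨f1, f2⟩ := tangent z h1 h2 h3 h4
    exact ⟨f1, f2, B.energy2_tangent h1 h2 h3 h4⟩

namespace Window

variable {C : SectionChart B} {ε δ σ σ' E Δ K : ℝ} {Bf D y : ℝ → ℝ → ℝ} {θp θm Mx tm : ℝ → ℝ}
  {tl tr : ℝ → ℝ → ℝ} {x : Label → ℝ → ℝ}

lemma exists_tangent_curve (W : Window C ε δ σ σ' E Δ K Bf D y θp θm Mx tm tl tr x) :
    ∃ Itan : Angle → ℝ, Continuous Itan ∧ (∀ θ : ℝ, Itan θ = Mx θ) ∧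
      S.tangentialCurve ε h = {x | x.2 = Itan x.1} := by
  obtain ⟨Itan, hc, hI⟩ := exists_angle_function W.corners.Mx_cont W.corners.Mx_per
  refine ⟨Itan, hc, hI, Set.ext fun u => ⟨fun hu => ?_, fun hu => ?_⟩⟩
  · obtain ⟨θ, rfl⟩ := W.eq_of_tangential hu
    exact (hI θ).symm
  · obtain ⟨φ, I⟩ := u
    induction φ using Angle.induction_on with | _ θ => ?_
    obtain rfl : I = Mx θ := Eq.trans hu (hI θ)
    exact W.tangential_of_eq

end Window

end Model

end OscStep

end

open OscStep in
theorem theorem3p4 (S : StepSystem) (h : ℝ) (hh : S.V₁ S.w₁ + S.V₂ S.w₂ < h)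
    (hU₁ : IsCompact {q | q ∈ S.U₁ ∧ S.V₁ q ≤ h}) (hU₂ : IsCompact {q | q ∈ S.U₂ ∧ S.V₂ q ≤ h}) :
    ∃ Δ > 0, ∃ C ≥ 0, ∃ ε₀ > 0, C * ε₀ < Δ ∧ ∀ ε : ℝ, |ε| < ε₀ →
      ∃ (Itan : Real.Angle → ℝ) (φ : Label → Label → ℝ → Real.Angle),
        -- the tangential curve is the graph of `Itan`
        Continuous Itan ∧ S.tangentialCurve ε h = {x | x.2 = Itan x.1} ∧
        -- the corner-singularity curves are the graphs of `φ a b` over `[-Δ, 0]`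
        (∀ a, ContinuousOn (φ a a.next) (Icc (-Δ) 0) ∧ ∀ k ∈ Icc (-Δ) 0, ∀ θ : Real.Angle,
          (θ, Itan θ + k) ∈ S.cornerCurve ε h a a.next ↔ θ = φ a a.next k) ∧
        -- the return map is defined on the regions
        (∀ b, ∀ x ∈ region Itan φ Δ b, ∃! y, S.ReturnsTo ε h x y) ∧
        -- the order of the regions and the reversed order of their images, in `(θ, I)`
        InOrder Itan Δ (region Itan φ Δ .R) (region Itan φ Δ .zero) (region Itan φ Δ .one) ∧
        InOrder (fun θ => Itan (-θ)) (Δ - C * |ε|)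
          (imageUnder (S.ReturnsTo ε h) (region Itan φ Δ .one))
          (imageUnder (S.ReturnsTo ε h) (region Itan φ Δ .zero))
          (imageUnder (S.ReturnsTo ε h) (region Itan φ Δ .R)) ∧
        -- the same in `(φ, K)`
        InOrder (fun _ => 0) Δ
          (regionNormal φ Δ .R) (regionNormal φ Δ .zero) (regionNormal φ Δ .one) ∧
        InOrder (epsF Itan) (Δ - C * |ε|)
          (imageUnder (S.ReturnsToNormal ε h Itan) (regionNormal φ Δ .one))
          (imageUnder (S.ReturnsToNormal ε h Itan) (regionNormal φ Δ .zero))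
          (imageUnder (S.ReturnsToNormal ε h Itan) (regionNormal φ Δ .R)) ∧
        -- the left and right boundaries of the images, in `(θ, I)` and in `(φ, K)`
        ∃ φbar : Label → Label → ℝ → Real.Angle, ∀ a b c, IsCyc c b a →
          (HasSides (fun θ => Itan (-θ)) (imageUnder (S.ReturnsTo ε h) (region Itan φ Δ b))
              (φbar a b) (φbar b c) Δ (C * |ε|) ∧
            curveOver (fun θ => Itan (-θ)) (φbar a b) Δ =
              reflect '' S.cornerCurveBand ε h Itan Δ b a ∧
            curveOver (fun θ => Itan (-θ)) (φbar b c) Δ =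
              reflect '' S.cornerCurveBand ε h Itan Δ c b) ∧
          (HasSides (epsF Itan) (imageUnder (S.ReturnsToNormal ε h Itan) (regionNormal φ Δ b))
              (φbar a b) (φbar b c) Δ (C * |ε|) ∧
            curveOver (epsF Itan) (φbar a b) Δ =
              reflectNormal Itan '' (toNormal Itan '' S.cornerCurveBand ε h Itan Δ b a) ∧
            curveOver (epsF Itan) (φbar b c) Δ =
              reflectNormal Itan '' (toNormal Itan '' S.cornerCurveBand ε h Itan Δ c b)) := by
  have hV1 := S.V1_pos S.w₁_mem S.w₁_neg.ne
  have hV2 := S.V2_pos S.w₂_mem S.w₂_neg.ne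
  obtain ⟨M⟩ := exists_model S h (by linarith) hU₁ hU₂
  obtain ⟨B⟩ := M.exists_base hh
  obtain ⟨C⟩ := Model.exists_sectionChart B
  obtain ⟨δ, σ, σ', E, Δ, K, hΔ, hK, ε0, hε₀, hW⟩ := Model.exists_window C
  have hB := M.B_nonneg
  have hτ : 0 < B.τ := (B.swing 0 0).τ_pos
  set N := 3 * K * (M.B * √(2 * (h + M.B)) * (4 * B.τ) + M.B) with hN
  have hN0 : 0 ≤ N := by positivity
  have hlt : N * min ε0 (Δ / (N + 1)) < Δ := by
    refine (mul_le_mul_of_nonneg_left (min_le_right _ _) hN0).trans_lt ?_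
    rw [← mul_div_assoc, div_lt_iff₀ (by linarith)]
    nlinarith
  refine ⟨Δ, hΔ, N, hN0, min ε0 (Δ / (N + 1)), by positivity, hlt, fun ε hε => ?_⟩
  obtain ⟨Bf, D, y, θp, θm, Mx, tm, tl, tr, x, W⟩ := hW ε (hε.trans_le (min_le_left _ _))
  obtain ⟨Itan, hIc, hI, htan⟩ := W.exists_tangent_curve
  obtain ⟨φ, hφ⟩ := conclusion_of_transitions (S := S) (h := h) (ε := ε) (Δ := Δ) (δ := N * |ε|)
    (Itan := Itan) (x := x) (Trans := Model.Transition C ε δ σ) (by positivity)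
    W.corners.x_cont
    (fun b k hk θ => W.corner_iff hI b hk θ) W.corners.order
    (fun b k hk θ => W.arc_iff hI b hk θ) (fun b u v => W.transition_returns)
    (fun b u v v' => W.transition_unique) (fun b u v => W.transition_reverse)
    (fun b u v ht => by
      obtain ⟨θ, h1, h2⟩ := W.transition_lt ht
      rw [h1, hI]; linarith)
    fun b u v ht => W.transition_close hI ht
  exact ⟨Itan, φ, hIc, htan, hφ⟩
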